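/- **Conventions.** $\lambda$ is the security parameter; $\Sigma$ is a fixed finite alphabet; all parameters $M,n,d,d',r,\ell$ are functions of $\lambda$. The edit distance $\Delta_E$ counts insertions and deletions. A channel is a fixed map $\mathcal E:\Sigma^*\to\Sigma^*$ (chosen before the keys are drawn); it is *$p(\cdot)$-bounded* if $\Delta_E(x,\mathcal E(x))\le p(|x|)\,|x|$ for all $x$. A function $\nu:\mathbb N\to\mathbb R_{\ge 0}$ is negligible if for each $c>0$ it is at most $\lambda^{-c}$ for all large $\lambda$. Algorithms are (strict) polynomial time and may sample uniformly from $\{0,\dots,k-1\}$. **Pseudorandom codes.** A public-key PRC over $\Sigma$ with message space $[M]$, codeword length $N$ and robustness to $\mathcal E$ consists of randomized polynomial-time algorithms $\mathsf{KeyGen}(1^\lambda)=(\mathsf{pk},\mathsf{sk})$ (bit strings of lengths depending only on $\lambda$), $\mathsf{Enc}(1^\lambda,\mathsf{pk},m)\in\Sigma^{N}$ and $\mathsf{Dec}(1^\lambda,\mathsf{sk},y)\in[M]\cup\{\bot\}$, such that: - (robustness) for some negligible $\nu$, for all $\lambda$ and $m\in[M]$, $\Pr[\mathsf{Dec}(1^\lambda,\mathsf{sk},\mathcal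 E(\mathsf{Enc}(1^\lambda,\mathsf{pk},m)))=m]\ge 1-\nu(\lambda)$; - (soundness) for each polynomial $P$ there is a negligible $\nu$ such that $\Pr[\mathsf{Dec}(1^\lambda,\mathsf{sk},c)=\bot]\ge 1-\nu(\lambda)$ for all $\lambda$ and all fixed $c\in\Sigma^*$ with $|c|\le P(\lambda)$; - (pseudorandomness) every probabilistic polynomial-time adversary that is given $(1^\lambda,\mathsf{pk})$ and an oracle on $[M]$ has negligible advantage in distinguishing $\mathsf{Enc}(1^\lambda,\mathsf{pk},\cdot)$ from the oracle that answers each query by a fresh uniform element of $\Sigma^{N}$. In a secret-key PRC, $\mathsf{pk}=\mathsf{sk}$ and the adversary is given only $1^\lambda$. A zero-bit PRC is one with $M=1$; its message is denoted $1$. A PRC is *uniform* if, for each $m$, $\mathsf{Enc}(1^\lambda,\mathsf{pk},m)$ is exactly uniform over the randomness of $\mathsf{KeyGen}$ and $\mathsf{Enc}$. **Seeded payload codes.** A seeded payload code robust to any $\delta$ fraction of edit errors is a pair of deterministic polynomial-time maps $\mathsf{ECC}_{\rm load}:[M]\times\{0,1\}^d\times\{0,1\}^r\to\Sigma^n$ and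 $\mathsf{ECC}_{\rm load}^{-1}:\Sigma^*\times\{0,1\}^d\times\{0,1\}^r\to[M]\cup\{\bot\}$ (with $d,r,M$ computable from $1^\lambda$ in polynomial time, $d$ and $r$ in unary and $M$ in binary) such that: - for some negligible $\nu$, for all $\lambda$ and $m$, with probability at least $1-\nu(\lambda)$ over uniform $(s,\mathsf{shift})$, every $y'$ with $\Delta_E(y',\mathsf{ECC}_{\rm load}(m,s,\mathsf{shift}))\le\delta n$ satisfies $\mathsf{ECC}_{\rm load}^{-1}(y',s,\mathsf{shift})=m$; - for all fixed $m,s$ and uniform $\mathsf{shift}$, $\mathsf{ECC}_{\rm load}(m,s,\mathsf{shift})$ is uniform on $\Sigma^n$; - every probabilistic polynomial-time adversary given $(1^\lambda,\mathsf{shift})$, $\mathsf{shift}$ uniform, has negligible advantage in distinguishing the oracle $m\mapsto\mathsf{ECC}_{\rm load}(m,s,\mathsf{shift})$, with a fresh uniform $s\in\{0,1\}^d$ for each query, from the oracle that answers by fresh uniform elements of $\Sigma^n$. Its rate is $R=\log_{|\Sigma|}M/n$. **Construction.** Let $\mathsf{PRC}_0=(\mathsf{KeyGen}_0,\mathsf{Enc}_0,\mathsf{Dec}_0)$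 be a zero-bit PRC over $\Sigma$ with codeword length $\ell$, and let $\mathsf{ECC}_{\rm seed}:\{0,1\}^d\to\{0,1\}^{d'}$ be a code with a decoder. - $\mathsf{KeyGen}$: draw $2d'$ independent pairs $(\mathsf{pk}_i,\mathsf{sk}_i)\gets\mathsf{KeyGen}_0(1^\lambda)$ and a uniform $\mathsf{shift}\in\{0,1\}^r$; set $\mathsf{pk}=(\mathsf{pk}_1,\dots,\mathsf{pk}_{2d'},\mathsf{shift})$ and $\mathsf{sk}=(\mathsf{sk}_1,\dots,\mathsf{sk}_{2d'},\mathsf{shift})$. - $\mathsf{Enc}$: draw $s\in\{0,1\}^d$ uniformly and let $s'=\mathsf{ECC}_{\rm seed}(s)\circ 1^{d'}$. For $i\le 2d'$ let $u_i\gets\mathsf{Enc}_0(1^\lambda,\mathsf{pk}_i,1)$ if $s'_i=1$, and let $u_i\in\Sigma^\ell$ be uniform otherwise. Draw uniformly $2d'$ pairwise disjoint intervals $I_1,\dots,I_{2d'}$ of length $\ell$ in $[n+2d'\ell]$. Output the word with $u_i$ on $I_i$ and the symbols of $\mathsf{ECC}_{\rm load}(m,s,\mathsf{shift})$, in order, on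 the other positions. - $\mathsf{Dec}$: given $y'$, for $i\le 2d'$ set $\tilde s_i=1$ if $\mathsf{Dec}_0(1^\lambda,\mathsf{sk}_i,\cdot)$ accepts some substring $y'_{[a:b]}$, and $\tilde s_i=0$ otherwise. If $\tilde s_{[d'+1:2d']}=0^{d'}$, output $\bot$. Decode $\tilde s_{[1:d']}$ with the decoder of $\mathsf{ECC}_{\rm seed}$; if this fails, output $\bot$; if it gives $s$, output $\mathsf{ECC}_{\rm load}^{-1}(y',s,\mathsf{shift})$. **Theorem.** Suppose that - $\mathsf{PRC}_0$ is a uniform zero-bit public-key (respectively, secret-key) PRC over $\Sigma$ with codeword length $\ell$ that is robust to every $p_0(\cdot)$-bounded edit channel, where $p_0:\mathbb N\to[0,1]$; - $\mathsf{ECC}_{\rm load}$ is a seeded payload code of rate $R$ robust to any $\delta$ fraction of edit errors, for a constant $\delta>0$; - $\mathsf{ECC}_{\rm seed}:\{0,1\}^d\to\{0,1\}^{d'}$ is a polynomial-time computable binary code with a polynomial-time decoder that corrects any $p_{\rm seed}$ fraction of Hamming errors, for a constant $0<p_{\rm seed}<1/4$; - $d'=\Theta(n^\gamma)$ and $\ell=\Theta(n^\gamma)$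 for a constant $0<\gamma<1/4$; - $p:\mathbb N\to[0,1]$ satisfies $p(N)\le(1-\varepsilon)\min\{\delta,\;p_0(\ell)\,p_{\rm seed}\}$ for all $\lambda$, where $N=n+2d'\ell$ and $\varepsilon>0$ is a constant. Then the scheme $(\mathsf{KeyGen},\mathsf{Enc},\mathsf{Dec})$ constructed above is a public-key (respectively, secret-key) PRC with message space $[M]$ and codeword length $N$: its three algorithms run in polynomial time, it is robust to every $p(\cdot)$-bounded edit channel, sound and pseudorandom. Its rate is $$\frac{\log_{|\Sigma|}M}{n+2d'\ell}=R-o(1)\qquad(\lambda\to\infty).$$ -/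

import Mathlib

open Filter Asymptotics

namespace PRC

/-! ### Data and programs: a machine model with a step count -/

/-- Binary trees (S-expressions), the data on which programs operate. -/
inductive Data : Type
  | nil : Data
  | cons : Data → Data → Data

namespace Data

/-- Number of nodes. -/
def size : Data → ℕ
  | nil => 1
  | cons a b => 1 + a.size + b.size

def fst : Data → Data
  | nil => nil
  | cons a _ => a

def snd : Data → Data
  | nil => nil
  | cons _ b => b

/-- Length of a tree read as a list. -/
def length : Data → ℕ
  | nil => 0
  | cons _ b => b.length + 1

end Data

/-! Encodings of the usual finite objects as data. -/

/-- The list `l`, entries encoded by `f`. -/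
def listData {α : Type} (f : α → Data) : List α → Data
  | [] => Data.nil
  | a :: l => Data.cons (f a) (listData f l)

/-- The number `k` in unary; `natData lam` is the input `1^lam`. -/
def natData (k : ℕ) : Data := listData (fun _ => Data.nil) (List.replicate k ())

def boolData : Bool → Data
  | false => Data.nil
  | true => Data.cons Data.nil Data.nil

/-- The number `k` in binary. -/
def binData (k : ℕ) : Data := listData boolData (Nat.bits k)

def optionData {α : Type} (f : α → Data) : Option α → Data
  | none => Data.nil
  | some a => Data.cons (f a) Data.nil

/-- A bit string of length `k`. -/
def bitsData {k : ℕ} (b : Fin k → Bool) : Data := listData boolData (List.ofFn b)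

/-- A string over the alphabet `Fin q`. -/
def wordData {q : ℕ} (y : List (Fin q)) : Data := listData (fun a : Fin q => natData a) y

/-- A message of the message space `[M] = Fin M`, in binary. -/
def msgData {M : ℕ} (m : Fin M) : Data := binData m

/-- Randomized oracle programs: a small Turing-complete language over binary trees. A program maps
its input to its output; see `Prog.eval`. -/
inductive Prog : Type
  | nil : Prog
  | id : Prog
  | fst : Prog
  | snd : Prog
  | pair : Prog → Prog → Prog
  | comp : Prog → Prog → Prog
  | ite : Prog → Prog → Prog → Prog
  | loop : Prog → Prog → Prog
  | rand : Prog
  | query : Prog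

/-- The law of a randomized computation: `none` if it was cut off, otherwise its result and the
number of steps that it took. -/
abbrev Run : Type := PMF (Option (Data × ℕ))

namespace Run

/-- Return `a` after `t` steps. -/
noncomputable def ret (a : Data) (t : ℕ) : Run := PMF.pure (some (a, t))

/-- Sequential composition; step counts add up. -/
noncomputable def andThen (p : Run) (k : Data → Run) : Run :=
  PMF.bind p fun o =>
    match o with
    | none => PMF.pure none
    | some (a, s) => (k a).map (Option.map fun bt => (bt.1, s + bt.2))

/-- `while c x do x := f x`, cut off after the condition was tested `fuel` times. -/
noncomputable def loop (c f : Data → Run) : ℕ → Data → Run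
  | 0, _ => PMF.pure none
  | fuel + 1, x => (c x).andThen fun b =>
      match b with
      | Data.nil => ret x 0
      | Data.cons _ _ => (f x).andThen (loop c f fuel)

end Run

/-- Semantics of programs with oracle `O` (which answers each query with a fresh sample).
Every elementary operation costs the size of the data it is applied to, so that the number of steps
bounds the size of everything that is computed. `rand`, applied to a list of length `k`, returns a
uniformly random number below `k` (in unary). Each loop is cut off after `fuel` tests; as each
test costs a step, a computation of at most `fuel` steps is never cut off. -/
noncomputable def Prog.eval (O : Data → PMF Data) (fuel : ℕ) : Prog → Data → Run
  | .nil, x => Run.ret Data.nil x.size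
  | .id, x => Run.ret x x.size
  | .fst, x => Run.ret x.fst x.size
  | .snd, x => Run.ret x.snd x.size
  | .pair f g, x => (f.eval O fuel x).andThen fun a => (g.eval O fuel x).andThen fun b =>
      Run.ret (Data.cons a b) 1
  | .comp f g, x => (g.eval O fuel x).andThen (f.eval O fuel)
  | .ite c f g, x => (c.eval O fuel x).andThen fun b =>
      match b with
      | Data.nil => g.eval O fuel x
      | Data.cons _ _ => f.eval O fuel x
  | .loop c f, x => Run.loop (c.eval O fuel) (f.eval O fuel) fuel x
  | .rand, x =>
      match x.length with
      | 0 => Run.ret Data.nil x.size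
      | k + 1 => (PMF.uniformOfFintype (Fin (k + 1))).map fun i => some (natData i, x.size)
  | .query, x => (O x).map fun a => some (a, x.size + a.size)

/-- On input `x` with oracle `O`, the program halts within `T` steps, whatever the outcome of the
random choices and the answers of the oracle. -/
def Prog.HaltsWithin (c : Prog) (O : Data → PMF Data) (x : Data) (T : ℕ) : Prop :=
  ∀ o ∈ (c.eval O T x).support, ∃ y t, o = some (y, t) ∧ t ≤ T

/-- Law of the output of the program (`none` if it does not halt in time). -/
noncomputable def Prog.output (c : Prog) (O : Data → PMF Data) (x : Data) (T : ℕ) :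
    PMF (Option Data) :=
  (c.eval O T x).map (Option.map Prod.fst)

/-- The oracle of a program that has no oracle. -/
noncomputable def noOracle : Data → PMF Data := fun _ => PMF.pure Data.nil

/-- The randomized map `input i ↦ output i` is computed in polynomial time: some program halts on
each input within a number of steps polynomial in the size of the input, and its output has exactly
the prescribed law. A deterministic map is the case `output i = PMF.pure _`. -/
def PolyTime {ι : Type} (input : ι → Data) (output : ι → PMF Data) : Prop :=
  ∃ (c : Prog) (P : Polynomial ℕ), ∀ i,
    c.HaltsWithin noOracle (input i) (P.eval (input i).size) ∧
    c.output noOracle (input i) (P.eval (input i).size) = (output i).map some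

/-! ### Probability -/

/-- Probability of an event. -/
noncomputable def prob {α : Type} (μ : PMF α) (S : Set α) : ℝ := (μ.toOuterMeasure S).toReal

/-- Independent samples from `μ 0, …, μ (k - 1)`. -/
noncomputable def indep {α : Type} : {k : ℕ} → (Fin k → PMF α) → PMF (Fin k → α)
  | 0, _ => PMF.pure Fin.elim0
  | _ + 1, μ => (μ 0).bind fun a => (indep fun i => μ i.succ).map fun f => Fin.cons a f

def Negligible (ν : ℕ → ℝ) : Prop :=
  (∀ k, 0 ≤ ν k) ∧ ∀ c : ℝ, 0 < c → ∃ k₀ : ℕ, ∀ k ≥ k₀, ν k ≤ (k : ℝ) ^ (-c)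

/-- Two families of oracles are computationally indistinguishable. For each `lam`, a key `k` is
drawn from `setup lam`, the adversary is given `input lam k`, and has access to the oracle
`real lam k` or `ideal lam k`. The adversaries are the programs whose running time in both
experiments is bounded by a polynomial in `lam`; an adversary accepts by returning the bit `1`. -/
def Indistinguishable {K : ℕ → Type} (setup : (lam : ℕ) → PMF (K lam))
    (input : (lam : ℕ) → K lam → Data) (real ideal : (lam : ℕ) → K lam → Data → PMF Data) : Prop :=
  ∀ (A : Prog) (P : Polynomial ℕ),
    (∀ lam, ∀ k ∈ (setup lam).support,
      A.HaltsWithin (real lam k) (input lam k) (P.eval lam) ∧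
      A.HaltsWithin (ideal lam k) (input lam k) (P.eval lam)) →
    Negligible fun lam =>
      |prob ((setup lam).bind fun k => A.output (real lam k) (input lam k) (P.eval lam))
          {some (boolData true)}
        - prob ((setup lam).bind fun k => A.output (ideal lam k) (input lam k) (P.eval lam))
          {some (boolData true)}|

open Classical in
/-- The oracle which answers a message `m` by a fresh sample from `f m`, and answers a query that is
not a message by an error symbol. -/
noncomputable def msgOracle {q M len : ℕ} (f : Fin M → PMF (Fin len → Fin q)) (x : Data) :
    PMF Data :=
  if h : ∃ m : Fin M, msgData m = x then
    (f h.choose).map fun y => optionData wordData (some (List.ofFn y))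
  else PMF.pure (optionData (wordData (q := q)) none)

/-! ### Edit distance and channels -/

/-- Length of a longest common subsequence. -/
noncomputable def lcsLength {α : Type} (x y : List α) : ℕ :=
  sSup {k | ∃ z : List α, z.Sublist x ∧ z.Sublist y ∧ z.length = k}

/-- Edit distance: the least number of insertions and deletions. -/
noncomputable def editDist {α : Type} (x y : List α) : ℕ :=
  x.length + y.length - 2 * lcsLength x y

/-- `E` is a `p`-bounded edit channel. -/
def EditBounded {α : Type} (p : ℕ → ℝ) (E : List α → List α) : Prop :=
  ∀ x, (editDist x (E x) : ℝ) ≤ p x.length * x.length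

/-! ### Pseudorandom codes -/

/-- In the public-key setting the adversary sees the encoding key; in the secret-key setting it
does not, and the encoding key and the decoding key coincide. -/
inductive KeyMode : Type
  | publicKey : KeyMode
  | secretKey : KeyMode

/-- A scheme `(KeyGen, Enc, Dec)` over the alphabet `Fin q`, with message space `[M lam]` and
codeword length `len lam`; a key is a bit string. The decoder returns `none` for `⊥`. A zero-bit
scheme is one with `M lam = 1` for all `lam`. -/
structure Scheme (q : ℕ) (M len : ℕ → ℕ) where
  ekLen : ℕ → ℕ
  dkLen : ℕ → ℕ
  keyGen : (lam : ℕ) → PMF ((Fin (ekLen lam) → Bool) × (Fin (dkLen lam) → Bool))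
  enc : (lam : ℕ) → (Fin (ekLen lam) → Bool) → Fin (M lam) → PMF (Fin (len lam) → Fin q)
  dec : (lam : ℕ) → (Fin (dkLen lam) → Bool) → List (Fin q) → PMF (Option (Fin (M lam)))

namespace Scheme

variable {q : ℕ} {M len : ℕ → ℕ}

/-- The three algorithms are randomized polynomial-time algorithms. -/
def Efficient (S : Scheme q M len) : Prop :=
  PolyTime (fun lam : ℕ => natData lam)
    (fun lam => (S.keyGen lam).map fun k => Data.cons (bitsData k.1) (bitsData k.2)) ∧
  PolyTime
    (fun i : (lam : ℕ) × ((Fin (S.ekLen lam) → Bool) × Fin (M lam)) =>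
      Data.cons (natData i.1) (Data.cons (bitsData i.2.1) (msgData i.2.2)))
    (fun i => (S.enc i.1 i.2.1 i.2.2).map fun y => wordData (List.ofFn y)) ∧
  PolyTime
    (fun i : (lam : ℕ) × ((Fin (S.dkLen lam) → Bool) × List (Fin q)) =>
      Data.cons (natData i.1) (Data.cons (bitsData i.2.1) (wordData i.2.2)))
    (fun i => (S.dec i.1 i.2.1 i.2.2).map (optionData msgData))

/-- What the adversary is given. -/
def adversaryInput (mode : KeyMode) (S : Scheme q M len) (lam : ℕ)
    (k : (Fin (S.ekLen lam) → Bool) × (Fin (S.dkLen lam) → Bool)) : Data :=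
  match mode with
  | .publicKey => Data.cons (natData lam) (bitsData k.1)
  | .secretKey => natData lam

def KeysMatch (mode : KeyMode) (S : Scheme q M len) : Prop :=
  match mode with
  | .publicKey => True
  | .secretKey => ∀ lam, ∀ k ∈ (S.keyGen lam).support, List.ofFn k.1 = List.ofFn k.2

def Robust (S : Scheme q M len) (E : List (Fin q) → List (Fin q)) : Prop :=
  ∃ ν, Negligible ν ∧ ∀ lam (m : Fin (M lam)),
    1 - ν lam ≤ prob
      ((S.keyGen lam).bind fun k => (S.enc lam k.1 m).bind fun x => S.dec lam k.2 (E (List.ofFn x)))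
      {some m}

/-- Every string of length polynomial in `lam`, fixed before the keys are drawn, is rejected. -/
def Sound (S : Scheme q M len) : Prop :=
  ∀ P : Polynomial ℕ, ∃ ν, Negligible ν ∧ ∀ lam (c : List (Fin q)), c.length ≤ P.eval lam →
    1 - ν lam ≤ prob ((S.keyGen lam).bind fun k => S.dec lam k.2 c) {none}

def Pseudorandom [NeZero q] (mode : KeyMode) (S : Scheme q M len) : Prop :=
  Indistinguishable S.keyGen (S.adversaryInput mode)
    (fun lam k => msgOracle fun m : Fin (M lam) => S.enc lam k.1 m)
    (fun lam _ => msgOracle fun _ : Fin (M lam) => PMF.uniformOfFintype (Fin (len lam) → Fin q))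

/-- `S` is a public-key (secret-key) pseudorandom code that is robust to the channel `E`. -/
structure IsPRC [NeZero q] (mode : KeyMode) (S : Scheme q M len)
    (E : List (Fin q) → List (Fin q)) : Prop where
  efficient : S.Efficient
  keysMatch : S.KeysMatch mode
  robust : S.Robust E
  sound : S.Sound
  pseudorandom : S.Pseudorandom mode

/-- For each message, over key generation and encoding, the codeword is exactly uniform. -/
def Uniform [NeZero q] (S : Scheme q M len) : Prop :=
  ∀ lam (m : Fin (M lam)),
    ((S.keyGen lam).bind fun k => S.enc lam k.1 m)
      = PMF.uniformOfFintype (Fin (len lam) → Fin q)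

/-- `log_q M / len`. -/
noncomputable def rate (_ : Scheme q M len) (lam : ℕ) : ℝ :=
  Real.logb q (M lam) / len lam

end Scheme

/-! ### Seeded payload codes and seed codes -/

/-- Encoder `[M] × {0,1}^d × {0,1}^r → Σ^n` and decoder `Σ^* × {0,1}^d × {0,1}^r → [M] ∪ {⊥}`. -/
structure PayloadCode (q : ℕ) (M n d r : ℕ → ℕ) where
  enc : (lam : ℕ) → Fin (M lam) → (Fin (d lam) → Bool) → (Fin (r lam) → Bool) →
    (Fin (n lam) → Fin q)
  dec : (lam : ℕ) → List (Fin q) → (Fin (d lam) → Bool) → (Fin (r lam) → Bool) →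
    Option (Fin (M lam))

namespace PayloadCode

variable {q : ℕ} {M n d r : ℕ → ℕ}

/-- Encoder, decoder and the parameters that an encoder has to know (seed length, mask length, size
of the message space) are computable in deterministic polynomial time. -/
def Efficient (L : PayloadCode q M n d r) : Prop :=
  PolyTime
    (fun i : (lam : ℕ) × (Fin (M lam) × (Fin (d lam) → Bool) × (Fin (r lam) → Bool)) =>
      Data.cons (natData i.1) (Data.cons (msgData i.2.1)
        (Data.cons (bitsData i.2.2.1) (bitsData i.2.2.2))))
    (fun i => PMF.pure (wordData (List.ofFn (L.enc i.1 i.2.1 i.2.2.1 i.2.2.2)))) ∧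
  PolyTime
    (fun i : (lam : ℕ) × (List (Fin q) × (Fin (d lam) → Bool) × (Fin (r lam) → Bool)) =>
      Data.cons (natData i.1) (Data.cons (wordData i.2.1)
        (Data.cons (bitsData i.2.2.1) (bitsData i.2.2.2))))
    (fun i => PMF.pure (optionData msgData (L.dec i.1 i.2.1 i.2.2.1 i.2.2.2))) ∧
  PolyTime (fun lam : ℕ => natData lam) (fun lam => PMF.pure (natData (d lam))) ∧
  PolyTime (fun lam : ℕ => natData lam) (fun lam => PMF.pure (natData (r lam))) ∧
  PolyTime (fun lam : ℕ => natData lam) (fun lam => PMF.pure (binData (M lam)))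

/-- For each message, with overwhelming probability over seed and mask, all words within edit
distance `δ n` of the codeword are decoded correctly. -/
def Robust (δ : ℝ) (L : PayloadCode q M n d r) : Prop :=
  ∃ ν, Negligible ν ∧ ∀ lam (m : Fin (M lam)),
    1 - ν lam ≤ prob
      (PMF.uniformOfFintype ((Fin (d lam) → Bool) × (Fin (r lam) → Bool)))
      {a | ∀ y : List (Fin q),
        (editDist y (List.ofFn (L.enc lam m a.1 a.2)) : ℝ) ≤ δ * n lam →
          L.dec lam y a.1 a.2 = some m}

def Uniform [NeZero q] (L : PayloadCode q M n d r) : Prop :=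
  ∀ lam (m : Fin (M lam)) (s : Fin (d lam) → Bool),
    (PMF.uniformOfFintype (Fin (r lam) → Bool)).map (fun shift => L.enc lam m s shift)
      = PMF.uniformOfFintype (Fin (n lam) → Fin q)

/-- The oracle draws a fresh seed for each query; the mask is public. -/
def Pseudorandom [NeZero q] (L : PayloadCode q M n d r) : Prop :=
  Indistinguishable (fun lam => PMF.uniformOfFintype (Fin (r lam) → Bool))
    (fun lam shift => Data.cons (natData lam) (bitsData shift))
    (fun lam shift => msgOracle fun m : Fin (M lam) =>
      (PMF.uniformOfFintype (Fin (d lam) → Bool)).map fun s => L.enc lam m s shift)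
    (fun lam _ => msgOracle fun _ : Fin (M lam) => PMF.uniformOfFintype (Fin (n lam) → Fin q))

/-- A seeded payload code robust to any `δ` fraction of edit errors. -/
structure IsSeeded [NeZero q] (δ : ℝ) (L : PayloadCode q M n d r) : Prop where
  efficient : L.Efficient
  robust : L.Robust δ
  uniform : L.Uniform
  pseudorandom : L.Pseudorandom

/-- `R = log_q M / n`. -/
noncomputable def rate (_ : PayloadCode q M n d r) (lam : ℕ) : ℝ :=
  Real.logb q (M lam) / n lam

end PayloadCode

/-- A binary code `{0,1}^d → {0,1}^{d'}` with a decoder. -/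
structure SeedCode (d d' : ℕ → ℕ) where
  enc : (lam : ℕ) → (Fin (d lam) → Bool) → (Fin (d' lam) → Bool)
  dec : (lam : ℕ) → (Fin (d' lam) → Bool) → Option (Fin (d lam) → Bool)

/-- The code is efficient, and efficiently decodable from any `ρ` fraction of Hamming errors. -/
structure SeedCode.Corrects {d d' : ℕ → ℕ} (ρ : ℝ) (C : SeedCode d d') : Prop where
  enc_polyTime : PolyTime
    (fun i : (lam : ℕ) × (Fin (d lam) → Bool) => Data.cons (natData i.1) (bitsData i.2))
    (fun i => PMF.pure (bitsData (C.enc i.1 i.2)))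
  dec_polyTime : PolyTime
    (fun i : (lam : ℕ) × (Fin (d' lam) → Bool) => Data.cons (natData i.1) (bitsData i.2))
    (fun i => PMF.pure (optionData bitsData (C.dec i.1 i.2)))
  corrects : ∀ lam (s : Fin (d lam) → Bool) (w : Fin (d' lam) → Bool),
    (hammingDist w (C.enc lam s) : ℝ) ≤ ρ * d' lam → C.dec lam w = some s

/-! ### The construction -/

/-- The concatenation `(key_1, …, key_k, shift)`. -/
def joinKey {k a r : ℕ} (key : Fin k → Fin a → Bool) (shift : Fin r → Bool) :
    Fin (k * a + r) → Bool :=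
  Fin.append (fun t => key (finProdFinEquiv.symm t).1 (finProdFinEquiv.symm t).2) shift

/-- The component `key_i` of a concatenation. -/
def keyPart {k a r : ℕ} (x : Fin (k * a + r) → Bool) (i : Fin k) : Fin a → Bool :=
  fun j => x (Fin.castAdd r (finProdFinEquiv (i, j)))

/-- The component `shift` of a concatenation. -/
def shiftPart {k a r : ℕ} (x : Fin (k * a + r) → Bool) : Fin r → Bool :=
  fun j => x (Fin.natAdd (k * a) j)

open Classical in
/-- All choices of `k` pairwise disjoint intervals `[loc i, loc i + ℓ)` in `[0, N)`. -/
noncomputable def placements (k ℓ N : ℕ) : Finset (Fin k → Fin (N + 1)) :=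
  Finset.univ.filter fun loc =>
    (∀ i, (loc i : ℕ) + ℓ ≤ N) ∧
    ∀ i j, i ≠ j →
      Disjoint (Finset.Ico (loc i : ℕ) (loc i + ℓ)) (Finset.Ico (loc j : ℕ) (loc j + ℓ))

theorem placements_nonempty {k ℓ N : ℕ} (h : k * ℓ ≤ N) : (placements k ℓ N).Nonempty := by
  classical
  have key : ∀ i : Fin k, (i : ℕ) * ℓ + ℓ ≤ N := fun i => by
    have h1 : ((i : ℕ) + 1) * ℓ ≤ k * ℓ := Nat.mul_le_mul_right _ i.2
    have h2 : ((i : ℕ) + 1) * ℓ = (i : ℕ) * ℓ + ℓ := by ring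
    omega
  refine ⟨fun i => ⟨(i : ℕ) * ℓ, by have := key i; omega⟩, ?_⟩
  simp only [placements, Finset.mem_filter, Finset.mem_univ, true_and]
  refine ⟨key, ?_⟩
  intro i j hij
  rw [Finset.disjoint_left]
  intro t ht ht'
  simp only [Finset.mem_Ico] at ht ht'
  rcases Nat.lt_or_gt_of_ne (fun e => hij (Fin.ext e)) with hlt | hlt
  · have h1 : ((i : ℕ) + 1) * ℓ ≤ (j : ℕ) * ℓ := Nat.mul_le_mul_right _ hlt
    have h2 : ((i : ℕ) + 1) * ℓ = (i : ℕ) * ℓ + ℓ := by ring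
    omega
  · have h1 : ((j : ℕ) + 1) * ℓ ≤ (i : ℕ) * ℓ := Nat.mul_le_mul_right _ hlt
    have h2 : ((j : ℕ) + 1) * ℓ = (j : ℕ) * ℓ + ℓ := by ring
    omega

open Classical in
/-- The word of length `N` that carries the block `u i` on the interval `[loc i, loc i + ℓ)` and the
symbols of `c` on the remaining positions, in their order. (The last branch is never reached when
`loc ∈ placements k ℓ N` and `N = n + k ℓ`.) -/
noncomputable def interleave {q : ℕ} [NeZero q] {k ℓ n N : ℕ} (loc : Fin k → Fin (N + 1))
    (u : Fin k → Fin ℓ → Fin q) (c : Fin n → Fin q) : Fin N → Fin q := fun t =>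
  if h : ∃ i, (loc i : ℕ) ≤ t ∧ (t : ℕ) < loc i + ℓ then
    u h.choose ⟨t - loc h.choose, by have := h.choose_spec; omega⟩
  else
    let before := ((Finset.range t).filter fun t' =>
      ¬ ∃ i, (loc i : ℕ) ≤ t' ∧ t' < loc i + ℓ).card
    if h' : before < n then c ⟨before, h'⟩ else 0

/-- All substrings `y[a..b]` over nonempty intervals. -/
def substrings {α : Type} (y : List α) : List (List α) :=
  (List.range y.length).flatMap fun a =>
    (List.range (y.length - a)).map fun b => (y.drop a).take (b + 1)

/-- Run the randomized test `f` on all members of a list with fresh coins: does it ever accept? -/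
noncomputable def anyAccepts {α β : Type} (f : α → PMF (Option β)) : List α → PMF Bool
  | [] => PMF.pure false
  | z :: zs => (f z).bind fun o => (anyAccepts f zs).map fun b => o.isSome || b

open Classical in
/-- The generic construction from a zero-bit scheme, a payload code and a seed code: there are
`d' + d' = 2 d'` marker blocks of length `ℓ`. -/
noncomputable def genericPRC {q : ℕ} [NeZero q] {M ℓ n d d' r : ℕ → ℕ}
    (S₀ : Scheme q (fun _ => 1) ℓ) (L : PayloadCode q M n d r) (C : SeedCode d d') :
    Scheme q M (fun lam => n lam + 2 * d' lam * ℓ lam) where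
  ekLen lam := (d' lam + d' lam) * S₀.ekLen lam + r lam
  dkLen lam := (d' lam + d' lam) * S₀.dkLen lam + r lam
  keyGen lam :=
    (indep fun _ : Fin (d' lam + d' lam) => S₀.keyGen lam).bind fun ks =>
    (PMF.uniformOfFintype (Fin (r lam) → Bool)).map fun shift =>
      (joinKey (fun i => (ks i).1) shift, joinKey (fun i => (ks i).2) shift)
  enc lam pk m :=
    (PMF.uniformOfFintype (Fin (d lam) → Bool)).bind fun s =>
    let s' : Fin (d' lam + d' lam) → Bool := Fin.append (C.enc lam s) (fun _ => true)
    (indep fun i =>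
      if s' i then S₀.enc lam (keyPart pk i) 0
      else PMF.uniformOfFintype (Fin (ℓ lam) → Fin q)).bind fun u =>
    (PMF.uniformOfFinset
      (placements (d' lam + d' lam) (ℓ lam) (n lam + 2 * d' lam * ℓ lam))
      (placements_nonempty (by rw [two_mul]; exact Nat.le_add_left _ _))).map fun loc =>
      interleave loc u (L.enc lam m s (shiftPart pk))
  dec lam sk y :=
    (indep fun i => anyAccepts (S₀.dec lam (keyPart sk i)) (substrings y)).map fun st =>
      if ∀ j : Fin (d' lam), st (Fin.natAdd (d' lam) j) = false then none
      else
        match C.dec lam (fun j => st (Fin.castAdd (d' lam) j)) with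
        | none => none
        | some s => L.dec lam y s (shiftPart sk)

end PRC

/-! Robustness rests on the fact that, by exact uniformity of the zero-bit code and of the payload
code, the transmitted word is uniform and independent of the placement of the blocks
(`placed_uniform`). The channel is a fixed map, so the set of window positions that it corrupts
heavily is a function of the word alone and hence independent of the placement. Aligning the sent
with the received word distributes the edits over the symbols. Each symbol lies in at most `ℓ`
windows of length `ℓ`, so a Markov argument leaves at most a `(1 - 2η) * pseed` fraction of starting
positions whose window costs more than `p₀ ℓ * ℓ` edits (`card_badStarts_le_mul`). A given set of
`t` blocks starts entirely in a set `B` of positions with probability at most `(|B| / n) ^ t`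
(`card_placements_filter_le`). The moment generating function is thus dominated by that of a
binomial variable, and in each half, except with probability exponentially small in `d'`, at most
`pseed * d'` blocks are bad (`prob_manyBad_le`).

A codeword in a good window is detected. With everything outside the block fixed, the map from the
block to its aligned window extends to a `p₀`-bounded channel. That channel varies with the context,
so robustness is needed uniformly over channels, which a diagonal argument provides
(`Scheme.exists_missProb_le`). A block without a codeword is not flagged, because its key is
independent of the received word and soundness applies to each of the polynomially many substrings.
Hence the first half of the test results is within the radius of the seed code and the second half
is not all zero (`decodeTests_eq_some`). The payload decoder sees the payload with the marker blocks
as additional insertions; their total length `2 d' ℓ` is `o(n)` since `2γ < 1`, and the slack `ε`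
absorbs it.

The growth of the parameters is not a hypothesis. If fixed words are rejected but codewords
accepted, there must be superpolynomially many words of length `ℓ` (`Scheme.exists_pow_mul_ge`). So
`ℓ` exceeds every multiple of `log λ`; `n` then tends to infinity and `d'` is superlogarithmic too.

Soundness is a union bound over the last `d'` keys and the substrings of the fixed word.
Pseudorandomness is a hybrid argument. The blocks are made uniform one at a time by a reduction that
guesses the index and plants its challenge there, losing a factor `2 d' + 1` (`hybridExp_blocks`).
Once all blocks are uniform the seed enters only through the payload, which the payload code
replaces by uniform symbols (`hybridExp_payload`). The rate follows from `log M ≤ n + 1`, a double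
counting of correctly decoded messages, and from the overhead being `o(n)`.

All algorithms and reductions have to be actual programs of the machine model. This is handled by
the predicate `PT`, which asserts that one program computes a whole family of laws in polynomial
time, and by its closure properties: composition, random choice, folds over lists with a size
invariant, and simulation of an oracle by a program (`PT.sim`). A uniformly random placement is
sampled by successive insertion of blocks at uniformly random places between the current items
(`scatter_law`). -/

namespace PRC

/-! ### Polynomials and laws -/

theorem polynomial_eval_mono (P : Polynomial ℕ) {a b : ℕ} (h : a ≤ b) : P.eval a ≤ P.eval b := by
  induction P using Polynomial.induction_on' with
  | add p q hp hq => simp only [Polynomial.eval_add]; omega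
  | monomial k c => simp only [Polynomial.eval_monomial]; gcongr

theorem bind_congr_support {α β : Type*} {p : PMF α} {f g : α → PMF β}
    (h : ∀ a ∈ p.support, f a = g a) : p.bind f = p.bind g := by
  ext b
  simp only [PMF.bind_apply]
  refine tsum_congr fun a => ?_
  by_cases ha : p a = 0
  · simp [ha]
  · rw [h a ((PMF.mem_support_iff _ _).2 ha)]

theorem map_eq_bind {α β : Type*} (p : PMF α) (f : α → β) :
    p.map f = p.bind fun a => PMF.pure (f a) := rfl

theorem map_congr_support {α β : Type*} {p : PMF α} {f g : α → β}
    (h : ∀ a ∈ p.support, f a = g a) : p.map f = p.map g := by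
  rw [map_eq_bind, map_eq_bind]
  exact bind_congr_support fun a ha => by rw [h a ha]

theorem map_injective_of_injective {α β : Type*} {f : α → β} (hf : Function.Injective f)
    {p q : PMF α} (h : p.map f = q.map f) : p = q := by
  ext a
  have := congrArg (fun r : PMF β => r.toOuterMeasure {f a}) h
  simp only [PMF.toOuterMeasure_map_apply] at this
  rwa [← Set.image_singleton, hf.preimage_image, PMF.toOuterMeasure_apply_singleton,
    PMF.toOuterMeasure_apply_singleton] at this

/-! ### Runs -/

theorem Data.size_pos (x : Data) : 1 ≤ x.size := by cases x <;> simp [Data.size]; omega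

theorem Data.size_fst_le (x : Data) : x.fst.size ≤ x.size := by
  cases x <;> simp [Data.size, Data.fst]; omega

theorem Data.size_snd_le (x : Data) : x.snd.size ≤ x.size := by
  cases x <;> simp [Data.size, Data.snd]

/-- Every outcome of the run is a result reached within `T` steps, and the result has law `μ`. -/
def Run.Good (p : Run) (μ : PMF Data) (T : ℕ) : Prop :=
  (∀ o ∈ p.support, ∃ y t, o = some (y, t) ∧ t ≤ T) ∧
    p.map (Option.map Prod.fst) = μ.map some

theorem Run.Good.mono {p : Run} {μ : PMF Data} {T T' : ℕ} (h : p.Good μ T) (hT : T ≤ T') :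
    p.Good μ T' :=
  ⟨fun o ho => by obtain ⟨y, t, e, ht⟩ := h.1 o ho; exact ⟨y, t, e, ht.trans hT⟩, h.2⟩

theorem Run.Good.ret (a : Data) (t : ℕ) : (Run.ret a t).Good (PMF.pure a) t := by
  refine ⟨?_, by simp [Run.ret, PMF.pure_map]⟩
  intro o ho
  simp only [Run.ret, PMF.mem_support_pure_iff] at ho
  exact ⟨a, t, ho, le_rfl⟩

theorem Run.mem_support_andThen {p : Run} {k : Data → Run} {o : Option (Data × ℕ)} :
    o ∈ (p.andThen k).support ↔
      (none ∈ p.support ∧ o = none) ∨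
      ∃ a s, some (a, s) ∈ p.support ∧ ∃ o' ∈ (k a).support,
        o = o'.map fun bt => (bt.1, s + bt.2) := by
  rw [Run.andThen, PMF.mem_support_bind_iff]
  constructor
  · rintro ⟨o1, h1, h2⟩
    rcases o1 with _ | ⟨a, s⟩
    · exact .inl ⟨h1, by simpa using h2⟩
    · simp only [PMF.mem_support_map_iff] at h2
      obtain ⟨o', h3, h4⟩ := h2
      exact .inr ⟨a, s, h1, o', h3, h4.symm⟩
  · rintro (⟨h1, h2⟩ | ⟨a, s, h1, o', h3, h4⟩)
    · exact ⟨none, h1, by simp [h2]⟩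
    · exact ⟨some (a, s), h1, by simp only [PMF.mem_support_map_iff]; exact ⟨o', h3, h4.symm⟩⟩

theorem Run.Good.exists_mem {p : Run} {μ : PMF Data} {T : ℕ} (h : p.Good μ T) {a : Data}
    (ha : a ∈ μ.support) : ∃ t, some (a, t) ∈ p.support ∧ t ≤ T := by
  have : some a ∈ (p.map (Option.map Prod.fst)).support := by
    rw [h.2, PMF.mem_support_map_iff]; exact ⟨a, ha, rfl⟩
  rw [PMF.mem_support_map_iff] at this
  obtain ⟨o, ho, e⟩ := this
  obtain ⟨y, t, rfl, ht⟩ := h.1 o ho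
  simp at e; subst e
  exact ⟨t, ho, ht⟩

theorem Run.Good.mem_of {p : Run} {μ : PMF Data} {T : ℕ} (h : p.Good μ T) {a : Data} {t : ℕ}
    (ha : some (a, t) ∈ p.support) : a ∈ μ.support := by
  have : some a ∈ (p.map (Option.map Prod.fst)).support := by
    rw [PMF.mem_support_map_iff]; exact ⟨_, ha, rfl⟩
  rw [h.2, PMF.mem_support_map_iff] at this
  obtain ⟨b, hb, e⟩ := this
  simp at e; rwa [e] at hb

theorem Run.Good.andThen {p : Run} {k : Data → Run} {μ : PMF Data} {κ : Data → PMF Data}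
    {T₁ T₂ : ℕ} (hp : p.Good μ T₁) (hk : ∀ a ∈ μ.support, (k a).Good (κ a) T₂) :
    (p.andThen k).Good (μ.bind κ) (T₁ + T₂) := by
  constructor
  · intro o ho
    rw [Run.mem_support_andThen] at ho
    rcases ho with ⟨h1, h2⟩ | ⟨a, s, h1, o', h3, h4⟩
    · obtain ⟨y, t, e, -⟩ := hp.1 _ h1; simp at e
    · obtain ⟨y, t, e, ht⟩ := hp.1 _ h1
      simp at e; obtain ⟨rfl, rfl⟩ := e
      obtain ⟨y', t', rfl, ht'⟩ := (hk a (hp.mem_of h1)).1 _ h3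
      exact ⟨y', s + t', by simpa using h4, by omega⟩
  -- The law of the final result depends on the first run only through the law of its result, so the
  -- projection that forgets step counts can be moved inside the composition.
  · have e1 : (p.andThen k).map (Option.map Prod.fst)
        = p.bind ((fun o : Option Data => match o with
            | none => PMF.pure none
            | some a => (k a).map (Option.map Prod.fst)) ∘ Option.map Prod.fst) := by
      rw [Run.andThen, PMF.map_bind]
      congr 1
      funext o
      rcases o with _ | ⟨a, s⟩
      · simp [PMF.pure_map]
      · simp only [PMF.map_comp, Function.comp, Option.map_some]
        congr 1
        funext o'
        rcases o' with _ | ⟨b, t⟩ <;> rfl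
    rw [e1, ← PMF.bind_map, hp.2, PMF.bind_map, PMF.map_bind]
    exact bind_congr_support fun a ha => (hk a ha).2

/-- More fuel does not change a run that is never cut off. -/
theorem Run.andThen_congr {p p' : Run} {k k' : Data → Run} (hn : none ∉ (p.andThen k).support)
    (hp : none ∉ p.support → p' = p)
    (hk : ∀ a s, some (a, s) ∈ p.support → none ∉ (k a).support → k' a = k a) :
    p'.andThen k' = p.andThen k := by
  have h1 : none ∉ p.support := fun h => hn (Run.mem_support_andThen.2 (.inl ⟨h, rfl⟩))
  rw [hp h1, Run.andThen, Run.andThen]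
  refine bind_congr_support fun o ho => ?_
  rcases o with _ | ⟨a, s⟩
  · rfl
  · simp only
    rw [hk a s ho fun h => hn (Run.mem_support_andThen.2 (.inr ⟨a, s, ho, none, h, rfl⟩))]

/-- The bound on the number of tests and the fuel inside condition and body are varied
independently, because the induction lowers only the former. -/
theorem Run.loop_congr {c f c' f' : Data → Run}
    (hc : ∀ x, none ∉ (c x).support → c' x = c x) (hf : ∀ x, none ∉ (f x).support → f' x = f x) :
    ∀ (n n' : ℕ), n ≤ n' → ∀ x, none ∉ (Run.loop c f n x).support →
      Run.loop c' f' n' x = Run.loop c f n x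
  | 0, _, _, x, h => by simp [Run.loop] at h
  | n + 1, 0, h, _, _ => by omega
  | n + 1, n' + 1, h, x, hx => by
    rw [Run.loop, Run.loop]
    rw [Run.loop] at hx
    refine Run.andThen_congr hx (hc x) ?_
    intro b s _ hb
    cases b with
    | nil => rfl
    | cons b1 b2 =>
      exact Run.andThen_congr hb (hf x) fun a s _ ha =>
        Run.loop_congr hc hf n n' (by omega) a ha

/-- A cut-off shows up as the outcome `none`, so its absence certifies that the fuel was never
exhausted. This makes a time bound proved for a subprogram usable inside a program that runs with
more fuel. -/
theorem Prog.eval_fuel (O : Data → PMF Data) {F F' : ℕ} (hF : F ≤ F') (c : Prog) :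
    ∀ x, none ∉ (c.eval O F x).support → c.eval O F' x = c.eval O F x := by
  induction c with
  | nil | id | fst | snd | rand | query => intro x _; simp only [Prog.eval]
  | pair f g ihf ihg =>
    intro x hx
    exact Run.andThen_congr hx (ihf x) fun a s _ ha =>
      Run.andThen_congr ha (ihg x) fun _ _ _ _ => rfl
  | comp f g ihf ihg =>
    intro x hx
    exact Run.andThen_congr hx (ihg x) fun a s _ ha => ihf a ha
  | ite c f g ihc ihf ihg =>
    intro x hx
    refine Run.andThen_congr hx (ihc x) fun b s _ hb => ?_
    cases b with
    | nil => exact ihg x hb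
    | cons _ _ => exact ihf x hb
  | loop c f ihc ihf =>
    intro x hx
    exact Run.loop_congr ihc ihf F F' hF x hx

/-! ### Sizes of results -/

theorem size_natData (k : ℕ) : (natData k).size = 2 * k + 1 := by
  induction k with
  | zero => rfl
  | succ k ih =>
    have : natData (k + 1) = Data.cons Data.nil (natData k) := rfl
    rw [this, Data.size, ih]; simp [Data.size]; omega

theorem Data.length_lt_size (x : Data) : 2 * x.length + 1 ≤ x.size := by
  induction x with
  | nil => simp [Data.length, Data.size]
  | cons a b _ ih =>
    have := a.size_pos
    simp only [Data.length, Data.size]; omega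

theorem Run.loop_size {c f : Data → Run}
    (hc : ∀ x y t, some (y, t) ∈ (c x).support → x.size ≤ t)
    (hf : ∀ x y t, some (y, t) ∈ (f x).support → x.size ≤ t ∧ y.size ≤ t) :
    ∀ n x y t, some (y, t) ∈ (Run.loop c f n x).support → x.size ≤ t ∧ y.size ≤ t
  | 0, x, y, t, h => by simp [Run.loop] at h
  | n + 1, x, y, t, h => by
    rw [Run.loop, Run.mem_support_andThen] at h
    rcases h with ⟨_, h⟩ | ⟨b, s, hb, o', ho', e⟩
    · simp at h
    have h1 := hc x b s hb
    cases b with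
    | nil =>
      simp only [Run.ret, PMF.mem_support_pure_iff] at ho'
      subst ho'; simp at e; obtain ⟨rfl, rfl⟩ := e
      exact ⟨h1, h1⟩
    | cons b1 b2 =>
      rcases o' with _ | ⟨y', t'⟩
      · simp at e
      simp at e; obtain ⟨rfl, rfl⟩ := e
      rw [Run.mem_support_andThen] at ho'
      rcases ho' with ⟨_, h⟩ | ⟨a, s', ha, o'', ho'', e⟩
      · simp at h
      rcases o'' with _ | ⟨y', t''⟩
      · simp at e
      simp at e; obtain ⟨rfl, rfl⟩ := e
      have h2 := Run.loop_size hc hf n a _ _ ho''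
      omega

/-- Each elementary operation costs at least the size of its argument. Time bounds therefore double
as size bounds, and polynomial time bounds compose without separate estimates of intermediate
results. -/
theorem Prog.size_le (O : Data → PMF Data) (F : ℕ) (c : Prog) :
    ∀ x y t, some (y, t) ∈ (c.eval O F x).support → x.size ≤ t ∧ y.size ≤ t := by
  induction c with
  | nil | id | fst | snd =>
    intro x y t h
    simp only [Prog.eval, Run.ret, PMF.mem_support_pure_iff, Option.some.injEq,
      Prod.mk.injEq] at h
    obtain ⟨h1, h2⟩ := h
    rw [h1, h2]
    have := x.size_pos; have := x.size_fst_le; have := x.size_snd_le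
    refine ⟨le_rfl, ?_⟩
    first | assumption | exact le_rfl
  | rand =>
    intro x y t h
    have hl := x.length_lt_size
    rw [Prog.eval] at h
    split at h
    · simp only [Run.ret, PMF.mem_support_pure_iff, Option.some.injEq, Prod.mk.injEq] at h
      obtain ⟨rfl, rfl⟩ := h
      exact ⟨le_rfl, x.size_pos⟩
    · next k hk =>
      rw [PMF.mem_support_map_iff] at h
      obtain ⟨i, hi, h⟩ := h
      simp only [Option.some.injEq, Prod.mk.injEq] at h
      obtain ⟨rfl, rfl⟩ := h
      obtain ⟨j, -, hj⟩ := (PMF.mem_support_bind_iff _ _ _).1 hi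
      obtain rfl := (PMF.mem_support_pure_iff _ _).1 hj
      rw [size_natData]
      have := j.isLt
      omega
  | query =>
    intro x y t h
    simp only [Prog.eval, PMF.mem_support_map_iff, Option.some.injEq, Prod.mk.injEq] at h
    obtain ⟨i, -, rfl, rfl⟩ := h
    omega
  | pair f g ihf ihg =>
    intro x y t h
    rw [Prog.eval, Run.mem_support_andThen] at h
    rcases h with ⟨_, h⟩ | ⟨a, s, ha, o', ho', e⟩
    · simp at h
    rcases o' with _ | ⟨y', t'⟩
    · simp at e
    simp at e; obtain ⟨rfl, rfl⟩ := e
    rw [Run.mem_support_andThen] at ho'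
    rcases ho' with ⟨_, h⟩ | ⟨b, s', hb, o'', ho'', e⟩
    · simp at h
    rcases o'' with _ | ⟨y', t''⟩
    · simp at e
    simp at e; obtain ⟨rfl, rfl⟩ := e
    simp only [Run.ret, PMF.mem_support_pure_iff, Option.some.injEq, Prod.mk.injEq] at ho''
    obtain ⟨rfl, rfl⟩ := ho''
    have h1 := ihf _ _ _ ha
    have h2 := ihg _ _ _ hb
    simp only [Data.size]; omega
  | comp f g ihf ihg =>
    intro x y t h
    rw [Prog.eval, Run.mem_support_andThen] at h
    rcases h with ⟨_, h⟩ | ⟨a, s, ha, o', ho', e⟩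
    · simp at h
    rcases o' with _ | ⟨y', t'⟩
    · simp at e
    simp at e; obtain ⟨rfl, rfl⟩ := e
    have h1 := ihg _ _ _ ha
    have h2 := ihf _ _ _ ho'
    omega
  | ite c f g ihc ihf ihg =>
    intro x y t h
    rw [Prog.eval, Run.mem_support_andThen] at h
    rcases h with ⟨_, h⟩ | ⟨a, s, ha, o', ho', e⟩
    · simp at h
    rcases o' with _ | ⟨y', t'⟩
    · simp at e
    simp at e; obtain ⟨rfl, rfl⟩ := e
    have h1 := ihc _ _ _ ha
    have h2 : x.size ≤ t' ∧ y.size ≤ t' := by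
      cases a with
      | nil => exact ihg _ _ _ ho'
      | cons _ _ => exact ihf _ _ _ ho'
    omega
  | loop c f ihc ihf =>
    intro x y t h
    exact Run.loop_size (fun x y t h => (ihc x y t h).1) ihf F x y t h

/-! ### Programs that compute a law within a time bound, and their combinators -/

/-- On input `x`, with any sufficient amount of fuel, the program halts within `T` steps and its
output has law `μ`. -/
def Computes (O : Data → PMF Data) (c : Prog) (x : Data) (μ : PMF Data) (T : ℕ) : Prop :=
  ∀ F, T ≤ F → (c.eval O F x).Good μ T

theorem Computes.mono {O : Data → PMF Data} {c : Prog} {x : Data} {μ : PMF Data} {T T' : ℕ}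
    (h : Computes O c x μ T) (hT : T ≤ T') : Computes O c x μ T' :=
  fun F hF => (h F (hT.trans hF)).mono hT

/-- Asking for all larger amounts of fuel costs nothing: by `Prog.eval_fuel` a run that halts with
fuel `T` is unchanged by more fuel. -/
theorem computes_iff {O : Data → PMF Data} {c : Prog} {x : Data} {μ : PMF Data} {T : ℕ} :
    Computes O c x μ T ↔ c.HaltsWithin O x T ∧ c.output O x T = μ.map some := by
  constructor
  · intro h
    exact ⟨(h T le_rfl).1, (h T le_rfl).2⟩
  · rintro ⟨h1, h2⟩ F hF
    have : none ∉ (c.eval O T x).support := fun h => by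
      obtain ⟨y, t, e, -⟩ := h1 _ h; simp at e
    rw [Prog.eval_fuel O hF c x this]
    exact ⟨h1, h2⟩

theorem Computes.size_le {O : Data → PMF Data} {c : Prog} {x : Data} {μ : PMF Data} {T : ℕ}
    (h : Computes O c x μ T) {a : Data} (ha : a ∈ μ.support) : a.size ≤ T := by
  obtain ⟨t, h1, h2⟩ := (h T le_rfl).exists_mem ha
  exact (Prog.size_le O T c x a t h1).2.trans h2

theorem Computes.comp {O : Data → PMF Data} {f g : Prog} {x : Data} {μ : PMF Data}
    {κ : Data → PMF Data} {T₁ T₂ : ℕ} (hg : Computes O g x μ T₁)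
    (hf : ∀ a ∈ μ.support, Computes O f a (κ a) T₂) :
    Computes O (.comp f g) x (μ.bind κ) (T₁ + T₂) := fun F hF =>
  (hg F (by omega)).andThen fun a ha => hf a ha F (by omega)

theorem Computes.pair {O : Data → PMF Data} {f g : Prog} {x : Data} {μ ν : PMF Data}
    {T₁ T₂ : ℕ} (hf : Computes O f x μ T₁) (hg : Computes O g x ν T₂) :
    Computes O (.pair f g) x (μ.bind fun a => ν.map fun b => Data.cons a b) (T₁ + (T₂ + 1)) :=
  fun F hF => (hf F (by omega)).andThen fun a _ =>
    (hg F (by omega)).andThen fun b _ => Run.Good.ret _ 1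

theorem Computes.ite_nil {O : Data → PMF Data} {c f g : Prog} {x : Data} {μ : PMF Data}
    {T₁ T₂ : ℕ} (hc : Computes O c x (PMF.pure Data.nil) T₁) (hg : Computes O g x μ T₂) :
    Computes O (.ite c f g) x μ (T₁ + T₂) := fun F hF => by
  rw [← PMF.pure_bind Data.nil fun _ => μ]
  refine (hc F (by omega)).andThen fun a ha => ?_
  rw [PMF.mem_support_pure_iff] at ha
  subst ha
  exact hg F (by omega)

theorem Computes.ite_cons {O : Data → PMF Data} {c f g : Prog} {x a b : Data} {μ : PMF Data}
    {T₁ T₂ : ℕ} (hc : Computes O c x (PMF.pure (Data.cons a b)) T₁) (hf : Computes O f x μ T₂) :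
    Computes O (.ite c f g) x μ (T₁ + T₂) := fun F hF => by
  rw [← PMF.pure_bind (Data.cons a b) fun _ => μ]
  refine (hc F (by omega)).andThen fun a ha => ?_
  rw [PMF.mem_support_pure_iff] at ha
  subst ha
  exact hf F (by omega)

/-- As `Computes`, for a loop, uniformly in the bound on the number of tests. -/
def LoopComputes (O : Data → PMF Data) (c f : Prog) (x : Data) (μ : PMF Data) (T : ℕ) : Prop :=
  ∀ F, T ≤ F → ∀ n, T ≤ n → (Run.loop (c.eval O F) (f.eval O F) n x).Good μ T

theorem LoopComputes.computes {O : Data → PMF Data} {c f : Prog} {x : Data} {μ : PMF Data} {T : ℕ}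
    (h : LoopComputes O c f x μ T) : Computes O (.loop c f) x μ T := fun F hF => h F hF F hF

theorem LoopComputes.mono {O : Data → PMF Data} {c f : Prog} {x : Data} {μ : PMF Data} {T T' : ℕ}
    (h : LoopComputes O c f x μ T) (hT : T ≤ T') : LoopComputes O c f x μ T' :=
  fun F hF n hn => (h F (hT.trans hF) n (hT.trans hn)).mono hT

theorem LoopComputes.done {O : Data → PMF Data} {c f : Prog} {x : Data} {T : ℕ}
    (hc : Computes O c x (PMF.pure Data.nil) T) : LoopComputes O c f x (PMF.pure x) (T + 1) := by
  intro F hF n hn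
  -- The `+ 1` in the time bound guarantees that at least one test of the condition is allowed.
  obtain ⟨n, rfl⟩ : ∃ k, n = k + 1 := ⟨n - 1, by omega⟩
  rw [Run.loop, ← PMF.pure_bind Data.nil fun _ => PMF.pure x]
  refine ((hc F (by omega)).andThen (T₂ := 1) fun a ha => ?_)
  rw [PMF.mem_support_pure_iff] at ha
  subst ha
  exact (Run.Good.ret x 0).mono (by omega)

theorem LoopComputes.step {O : Data → PMF Data} {c f : Prog} {x a b : Data} {μ : PMF Data}
    {κ : Data → PMF Data} {T₁ T₂ T₃ : ℕ} (hc : Computes O c x (PMF.pure (Data.cons a b)) T₁)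
    (hf : Computes O f x μ T₂) (hl : ∀ y ∈ μ.support, LoopComputes O c f y (κ y) T₃) :
    LoopComputes O c f x (μ.bind κ) (T₁ + (T₂ + T₃) + 1) := by
  intro F hF n hn
  obtain ⟨n, rfl⟩ : ∃ k, n = k + 1 := ⟨n - 1, by omega⟩
  rw [Run.loop, ← PMF.pure_bind (Data.cons a b) fun _ => μ.bind κ]
  refine ((hc F (by omega)).andThen (T₂ := T₂ + T₃) fun a ha => ?_).mono (by omega)
  rw [PMF.mem_support_pure_iff] at ha
  subst ha
  exact (hf F (by omega)).andThen fun y hy => hl y hy F (by omega) n (by omega)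

theorem computes_nil (O : Data → PMF Data) (x : Data) :
    Computes O .nil x (PMF.pure Data.nil) x.size := fun _ _ => Run.Good.ret _ _

theorem computes_id (O : Data → PMF Data) (x : Data) :
    Computes O .id x (PMF.pure x) x.size := fun _ _ => Run.Good.ret _ _

theorem computes_fst (O : Data → PMF Data) (x : Data) :
    Computes O .fst x (PMF.pure x.fst) x.size := fun _ _ => Run.Good.ret _ _

theorem computes_snd (O : Data → PMF Data) (x : Data) :
    Computes O .snd x (PMF.pure x.snd) x.size := fun _ _ => Run.Good.ret _ _

theorem computes_rand (O : Data → PMF Data) (x : Data) {k : ℕ} [NeZero k] (hk : x.length = k) :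
    Computes O .rand x ((PMF.uniformOfFintype (Fin k)).map fun i => natData i) x.size := by
  intro F _
  obtain ⟨k, rfl⟩ : ∃ j, k = j + 1 := ⟨k - 1, by have := NeZero.ne k; omega⟩
  rw [Prog.eval]
  split
  · omega
  · next k' hk' =>
    obtain rfl : k = k' := by omega
    constructor
    · intro o ho
      rw [PMF.mem_support_map_iff] at ho
      obtain ⟨i, -, rfl⟩ := ho
      exact ⟨_, _, rfl, le_rfl⟩
    · rw [PMF.map_comp, PMF.map_comp]; rfl

theorem computes_query (O : Data → PMF Data) (x : Data) {T : ℕ}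
    (hT : ∀ a ∈ (O x).support, a.size ≤ T) : Computes O .query x (O x) (x.size + T) := by
  intro F _
  rw [Prog.eval]
  constructor
  · intro o ho
    rw [PMF.mem_support_map_iff] at ho
    obtain ⟨a, ha, rfl⟩ := ho
    exact ⟨_, _, rfl, by have := hT a ha; omega⟩
  · rw [PMF.map_comp]; rfl

/-! ### Oracles -/

/-- The program with each query replaced by the answer of the trivial oracle. -/
def Prog.strip : Prog → Prog
  | .nil => .nil
  | .id => .id
  | .fst => .fst
  | .snd => .snd
  | .pair f g => .pair f.strip g.strip
  | .comp f g => .comp f.strip g.strip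
  | .ite c f g => .ite c.strip f.strip g.strip
  | .loop c f => .loop c.strip f.strip
  | .rand => .rand
  | .query => .comp .nil .nil

theorem Prog.eval_strip (O : Data → PMF Data) (F : ℕ) (c : Prog) :
    c.strip.eval O F = c.eval noOracle F := by
  induction c with
  | nil | id | fst | snd | rand => funext x; simp only [Prog.strip, Prog.eval]
  | query =>
    funext x
    simp [Prog.strip, Prog.eval, Run.andThen, Run.ret, noOracle, PMF.pure_bind, PMF.pure_map,
      Data.size]
  | pair f g ihf ihg => funext x; simp only [Prog.strip, Prog.eval, ihf, ihg]
  | comp f g ihf ihg => funext x; simp only [Prog.strip, Prog.eval, ihf, ihg]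
  | ite c f g ihc ihf ihg => funext x; simp only [Prog.strip, Prog.eval, ihc, ihf, ihg]
  | loop c f ihc ihf => funext x; simp only [Prog.strip, Prog.eval, ihc, ihf]

theorem Computes.strip {c : Prog} {x : Data} {μ : PMF Data} {T : ℕ}
    (h : Computes noOracle c x μ T) (O : Data → PMF Data) : Computes O c.strip x μ T := by
  intro F hF
  rw [Prog.eval_strip]
  exact h F hF

theorem Run.andThen_support_mono {p p' : Run} {k k' : Data → Run} (hp : p'.support ⊆ p.support)
    (hk : ∀ a, (k' a).support ⊆ (k a).support) :
    (p'.andThen k').support ⊆ (p.andThen k).support := by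
  intro o ho
  rw [Run.mem_support_andThen] at ho ⊢
  rcases ho with ⟨h, e⟩ | ⟨a, s, ha, o', ho', e⟩
  · exact .inl ⟨hp h, e⟩
  · exact .inr ⟨a, s, hp ha, o', hk a ho', e⟩

/-- Halting within a time bound constrains possible outcomes only, not their probabilities. It is
therefore inherited by every oracle whose answers are also possible answers of an oracle for which
it holds, such as a uniform one. -/
theorem Prog.eval_support_mono {O O' : Data → PMF Data}
    (hO : ∀ y, (O' y).support ⊆ (O y).support) (F : ℕ) (c : Prog) :
    ∀ x, (c.eval O' F x).support ⊆ (c.eval O F x).support := by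
  induction c with
  | nil | id | fst | snd | rand => intro x; simp only [Prog.eval]; exact subset_rfl
  | query =>
    intro x
    simp only [Prog.eval, PMF.support_map]
    exact Set.image_mono (hO x)
  | pair f g ihf ihg =>
    intro x
    exact Run.andThen_support_mono (ihf x) fun a =>
      Run.andThen_support_mono (ihg x) fun _ => subset_rfl
  | comp f g ihf ihg => intro x; exact Run.andThen_support_mono (ihg x) ihf
  | ite c f g ihc ihf ihg =>
    intro x
    refine Run.andThen_support_mono (ihc x) fun b => ?_
    cases b with
    | nil => exact ihg x
    | cons _ _ => exact ihf x
  | loop c f ihc ihf =>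
    intro x
    have : ∀ n x, (Run.loop (c.eval O' F) (f.eval O' F) n x).support
        ⊆ (Run.loop (c.eval O F) (f.eval O F) n x).support := by
      intro n
      induction n with
      | zero => intro x; exact subset_rfl
      | succ n ih =>
        intro x
        refine Run.andThen_support_mono (ihc x) fun b => ?_
        cases b with
        | nil => exact subset_rfl
        | cons _ _ => exact Run.andThen_support_mono (ihf x) ih
    exact this F x

theorem Prog.HaltsWithin.of_support_subset {O O' : Data → PMF Data}
    (hO : ∀ y, (O' y).support ⊆ (O y).support) {c : Prog} {x : Data} {T : ℕ}
    (h : c.HaltsWithin O x T) : c.HaltsWithin O' x T :=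
  fun o ho => h o (Prog.eval_support_mono hO T c x ho)

/-- The law of the output of a program that halts within `T` steps. -/
noncomputable def Prog.law (c : Prog) (O : Data → PMF Data) (x : Data) (T : ℕ) : PMF Data :=
  (c.output O x T).map fun o => o.getD Data.nil

theorem Prog.HaltsWithin.computes {O : Data → PMF Data} {c : Prog} {x : Data} {T : ℕ}
    (h : c.HaltsWithin O x T) : Computes O c x (c.law O x T) T := by
  refine computes_iff.2 ⟨h, ?_⟩
  rw [Prog.law, PMF.map_comp]
  conv_lhs => rw [← PMF.map_id (c.output O x T)]
  refine map_congr_support fun o ho => ?_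
  rw [Prog.output, PMF.mem_support_map_iff] at ho
  obtain ⟨o', ho', rfl⟩ := ho
  obtain ⟨y, t, rfl, -⟩ := h _ ho'
  rfl

end PRC

/-! ### Families of laws computable in polynomial time, and their closure properties -/

namespace PRC

theorem Computes.comp_pure {O : Data → PMF Data} {f g : Prog} {x a : Data} {μ : PMF Data}
    {T₁ T₂ : ℕ} (hg : Computes O g x (PMF.pure a) T₁) (hf : Computes O f a μ T₂) :
    Computes O (.comp f g) x μ (T₁ + T₂) := by
  have := hg.comp (κ := fun _ => μ) (f := f) (T₂ := T₂) fun b hb => by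
    rw [PMF.mem_support_pure_iff] at hb; subst hb; exact hf
  rwa [PMF.pure_bind] at this

theorem Computes.pair_pure_left {O : Data → PMF Data} {f g : Prog} {x a : Data} {μ : PMF Data}
    {T₁ T₂ : ℕ} (hf : Computes O f x (PMF.pure a) T₁) (hg : Computes O g x μ T₂) :
    Computes O (.pair f g) x (μ.map fun b => Data.cons a b) (T₁ + (T₂ + 1)) := by
  have := hf.pair hg
  rwa [PMF.pure_bind] at this

theorem Computes.pair_pure {O : Data → PMF Data} {f g : Prog} {x a b : Data}
    {T₁ T₂ : ℕ} (hf : Computes O f x (PMF.pure a) T₁) (hg : Computes O g x (PMF.pure b) T₂) :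
    Computes O (.pair f g) x (PMF.pure (Data.cons a b)) (T₁ + (T₂ + 1)) := by
  have := hf.pair_pure_left hg
  rwa [PMF.pure_map] at this

/-- The family of laws `f i` is computed by one program from the environments `e i`, with the
oracles `O i`, in time polynomial in the size of the environment. -/
def PT {ι : Type} (O : ι → Data → PMF Data) (e : ι → Data) (f : ι → PMF Data) : Prop :=
  ∃ (c : Prog) (P : Polynomial ℕ), ∀ i, Computes (O i) c (e i) (f i) (P.eval (e i).size)

theorem polyTime_iff {ι : Type} {e : ι → Data} {f : ι → PMF Data} :
    PolyTime e f ↔ PT (fun _ => noOracle) e f := by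
  simp only [PolyTime, PT, computes_iff]

variable {ι : Type} {O : ι → Data → PMF Data} {e : ι → Data}

theorem PT.size_le {f : ι → PMF Data} (h : PT O e f) :
    ∃ P : Polynomial ℕ, ∀ i, ∀ a ∈ (f i).support, a.size ≤ P.eval (e i).size := by
  obtain ⟨c, P, h⟩ := h
  exact ⟨P, fun i a ha => (h i).size_le ha⟩

theorem PT.size_pure_le {v : ι → Data} (h : PT O e fun i => PMF.pure (v i)) :
    ∃ P : Polynomial ℕ, ∀ i, (v i).size ≤ P.eval (e i).size := by
  obtain ⟨P, hP⟩ := h.size_le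
  exact ⟨P, fun i => hP i _ (by simp)⟩

theorem PT.anyOracle {f : ι → PMF Data} (h : PT (fun _ => noOracle) e f)
    (O : ι → Data → PMF Data) : PT O e f := by
  obtain ⟨c, P, h⟩ := h
  exact ⟨c.strip, P, fun i => (h i).strip (O i)⟩

theorem PT.reindex {κ : Type} {f : ι → PMF Data} (h : PT O e f) (φ : κ → ι) :
    PT (fun k => O (φ k)) (fun k => e (φ k)) (fun k => f (φ k)) := by
  obtain ⟨c, P, h⟩ := h
  exact ⟨c, P, fun k => h (φ k)⟩

theorem PT.congr {f g : ι → PMF Data} (h : PT O e f) (hfg : ∀ i, f i = g i) : PT O e g := by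
  rwa [show g = f from funext fun i => (hfg i).symm]

theorem PT.id : PT O e fun i => PMF.pure (e i) :=
  ⟨.id, Polynomial.X, fun i => by simpa using computes_id (O i) (e i)⟩

theorem PT.nil : PT O e fun _ => PMF.pure Data.nil :=
  ⟨.nil, Polynomial.X, fun i => by simpa using computes_nil (O i) (e i)⟩

/-- Composition: run `g` on the data computed by the first program. -/
theorem PT.comp {v : ι → Data} {g : ι → PMF Data} (hg : PT O v g)
    (hv : PT O e fun i => PMF.pure (v i)) : PT O e g := by
  obtain ⟨c, P, hg⟩ := hg
  obtain ⟨c', P', hv⟩ := hv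
  refine ⟨.comp c c', P' + P.comp P', fun i => ?_⟩
  rw [Polynomial.eval_add, Polynomial.eval_comp]
  refine (hv i).comp_pure ((hg i).mono (polynomial_eval_mono P ?_))
  exact (hv i).size_le (by simp)

theorem PT.pair {a b : ι → Data} (ha : PT O e fun i => PMF.pure (a i))
    (hb : PT O e fun i => PMF.pure (b i)) : PT O e fun i => PMF.pure (Data.cons (a i) (b i)) := by
  obtain ⟨c, P, ha⟩ := ha
  obtain ⟨c', P', hb⟩ := hb
  refine ⟨.pair c c', P + (P' + 1), fun i => ?_⟩
  simp only [Polynomial.eval_add, Polynomial.eval_one]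
  exact (ha i).pair_pure (hb i)

theorem PT.fst {v : ι → Data} (hv : PT O e fun i => PMF.pure (v i)) :
    PT O e fun i => PMF.pure (v i).fst :=
  PT.comp (v := v) ⟨.fst, Polynomial.X, fun i => by simpa using computes_fst (O i) (v i)⟩ hv

theorem PT.snd {v : ι → Data} (hv : PT O e fun i => PMF.pure (v i)) :
    PT O e fun i => PMF.pure (v i).snd :=
  PT.comp (v := v) ⟨.snd, Polynomial.X, fun i => by simpa using computes_snd (O i) (v i)⟩ hv

/-- The component of `x` at the end of a path; `false` stands for `fst`. -/
def Data.get : List Bool → Data → Data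
  | [], x => x
  | false :: l, x => Data.get l x.fst
  | true :: l, x => Data.get l x.snd

theorem PT.get' {v : ι → Data} (l : List Bool) (hv : PT O e fun i => PMF.pure (v i)) :
    PT O e fun i => PMF.pure ((v i).get l) := by
  induction l generalizing v with
  | nil => exact hv
  | cons b l ih =>
    cases b with
    | false => exact ih hv.fst
    | true => exact ih hv.snd

theorem PT.get (l : List Bool) : PT O e fun i => PMF.pure ((e i).get l) := PT.get' l PT.id

theorem PT.const (x : Data) : PT O e fun _ => PMF.pure x := by
  induction x with
  | nil => exact PT.nil
  | cons a b iha ihb => exact iha.pair ihb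

/-- Sequential composition of randomized computations; the second one sees the result of the
first one next to the environment. -/
theorem PT.bindSupport {α : ι → Type} {enc : ∀ i, α i → Data} {g : ∀ i, PMF (α i)}
    {h : ∀ i, α i → PMF Data} (hg : PT O e fun i => (g i).map (enc i))
    (hh : PT (fun p : (i : ι) × {a : α i // a ∈ (g i).support} => O p.1)
      (fun p => Data.cons (e p.1) (enc p.1 p.2)) (fun p => h p.1 p.2)) :
    PT O e fun i => (g i).bind (h i) := by
  obtain ⟨c, P, hg⟩ := hg
  obtain ⟨c', P', hh⟩ := hh
  refine ⟨.comp c' (.pair .id c),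
    (Polynomial.X + (P + 1)) + P'.comp (Polynomial.X + (P + 1)), fun i => ?_⟩
  have h1 := (computes_id (O i) (e i)).pair_pure_left (hg i)
  -- The second program sees only the encoding of `a`, so the law `h i a` has to factor through it.
  -- Encodings need not be injective, but two values with the same code and different laws would
  -- force one program to have two output laws on one input.
  have h2 : ∃ κ : Data → PMF Data, ∀ a : α i, a ∈ (g i).support →
      κ (Data.cons (e i) (enc i a)) = h i a := by
    classical
    by_cases hne : ∀ a b : α i, a ∈ (g i).support → b ∈ (g i).support → enc i a = enc i b →
      h i a = h i b
    · refine ⟨fun x => if hx : ∃ a, a ∈ (g i).support ∧ Data.cons (e i) (enc i a) = x then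
        h i hx.choose else PMF.pure x, fun a ha => ?_⟩
      have hx : ∃ b, b ∈ (g i).support ∧
          Data.cons (e i) (enc i b) = Data.cons (e i) (enc i a) := ⟨a, ha, rfl⟩
      simp only
      rw [dif_pos hx]
      refine hne _ _ hx.choose_spec.1 ha ?_
      have := hx.choose_spec.2
      simpa using this
    · push Not at hne
      obtain ⟨a, b, ha, hb, hab, hne⟩ := hne
      refine absurd ?_ hne
      have ea := hh ⟨i, a, ha⟩ (max (P'.eval (Data.cons (e i) (enc i a)).size) 0) (by simp)
      have eb := hh ⟨i, b, hb⟩ (max (P'.eval (Data.cons (e i) (enc i b)).size) 0) (by simp)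
      simp only at ea eb
      rw [hab] at ea
      have := ea.2.symm.trans eb.2
      exact map_injective_of_injective (Option.some_injective _) this
  obtain ⟨κ, hκ⟩ := h2
  have e1 : (g i).bind (h i) =
      (((g i).map (enc i)).map fun b => Data.cons (e i) b).bind κ := by
    rw [PMF.map_comp, PMF.bind_map]
    exact bind_congr_support fun a ha => (hκ a ha).symm
  beta_reduce
  rw [e1]
  simp only [Polynomial.eval_add, Polynomial.eval_comp, Polynomial.eval_X, Polynomial.eval_one]
  refine h1.comp fun x hx => ?_
  have hsz := h1.size_le hx
  rw [PMF.mem_support_map_iff] at hx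
  obtain ⟨b, hb, rfl⟩ := hx
  rw [PMF.mem_support_map_iff] at hb
  obtain ⟨a, ha, rfl⟩ := hb
  rw [hκ a ha]
  exact (hh ⟨i, a, ha⟩).mono (polynomial_eval_mono P' hsz)

theorem PT.bind {α : ι → Type} {enc : ∀ i, α i → Data} {g : ∀ i, PMF (α i)}
    {h : ∀ i, α i → PMF Data} (hg : PT O e fun i => (g i).map (enc i))
    (hh : PT (fun p : (i : ι) × α i => O p.1) (fun p => Data.cons (e p.1) (enc p.1 p.2))
      (fun p => h p.1 p.2)) : PT O e fun i => (g i).bind (h i) :=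
  PT.bindSupport hg (hh.reindex fun p : (i : ι) × {a : α i // a ∈ (g i).support} =>
    (⟨p.1, p.2.1⟩ : (i : ι) × α i))

/-- Local definition of a deterministic value. -/
theorem PT.let {v : ι → Data} {h : ι → PMF Data} (hv : PT O e fun i => PMF.pure (v i))
    (hh : PT O (fun i => Data.cons (e i) (v i)) h) : PT O e h :=
  PT.comp hh (PT.id.pair hv)

theorem PT.map {α : ι → Type} {enc : ∀ i, α i → Data} {g : ∀ i, PMF (α i)}
    {h : ∀ i, α i → Data} (hg : PT O e fun i => (g i).map (enc i))
    (hh : PT (fun p : (i : ι) × α i => O p.1) (fun p => Data.cons (e p.1) (enc p.1 p.2))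
      (fun p => PMF.pure (h p.1 p.2))) : PT O e fun i => (g i).map (h i) :=
  PT.bind hg hh

/-- Case distinction on whether a value is `nil`. -/
theorem PT.ite {v : ι → Data} {f g : ι → PMF Data} {h : ι → PMF Data}
    (hv : PT O e fun i => PMF.pure (v i))
    (hf : PT (fun i : {i // v i ≠ Data.nil} => O i) (fun i => e i) fun i => f i)
    (hg : PT (fun i : {i // v i = Data.nil} => O i) (fun i => e i) fun i => g i)
    (h1 : ∀ i, v i ≠ Data.nil → h i = f i) (h2 : ∀ i, v i = Data.nil → h i = g i) :
    PT O e h := by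
  obtain ⟨c, P, hv⟩ := hv
  obtain ⟨cf, Pf, hf⟩ := hf
  obtain ⟨cg, Pg, hg⟩ := hg
  refine ⟨.ite c cf cg, P + (Pf + Pg), fun i => ?_⟩
  simp only [Polynomial.eval_add]
  by_cases hi : v i = Data.nil
  · rw [h2 i hi]
    have := hv i
    simp only [hi] at this
    exact this.ite_nil ((hg ⟨i, hi⟩).mono (by simp))
  · rw [h1 i hi]
    have := hv i
    obtain ⟨a, b, hab⟩ : ∃ a b, v i = Data.cons a b := by
      cases hh : v i with
      | nil => exact absurd hh hi
      | cons a b => exact ⟨a, b, rfl⟩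
    simp only [hab] at this
    exact this.ite_cons ((hf ⟨i, hi⟩).mono (by simp))

theorem PT.ite' {v : ι → Data} {f g : ι → PMF Data} {h : ι → PMF Data}
    (hv : PT O e fun i => PMF.pure (v i)) (hf : PT O e f) (hg : PT O e g)
    (h1 : ∀ i, v i ≠ Data.nil → h i = f i) (h2 : ∀ i, v i = Data.nil → h i = g i) :
    PT O e h :=
  PT.ite hv (hf.reindex Subtype.val) (hg.reindex Subtype.val) h1 h2

theorem PT.optionElim {α : ι → Type} {enc : ∀ i, α i → Data} {o : ∀ i, Option (α i)}
    {g : ι → PMF Data} {f : ∀ i, α i → PMF Data}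
    (ho : PT O e fun i => PMF.pure (optionData (enc i) (o i)))
    (hg : PT O e g)
    (hf : PT (fun p : (i : ι) × α i => O p.1) (fun p => Data.cons (e p.1) (enc p.1 p.2))
      (fun p => f p.1 p.2)) :
    PT O e fun i => (o i).elim (g i) (f i) := by
  refine PT.ite (f := fun i => (o i).elim (g i) (f i)) (g := g) ho ?_ (hg.reindex Subtype.val)
    (fun _ _ => rfl) ?_
  · have key : ∀ i : {i // optionData (enc i) (o i) ≠ Data.nil}, (o i).isSome := by
      rintro ⟨i, hi⟩
      cases h : o i with
      | none => simp [h, optionData] at hi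
      | some a => simp
    refine PT.comp (v := fun i : {i // optionData (enc i) (o i) ≠ Data.nil} =>
      Data.cons (e i) (enc i ((o i).get (key i)))) ?_ (PT.id.pair ?_)
    · refine (hf.reindex fun i : {i // optionData (enc i) (o i) ≠ Data.nil} =>
        ⟨i.1, (o i).get (key i)⟩).congr fun i => ?_
      obtain ⟨a, ha⟩ := Option.isSome_iff_exists.1 (key i)
      simp [ha]
    · refine (ho.reindex Subtype.val).fst.congr fun i => ?_
      obtain ⟨a, ha⟩ := Option.isSome_iff_exists.1 (key i)
      simp [ha, optionData, Data.fst]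
  · intro i hi
    cases h : o i with
    | none => rfl
    | some a => simp [h, optionData] at hi

/-! ### Folds and maps -/

/-- Randomized left fold. -/
noncomputable def foldP {α β : Type} (f : β → α → PMF β) : List α → β → PMF β
  | [], b => PMF.pure b
  | a :: l, b => (f b a).bind (foldP f l)

/-- Independent samples from `f a`, for `a` in the list. -/
noncomputable def mapP {α β : Type} (f : α → PMF β) : List α → PMF (List β)
  | [] => PMF.pure []
  | a :: l => (f a).bind fun b => (mapP f l).map (List.cons b)

theorem length_le_size_listData {α : Type} (enc : α → Data) (l : List α) :
    l.length ≤ (listData enc l).size := by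
  induction l with
  | nil => simp
  | cons a l ih => simp only [listData, Data.size, List.length_cons]; omega

theorem size_le_size_listData {α : Type} (enc : α → Data) {l : List α} {a : α} (ha : a ∈ l) :
    (enc a).size ≤ (listData enc l).size := by
  induction l with
  | nil => simp at ha
  | cons b l ih =>
    simp only [listData, Data.size]
    rcases List.mem_cons.1 ha with rfl | h
    · omega
    · have := ih h; omega

/-- The body of the loop of a fold; `s` is the program of one step. -/
def foldBody (s : Prog) : Prog :=
  .pair .fst (.pair (.comp .snd (.comp .fst .snd))
    (.comp s (.pair .fst (.pair (.comp .fst (.comp .fst .snd)) (.comp .snd .snd)))))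

/-- The program of a fold, run on the environment, the list, and the initial value. -/
def foldProg (s : Prog) : Prog :=
  .comp (.comp .snd .snd) (.loop (.comp .fst .snd) (foldBody s))

/-- The relation `R` between the remaining list and the accumulator is an invariant. It is assumed
to bound the size of the state by `W` and the time of one step by `T`, which gives a time bound
linear in the length of the list. -/
theorem computes_foldProg {O : Data → PMF Data} {s : Prog} {x : Data} {α β : Type}
    {encA : α → Data} {encB : β → Data} {step : β → α → PMF β} {R : List α → β → Prop} {W T : ℕ}
    (hW : ∀ a t b, R (a :: t) b → (Data.cons x (Data.cons (listData encA (a :: t)) (encB b))).size ≤ W)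
    (hW' : ∀ b, R [] b → (Data.cons x (Data.cons Data.nil (encB b))).size ≤ W)
    (hs : ∀ a t b, R (a :: t) b → Computes O s (Data.cons x (Data.cons (encA a) (encB b)))
      ((step b a).map encB) T)
    (hR : ∀ a t b, R (a :: t) b → ∀ b' ∈ (step b a).support, R t b') (l : List α) (b : β)
    (h0 : R l b) :
    LoopComputes O (.comp .fst .snd) (foldBody s)
      (Data.cons x (Data.cons (listData encA l) (encB b)))
      ((foldP step l b).map fun b' => Data.cons x (Data.cons Data.nil (encB b')))
      ((20 * W + T + 10) * (l.length + 1)) := by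
  have hcond : ∀ l b, (Data.cons x (Data.cons (listData encA l) (encB b))).size ≤ W →
      Computes O (.comp .fst .snd) (Data.cons x (Data.cons (listData encA l) (encB b)))
        (PMF.pure (listData encA l)) (W + W) := by
    intro l b h
    exact ((computes_snd _ _).mono h).comp_pure
      ((computes_fst _ _).mono ((Data.size_snd_le _).trans h))
  induction l generalizing b with
  | nil =>
    rw [foldP, PMF.pure_map]
    refine ((LoopComputes.done (hcond [] b (hW' b h0)))).mono ?_
    simp; omega
  | cons a t ih =>
    have hw := hW a t b h0
    have hw1 : (Data.cons (listData encA (a :: t)) (encB b)).size ≤ W :=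
      (Data.size_snd_le (Data.cons x (Data.cons (listData encA (a :: t)) (encB b)))).trans hw
    have hw2 : (listData encA (a :: t)).size ≤ W :=
      (Data.size_fst_le (Data.cons (listData encA (a :: t)) (encB b))).trans hw1
    have hbody : Computes O (foldBody s)
        (Data.cons x (Data.cons (listData encA (a :: t)) (encB b)))
        (((step b a).map encB).map fun d => Data.cons x (Data.cons (listData encA t) d))
        (10 * W + T + 5) := by
      have h1 : Computes O (.comp .snd (.comp .fst .snd))
          (Data.cons x (Data.cons (listData encA (a :: t)) (encB b)))
          (PMF.pure (listData encA t)) (W + W + W) :=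
        (hcond _ _ hw).comp_pure ((computes_snd _ _).mono hw2)
      have h2 : Computes O (.comp .fst (.comp .fst .snd))
          (Data.cons x (Data.cons (listData encA (a :: t)) (encB b)))
          (PMF.pure (encA a)) (W + W + W) :=
        (hcond _ _ hw).comp_pure ((computes_fst _ _).mono hw2)
      have h3 : Computes O (.comp .snd .snd)
          (Data.cons x (Data.cons (listData encA (a :: t)) (encB b)))
          (PMF.pure (encB b)) (W + W) :=
        ((computes_snd _ _).mono hw).comp_pure ((computes_snd _ _).mono hw1)
      have h0' : Computes O .fst (Data.cons x (Data.cons (listData encA (a :: t)) (encB b)))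
          (PMF.pure x) W := (computes_fst _ _).mono hw
      have h4 := (h0'.pair_pure (h2.pair_pure h3)).comp_pure (hs a t b h0)
      have h5 := h0'.pair_pure_left (h1.pair_pure_left h4)
      rw [PMF.map_comp] at h5
      rw [PMF.map_comp] at h5 ⊢
      exact h5.mono (by omega)
    rw [foldP, PMF.map_bind]
    -- The continuation must be a function of the encoded state, from which `b'` may not be
    -- recoverable. The law of the remaining loop itself, run with the fuel that the induction
    -- hypothesis provides, serves as this function.
    have e1 : ((step b a).bind fun b' =>
        (foldP step t b').map fun b' => Data.cons x (Data.cons Data.nil (encB b')))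
      = (((step b a).map encB).map fun d => Data.cons x (Data.cons (listData encA t) d)).bind
        (fun d => (Run.loop
          ((Prog.comp .fst .snd).eval O ((20 * W + T + 10) * (t.length + 1)))
          ((foldBody s).eval O ((20 * W + T + 10) * (t.length + 1)))
            ((20 * W + T + 10) * (t.length + 1)) d).map
            fun o => (o.map Prod.fst).getD Data.nil) := by
      rw [PMF.map_comp, PMF.bind_map]
      refine bind_congr_support fun b' hb' => ?_
      have := (ih b' (hR a t b h0 b' hb') _ le_rfl _ le_rfl).2
      simp only [Function.comp]
      have h2 := congrArg (PMF.map fun o : Option Data => o.getD Data.nil) this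
      rw [PMF.map_comp, PMF.map_comp, PMF.map_comp] at h2
      exact h2.symm
    rw [e1]
    refine (LoopComputes.step (hcond _ _ hw) hbody (T₃ := (20 * W + T + 10) * (t.length + 1))
      fun y hy => ?_).mono ?_
    · rw [PMF.map_comp, PMF.mem_support_map_iff] at hy
      obtain ⟨b', hb', rfl⟩ := hy
      have h6 := ih b' (hR a t b h0 b' hb')
      have := (h6 _ le_rfl _ le_rfl).2
      have h2 := congrArg (PMF.map fun o : Option Data => o.getD Data.nil) this
      rw [PMF.map_comp, PMF.map_comp, PMF.map_comp] at h2
      simp only [Function.comp] at h2 ⊢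
      have h7 : (PMF.map (fun o => (Option.map Prod.fst o).getD Data.nil)
          (Run.loop ((Prog.comp .fst .snd).eval O ((20 * W + T + 10) * (t.length + 1)))
          ((foldBody s).eval O ((20 * W + T + 10) * (t.length + 1)))
            ((20 * W + T + 10) * (t.length + 1))
            (Data.cons x (Data.cons (listData encA t) (encB b'))))) = _ := h2
      rw [h7]
      exact h6
    · rw [List.length_cons]
      nlinarith

/-- Polynomial time of a single step is not enough, since an accumulator that doubles at each step
grows exponentially. The invariant `R` together with the polynomial `Q` keeps all reachable
accumulators small. -/
theorem PT.fold {α β : ι → Type} {encA : ∀ i, α i → Data} {encB : ∀ i, β i → Data}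
    {l : ∀ i, List (α i)} {init : ∀ i, β i} {step : ∀ i, β i → α i → PMF (β i)}
    (R : ∀ i, List (α i) → β i → Prop) (Q : Polynomial ℕ)
    (hl : PT O e fun i => PMF.pure (listData (encA i) (l i)))
    (hi : PT O e fun i => PMF.pure (encB i (init i)))
    (hs : PT (fun p : (i : ι) × (α i × β i) => O p.1)
      (fun p => Data.cons (e p.1) (Data.cons (encA p.1 p.2.1) (encB p.1 p.2.2)))
      (fun p => (step p.1 p.2.2 p.2.1).map (encB p.1)))
    (hR0 : ∀ i, R i (l i) (init i))
    (hR : ∀ i a t b, R i (a :: t) b → ∀ b' ∈ (step i b a).support, R i t b')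
    (hQ : ∀ i t b, R i t b → (encB i b).size ≤ Q.eval (e i).size) :
    PT O e fun i => (foldP (step i) (l i) (init i)).map (encB i) := by
  obtain ⟨cl, Pl, hl⟩ := hl
  obtain ⟨ci, Pi, hi⟩ := hi
  obtain ⟨cs, Ps, hs⟩ := hs
  -- Size of the loop state: environment, remaining list, accumulator and the two nodes that join
  -- them.
  set W : Polynomial ℕ := Polynomial.X + Pl + Q + 2 with hWdef
  set TL : Polynomial ℕ := (20 * W + Ps.comp W + 10) * (Pl + 1) with hTL
  refine ⟨.comp (foldProg cs) (.pair .id (.pair cl ci)),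
    (Polynomial.X + (Pl + (Pi + 1) + 1)) + (TL + (W + W)), fun i => ?_⟩
  have hsz : (listData (encA i) (l i)).size ≤ Pl.eval (e i).size := (hl i).size_le (by simp)
  have hWe : W.eval (e i).size = (e i).size + Pl.eval (e i).size + Q.eval (e i).size + 2 := by
    simp [hWdef]
  have hTLe : TL.eval (e i).size = (20 * W.eval (e i).size + Ps.eval (W.eval (e i).size) + 10) *
      (Pl.eval (e i).size + 1) := by simp [hTL, Polynomial.eval_comp]
  have hloop := computes_foldProg (O := O i) (s := cs) (x := e i) (encA := encA i)
    (encB := encB i) (step := step i)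
    (R := fun t b => R i t b ∧ (listData (encA i) t).size ≤ Pl.eval (e i).size)
    (W := W.eval (e i).size) (T := Ps.eval (W.eval (e i).size))
    (fun a t b h => by
      have := hQ _ _ _ h.1
      have := h.2
      simp only [Data.size] at *; omega)
    (fun b h => by
      have := hQ _ _ _ h.1
      have := h.2
      simp only [Data.size, listData] at *; omega)
    (fun a t b h => by
      refine (hs ⟨i, a, b⟩).mono (polynomial_eval_mono _ ?_)
      have := hQ _ _ _ h.1
      have := h.2
      simp only [Data.size, listData] at *; omega)
    (fun a t b h b' hb' => ⟨hR _ _ _ _ h.1 b' hb', by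
      have := h.2
      simp only [Data.size, listData] at *; omega⟩)
    (l i) (init i) ⟨hR0 i, hsz⟩
  have hinput := (computes_id (O i) (e i)).pair_pure ((hl i).pair_pure (hi i))
  simp only [Polynomial.eval_add, Polynomial.eval_X, Polynomial.eval_one]
  refine hinput.comp_pure ?_
  have hlen : (l i).length ≤ Pl.eval (e i).size := (length_le_size_listData _ _).trans hsz
  have h8 := (hloop.mono (T' := TL.eval (e i).size) (by
    rw [hTLe]
    exact Nat.mul_le_mul_left _ (by omega))).computes
  have h9 : ((foldP (step i) (l i) (init i)).map (encB i)) =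
      ((foldP (step i) (l i) (init i)).map fun b' =>
        Data.cons (e i) (Data.cons Data.nil (encB i b'))).bind fun d => PMF.pure d.snd.snd := by
    rw [PMF.bind_map]; rfl
  rw [h9, foldProg]
  have hRf : ∀ (t : List (α i)) (b : β i), R i t b →
      ∀ b' ∈ (foldP (step i) t b).support, R i [] b' := by
    intro t
    induction t with
    | nil =>
      intro b hb b' hb'
      rw [foldP, PMF.mem_support_pure_iff] at hb'
      exact hb' ▸ hb
    | cons a t ih =>
      intro b hb b' hb'
      rw [foldP, PMF.mem_support_bind_iff] at hb'
      obtain ⟨b1, h1, h2⟩ := hb'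
      exact ih b1 (hR _ _ _ _ hb b1 h1) b' h2
  refine h8.comp fun d hd => ?_
  rw [PMF.mem_support_map_iff] at hd
  obtain ⟨b', hb', rfl⟩ := hd
  have hQb := hQ _ _ _ (hRf _ _ (hR0 i) b' hb')
  have hsz2 : (Data.cons (e i) (Data.cons Data.nil (encB i b'))).size ≤ W.eval (e i).size := by
    have := (listData (encA i) (l i)).size_pos
    rw [hWe]; simp only [Data.size]; omega
  exact ((computes_snd _ _).mono hsz2).comp_pure
    ((computes_snd _ _).mono ((Data.size_snd_le _).trans hsz2))

end PRC

/-! ### Polynomial-time operations on lists -/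

namespace PRC

theorem foldP_append {α β : Type} (f : β → α → PMF β) (l l' : List α) (b : β) :
    foldP f (l ++ l') b = (foldP f l b).bind (foldP f l') := by
  induction l generalizing b with
  | nil => simp [foldP, PMF.pure_bind]
  | cons a l ih =>
    simp only [List.cons_append, foldP, PMF.bind_bind]
    exact congrArg _ (funext ih)

theorem foldP_pure {α β : Type} (f : β → α → β) (l : List α) (b : β) :
    foldP (fun b a => PMF.pure (f b a)) l b = PMF.pure (l.foldl f b) := by
  induction l generalizing b with
  | nil => rfl
  | cons a l ih => simp only [foldP, PMF.pure_bind, ih, List.foldl_cons]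

/-- Pushing results on a stack reverses them, so the list is traversed backwards. The samples are
independent, and the order in which they are drawn does not affect the law. -/
theorem foldP_reverse {α β : Type} (f : α → PMF β) (l : List α) (b : List β) :
    foldP (fun b a => (f a).map fun x => x :: b) l.reverse b
      = (mapP f l).map fun t => t ++ b := by
  induction l with
  | nil => simp [foldP, mapP, PMF.pure_map]
  | cons a l ih =>
    simp only [List.reverse_cons, foldP_append, ih, mapP, PMF.map_bind, PMF.map_comp,
      PMF.bind_map, foldP, PMF.bind_pure]
    simp only [map_eq_bind]
    rw [PMF.bind_comm]
    rfl

theorem mapP_pure {α β : Type} (f : α → β) (l : List α) :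
    mapP (fun a => PMF.pure (f a)) l = PMF.pure (l.map f) := by
  induction l with
  | nil => rfl
  | cons a l ih => simp only [mapP, PMF.pure_bind, ih, PMF.pure_map, List.map_cons]

theorem mapP_ofFn {α β : Type} (f : α → PMF β) {k : ℕ} (v : Fin k → α) :
    mapP f (List.ofFn v) = (indep fun j => f (v j)).map List.ofFn := by
  induction k with
  | zero => simp [mapP, indep, PMF.pure_map]
  | succ k ih =>
    simp only [List.ofFn_succ, mapP, indep, PMF.map_bind, PMF.map_comp]
    congr 1
    funext b
    rw [ih, PMF.map_comp]
    congr 1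
    funext f
    simp [List.ofFn_succ]

/-! ### Sizes of lists -/

theorem size_listData {α : Type} (enc : α → Data) (l : List α) :
    (listData enc l).size = 1 + (l.map fun a => 1 + (enc a).size).sum := by
  induction l with
  | nil => rfl
  | cons a l ih => simp only [listData, Data.size, ih, List.map_cons, List.sum_cons]; omega

theorem size_listData_le_of_sublist {α : Type} (enc : α → Data) {l l' : List α}
    (h : l.Sublist l') : (listData enc l).size ≤ (listData enc l').size := by
  rw [size_listData, size_listData]
  have := (h.map fun a => 1 + (enc a).size).sum_le_sum (by simp)
  omega

theorem size_listData_append {α : Type} (enc : α → Data) (l l' : List α) :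
    (listData enc (l ++ l')).size + 1 = (listData enc l).size + (listData enc l').size := by
  simp only [size_listData, List.map_append, List.sum_append]; omega

theorem size_listData_reverse {α : Type} (enc : α → Data) (l : List α) :
    (listData enc l.reverse).size = (listData enc l).size := by
  simp only [size_listData, List.map_reverse, List.sum_reverse]

theorem size_listData_flatten {α : Type} (enc : α → Data) (l : List (List α)) :
    (listData enc l.flatten).size ≤ (listData (listData enc) l).size := by
  induction l with
  | nil => simp [listData]
  | cons a l ih =>
    have := size_listData_append enc a l.flatten
    simp only [List.flatten_cons, listData, Data.size]; omega

theorem size_listData_le {α : Type} (enc : α → Data) {l : List α} {S : ℕ}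
    (h : ∀ a ∈ l, (enc a).size ≤ S) : (listData enc l).size ≤ 1 + l.length * (1 + S) := by
  induction l with
  | nil => simp [listData, Data.size]
  | cons a l ih =>
    have := ih fun a ha => h a (by simp [ha])
    have := h a (by simp)
    simp only [listData, Data.size, List.length_cons]
    nlinarith

/-- Pairs. -/
def pairData {α β : Type} (encA : α → Data) (encB : β → Data) (p : α × β) : Data :=
  Data.cons (encA p.1) (encB p.2)

/-! ### List programs -/

variable {ι : Type} {O : ι → Data → PMF Data} {e : ι → Data}

/-- For a deterministic step the reachable accumulators are exactly the folds over prefixes of the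
list, so a size bound is needed for those only. -/
theorem PT.foldl {α β : ι → Type} {encA : ∀ i, α i → Data} {encB : ∀ i, β i → Data}
    {l : ∀ i, List (α i)} {init : ∀ i, β i} {step : ∀ i, β i → α i → β i} (Q : Polynomial ℕ)
    (hl : PT O e fun i => PMF.pure (listData (encA i) (l i)))
    (hi : PT O e fun i => PMF.pure (encB i (init i)))
    (hs : PT (fun p : (i : ι) × (α i × β i) => O p.1)
      (fun p => Data.cons (e p.1) (Data.cons (encA p.1 p.2.1) (encB p.1 p.2.2)))
      (fun p => PMF.pure (encB p.1 (step p.1 p.2.2 p.2.1))))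
    (hQ : ∀ i t, t <+: l i → (encB i (t.foldl (step i) (init i))).size ≤ Q.eval (e i).size) :
    PT O e fun i => PMF.pure (encB i ((l i).foldl (step i) (init i))) := by
  refine (PT.fold (step := fun i b a => PMF.pure (step i b a))
    (fun i t b => ∃ p, p ++ t = l i ∧ b = p.foldl (step i) (init i)) Q hl hi
    (hs.congr fun _ => (PMF.pure_map _ _).symm) (fun i => ⟨[], rfl, rfl⟩) ?_ ?_).congr ?_
  · rintro i a t b ⟨p, hp, rfl⟩ b' hb'
    rw [PMF.mem_support_pure_iff] at hb'
    subst hb'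
    exact ⟨p ++ [a], by simpa using hp, by simp⟩
  · rintro i t b ⟨p, hp, rfl⟩
    exact hQ i p ⟨t, hp⟩
  · intro i
    rw [foldP_pure, PMF.pure_map]

theorem PT.reverse {α : ι → Type} {enc : ∀ i, α i → Data} {l : ∀ i, List (α i)}
    (hl : PT O e fun i => PMF.pure (listData (enc i) (l i))) :
    PT O e fun i => PMF.pure (listData (enc i) (l i).reverse) := by
  obtain ⟨P, hP⟩ := hl.size_pure_le
  refine (PT.foldl (encB := fun i => listData (enc i)) (init := fun _ => [])
    (step := fun _ b a => a :: b) P hl PT.nil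
    ((PT.get [true, false]).pair (PT.get [true, true])) ?_).congr fun i => by
      rw [List.foldl_flip_cons_eq_append']; simp
  intro i t ht
  rw [List.foldl_flip_cons_eq_append', List.append_nil, size_listData_reverse]
  exact (size_listData_le_of_sublist _ ht.sublist).trans (hP i)

theorem PT.append {α : ι → Type} {enc : ∀ i, α i → Data} {l l' : ∀ i, List (α i)}
    (hl : PT O e fun i => PMF.pure (listData (enc i) (l i)))
    (hl' : PT O e fun i => PMF.pure (listData (enc i) (l' i))) :
    PT O e fun i => PMF.pure (listData (enc i) (l i ++ l' i)) := by
  obtain ⟨P, hP⟩ := hl.size_pure_le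
  obtain ⟨P', hP'⟩ := hl'.size_pure_le
  refine (PT.foldl (encB := fun i => listData (enc i)) (init := l')
    (step := fun _ b a => a :: b) (P + P') hl.reverse hl'
    ((PT.get [true, false]).pair (PT.get [true, true])) ?_).congr fun i => by
      rw [List.foldl_flip_cons_eq_append']; simp
  intro i t ht
  rw [List.foldl_flip_cons_eq_append', Polynomial.eval_add]
  have h1 := size_listData_append (enc i) t.reverse (l' i)
  have h2 := (size_listData_le_of_sublist (enc i) ht.sublist)
  rw [size_listData_reverse] at h1 h2
  have := hP i
  have := hP' i
  omega

theorem foldl_flatten {α : Type} (t : List (List α)) (b : List α) :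
    t.foldl (fun b a => a ++ b) b = t.reverse.flatten ++ b := by
  induction t generalizing b with
  | nil => simp
  | cons a t ih => simp [ih]

theorem PT.flatten {α : ι → Type} {enc : ∀ i, α i → Data} {l : ∀ i, List (List (α i))}
    (hl : PT O e fun i => PMF.pure (listData (listData (enc i)) (l i))) :
    PT O e fun i => PMF.pure (listData (enc i) (l i).flatten) := by
  obtain ⟨P, hP⟩ := hl.size_pure_le
  refine (PT.foldl (encA := fun i => listData (enc i)) (encB := fun i => listData (enc i))
    (init := fun _ => [])
    (step := fun _ b a => a ++ b) P hl.reverse PT.nil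
    (PT.append (PT.get [true, false]) (PT.get [true, true])) ?_).congr fun i => by
      rw [foldl_flatten]; simp
  intro i t ht
  rw [foldl_flatten, List.append_nil]
  refine (size_listData_flatten _ _).trans ?_
  rw [size_listData_reverse]
  refine (size_listData_le_of_sublist _ ht.sublist).trans ?_
  rw [size_listData_reverse]
  exact hP i

theorem PT.mapP {α β : ι → Type} {encA : ∀ i, α i → Data} {encB : ∀ i, β i → Data}
    {l : ∀ i, List (α i)} {f : ∀ i, α i → PMF (β i)}
    (hl : PT O e fun i => PMF.pure (listData (encA i) (l i)))
    (hf : PT (fun p : (i : ι) × α i => O p.1) (fun p => Data.cons (e p.1) (encA p.1 p.2))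
      (fun p => (f p.1 p.2).map (encB p.1))) :
    PT O e fun i => (PRC.mapP (f i) (l i)).map (listData (encB i)) := by
  obtain ⟨P, hP⟩ := hl.size_pure_le
  obtain ⟨Pf, hPf⟩ := hf.size_le
  refine (PT.fold (encB := fun i => listData (encB i)) (init := fun _ => [])
    (step := fun i b a => (f i a).map fun x => x :: b)
    -- The accumulator consists of results for entries already read. Their number is controlled by
    -- the second clause, and the size of each by the time that the program for `f` takes on an
    -- entry of the original list.
    (fun i t b => t <:+ (l i).reverse ∧ b.length + t.length = (l i).length ∧
      ∀ x ∈ b, (encB i x).size ≤ Pf.eval (1 + (e i).size + P.eval (e i).size))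
    (1 + P * (1 + Pf.comp (1 + Polynomial.X + P))) hl.reverse PT.nil ?_ ?_ ?_ ?_).congr ?_
  · have h1 : PT (fun p : (i : ι) × (α i × List (β i)) => O p.1)
        (fun p => Data.cons (e p.1) (Data.cons (encA p.1 p.2.1) (listData (encB p.1) p.2.2)))
        (fun p => (f p.1 p.2.1).map (encB p.1)) :=
      PT.comp (hf.reindex fun p : (i : ι) × (α i × List (β i)) => ⟨p.1, p.2.1⟩)
        ((PT.get [false]).pair (PT.get [true, false]))
    exact (PT.map h1 ((PT.get [true]).pair (PT.get [false, true, true]))).congr fun p => by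
      rw [PMF.map_comp]
  · intro i
    exact ⟨List.suffix_rfl, by simp, by simp⟩
  · rintro i a t b ⟨h1, h2, h3⟩ b' hb'
    rw [PMF.mem_support_map_iff] at hb'
    obtain ⟨x, hx, rfl⟩ := hb'
    refine ⟨(List.suffix_cons a t).trans h1, by simp at h2 ⊢; omega, ?_⟩
    intro y hy
    rcases List.mem_cons.1 hy with rfl | hy
    · refine (hPf ⟨i, a⟩ (encB i y) ((PMF.mem_support_map_iff _ _ _).2 ⟨y, hx, rfl⟩)).trans
        (polynomial_eval_mono _ ?_)
      have ha : a ∈ l i := by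
        have := h1.subset (List.mem_cons_self)
        simpa using this
      have := (size_le_size_listData (encA i) ha).trans (hP i)
      simp only [Data.size]; omega
    · exact h3 y hy
  · rintro i t b ⟨h1, h2, h3⟩
    have h4 := size_listData_le (encB i) h3
    have h5 := (length_le_size_listData (encA i) (l i)).trans (hP i)
    simp only [Polynomial.eval_add, Polynomial.eval_mul, Polynomial.eval_one, Polynomial.eval_comp,
      Polynomial.eval_X]
    refine h4.trans ?_
    have : b.length ≤ P.eval (e i).size := by omega
    gcongr
  · intro i
    rw [foldP_reverse]
    simp only [List.append_nil]
    rw [PMF.map_comp]; rfl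

theorem PT.listMap {α β : ι → Type} {encA : ∀ i, α i → Data} {encB : ∀ i, β i → Data}
    {l : ∀ i, List (α i)} {f : ∀ i, α i → β i}
    (hl : PT O e fun i => PMF.pure (listData (encA i) (l i)))
    (hf : PT (fun p : (i : ι) × α i => O p.1) (fun p => Data.cons (e p.1) (encA p.1 p.2))
      (fun p => PMF.pure (encB p.1 (f p.1 p.2)))) :
    PT O e fun i => PMF.pure (listData (encB i) ((l i).map (f i))) :=
  (PT.mapP (f := fun i a => PMF.pure (f i a)) hl (hf.congr fun _ => (PMF.pure_map _ _).symm)).congr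
    fun i => by rw [mapP_pure, PMF.pure_map]

theorem PT.replicate_nil {α : ι → Type} {enc : ∀ i, α i → Data} {l : ∀ i, List (α i)}
    (hl : PT O e fun i => PMF.pure (listData (enc i) (l i))) :
    PT O e fun i => PMF.pure (natData (l i).length) :=
  (PT.listMap (encB := fun _ (_ : Unit) => Data.nil) (f := fun _ _ => ()) hl PT.nil).congr
    fun i => by simp [natData, List.map_const']

/-- Take from the second component and push on the first one. -/
def moveStep {α : Type} (b : List α × List α) : List α × List α :=
  match b.2 with
  | [] => b
  | a :: t => (a :: b.1, t)

theorem foldl_moveStep {α γ : Type} (t : List γ) (b : List α × List α) :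
    t.foldl (fun b _ => moveStep b) b
      = ((b.2.take t.length).reverse ++ b.1, b.2.drop t.length) := by
  induction t generalizing b with
  | nil => simp
  | cons c t ih =>
    obtain ⟨b1, b2⟩ := b
    rw [List.foldl_cons, ih]
    cases b2 <;> simp [moveStep]

theorem PT.takeDrop {α : ι → Type} {enc : ∀ i, α i → Data} {l : ∀ i, List (α i)} {k : ι → ℕ}
    (hk : PT O e fun i => PMF.pure (natData (k i)))
    (hl : PT O e fun i => PMF.pure (listData (enc i) (l i))) :
    PT O e fun i => PMF.pure (Data.cons (listData (enc i) ((l i).take (k i)).reverse)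
      (listData (enc i) ((l i).drop (k i)))) := by
  obtain ⟨P, hP⟩ := hl.size_pure_le
  refine (PT.foldl (l := fun i => List.replicate (k i) ()) (encA := fun _ _ => Data.nil)
    (encB := fun i => pairData (listData (enc i)) (listData (enc i)))
    (init := fun i => ([], l i)) (step := fun _ b _ => moveStep b) (1 + P + P) hk
    (PT.nil.pair hl) ?_ ?_).congr fun i => by rw [foldl_moveStep]; simp [pairData]
  · refine PT.ite' (v := fun p => listData (enc p.1) p.2.2.2) (PT.get [true, true, true])
      ((((PT.get [true, true, true, false]).pair (PT.get [true, true, false]))).pair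
        (PT.get [true, true, true, true])) (PT.get [true, true]) ?_ ?_
    · rintro ⟨i, _, b1, b2⟩ hi
      cases b2 with
      | nil => exact absurd rfl hi
      | cons a t => rfl
    · rintro ⟨i, _, b1, b2⟩ hi
      cases b2 with
      | nil => rfl
      | cons a t => simp [listData] at hi
  · intro i t _
    rw [foldl_moveStep]
    have h1 := size_listData_le_of_sublist (enc i) (List.take_sublist t.length (l i))
    have h2 := size_listData_le_of_sublist (enc i) (List.drop_sublist t.length (l i))
    have := hP i
    simp only [pairData, Data.size, List.append_nil, size_listData_reverse, Polynomial.eval_add,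
      Polynomial.eval_one]
    omega

theorem PT.take {α : ι → Type} {enc : ∀ i, α i → Data} {l : ∀ i, List (α i)} {k : ι → ℕ}
    (hk : PT O e fun i => PMF.pure (natData (k i)))
    (hl : PT O e fun i => PMF.pure (listData (enc i) (l i))) :
    PT O e fun i => PMF.pure (listData (enc i) ((l i).take (k i))) :=
  (PT.reverse (l := fun i => ((l i).take (k i)).reverse) (PT.fst (PT.takeDrop hk hl))).congr
    fun i => by simp

theorem PT.drop {α : ι → Type} {enc : ∀ i, α i → Data} {l : ∀ i, List (α i)} {k : ι → ℕ}
    (hk : PT O e fun i => PMF.pure (natData (k i)))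
    (hl : PT O e fun i => PMF.pure (listData (enc i) (l i))) :
    PT O e fun i => PMF.pure (listData (enc i) ((l i).drop (k i))) :=
  PT.snd (PT.takeDrop hk hl)

/-- The first `k` consecutive pieces of length `a`. -/
def chunks {α : Type} (a : ℕ) : ℕ → List α → List (List α)
  | 0, _ => []
  | k + 1, l => l.take a :: chunks a k (l.drop a)

theorem length_chunks {α : Type} (a k : ℕ) (l : List α) : (chunks a k l).length = k := by
  induction k generalizing l with
  | zero => rfl
  | succ k ih => simp [chunks, ih]

theorem sublist_of_mem_chunks {α : Type} {a k : ℕ} {l c : List α} (h : c ∈ chunks a k l) :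
    c.Sublist l := by
  induction k generalizing l with
  | zero => simp [chunks] at h
  | succ k ih =>
    rcases List.mem_cons.1 h with rfl | h
    · exact List.take_sublist _ _
    · exact (ih h).trans (List.drop_sublist _ _)

theorem foldl_chunks {α γ : Type} (a : ℕ) (t : List γ) (b : List (List α) × List α) :
    t.foldl (fun b _ => (b.2.take a :: b.1, b.2.drop a)) b
      = ((chunks a t.length b.2).reverse ++ b.1, b.2.drop (t.length * a)) := by
  induction t generalizing b with
  | nil => simp [chunks]
  | cons c t ih =>
    rw [List.foldl_cons, ih]
    simp [chunks, Nat.add_mul, Nat.add_comm]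

theorem PT.chunks {α : ι → Type} {enc : ∀ i, α i → Data} {l : ∀ i, List (α i)} {k a : ι → ℕ}
    (hk : PT O e fun i => PMF.pure (natData (k i))) (ha : PT O e fun i => PMF.pure (natData (a i)))
    (hl : PT O e fun i => PMF.pure (listData (enc i) (l i))) :
    PT O e fun i => PMF.pure (Data.cons
      (listData (listData (enc i)) (PRC.chunks (a i) (k i) (l i)))
      (listData (enc i) ((l i).drop (k i * a i)))) := by
  obtain ⟨P, hP⟩ := hl.size_pure_le
  obtain ⟨Pk, hPk⟩ := hk.size_pure_le
  have key : PT O e fun i => PMF.pure (pairData (listData (listData (enc i))) (listData (enc i))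
      ((PRC.chunks (a i) (k i) (l i)).reverse, (l i).drop (k i * a i))) := by
    -- The length `a i` of a piece is stored in the environment, so that every step of the fold can
    -- use it.
    refine PT.let ha ?_
    refine (PT.foldl (l := fun i => List.replicate (k i) ()) (encA := fun _ _ => Data.nil)
      (encB := fun i => pairData (listData (listData (enc i))) (listData (enc i)))
      (init := fun i => ([], l i)) (step := fun i b _ => (b.2.take (a i) :: b.1, b.2.drop (a i)))
      (2 + Pk * (1 + P) + P) (PT.comp hk (PT.get [false]))
      (PT.nil.pair (PT.comp hl (PT.get [false])))
      ?_ ?_).congr fun i => by rw [foldl_chunks]; simp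
    · exact ((PT.take (l := fun p : (i : ι) × Unit × List (List (α i)) × List (α i) => p.2.2.2)
          (PT.get [false, true]) (PT.get [true, true, true])).pair
          (PT.get [true, true, false])).pair
        (PT.drop (l := fun p : (i : ι) × Unit × List (List (α i)) × List (α i) => p.2.2.2)
          (PT.get [false, true]) (PT.get [true, true, true]))
    · intro i t ht
      rw [foldl_chunks]
      have h0 := hP i
      have h1 : (listData (listData (enc i)) (PRC.chunks (a i) t.length (l i)).reverse).size
          ≤ 1 + (PRC.chunks (a i) t.length (l i)).reverse.length * (1 + P.eval (e i).size) :=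
        size_listData_le _ fun c hc =>
          (size_listData_le_of_sublist _ (sublist_of_mem_chunks (List.mem_reverse.1 hc))).trans h0
      have h2 := size_listData_le_of_sublist (enc i) (List.drop_sublist (t.length * a i) (l i))
      have h3 := hPk i
      rw [size_natData] at h3
      have h4 := ht.length_le
      have he : (e i).size ≤ (Data.cons (e i) (natData (a i))).size :=
        Data.size_fst_le (Data.cons (e i) (natData (a i)))
      rw [List.length_replicate] at h4
      rw [List.length_reverse, length_chunks] at h1
      refine le_trans ?_ (polynomial_eval_mono _ he)
      simp only [pairData, Data.size, List.append_nil, Polynomial.eval_add,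
        Polynomial.eval_one, Polynomial.eval_mul, Polynomial.eval_ofNat]
      have : t.length * (1 + P.eval (e i).size) ≤ Pk.eval (e i).size * (1 + P.eval (e i).size) :=
        Nat.mul_le_mul_right _ (by omega)
      omega
  refine PT.let key ?_
  refine PT.pair ?_ (PT.get [true, true])
  exact (PT.reverse (l := fun i => (PRC.chunks (a i) (k i) (l i)).reverse)
    (PT.get [true, false])).congr fun i => by simp

/-- Pair with the head of the second component and push on the first one. -/
def zipStep {α β : Type} (b : List (α × β) × List β) (a : α) : List (α × β) × List β :=
  match b.2 with
  | [] => b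
  | x :: s => ((a, x) :: b.1, s)

theorem foldl_zip {α β : Type} (t : List α) (b : List (α × β) × List β) :
    t.foldl zipStep b = ((t.zip b.2).reverse ++ b.1, b.2.drop t.length) := by
  induction t generalizing b with
  | nil => simp
  | cons c t ih =>
    obtain ⟨b1, b2⟩ := b
    rw [List.foldl_cons, ih]
    cases b2 <;> simp [zipStep]

theorem PT.zip {α β : ι → Type} {encA : ∀ i, α i → Data} {encB : ∀ i, β i → Data}
    {l : ∀ i, List (α i)} {l' : ∀ i, List (β i)}
    (hl : PT O e fun i => PMF.pure (listData (encA i) (l i)))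
    (hl' : PT O e fun i => PMF.pure (listData (encB i) (l' i))) :
    PT O e fun i => PMF.pure (listData (pairData (encA i) (encB i)) ((l i).zip (l' i))) := by
  obtain ⟨P, hP⟩ := hl.size_pure_le
  obtain ⟨P', hP'⟩ := hl'.size_pure_le
  have key : PT O e fun i => PMF.pure (pairData (listData (pairData (encA i) (encB i)))
      (listData (encB i)) (((l i).zip (l' i)).reverse, (l' i).drop (l i).length)) := by
    refine (PT.foldl
      (encB := fun i => pairData (listData (pairData (encA i) (encB i))) (listData (encB i)))
      (init := fun i => ([], l' i)) (step := fun i => zipStep)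
      (2 + P * (1 + (1 + P + P')) + P') hl (PT.nil.pair hl') ?_ ?_).congr
      fun i => by rw [foldl_zip]; simp
    · refine PT.ite' (v := fun p => listData (encB p.1) p.2.2.2) (PT.get [true, true, true])
        (((((PT.get [true, false]).pair (PT.get [true, true, true, false]))).pair
          (PT.get [true, true, false])).pair
          (PT.get [true, true, true, true])) (PT.get [true, true]) ?_ ?_
      · rintro ⟨i, _, b1, b2⟩ hi
        cases b2 with
        | nil => exact absurd rfl hi
        | cons a t => rfl
      · rintro ⟨i, _, b1, b2⟩ hi
        cases b2 with
        | nil => rfl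
        | cons a t => simp [listData] at hi
    · intro i t ht
      rw [foldl_zip]
      have h0 := hP i
      have h0' := hP' i
      have h1 : (listData (pairData (encA i) (encB i)) (t.zip (l' i)).reverse).size
          ≤ 1 + (t.zip (l' i)).reverse.length * (1 + (1 + P.eval (e i).size + P'.eval (e i).size)) :=
        size_listData_le _ fun c hc => by
          obtain ⟨h3, h4⟩ := List.of_mem_zip (List.mem_reverse.1 hc)
          have := size_le_size_listData (encA i) (ht.subset h3)
          have := size_le_size_listData (encB i) h4
          simp only [pairData, Data.size]; omega
      have h2 := size_listData_le_of_sublist (encB i) (List.drop_sublist t.length (l' i))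
      have h5 := (length_le_size_listData (encA i) (l i))
      have h4 := ht.length_le
      rw [List.length_reverse, List.length_zip] at h1
      simp only [pairData, Data.size, List.append_nil, Polynomial.eval_add,
        Polynomial.eval_one, Polynomial.eval_mul, Polynomial.eval_ofNat]
      have : min t.length (l' i).length * (1 + (1 + P.eval (e i).size + P'.eval (e i).size))
          ≤ P.eval (e i).size * (1 + (1 + P.eval (e i).size + P'.eval (e i).size)) :=
        Nat.mul_le_mul_right _ (by omega)
      omega
  exact (PT.reverse (l := fun i => ((l i).zip (l' i)).reverse) (PT.fst key)).congr
    fun i => by simp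

end PRC

namespace PRC

/-! ### Simulation of an oracle by a program -/

/-- Every outcome of the run is a result reached within `T` steps. -/
def Run.AllLe (p : Run) (T : ℕ) : Prop := ∀ o ∈ p.support, ∃ y t, o = some (y, t) ∧ t ≤ T

/-- The law of the result of a run, `nil` if it was cut off. -/
noncomputable def Run.law (p : Run) : PMF Data := p.map fun o => (o.map Prod.fst).getD Data.nil

theorem Run.Good.law_eq {p : Run} {μ : PMF Data} {T : ℕ} (h : p.Good μ T) : μ = p.law := by
  have := congrArg (PMF.map fun o : Option Data => o.getD Data.nil) h.2
  rw [PMF.map_comp, PMF.map_comp] at this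
  rw [Run.law]
  refine Eq.trans ?_ this.symm
  exact (PMF.map_id μ).symm

theorem Run.AllLe.good {p : Run} {T : ℕ} (h : p.AllLe T) : p.Good p.law T := by
  refine ⟨h, ?_⟩
  rw [Run.law, PMF.map_comp]
  refine map_congr_support fun o ho => ?_
  obtain ⟨y, t, rfl, -⟩ := h o ho
  rfl

theorem Run.AllLe.mono {p : Run} {T T' : ℕ} (h : p.AllLe T) (hT : T ≤ T') : p.AllLe T' :=
  fun o ho => by obtain ⟨y, t, e, ht⟩ := h o ho; exact ⟨y, t, e, ht.trans hT⟩

theorem Run.AllLe.of_andThen {p : Run} {k : Data → Run} {T : ℕ} (h : (p.andThen k).AllLe T) :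
    p.AllLe T ∧ ∀ a s, some (a, s) ∈ p.support → s ≤ T ∧ (k a).AllLe (T - s) := by
  have h2 : ∀ a s, some (a, s) ∈ p.support → s ≤ T ∧ (k a).AllLe (T - s) := by
    intro a s ha
    have key : ∀ o ∈ (k a).support, ∃ y t, o = some (y, t) ∧ s + t ≤ T := by
      intro o ho
      obtain ⟨y, t, e, ht⟩ := h _ (Run.mem_support_andThen.2 (.inr ⟨a, s, ha, o, ho, rfl⟩))
      rcases o with _ | ⟨y', t'⟩
      · simp at e
      · simp at e; exact ⟨y', t', rfl, by omega⟩
    obtain ⟨o, ho⟩ := (k a).support_nonempty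
    obtain ⟨y, t, -, ht⟩ := key o ho
    refine ⟨by omega, fun o ho => ?_⟩
    obtain ⟨y, t, e, ht⟩ := key o ho
    exact ⟨y, t, e, by omega⟩
  refine ⟨fun o ho => ?_, h2⟩
  rcases o with _ | ⟨a, s⟩
  · obtain ⟨y, t, e, -⟩ := h none (Run.mem_support_andThen.2 (.inl ⟨ho, rfl⟩))
    simp at e
  · exact ⟨a, s, rfl, (h2 a s ho).1⟩

theorem Run.AllLe.law_andThen {p : Run} {k : Data → Run} {T : ℕ} (h : (p.andThen k).AllLe T) :
    (p.andThen k).law = p.law.bind fun a => (k a).law := by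
  obtain ⟨h1, h2⟩ := h.of_andThen
  refine (Run.Good.law_eq (T := T + T) (h1.good.andThen fun a ha => ?_)).symm
  obtain ⟨t, ht, -⟩ := h1.good.exists_mem ha
  exact ((h2 a t ht).2.mono (Nat.sub_le _ _)).good

/-- The program which runs the given one on the second component of its input, and answers queries
by running `B` on the first component and the query. -/
def Prog.sim : Prog → Prog → Prog
  | .nil, _ => .nil
  | .id, _ => .snd
  | .fst, _ => .comp .fst .snd
  | .snd, _ => .comp .snd .snd
  | .pair f g, B => .pair (f.sim B) (g.sim B)
  | .comp f g, B => .comp (f.sim B) (.pair .fst (g.sim B))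
  | .ite c f g, B => .ite (c.sim B) (f.sim B) (g.sim B)
  | .loop c f, B => .comp .snd (.loop (c.sim B) (.pair .fst (f.sim B)))
  | .rand, _ => .comp .rand .snd
  | .query, B => B

open Polynomial in
/-- Running time of the simulation. -/
noncomputable def simPoly (PB : ℕ[X]) : Prog → ℕ[X]
  | .nil => X
  | .id => X
  | .fst => X + X
  | .snd => X + X
  | .pair f g => simPoly PB f + (simPoly PB g + 1)
  | .comp f g => (X + (simPoly PB g + 1)) + simPoly PB f
  | .ite c f g => simPoly PB c + (simPoly PB f + simPoly PB g)
  | .loop c f => (simPoly PB c + (X + (simPoly PB f + 1)) + 1) * (X + 1) + X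
  | .rand => X + X
  | .query => PB

/-- The number of iterations is not known beforehand but is at most the simulated time `T`, because
each test consumes some of it. The induction passes the remaining time to the rest of the loop, and
each iteration costs the simulation a fixed amount. -/
theorem computes_sim_loop {O O' : Data → PMF Data} {B c f : Prog} {v : Data} {F W Kc Kf : ℕ}
    (hc : ∀ x T, (c.eval O' F x).AllLe T → 1 + v.size + T ≤ W →
      Computes O (c.sim B) (Data.cons v x) (c.eval O' F x).law Kc)
    (hf : ∀ x T, (f.eval O' F x).AllLe T → 1 + v.size + T ≤ W →
      Computes O (f.sim B) (Data.cons v x) (f.eval O' F x).law Kf) :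
    ∀ n x T, (Run.loop (c.eval O' F) (f.eval O' F) n x).AllLe T → 1 + v.size + T ≤ W →
      LoopComputes O (c.sim B) (.pair .fst (f.sim B)) (Data.cons v x)
        ((Run.loop (c.eval O' F) (f.eval O' F) n x).law.map fun y => Data.cons v y)
        ((Kc + (W + (Kf + 1)) + 1) * (T + 1)) := by
  intro n
  induction n with
  | zero =>
    intro x T h _
    obtain ⟨y, t, e, -⟩ := h none (by simp [Run.loop])
    simp at e
  | succ n ih =>
    intro x T h hW
    rw [Run.loop] at h ⊢
    rw [h.law_andThen]
    obtain ⟨h1, h2⟩ := h.of_andThen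
    have hcx := hc x T h1 hW
    intro F₁ hF₁ n₁ hn₁
    obtain ⟨n₁, rfl⟩ : ∃ k, n₁ = k + 1 := ⟨n₁ - 1, by
      have : 1 ≤ (Kc + (W + (Kf + 1)) + 1) * (T + 1) := Nat.mul_pos (by omega) (by omega)
      omega⟩
    have hKc : Kc ≤ (Kc + (W + (Kf + 1)) + 1) * (T + 1) := by nlinarith
    rw [Run.loop, PMF.map_bind]
    refine ((hcx F₁ (hKc.trans hF₁)).andThen (T₂ := (W + (Kf + 1)) +
      (Kc + (W + (Kf + 1)) + 1) * T) fun b hb => ?_).mono (by nlinarith)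
    obtain ⟨s, hs, -⟩ := h1.good.exists_mem hb
    -- A test costs at least the size of its input, which is positive; so the remaining time
    -- strictly decreases.
    have hs1 : 1 ≤ s := x.size_pos.trans (Prog.size_le _ _ _ _ _ _ hs).1
    obtain ⟨hsT, h3⟩ := h2 b s hs
    cases b with
    | nil =>
      have hx : (Data.cons v x).size ≤ W := by
        have h4 := (Prog.size_le _ _ _ _ _ _ hs).1
        simp only [Data.size]; omega
      simp only
      rw [← (Run.Good.ret x 0).law_eq, PMF.pure_map]
      exact (Run.Good.ret _ 0).mono (Nat.zero_le _)
    | cons b1 b2 =>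
      simp only at h3 ⊢
      rw [h3.law_andThen, PMF.map_bind]
      obtain ⟨h4, h5⟩ := h3.of_andThen
      have hfx := hf x (T - s) h4 (by omega)
      have hx : (Data.cons v x).size ≤ W := by
        have h4 := (Prog.size_le _ _ _ _ _ _ hs).1
        simp only [Data.size]; omega
      have hbody := ((computes_fst O (Data.cons v x)).mono hx).pair_pure_left hfx
      have hT1 : (Kc + (W + (Kf + 1)) + 1) * (T + 1) =
        (Kc + (W + (Kf + 1)) + 1) * T + (Kc + (W + (Kf + 1)) + 1) := by ring
      obtain ⟨T', rfl⟩ : ∃ T', T = T' + 1 := ⟨T - 1, by omega⟩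
      have hb2 := (hbody F₁ (by omega)).andThen
        (T₂ := (Kc + (W + (Kf + 1)) + 1) * (T' + 1))
        (k := Run.loop ((c.sim B).eval O F₁) ((Prog.pair .fst (f.sim B)).eval O F₁) n₁)
        (κ := fun d => (Run.loop (c.eval O' F) (f.eval O' F) n d.snd).law.map fun y =>
          Data.cons v y) ?_
      · rw [PMF.bind_map] at hb2
        exact hb2
      · intro d hd
        rw [PMF.mem_support_map_iff] at hd
        obtain ⟨a, ha, rfl⟩ := hd
        obtain ⟨s', hs', -⟩ := h4.good.exists_mem ha
        obtain ⟨h6, h7⟩ := h5 a s' hs'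
        exact ih a T' (h7.mono (by omega)) (by omega) F₁ (by omega) n₁ (by omega)

/-- In a run of at most `T` steps all intermediate data have size at most `T`. Hence `W` bounds
every pair of the auxiliary data `v` and the current value, and the time of the simulation is a
polynomial in `W` determined by the shape of the program `A`. -/
theorem computes_sim {O O' : Data → PMF Data} {B : Prog} {v : Data} {PB : Polynomial ℕ} {W : ℕ}
    (hB : ∀ y, Computes O B (Data.cons v y) (O' y) (PB.eval (Data.cons v y).size)) {F : ℕ}
    (A : Prog) : ∀ x T, (A.eval O' F x).AllLe T → 1 + v.size + T ≤ W →
      Computes O (A.sim B) (Data.cons v x) (A.eval O' F x).law ((simPoly PB A).eval W) := by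
  have hsize : ∀ (A : Prog) x T, (A.eval O' F x).AllLe T → x.size ≤ T := by
    intro A x T h
    obtain ⟨o, ho⟩ := (A.eval O' F x).support_nonempty
    obtain ⟨y, t, rfl, ht⟩ := h o ho
    exact (Prog.size_le _ _ _ _ _ _ ho).1.trans ht
  have hcons : ∀ (A : Prog) x T, (A.eval O' F x).AllLe T → 1 + v.size + T ≤ W →
      (Data.cons v x).size ≤ W := by
    intro A x T h hW
    have := hsize A x T h
    simp only [Data.size]; omega
  have hx : ∀ (A : Prog) x T, (A.eval O' F x).AllLe T → 1 + v.size + T ≤ W → x.size ≤ W := by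
    intro A x T h hW
    have := hsize A x T h
    omega
  induction A with
  | nil =>
    intro x T h hW
    rw [Prog.eval, ← (Run.Good.ret _ _).law_eq]
    simpa [simPoly, Prog.sim, Data.snd] using (computes_nil O (Data.cons v x)).mono (hcons _ x T h hW)
  | id =>
    intro x T h hW
    rw [Prog.eval, ← (Run.Good.ret _ _).law_eq]
    simpa [simPoly, Prog.sim, Data.snd] using (computes_snd O (Data.cons v x)).mono (hcons _ x T h hW)
  | fst =>
    intro x T h hW
    rw [Prog.eval, ← (Run.Good.ret _ _).law_eq]
    simpa [simPoly, Prog.sim, Data.snd] using ((computes_snd O (Data.cons v x)).mono (hcons _ x T h hW)).comp_pure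
      ((computes_fst O x).mono (hx _ x T h hW))
  | snd =>
    intro x T h hW
    rw [Prog.eval, ← (Run.Good.ret _ _).law_eq]
    simpa [simPoly, Prog.sim, Data.snd] using ((computes_snd O (Data.cons v x)).mono (hcons _ x T h hW)).comp_pure
      ((computes_snd O x).mono (hx _ x T h hW))
  | rand =>
    intro x T h hW
    have h1 : Computes O .rand x (Prog.rand.eval O' F x).law W := by
      intro F' _
      rw [show Prog.rand.eval O F' x = Prog.rand.eval O' F x by simp only [Prog.eval]]
      exact h.good.mono (by omega)
    simpa [simPoly, Prog.sim, Data.snd] using ((computes_snd O (Data.cons v x)).mono (hcons _ x T h hW)).comp_pure h1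
  | query =>
    intro x T h hW
    have h1 : (Prog.query.eval O' F x).law = O' x := by
      rw [Run.law, Prog.eval, PMF.map_comp]; exact PMF.map_id _
    rw [h1]
    exact (hB x).mono (polynomial_eval_mono _ (hcons _ x T h hW))
  | pair f g ihf ihg =>
    intro x T h hW
    have hW' := hcons _ x T h hW
    rw [Prog.eval] at h ⊢
    rw [h.law_andThen]
    obtain ⟨h1, h2⟩ := h.of_andThen
    have h4 : Computes O (g.sim B) (Data.cons v x) (g.eval O' F x).law
        ((simPoly PB g).eval W) := by
      obtain ⟨o, ho⟩ := (f.eval O' F x).support_nonempty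
      obtain ⟨a, s, rfl, -⟩ := h1 o ho
      exact ihg x T ((h2 a s ho).2.of_andThen.1.mono (Nat.sub_le _ _)) hW
    have h5 := (ihf x T h1 hW).pair h4
    have h6 : ((f.eval O' F x).law.bind fun a => (g.eval O' F x).law.map fun b => Data.cons a b)
        = (f.eval O' F x).law.bind fun a => ((g.eval O' F x).andThen fun b =>
          Run.ret (Data.cons a b) 1).law := by
      refine bind_congr_support fun a ha => ?_
      obtain ⟨s, hs, -⟩ := h1.good.exists_mem ha
      rw [(h2 a s hs).2.law_andThen]
      refine bind_congr_support fun b _ => ?_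
      exact (Run.Good.ret _ _).law_eq
    rw [← h6]
    simpa [simPoly, Prog.sim, Data.snd] using h5
  | comp f g ihf ihg =>
    intro x T h hW
    have hW' := hcons _ x T h hW
    rw [Prog.eval] at h ⊢
    rw [h.law_andThen]
    obtain ⟨h1, h2⟩ := h.of_andThen
    have h3 := ((computes_fst O (Data.cons v x)).mono hW').pair_pure_left (ihg x T h1 hW)
    have h4 := h3.comp (f := f.sim B) (T₂ := (simPoly PB f).eval W)
      (κ := fun d => (f.eval O' F d.snd).law) ?_
    · rw [PMF.bind_map] at h4
      simp only [simPoly, Polynomial.eval_add, Polynomial.eval_X, Polynomial.eval_one]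
      exact h4
    · intro d hd
      rw [PMF.mem_support_map_iff] at hd
      obtain ⟨a, ha, rfl⟩ := hd
      obtain ⟨s, hs, -⟩ := h1.good.exists_mem ha
      exact ihf a (T - s) (h2 a s hs).2 (by omega)
  | ite c f g ihc ihf ihg =>
    intro x T h hW
    have hW' := hcons _ x T h hW
    rw [Prog.eval] at h ⊢
    rw [h.law_andThen]
    obtain ⟨h1, h2⟩ := h.of_andThen
    simp only [simPoly, Polynomial.eval_add]
    intro F' hF'
    refine (ihc x T h1 hW F' (by omega)).andThen fun b hb => ?_
    obtain ⟨s, hs, -⟩ := h1.good.exists_mem hb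
    have h3 := (h2 b s hs).2
    cases b with
    | nil => exact (ihg x (T - s) h3 (by omega) F' (by omega)).mono (by omega)
    | cons _ _ => exact (ihf x (T - s) h3 (by omega) F' (by omega)).mono (by omega)
  | loop c f ihc ihf =>
    intro x T h hW
    have hW' := hcons _ x T h hW
    have h1 := (computes_sim_loop ihc ihf F x T h hW).computes
    have h2 := h1.comp (f := .snd) (T₂ := W) (κ := fun d => PMF.pure d.snd) ?_
    · rw [PMF.bind_map] at h2
      have h3 : ((Run.loop (c.eval O' F) (f.eval O' F) F x).law.bind
          ((fun d : Data => PMF.pure d.snd) ∘ fun y => Data.cons v y))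
          = (Run.loop (c.eval O' F) (f.eval O' F) F x).law := PMF.bind_pure _
      rw [h3] at h2
      refine h2.mono ?_
      simp only [simPoly, Polynomial.eval_add, Polynomial.eval_mul, Polynomial.eval_X,
        Polynomial.eval_one]
      gcongr
      omega
    · intro d hd
      rw [PMF.mem_support_map_iff] at hd
      obtain ⟨a, ha, rfl⟩ := hd
      refine (computes_snd O _).mono ?_
      obtain ⟨t, ht, htT⟩ := Run.Good.exists_mem (Run.AllLe.good h) ha
      have := (Prog.size_le O' F (.loop c f) x a t ht).2
      simp only [Data.size]; omega

variable {ι : Type} {O : ι → Data → PMF Data} {e : ι → Data}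

/-- Running a halting oracle program, the oracle being simulated by a program that has access to
the data `v`. -/
theorem PT.sim (A : Prog) {O' : ι → Data → PMF Data} {v x : ι → Data} {T : ι → ℕ}
    (Q : Polynomial ℕ) (hv : PT O e fun i => PMF.pure (v i))
    (hx : PT O e fun i => PMF.pure (x i)) (hA : ∀ i, A.HaltsWithin (O' i) (x i) (T i))
    (hT : ∀ i, T i ≤ Q.eval (e i).size)
    (hB : PT (fun p : ι × Data => O p.1) (fun p => Data.cons (v p.1) p.2) fun p => O' p.1 p.2) :
    PT O e fun i => A.law (O' i) (x i) (T i) := by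
  obtain ⟨B, PB, hB⟩ := hB
  obtain ⟨Pv, hPv⟩ := hv.size_pure_le
  have key : PT O (fun i => Data.cons (e i) (Data.cons (v i) (x i))) fun i =>
      A.law (O' i) (x i) (T i) := by
    refine ⟨.comp (A.sim B) .snd, Polynomial.X + (simPoly PB A).comp (1 + Pv + Q), fun i => ?_⟩
    have h1 := computes_sim (O := O i) (O' := O' i) (B := B) (v := v i) (PB := PB)
      (F := T i) (W := (1 + Pv + Q).eval (e i).size) (fun y => hB (i, y)) A (x i) (T i) (hA i) (by
        have := hPv i
        have := hT i
        simp only [Polynomial.eval_add, Polynomial.eval_one]; omega)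
    rw [Polynomial.eval_add, Polynomial.eval_X, Polynomial.eval_comp]
    have h2 : A.law (O' i) (x i) (T i) = (A.eval (O' i) (T i) (x i)).law := by
      rw [Prog.law, Prog.output, PMF.map_comp]; rfl
    beta_reduce
    rw [h2]
    refine (computes_snd _ _).comp_pure (h1.mono (polynomial_eval_mono _
      (polynomial_eval_mono _ ?_)))
    simp only [Data.size]; omega
  exact PT.comp key (PT.id.pair (hv.pair hx))

end PRC

namespace PRC

/-! ### Independent samples and uniform laws -/

theorem uniform_map_bijective {α β : Type*} [Fintype α] [Nonempty α] [Fintype β] [Nonempty β]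
    {f : α → β} (hf : Function.Bijective f) :
    (PMF.uniformOfFintype α).map f = PMF.uniformOfFintype β := by
  ext b
  obtain ⟨a, rfl⟩ := hf.2 b
  rw [PMF.map_apply, tsum_eq_single a]
  · simp [Fintype.card_of_bijective hf]
  · intro a' ha'
    rw [if_neg fun h => ha' (hf.1 h).symm]

theorem indep_apply {α : Type} {k : ℕ} (μ : Fin k → PMF α) (f : Fin k → α) :
    indep μ f = ∏ i, μ i (f i) := by
  induction k with
  | zero => simp [indep, PMF.pure_apply, Subsingleton.elim f Fin.elim0]
  | succ k ih =>
    rw [indep, PMF.bind_apply, tsum_eq_single (f 0), Fin.prod_univ_succ]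
    · congr 1
      rw [PMF.map_apply, tsum_eq_single (Fin.tail f), if_pos (Fin.cons_self_tail f).symm, ih]
      · rfl
      · intro g hg
        rw [if_neg]
        rintro h
        exact hg (by rw [h, Fin.tail_cons])
    · intro a ha
      rw [PMF.map_apply, ENNReal.tsum_eq_zero.2, mul_zero]
      intro g
      rw [if_neg]
      rintro h
      exact ha (by rw [h, Fin.cons_zero])

theorem indep_uniform {α : Type} [Fintype α] [Nonempty α] (k : ℕ) :
    (indep fun _ : Fin k => PMF.uniformOfFintype α) = PMF.uniformOfFintype (Fin k → α) := by
  ext f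
  simp [indep_apply, PMF.uniformOfFintype_apply, ENNReal.inv_pow]

theorem indep_bind {α β : Type} {k : ℕ} (μ : Fin k → PMF α) (κ : Fin k → α → PMF β) :
    ((indep μ).bind fun f => indep fun i => κ i (f i)) = indep fun i => (μ i).bind (κ i) := by
  induction k with
  | zero => simp [indep]
  | succ k ih =>
    simp only [indep, PMF.bind_bind, PMF.bind_map]
    refine congrArg _ (funext fun a => ?_)
    rw [← ih]
    simp only [Function.comp_def, Fin.cons_zero, Fin.cons_succ, PMF.map_bind]
    rw [PMF.bind_comm]

theorem indep_map {α β : Type} {k : ℕ} (μ : Fin k → PMF α) (g : Fin k → α → β) :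
    ((indep μ).map fun f i => g i (f i)) = indep fun i => (μ i).map (g i) := by
  have := indep_bind μ fun i a => PMF.pure (g i a)
  rw [show (indep fun i => (μ i).map (g i)) = _ from this.symm, map_eq_bind]
  refine congrArg _ (funext fun f => ?_)
  ext h
  rw [indep_apply, PMF.pure_apply]
  simp only [PMF.pure_apply]
  by_cases hh : h = fun i => g i (f i)
  · simp [hh]
  · rw [if_neg hh]
    obtain ⟨i, hi⟩ := Function.ne_iff.1 hh
    exact (Finset.prod_eq_zero (Finset.mem_univ i) (if_neg hi)).symm

/-- A coordinate may be drawn afresh at the end, whatever was in its place before. This isolates one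
key or one block from all others, both in the hybrid argument and in the analysis of a single test.
-/
theorem indep_resample {α β : Type} {k : ℕ} {μ μ' : Fin k → PMF α} (i : Fin k)
    (h : ∀ j, j ≠ i → μ' j = μ j) (G : (Fin k → α) → PMF β) :
    (indep μ).bind G = (indep μ').bind fun f => (μ i).bind fun a => G (Function.update f i a) := by
  induction k with
  | zero => exact i.elim0
  | succ k ih =>
    simp only [indep, PMF.bind_bind, PMF.bind_map]
    induction i using Fin.cases with
    | zero =>
      have h1 : (fun i : Fin k => μ' i.succ) = fun i => μ i.succ :=
        funext fun j => h _ (Fin.succ_ne_zero j)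
      have h2 : ∀ a b, (G ∘ fun f : Fin k → α => (Fin.cons a f : Fin (k + 1) → α)) b
        = G (Fin.cons a b) := fun _ _ => rfl
      simp only [h1, Function.comp_def, Fin.update_cons_zero]
      rw [PMF.bind_const]
      rw [PMF.bind_comm]
    | succ i =>
      rw [h 0 (Fin.succ_ne_zero i).symm]
      refine congrArg _ (funext fun a => ?_)
      rw [ih (μ := fun j => μ j.succ) (μ' := fun j => μ' j.succ) i
        fun j hj => h _ fun e => hj (Fin.succ_injective _ e)]
      refine congrArg _ (funext fun f => ?_)
      simp only [Function.comp_def, Fin.cons_update]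

theorem indep_map_eval {α : Type} {k : ℕ} (μ : Fin k → PMF α) (i : Fin k) :
    (indep μ).map (fun f => f i) = μ i := by
  rw [map_eq_bind, indep_resample i (fun _ _ => rfl)]
  simp only [Function.update_self]
  rw [PMF.bind_const, PMF.bind_pure]

/-! ### Random numbers, bit strings and words -/

variable {ι : Type} {O : ι → Data → PMF Data} {e : ι → Data}

theorem length_listData {α : Type} (enc : α → Data) (l : List α) :
    (listData enc l).length = l.length := by
  induction l with
  | nil => rfl
  | cons a l ih => simp [listData, Data.length, ih]

theorem PT.rand {α : ι → Type} {enc : ∀ i, α i → Data} {l : ∀ i, List (α i)} {k : ι → ℕ}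
    [∀ i, NeZero (k i)] (hk : ∀ i, (l i).length = k i)
    (hl : PT O e fun i => PMF.pure (listData (enc i) (l i))) :
    PT O e fun i => (PMF.uniformOfFintype (Fin (k i))).map fun j : Fin (k i) => natData (j : ℕ) := by
  refine PT.comp (v := fun i => listData (enc i) (l i)) ⟨.rand, Polynomial.X, fun i => ?_⟩ hl
  have := computes_rand (O i) (listData (enc i) (l i)) (k := k i)
    ((length_listData _ _).trans (hk i))
  simp only [Polynomial.eval_X]
  convert this using 1
  exact (PMF.map_comp (fun j : Fin (k i) => (j : ℕ)) _ natData).symm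

/-- The unary numbers `0` and `1` are the same trees as the two bits, so a random number below `2`
is already a fair bit. -/
theorem uniform_bool_data :
    (PMF.uniformOfFintype (Fin 2)).map (fun j : Fin 2 => natData (j : ℕ))
      = (PMF.uniformOfFintype Bool).map boolData := by
  rw [← uniform_map_bijective finTwoEquiv.bijective, PMF.map_comp]
  congr 1
  funext j
  fin_cases j <;> rfl

theorem mapP_replicate {α β : Type} (μ : PMF β) (a : α) (k : ℕ) :
    mapP (fun _ => μ) (List.replicate k a) = (indep fun _ : Fin k => μ).map List.ofFn := by
  rw [← mapP_ofFn (fun _ : α => μ) fun _ : Fin k => a, List.ofFn_const]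

theorem PT.iid {β : ι → Type} {enc : ∀ i, β i → Data} {k : ι → ℕ} {μ : ∀ i, PMF (β i)}
    (hk : PT O e fun i => PMF.pure (natData (k i))) (hμ : PT O e fun i => (μ i).map (enc i)) :
    PT O e fun i => (indep fun _ : Fin (k i) => μ i).map fun f =>
      listData (enc i) (List.ofFn f) :=
  (PT.mapP (l := fun i => List.replicate (k i) ()) (encA := fun _ _ => Data.nil) (encB := enc)
    (f := fun i _ => μ i) hk (PT.comp (hμ.reindex Sigma.fst) (PT.get [false]))).congr fun i => by
      rw [mapP_replicate, PMF.map_comp]; rfl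

theorem PT.bits {k : ι → ℕ} (hk : PT O e fun i => PMF.pure (natData (k i))) :
    PT O e fun i => (PMF.uniformOfFintype (Fin (k i) → Bool)).map bitsData := by
  refine (PT.iid (μ := fun _ => PMF.uniformOfFintype Bool) (enc := fun _ => boolData) hk ?_).congr
    fun i => by rw [indep_uniform]; rfl
  refine (PT.rand (k := fun _ => 2) (l := fun _ => [(), ()]) (enc := fun _ _ => Data.nil)
    (fun _ => rfl) (PT.const _)).congr fun i => uniform_bool_data

theorem PT.word {q : ℕ} [NeZero q] {k : ι → ℕ} (hk : PT O e fun i => PMF.pure (natData (k i))) :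
    PT O e fun i => (PMF.uniformOfFintype (Fin (k i) → Fin q)).map
      fun y => wordData (List.ofFn y) := by
  refine (PT.iid (μ := fun _ => PMF.uniformOfFintype (Fin q))
    (enc := fun _ (a : Fin q) => natData a) hk ?_).congr fun i => by rw [indep_uniform]; rfl
  exact PT.rand (k := fun _ => q) (l := fun _ => List.replicate q ()) (enc := fun _ _ => Data.nil)
    (fun _ => by simp) (PT.const _)

/-! ### Substrings -/

theorem foldl_tails {α γ : Type} (t : List γ) (b : List (List α) × List α) :
    t.foldl (fun b _ => (b.2 :: b.1, b.2.tail)) b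
      = (((List.range t.length).map fun a => b.2.drop a).reverse ++ b.1, b.2.drop t.length) := by
  induction t generalizing b with
  | nil => simp
  | cons c t ih =>
    rw [List.foldl_cons, ih]
    simp [List.range_succ_eq_map, Function.comp_def]

theorem PT.tails {α : ι → Type} {enc : ∀ i, α i → Data} {l : ∀ i, List (α i)}
    (hl : PT O e fun i => PMF.pure (listData (enc i) (l i))) :
    PT O e fun i => PMF.pure (listData (listData (enc i))
      ((List.range (l i).length).map fun a => (l i).drop a)) := by
  obtain ⟨P, hP⟩ := hl.size_pure_le
  have key : PT O e fun i => PMF.pure (pairData (listData (listData (enc i))) (listData (enc i))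
      (((List.range (l i).length).map fun a => (l i).drop a).reverse,
        (l i).drop (l i).length)) := by
    refine (PT.foldl (encB := fun i => pairData (listData (listData (enc i))) (listData (enc i)))
      (init := fun i => ([], l i)) (step := fun _ b _ => (b.2 :: b.1, b.2.tail))
      (2 + P * (1 + P) + P) hl (PT.nil.pair hl) ?_ ?_).congr fun i => by rw [foldl_tails]; simp
    · refine (((PT.get [true, true, true]).pair (PT.get [true, true, false])).pair
        (PT.get [true, true, true, true])).congr ?_
      rintro ⟨i, a, b1, b2⟩
      cases b2 <;> rfl
    · intro i t ht
      rw [foldl_tails]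
      have h0 := hP i
      have h1 : (listData (listData (enc i))
          ((List.range t.length).map fun a => (l i).drop a).reverse).size
          ≤ 1 + ((List.range t.length).map fun a => (l i).drop a).reverse.length
            * (1 + P.eval (e i).size) :=
        size_listData_le _ fun c hc => by
          obtain ⟨a, -, rfl⟩ := List.mem_map.1 (List.mem_reverse.1 hc)
          exact (size_listData_le_of_sublist _ (List.drop_sublist _ _)).trans h0
      have h2 := size_listData_le_of_sublist (enc i) (List.drop_sublist t.length (l i))
      have h3 := length_le_size_listData (enc i) (l i)
      have h4 := ht.length_le
      rw [List.length_reverse, List.length_map, List.length_range] at h1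
      simp only [pairData, Data.size, List.append_nil, Polynomial.eval_add,
        Polynomial.eval_one, Polynomial.eval_mul, Polynomial.eval_ofNat]
      have : t.length * (1 + P.eval (e i).size) ≤ P.eval (e i).size * (1 + P.eval (e i).size) :=
        Nat.mul_le_mul_right _ (by omega)
      omega
  exact (PT.reverse (l := fun i => ((List.range (l i).length).map fun a => (l i).drop a).reverse)
    (PT.fst key)).congr fun i => by simp

/-- Prefixes are the reversed suffixes of the reversed list, so the program for suffixes also
enumerates prefixes, and with them all substrings. -/
theorem inits_eq_reverse_tails {α : Type} (z : List α) :
    ((List.range z.length).map fun b => z.take (b + 1))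
      = (((List.range z.reverse.length).map fun a => z.reverse.drop a).map
          List.reverse).reverse := by
  apply List.ext_getElem
  · simp
  · intro i h1 h2
    simp only [List.getElem_map, List.getElem_range, List.getElem_reverse, List.length_map,
      List.length_range, List.length_reverse, List.drop_reverse, List.reverse_reverse]
    congr 1
    simp at h1
    omega

theorem substrings_eq {α : Type} (y : List α) :
    substrings y = (((List.range y.length).map fun a => y.drop a).map fun z =>
      (((List.range z.reverse.length).map fun a => z.reverse.drop a).map
          List.reverse).reverse).flatten := by
  rw [substrings, List.flatMap_def, List.map_map]
  congr 1
  refine List.map_congr_left fun a _ => ?_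
  rw [Function.comp, ← inits_eq_reverse_tails, List.length_drop]

theorem PT.substrings {α : ι → Type} {enc : ∀ i, α i → Data} {l : ∀ i, List (α i)}
    (hl : PT O e fun i => PMF.pure (listData (enc i) (l i))) :
    PT O e fun i => PMF.pure (listData (listData (enc i)) (PRC.substrings (l i))) := by
  simp only [substrings_eq]
  refine PT.flatten (PT.listMap (encA := fun i => listData (enc i)) hl.tails ?_)
  refine PT.reverse (α := fun p : (i : ι) × List (α i) => List (α p.1))
    (PT.listMap (encA := fun p : (i : ι) × List (α i) => listData (enc p.1)) (PT.tails (PT.reverse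
      (l := fun p : (i : ι) × List (α i) => p.2) (PT.get [true]))) ?_)
  exact PT.reverse (l := fun p : (p : (i : ι) × List (α i)) × List (α p.1) => p.2) (PT.get [true])

theorem anyAccepts_eq {α β : Type} (f : α → PMF (Option β)) (l : List α) :
    anyAccepts f l = (mapP f l).map fun os => os.any Option.isSome := by
  induction l with
  | nil => simp [anyAccepts, mapP, PMF.pure_map]
  | cons a l ih =>
    simp only [anyAccepts, mapP, PMF.map_bind, PMF.map_comp, ih]
    rfl

/-- Selection by a condition. -/
def Data.select : Data → Data → Data → Data
  | .nil, _, y => y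
  | .cons _ _, x, _ => x

theorem PT.select {c x y : ι → Data} (hc : PT O e fun i => PMF.pure (c i))
    (hx : PT O e fun i => PMF.pure (x i)) (hy : PT O e fun i => PMF.pure (y i)) :
    PT O e fun i => PMF.pure ((c i).select (x i) (y i)) := by
  refine PT.ite' hc hx hy ?_ ?_
  · intro i hi
    cases h : c i with
    | nil => exact absurd h hi
    | cons a b => rfl
  · intro i hi
    rw [hi]; rfl

theorem foldl_or {α : Type} (p : α → Bool) (l : List α) (b : Bool) :
    l.foldl (fun b a => b || p a) b = (b || l.any p) := by
  induction l generalizing b with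
  | nil => simp
  | cons a l ih => simp [ih, Bool.or_assoc]

theorem PT.any {α : ι → Type} {enc : ∀ i, α i → Data} {l : ∀ i, List (α i)}
    {p : ∀ i, α i → Bool} (hl : PT O e fun i => PMF.pure (listData (enc i) (l i)))
    (hp : PT (fun p : (i : ι) × α i => O p.1) (fun p => Data.cons (e p.1) (enc p.1 p.2))
      fun a => PMF.pure (boolData (p a.1 a.2))) :
    PT O e fun i => PMF.pure (boolData ((l i).any (p i))) := by
  refine (PT.foldl (encB := fun _ => boolData) (init := fun _ => false)
    (step := fun i b a => b || p i a) 3 hl PT.nil ?_ ?_).congr fun i => by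
      rw [foldl_or, Bool.false_or]
  · refine (PT.select (PT.get [true, true]) (PT.const (boolData true))
      (PT.comp (hp.reindex fun p : (i : ι) × (α i × Bool) => ⟨p.1, p.2.1⟩)
        ((PT.get [false]).pair (PT.get [true, false])))).congr ?_
    rintro ⟨i, a, b⟩
    cases b <;> rfl
  · intro i t _
    cases t.foldl (fun b a => b || p i a) false <;> simp [boolData, Data.size]

theorem PT.anyAccepts {α β : ι → Type} {encA : ∀ i, α i → Data} {encB : ∀ i, β i → Data}
    {l : ∀ i, List (α i)} {f : ∀ i, α i → PMF (Option (β i))}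
    (hl : PT O e fun i => PMF.pure (listData (encA i) (l i)))
    (hf : PT (fun p : (i : ι) × α i => O p.1) (fun p => Data.cons (e p.1) (encA p.1 p.2))
      (fun p => (f p.1 p.2).map (optionData (encB p.1)))) :
    PT O e fun i => (PRC.anyAccepts (f i) (l i)).map boolData := by
  refine (PT.map (PT.mapP (encB := fun i => optionData (encB i)) hl hf)
    (PT.any (l := fun p : (i : ι) × List (Option (β i)) => p.2) (p := fun _ => Option.isSome)
      (PT.get [true]) ?_)).congr fun i => by rw [anyAccepts_eq, PMF.map_comp]
  refine (PT.select (PT.get [true]) (PT.const (boolData true)) (PT.const (boolData false))).congr ?_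
  rintro ⟨i, a⟩
  cases a <;> rfl

/-! ### Random insertions -/

/-- Insert `u` at a uniformly random place of a list. -/
noncomputable def insertRandom {α : Type} (its : List α) (u : α) : PMF (List α) :=
  (PMF.uniformOfFintype (Fin (its.length + 1))).map
    fun j : Fin (its.length + 1) => its.take (j : ℕ) ++ u :: its.drop (j : ℕ)

theorem size_listData_insert {α : Type} (enc : α → Data) (l : List α) (u : α) (j : ℕ) :
    (listData enc (l.take j ++ u :: l.drop j)).size = (listData enc l).size + 1 + (enc u).size := by
  have h1 := size_listData_append enc (l.take j) (u :: l.drop j)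
  have h2 := size_listData_append enc (l.take j) (l.drop j)
  rw [List.take_append_drop] at h2
  simp only [listData, Data.size] at h1
  omega

theorem PT.insertRandom {α : ι → Type} {enc : ∀ i, α i → Data} {l : ∀ i, List (α i)}
    {u : ∀ i, α i} (hl : PT O e fun i => PMF.pure (listData (enc i) (l i)))
    (hu : PT O e fun i => PMF.pure (enc i (u i))) :
    PT O e fun i => (PRC.insertRandom (l i) (u i)).map (listData (enc i)) := by
  refine (PT.map (enc := fun i (j : Fin ((l i).length + 1)) => natData j)
    (h := fun i j => listData (enc i) ((l i).take j ++ u i :: (l i).drop j))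
    -- A list of length `m` has `m + 1` places for an insertion; the extra entry `none`, encoded by
    -- `nil`, supplies the missing unit.
    (PT.rand (l := fun i => none :: (l i).map some) (enc := fun i => fun
      | none => Data.nil
      | some a => enc i a) (fun i => by simp) ?_) ?_).congr fun i => by
      rw [PRC.insertRandom, PMF.map_comp]; rfl
  · refine (PT.nil.pair hl).congr fun i => ?_
    simp only [listData]
    congr 2
    induction l i with
    | nil => rfl
    | cons a t ih => simp [listData, ih]
  · have hl' := PT.comp (hl.reindex Sigma.fst) (PT.get (O := fun p :
      (i : ι) × Fin ((l i).length + 1) => O p.1) (e := fun p => Data.cons (e p.1) (natData p.2))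
      [false])
    have hu' := PT.comp (hu.reindex Sigma.fst) (PT.get (O := fun p :
      (i : ι) × Fin ((l i).length + 1) => O p.1) (e := fun p => Data.cons (e p.1) (natData p.2))
      [false])
    exact (PT.take (PT.get [true]) hl').append
      (l' := fun p : (i : ι) × Fin ((l i).length + 1) => u p.1 :: (l p.1).drop p.2)
      (hu'.pair (PT.drop (PT.get [true]) hl'))

theorem PT.insertAll {α : ι → Type} {enc : ∀ i, α i → Data} {l us : ∀ i, List (α i)}
    (hl : PT O e fun i => PMF.pure (listData (enc i) (l i)))
    (hu : PT O e fun i => PMF.pure (listData (enc i) (us i))) :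
    PT O e fun i => (PRC.foldP PRC.insertRandom (us i) (l i)).map (listData (enc i)) := by
  obtain ⟨P, hP⟩ := hl.size_pure_le
  obtain ⟨P', hP'⟩ := hu.size_pure_le
  refine PT.fold (encB := fun i => listData (enc i)) (step := fun _ => PRC.insertRandom)
    -- An insertion moves an item from the remaining list to the accumulator, so the sum of the two
    -- sizes is conserved.
    (fun i t b => (listData (enc i) b).size + (listData (enc i) t).size
      = (listData (enc i) (l i)).size + (listData (enc i) (us i)).size) (P + P') hu hl
    (PT.insertRandom (enc := fun p : (i : ι) × (α i × List (α i)) => enc p.1)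
      (l := fun p : (i : ι) × (α i × List (α i)) => p.2.2)
      (u := fun p : (i : ι) × (α i × List (α i)) => p.2.1) (PT.get [true, true]) (PT.get [true, false])) (fun i => rfl) ?_ ?_
  · intro i a t b h b' hb'
    rw [PRC.insertRandom, PMF.mem_support_map_iff] at hb'
    obtain ⟨j, -, rfl⟩ := hb'
    rw [size_listData_insert]
    simp only [listData, Data.size] at h
    omega
  · intro i t b h
    have := hP i
    have := hP' i
    rw [Polynomial.eval_add]
    omega

end PRC

namespace PRC

/-! ### Recognizing the messages -/

theorem bits_bit {n : ℕ} {b : Bool} (h : n = 0 → b = true) :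
    Nat.bits (Nat.bit b n) = b :: Nat.bits n := Nat.bits_append_bit n b h

/-- The number with the given binary digits, the least significant one first. -/
def bitsVal : List Bool → ℕ
  | [] => 0
  | b :: t => Nat.bit b (bitsVal t)

theorem bitsVal_bits (m : ℕ) : bitsVal (Nat.bits m) = m := by
  induction m using Nat.binaryRec' with
  | zero => simp [bitsVal]
  | bit b n h ih => rw [bits_bit h, bitsVal, ih]

theorem getLastD_bits (m : ℕ) : (Nat.bits m).getLastD true = true := by
  induction m using Nat.binaryRec' with
  | zero => simp
  | bit b n h ih =>
    rw [bits_bit h]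
    rcases hn : Nat.bits n with _ | ⟨c, t⟩
    · have : n = 0 := by rw [← bitsVal_bits n, hn]; rfl
      simp [h this]
    · rw [hn] at ih
      simpa using ih

/-- A digit list is canonical exactly when it has no leading zero, that is, when its last entry is
`true` or it is empty. The default value `true` covers the empty list, which represents `0`. -/
theorem bits_bitsVal {bs : List Bool} (h : bs.getLastD true = true) :
    Nat.bits (bitsVal bs) = bs := by
  induction bs with
  | nil => simp [bitsVal]
  | cons b t ih =>
    rcases t with _ | ⟨c, t⟩
    · have hb : b = true := by simpa using h
      subst hb
      simp [bitsVal]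
    · have h2 := ih (by simpa using h)
      rw [bitsVal, bits_bit, h2]
      intro h0
      rw [h0] at h2
      simp at h2

/-- The bit that is encoded by the given data. -/
def bitOf : Data → Option Bool
  | .nil => some false
  | .cons .nil .nil => some true
  | _ => none

theorem bitOf_eq_some {a : Data} {x : Bool} (h : bitOf a = some x) : a = boolData x := by
  unfold bitOf at h
  split at h <;> simp_all [boolData]

theorem bitOf_boolData (x : Bool) : bitOf (boolData x) = some x := by
  cases x <;> rfl

/-- One step of the comparison of two binary numbers. The state consists of the remaining digits of
the second number, the result for the digits read so far, the last digit of the first number, and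
whether the data read so far encode digits. -/
def cmpStep (s : List Bool × Bool × Bool × Bool) (a : Data) : List Bool × Bool × Bool × Bool :=
  match bitOf a, s.1 with
  | some x, m :: t => (t, if x = m then s.2.1 else m, x, s.2.2.2)
  | _, _ => (s.1, s.2.1, s.2.2.1, false)

/-- The last flag can only be lowered: by an entry that is not a bit, or by running out of digits of
the other number. If it survives, the input is a list of bits that is not too long. -/
theorem cmpStep_ok {xs : List Data} {s : List Bool × Bool × Bool × Bool}
    (h : (xs.foldl cmpStep s).2.2.2 = true) :
    s.2.2.2 = true ∧ ∃ bs : List Bool, xs = bs.map boolData ∧ bs.length ≤ s.1.length := by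
  induction xs generalizing s with
  | nil => exact ⟨h, [], rfl, by simp⟩
  | cons a t ih =>
    obtain ⟨h1, bs, rfl, h2⟩ := ih h
    unfold cmpStep at h1 h2
    split at h1
    · next x m t' hx hm =>
      rw [hx, hm] at h2
      exact ⟨h1, x :: bs, by rw [bitOf_eq_some hx]; rfl, by rw [hm]; simpa using h2⟩
    · simp at h1

/-- Digits arrive with the least significant one first, so a later differing digit overrides the
verdict reached so far, and equal digits leave it unchanged. -/
theorem foldl_cmpStep {bs ms : List Bool} (h : bs.length ≤ ms.length) (lt la ok : Bool) :
    (bs.map boolData).foldl cmpStep (ms, lt, la, ok)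
      = (ms.drop bs.length, decide (bitsVal bs < bitsVal (ms.take bs.length) ∨
          bitsVal bs = bitsVal (ms.take bs.length) ∧ lt = true), bs.getLastD la, ok) := by
  induction bs generalizing ms lt la with
  | nil => simp [bitsVal]
  | cons b t ih =>
    obtain ⟨m, ms, rfl⟩ : ∃ m t, ms = m :: t := by
      cases ms with
      | nil => simp at h
      | cons m t => exact ⟨m, t, rfl⟩
    have hlast : (b :: t).getLastD la = t.getLastD b := by cases t <;> rfl
    rw [List.map_cons, List.foldl_cons, hlast]
    have : cmpStep (m :: ms, lt, la, ok) (boolData b)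
        = (ms, if b = m then lt else m, b, ok) := by
      unfold cmpStep; rw [bitOf_boolData]
    rw [this, ih (by simpa using h)]
    simp only [List.length_cons, List.drop_succ_cons, List.take_succ_cons, bitsVal, Nat.bit_val]
    refine Prod.ext rfl (Prod.ext ?_ rfl)
    rw [decide_eq_decide]
    cases b <;> cases m <;> simp <;> omega

theorem bitsVal_lt (bs : List Bool) : bitsVal bs < 2 ^ bs.length := by
  induction bs with
  | nil => simp [bitsVal]
  | cons b t ih =>
    rw [bitsVal, Nat.bit_val, List.length_cons, pow_succ]
    cases b <;> simp <;> omega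

/-- The entries of a tree read as a list. -/
def Data.toList : Data → List Data
  | .nil => []
  | .cons a b => a :: b.toList

theorem listData_toList (x : Data) : listData (fun a => a) x.toList = x := by
  induction x with
  | nil => rfl
  | cons a b _ ih => simp [Data.toList, listData, ih]

theorem toList_listData {α : Type} (enc : α → Data) (l : List α) :
    (listData enc l).toList = l.map enc := by
  induction l with
  | nil => rfl
  | cons a t ih => simp [Data.toList, listData, ih]

/-- The verdict at the end of the comparison. -/
def cmpResult (s : List Bool × Bool × Bool × Bool) : Bool :=
  s.2.2.2 && (s.2.2.1 && (!s.1.isEmpty || s.2.1))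

theorem cmpResult_iff (M : ℕ) (x : Data) :
    cmpResult (x.toList.foldl cmpStep (Nat.bits M, false, true, true)) = true ↔
      ∃ m : Fin M, msgData m = x := by
  -- If digits of `M` are left over, the other number is shorter and below a power of two that does
  -- not exceed `M`. If none are left over, the verdict of the comparison decides.
  have hcan : ∀ bs : List Bool, bs.length ≤ (Nat.bits M).length → bs.getLastD true = true →
      ((!((Nat.bits M).drop bs.length).isEmpty || decide (bitsVal bs <
        bitsVal ((Nat.bits M).take bs.length))) = true ↔ bitsVal bs < M) := by
    intro bs h1 h2
    rcases h1.lt_or_eq with h1 | h1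
    · have h3 : bitsVal bs < M := by
        refine (bitsVal_lt bs).trans_le ?_
        rw [← Nat.lt_size, ← Nat.size_eq_bits_len]
        exact h1
      simp [h3, h1]
    · rw [h1, List.take_length, bitsVal_bits]
      simp
  constructor
  · intro h
    simp only [cmpResult, Bool.and_eq_true] at h
    obtain ⟨h1, h2, h3⟩ := h
    obtain ⟨-, bs, hbs, hlen⟩ := cmpStep_ok h1
    rw [hbs, foldl_cmpStep hlen] at h2 h3
    simp only [Bool.false_eq_true, and_false, or_false] at h2 h3
    refine ⟨⟨bitsVal bs, (hcan bs hlen h2).1 h3⟩, ?_⟩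
    rw [msgData, binData, bits_bitsVal h2, ← listData_toList x, hbs, ← toList_listData,
      listData_toList]
  · rintro ⟨m, rfl⟩
    have hlen : (Nat.bits m).length ≤ (Nat.bits M).length := by
      rw [Nat.size_eq_bits_len, Nat.size_eq_bits_len]
      exact Nat.size_le_size m.2.le
    rw [msgData, binData, toList_listData, foldl_cmpStep hlen]
    simp only [cmpResult, Bool.and_eq_true, Bool.false_eq_true, and_false, or_false]
    refine ⟨trivial, getLastD_bits m, ?_⟩
    rw [hcan _ hlen (getLastD_bits m), bitsVal_bits]
    exact m.2

variable {ι : Type} {O : ι → Data → PMF Data} {e : ι → Data}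

/-- Encoding of the state of the comparison. -/
def cmpData : List Bool × Bool × Bool × Bool → Data :=
  pairData (listData boolData) (pairData boolData (pairData boolData boolData))

theorem PT.cmpStep {s : ι → List Bool × Bool × Bool × Bool} {a : ι → Data}
    (hs : PT O e fun i => PMF.pure (cmpData (s i))) (ha : PT O e fun i => PMF.pure (a i)) :
    PT O e fun i => PMF.pure (cmpData (PRC.cmpStep (s i) (a i))) := by
  have hrest := PT.get' [false] hs
  have hm := PT.get' [false, false] hs
  have ht := PT.get' [false, true] hs
  have hlt := PT.get' [true, false] hs
  have hla := PT.get' [true, true, false] hs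
  have hok := PT.get' [true, true, true] hs
  have bad := hrest.pair (hlt.pair (hla.pair (PT.const (boolData false))))
  have good0 := ht.pair ((PT.select hm (PT.const (boolData true)) hlt).pair
    ((PT.const (boolData false)).pair hok))
  have good1 := ht.pair ((PT.select hm hlt (PT.const (boolData false))).pair
    ((PT.const (boolData true)).pair hok))
  refine (PT.select hrest (PT.select ha (PT.select ha.fst bad (PT.select ha.snd bad good1)) good0)
    bad).congr fun i => congrArg _ ?_
  obtain ⟨ms, lt, la, ok⟩ := s i
  rcases ms with _ | ⟨m, ms⟩
  · simp [PRC.cmpStep]; rfl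
  rcases a i with _ | ⟨f, t⟩
  · cases m <;> rfl
  · rcases f with _ | ⟨f1, f2⟩
    · rcases t with _ | ⟨t1, t2⟩
      · cases m <;> rfl
      · rfl
    · rfl

-- The reductions have to answer malformed queries as `msgOracle` does, so membership of a query in
-- the message space must be decided in polynomial time. A query is a message when it is a canonical
-- binary numeral below `M`.
open Classical in
theorem PT.isMsg {M : ι → ℕ} {x : ι → Data} (hM : PT O e fun i => PMF.pure (binData (M i)))
    (hx : PT O e fun i => PMF.pure (x i)) :
    PT O e fun i => PMF.pure (boolData (decide (∃ m : Fin (M i), msgData m = x i))) := by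
  obtain ⟨P, hP⟩ := hM.size_pure_le
  have key : PT O e fun i => PMF.pure (cmpData
      ((x i).toList.foldl PRC.cmpStep (Nat.bits (M i), false, true, true))) := by
    refine PT.foldl (encA := fun _ (a : Data) => a) (encB := fun _ => cmpData) (step := fun _ => PRC.cmpStep)
      (12 + P) (hx.congr fun i => by rw [listData_toList])
      (hM.pair ((PT.const (boolData false)).pair ((PT.const (boolData true)).pair
        (PT.const (boolData true)))))
      (PT.cmpStep (s := fun p : (i : ι) × (Data × (List Bool × Bool × Bool × Bool)) => p.2.2)
        (PT.get [true, true]) (PT.get [true, false])) ?_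
    intro i t _
    have h1 : ∀ (t : List Data) s, (t.foldl PRC.cmpStep s).1 <:+ s.1 := by
      intro t
      induction t with
      | nil => intro s; exact List.suffix_rfl
      | cons a t ih =>
        intro s
        refine (ih _).trans ?_
        unfold PRC.cmpStep
        split
        · next h => rw [h]; exact List.suffix_cons _ _
        · exact List.suffix_rfl
    have h2 := size_listData_le_of_sublist boolData (h1 t (Nat.bits (M i), false, true, true)).sublist
    have h3 : ∀ b, (boolData b).size ≤ 3 := by intro b; cases b <;> simp [boolData, Data.size]
    have h4 := hP i
    rw [binData] at h4
    simp only [Polynomial.eval_add, Polynomial.eval_ofNat, cmpData, pairData, Data.size]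
    have := h3 (t.foldl PRC.cmpStep (Nat.bits (M i), false, true, true)).2.1
    have := h3 (t.foldl PRC.cmpStep (Nat.bits (M i), false, true, true)).2.2.1
    have := h3 (t.foldl PRC.cmpStep (Nat.bits (M i), false, true, true)).2.2.2
    simp only at h2
    omega
  have hfalse : PT O e fun _ => PMF.pure (boolData false) := PT.const _
  refine (PT.select (PT.get' [true, true, true] key)
    (PT.select (PT.get' [true, true, false] key) (PT.select (PT.get' [false] key)
      (PT.const (boolData true)) (PT.get' [true, false] key)) hfalse) hfalse).congr
      fun i => congrArg _ ?_
  have h := cmpResult_iff (M i) (x i)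
  rw [show decide (∃ m : Fin (M i), msgData m = x i) = cmpResult
    ((x i).toList.foldl PRC.cmpStep (Nat.bits (M i), false, true, true)) by
      rw [Bool.eq_iff_iff, h, decide_eq_true_iff]]
  obtain ⟨ms, lt, la, ok⟩ := (x i).toList.foldl PRC.cmpStep (Nat.bits (M i), false, true, true)
  cases ms <;> cases lt <;> cases la <;> cases ok <;> rfl

end PRC

namespace PRC

/-! ### Placements of blocks -/

/-- The intervals `[loc i, loc i + ℓ)` lie in `[0, N)` and are pairwise disjoint. -/
def IsPlacement {k : ℕ} (ℓ N : ℕ) (loc : Fin k → ℕ) : Prop :=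
  (∀ i, loc i + ℓ ≤ N) ∧ ∀ i j, i ≠ j → loc i + ℓ ≤ loc j ∨ loc j + ℓ ≤ loc i

/-- A new block can be inserted at the position `a`. -/
def IsGap {k : ℕ} (ℓ : ℕ) (loc : Fin k → ℕ) (a : ℕ) : Prop := ∀ i, a ≤ loc i ∨ loc i + ℓ ≤ a

/-- New position of a block after the insertion of `ℓ` symbols at the position `a`. -/
def shiftPos (ℓ a b : ℕ) : ℕ := if b < a then b else b + ℓ

/-- The positions after the insertion of a first block at the position `a`. -/
def insertPos {k : ℕ} (ℓ a : ℕ) (loc : Fin k → ℕ) : Fin (k + 1) → ℕ :=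
  Fin.cons a fun i => shiftPos ℓ a (loc i)

theorem shiftPos_injective (ℓ a : ℕ) : Function.Injective (shiftPos ℓ a) := by
  intro b c h
  unfold shiftPos at h
  split_ifs at h <;> omega

theorem isPlacement_insertPos {k ℓ N a : ℕ} {loc : Fin k → ℕ} (h : IsPlacement ℓ N loc)
    (ha : a ≤ N) (hg : IsGap ℓ loc a) : IsPlacement ℓ (N + ℓ) (insertPos ℓ a loc) := by
  constructor
  · intro i
    induction i using Fin.cases with
    | zero => simpa [insertPos] using ha
    | succ i =>
      have := h.1 i
      simp only [insertPos, Fin.cons_succ, shiftPos]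
      split_ifs <;> omega
  · intro i j hij
    induction i using Fin.cases with
    | zero =>
      induction j using Fin.cases with
      | zero => exact absurd rfl hij
      | succ j =>
        have := hg j
        simp only [insertPos, Fin.cons_succ, Fin.cons_zero, shiftPos]
        split_ifs <;> omega
    | succ i =>
      induction j using Fin.cases with
      | zero =>
        have := hg i
        simp only [insertPos, Fin.cons_succ, Fin.cons_zero, shiftPos]
        split_ifs <;> omega
      | succ j =>
        have := h.2 i j fun e => hij (by rw [e])
        have := hg i
        have := hg j
        simp only [insertPos, Fin.cons_succ, shiftPos]
        split_ifs <;> omega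

/-- The first block is cut out and the positions behind it are moved back by `ℓ`; the place where it
stood becomes a gap of the remaining placement. -/
theorem exists_insertPos {k ℓ N : ℕ} (hℓ : 0 < ℓ) {loc : Fin (k + 1) → ℕ}
    (h : IsPlacement ℓ (N + ℓ) loc) :
    ∃ loc' : Fin k → ℕ, IsPlacement ℓ N loc' ∧ loc 0 ≤ N ∧ IsGap ℓ loc' (loc 0) ∧
      loc = insertPos ℓ (loc 0) loc' := by
  refine ⟨fun i => if loc i.succ < loc 0 then loc i.succ else loc i.succ - ℓ, ⟨?_, ?_⟩, ?_, ?_, ?_⟩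
  · intro i
    have h1 := h.1 i.succ
    have h2 := h.2 0 i.succ (Fin.succ_ne_zero i).symm
    have h3 := h.1 0
    beta_reduce
    split_ifs <;> omega
  · intro i j hij
    have h1 := h.2 i.succ j.succ fun e => hij (Fin.succ_injective _ e)
    have h2 := h.2 0 i.succ (Fin.succ_ne_zero i).symm
    have h3 := h.2 0 j.succ (Fin.succ_ne_zero j).symm
    beta_reduce
    split_ifs <;> omega
  · have := h.1 0; omega
  · intro i
    have h2 := h.2 0 i.succ (Fin.succ_ne_zero i).symm
    beta_reduce
    split_ifs <;> omega
  · funext i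
    induction i using Fin.cases with
    | zero => rfl
    | succ i =>
      have h2 := h.2 0 i.succ (Fin.succ_ne_zero i).symm
      simp only [insertPos, Fin.cons_succ, shiftPos]
      split_ifs <;> omega

/-- Sequences of choices of places for successive insertions into a list of length `n`. -/
def Choices (n : ℕ) : ℕ → Type
  | 0 => Unit
  | k + 1 => Choices n k × Fin (n + k + 1)

instance Choices.instFintype (n : ℕ) : (k : ℕ) → Fintype (Choices n k)
  | 0 => inferInstanceAs (Fintype Unit)
  | k + 1 => by
    haveI := Choices.instFintype n k
    exact inferInstanceAs (Fintype (Choices n k × Fin (n + k + 1)))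

instance Choices.instNonempty (n : ℕ) : (k : ℕ) → Nonempty (Choices n k)
  | 0 => inferInstanceAs (Nonempty Unit)
  | k + 1 => by
    have := Choices.instNonempty n k
    exact inferInstanceAs (Nonempty (Choices n k × Fin (n + k + 1)))

/-- Insertion at the place `j`. -/
def insertAt {α : Type} (l : List α) (j : ℕ) (u : α) : List α := l.take j ++ u :: l.drop j

/-- The list after the insertions. -/
def Choices.list {α : Type} (c : List α) {n : ℕ} :
    {k : ℕ} → (Fin k → α) → Choices n k → List α
  | 0, _, _ => c
  | _ + 1, u, x => insertAt (Choices.list c (fun i => u i.succ) x.1) x.2 (u 0)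

/-- The lengths of the items after the insertion of blocks of length `ℓ`. -/
def Choices.lens (ℓ : ℕ) {n k : ℕ} (x : Choices n k) : List ℕ :=
  Choices.list (List.replicate n 1) (fun _ => ℓ) x

/-- The positions of the blocks. -/
def Choices.loc (ℓ : ℕ) {n : ℕ} : {k : ℕ} → Choices n k → Fin k → ℕ
  | 0, _ => Fin.elim0
  | _ + 1, x => insertPos ℓ ((Choices.lens ℓ x.1).take x.2).sum (Choices.loc ℓ x.1)

theorem Choices.length_list {α : Type} (c : List α) {k : ℕ} (u : Fin k → α)
    (x : Choices c.length k) : (Choices.list c u x).length = c.length + k := by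
  induction k with
  | zero => rfl
  | succ k ih =>
    have h1 := ih (fun i => u i.succ) x.1
    have h2 := x.2.2
    simp only [Choices.list, insertAt, List.length_append, List.length_cons, List.length_take,
      List.length_drop, h1]
    omega

theorem Choices.length_lens (ℓ : ℕ) {n k : ℕ} (x : Choices n k) :
    (x.lens ℓ).length = n + k := by
  have h : (List.replicate n 1).length = n := by simp
  have key : ∀ (m : ℕ) (hm : m = n) (y : Choices m k),
      (Choices.list (List.replicate n 1) (fun _ => ℓ) y).length = n + k := by
    intro m hm y
    rw [← h] at hm
    subst hm
    rw [Choices.length_list, h]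
  exact key n rfl x

theorem sum_take_insertAt {L : List ℕ} {j : ℕ} (hj : j ≤ L.length) (ℓ i : ℕ) :
    ((insertAt L j ℓ).take i).sum
      = if i ≤ j then (L.take i).sum else (L.take (i - 1)).sum + ℓ := by
  rw [insertAt, List.take_append, List.length_take, min_eq_left hj]
  split_ifs with h
  · rw [Nat.sub_eq_zero_of_le h, List.take_zero, List.append_nil, List.take_take, min_eq_left h]
  · push Not at h
    obtain ⟨s, rfl⟩ : ∃ s, i = j + (s + 1) := ⟨i - j - 1, by omega⟩
    rw [show j + (s + 1) - j = s + 1 by omega, show j + (s + 1) - 1 = j + s by omega,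
      List.take_take, min_eq_right (by omega), List.take_succ_cons, List.take_add]
    simp only [List.sum_append, List.sum_cons]
    omega

theorem sum_take_mono {L : List ℕ} {i j : ℕ} (h : i ≤ j) : (L.take i).sum ≤ (L.take j).sum := by
  obtain ⟨s, rfl⟩ := Nat.exists_eq_add_of_le h
  rw [List.take_add, List.sum_append]
  omega

theorem sum_take_strictMono {L : List ℕ} (hL : ∀ a ∈ L, 0 < a) {i j : ℕ} (h : i < j)
    (hj : j ≤ L.length) : (L.take i).sum < (L.take j).sum := by
  have h1 : (L.take (i + 1)).sum ≤ (L.take j).sum := sum_take_mono h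
  have h2 : i < L.length := by omega
  rw [List.take_add_one, List.getElem?_eq_getElem h2, Option.toList_some, List.sum_append,
    List.sum_singleton] at h1
  have := hL _ (List.getElem_mem h2)
  omega

theorem Choices.pos_lens {ℓ : ℕ} (hℓ : 0 < ℓ) {n k : ℕ} (x : Choices n k) :
    ∀ a ∈ x.lens ℓ, 0 < a := by
  induction k with
  | zero =>
    intro a ha
    have := List.eq_of_mem_replicate (show a ∈ List.replicate n 1 from ha)
    omega
  | succ k ih =>
    intro a ha
    rcases List.mem_append.1 (show a ∈ (Choices.lens ℓ x.1).take x.2 ++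
      ℓ :: (Choices.lens ℓ x.1).drop x.2 from ha) with h | h
    · exact ih x.1 a (List.mem_of_mem_take h)
    · rcases List.mem_cons.1 h with rfl | h
      · exact hℓ
      · exact ih x.1 a (List.mem_of_mem_drop h)

theorem isGap_insertPos {k ℓ a : ℕ} {loc : Fin k → ℕ} (hg : IsGap ℓ loc a) (x : ℕ) :
    IsGap ℓ (insertPos ℓ a loc) x ↔
      x ≤ a ∧ IsGap ℓ loc x ∨ a + ℓ ≤ x ∧ IsGap ℓ loc (x - ℓ) := by
  have h0 : IsGap ℓ (insertPos ℓ a loc) x ↔ (x ≤ a ∨ a + ℓ ≤ x) ∧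
      ∀ i, x ≤ shiftPos ℓ a (loc i) ∨ shiftPos ℓ a (loc i) + ℓ ≤ x := by
    rw [IsGap, Fin.forall_fin_succ]; rfl
  rw [h0]
  constructor
  · rintro ⟨h1 | h1, h2⟩
    · refine .inl ⟨h1, fun i => ?_⟩
      have := hg i
      have := h2 i
      unfold shiftPos at this
      split_ifs at this <;> omega
    · refine .inr ⟨h1, fun i => ?_⟩
      have := hg i
      have := h2 i
      unfold shiftPos at this
      split_ifs at this <;> omega
  · rintro (⟨h1, h2⟩ | ⟨h1, h2⟩)
    · refine ⟨.inl h1, fun i => ?_⟩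
      have := hg i
      have := h2 i
      unfold shiftPos
      split_ifs <;> omega
    · refine ⟨.inr h1, fun i => ?_⟩
      have := hg i
      have := h2 i
      unfold shiftPos
      split_ifs <;> omega

/-- The boundaries between consecutive items, which are the partial sums of their lengths, are
exactly the positions at which a further block can be inserted without cutting an existing one. Both
sides are updated in the same way by an insertion, and this is what identifies sequences of choices
with placements. -/
theorem Choices.boundary_iff {ℓ : ℕ} (hℓ : 0 < ℓ) {n k : ℕ} (x : Choices n k) :
    IsPlacement ℓ (n + k * ℓ) (x.loc ℓ) ∧ ∀ a, (∃ j ≤ n + k, ((x.lens ℓ).take j).sum = a) ↔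
      a ≤ n + k * ℓ ∧ IsGap ℓ (x.loc ℓ) a := by
  induction k with
  | zero =>
    refine ⟨⟨fun i => i.elim0, fun i => i.elim0⟩, fun a => ?_⟩
    simp only [Choices.lens, Choices.list, List.take_replicate, List.sum_replicate, smul_eq_mul,
      mul_one]
    constructor
    · rintro ⟨j, hj, rfl⟩
      exact ⟨by omega, fun i => i.elim0⟩
    · rintro ⟨h, -⟩
      exact ⟨a, by omega, by omega⟩
  | succ k ih =>
    obtain ⟨h1, h2⟩ := ih x.1
    have hlen := Choices.length_lens ℓ x.1
    have hj : (x.2 : ℕ) ≤ (Choices.lens ℓ x.1).length := by have := x.2.2; omega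
    set a₀ := ((Choices.lens ℓ x.1).take x.2).sum with ha₀
    obtain ⟨h3, h4⟩ := (h2 a₀).1 ⟨x.2, by omega, rfl⟩
    have hN : n + (k + 1) * ℓ = n + k * ℓ + ℓ := by ring
    have hloc : x.loc ℓ = insertPos ℓ a₀ (Choices.loc ℓ x.1) := rfl
    have hlens : x.lens ℓ = insertAt (Choices.lens ℓ x.1) x.2 ℓ := rfl
    refine ⟨by rw [hN, hloc]; exact isPlacement_insertPos h1 h3 h4, fun a => ?_⟩
    rw [hloc, isGap_insertPos h4, hN, hlens]
    constructor
    · rintro ⟨j, hj', rfl⟩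
      rw [sum_take_insertAt hj]
      split_ifs with hjx
      · obtain ⟨h5, h6⟩ := (h2 ((Choices.lens ℓ x.1).take j).sum).1 ⟨j, by omega, rfl⟩
        exact ⟨by omega, .inl ⟨sum_take_mono hjx, h6⟩⟩
      · obtain ⟨h5, h6⟩ := (h2 ((Choices.lens ℓ x.1).take (j - 1)).sum).1 ⟨j - 1, by omega, rfl⟩
        refine ⟨by omega, .inr ⟨?_, by rwa [Nat.add_sub_cancel]⟩⟩
        have : a₀ ≤ ((Choices.lens ℓ x.1).take (j - 1)).sum := sum_take_mono (by omega)
        omega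
    · rintro ⟨h5, ⟨h6, h7⟩ | ⟨h6, h7⟩⟩
      · obtain ⟨j, hj', rfl⟩ := (h2 a).2 ⟨by omega, h7⟩
        by_cases hjx : j ≤ x.2
        · exact ⟨j, by omega, by rw [sum_take_insertAt hj, if_pos hjx]⟩
        · refine ⟨x.2, by omega, ?_⟩
          rw [sum_take_insertAt hj, if_pos le_rfl]
          exact le_antisymm (sum_take_mono (by omega)) h6
      · obtain ⟨j, hj', hja⟩ := (h2 (a - ℓ)).2 ⟨by omega, h7⟩
        by_cases hjx : (x.2 : ℕ) ≤ j
        · refine ⟨j + 1, by omega, ?_⟩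
          rw [sum_take_insertAt hj, if_neg (by omega), Nat.add_sub_cancel, hja]
          omega
        · refine ⟨x.2 + 1, by have := x.2.2; omega, ?_⟩
          rw [sum_take_insertAt hj, if_neg (by omega), Nat.add_sub_cancel]
          have : ((Choices.lens ℓ x.1).take j).sum ≤ a₀ := sum_take_mono (by omega)
          omega

/-- For `0 < ℓ` all items have positive length, so distinct places have distinct positions. With
empty blocks this would fail. -/
theorem Choices.loc_injective {ℓ : ℕ} (hℓ : 0 < ℓ) {n k : ℕ} :
    Function.Injective (Choices.loc ℓ : Choices n k → Fin k → ℕ) := by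
  induction k with
  | zero => intro x y _; rfl
  | succ k ih =>
    intro x y h
    have h0 : ((Choices.lens ℓ x.1).take x.2).sum = ((Choices.lens ℓ y.1).take y.2).sum :=
      congrFun h 0
    have h1 : x.1 = y.1 := by
      refine ih (funext fun i => ?_)
      have h2 : shiftPos ℓ ((Choices.lens ℓ x.1).take x.2).sum (Choices.loc ℓ x.1 i)
          = shiftPos ℓ ((Choices.lens ℓ y.1).take y.2).sum (Choices.loc ℓ y.1 i) :=
        congrFun h i.succ
      rw [h0] at h2
      exact shiftPos_injective _ _ h2
    refine Prod.ext h1 (Fin.ext ?_)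
    rw [h1] at h0
    have hlen := Choices.length_lens ℓ y.1
    have hx := x.2.2
    have hy := y.2.2
    rcases lt_trichotomy (x.2 : ℕ) y.2 with h3 | h3 | h3
    · exact absurd h0 (sum_take_strictMono (Choices.pos_lens hℓ y.1) h3 (by omega)).ne
    · exact h3
    · exact absurd h0 (sum_take_strictMono (Choices.pos_lens hℓ y.1) h3 (by omega)).ne'

/-- The first block is removed, the rest is realized by induction, and the position of the removed
block is a boundary because it is a gap. -/
theorem Choices.exists_loc_eq {ℓ : ℕ} (hℓ : 0 < ℓ) {n k : ℕ} {loc : Fin k → ℕ}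
    (h : IsPlacement ℓ (n + k * ℓ) loc) : ∃ x : Choices n k, x.loc ℓ = loc := by
  induction k with
  | zero => exact ⟨(), funext fun i => i.elim0⟩
  | succ k ih =>
    rw [show n + (k + 1) * ℓ = n + k * ℓ + ℓ by ring] at h
    obtain ⟨loc', h1, h2, h3, h4⟩ := exists_insertPos hℓ h
    obtain ⟨x, rfl⟩ := ih h1
    obtain ⟨j, hj, hja⟩ := ((Choices.boundary_iff hℓ x).2 (loc 0)).2 ⟨h2, h3⟩
    refine ⟨(x, ⟨j, by omega⟩), ?_⟩
    rw [h4, ← hja]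
    rfl

theorem mem_placements_iff {k ℓ N : ℕ} (hℓ : 0 < ℓ) {loc : Fin k → Fin (N + 1)} :
    loc ∈ placements k ℓ N ↔ IsPlacement ℓ N fun i => (loc i : ℕ) := by
  simp only [placements, Finset.mem_filter, Finset.mem_univ, true_and, IsPlacement]
  refine and_congr_right fun _ => forall_congr' fun i => forall_congr' fun j =>
    imp_congr_right fun _ => ?_
  constructor
  · intro h
    rw [Finset.disjoint_left] at h
    by_contra hc
    push Not at hc
    rcases le_total (loc i : ℕ) (loc j) with h1 | h1
    · exact h (a := loc j) (by simp; omega) (by simp; omega)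
    · exact h (a := loc i) (by simp; omega) (by simp; omega)
  · intro h
    rw [Finset.disjoint_left]
    intro t ht ht'
    simp only [Finset.mem_Ico] at ht ht'
    omega

/-- The positions of the blocks, as an element of the set of placements. -/
def Choices.locFin {ℓ : ℕ} (hℓ : 0 < ℓ) {n k N : ℕ} (hN : N = n + k * ℓ) (x : Choices n k) :
    Fin k → Fin (N + 1) := fun i =>
  ⟨x.loc ℓ i, by have := (Choices.boundary_iff hℓ x).1.1 i; omega⟩

theorem uniformOfFinset_eq_map {α β : Type*} [Fintype α] [Nonempty α] {s : Finset β}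
    (hs : s.Nonempty) {f : α → β} (hf : Function.Injective f) (hfs : ∀ b, b ∈ s ↔ ∃ a, f a = b) :
    PMF.uniformOfFinset s hs = (PMF.uniformOfFintype α).map f := by
  classical
  have hcard : s.card = Fintype.card α := by
    rw [show s = Finset.univ.image f by ext b; simp [hfs], Finset.card_image_of_injective _ hf,
      Finset.card_univ]
  ext b
  by_cases hb : b ∈ s
  · obtain ⟨a, rfl⟩ := (hfs b).1 hb
    rw [PMF.uniformOfFinset_apply_of_mem _ hb, PMF.map_apply, tsum_eq_single a]
    · simp [hcard]
    · intro a' ha'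
      rw [if_neg fun h => ha' (hf h.symm)]
  · rw [PMF.uniformOfFinset_apply_of_notMem _ hb, PMF.map_apply, eq_comm, ENNReal.tsum_eq_zero]
    intro a
    rw [if_neg fun h => hb ((hfs b).2 ⟨a, h.symm⟩)]

/-- Sequences of choices are in bijection with placements, and the number of available places at
each insertion does not depend on earlier choices. So independent uniform choices give a uniform
placement. -/
theorem uniform_placements {k ℓ n N : ℕ} (hℓ : 0 < ℓ) (hN : N = n + k * ℓ)
    (h : (placements k ℓ N).Nonempty) :
    PMF.uniformOfFinset (placements k ℓ N) h
      = (PMF.uniformOfFintype (Choices n k)).map (Choices.locFin hℓ hN) := by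
  subst hN
  refine uniformOfFinset_eq_map h ?_ ?_
  · intro x y hxy
    refine Choices.loc_injective hℓ (funext fun i => ?_)
    exact congrArg Fin.val (congrFun hxy i)
  · intro loc
    rw [mem_placements_iff hℓ]
    constructor
    · intro h1
      obtain ⟨x, hx⟩ := Choices.exists_loc_eq hℓ h1
      exact ⟨x, funext fun i => Fin.ext (congrFun hx i)⟩
    · rintro ⟨x, rfl⟩
      exact (Choices.boundary_iff hℓ x).1

/-! ### The law of random insertions -/

theorem insertRandom_eq {α : Type} {its : List α} {m : ℕ} (h : its.length = m) (u : α) :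
    insertRandom its u = (PMF.uniformOfFintype (Fin (m + 1))).map
      fun j : Fin (m + 1) => insertAt its (j : ℕ) u := by
  subst h; rfl

theorem uniform_prod {α β : Type} [Fintype α] [Nonempty α] [Fintype β] [Nonempty β] :
    PMF.uniformOfFintype (α × β) = (PMF.uniformOfFintype α).bind fun a =>
      (PMF.uniformOfFintype β).map fun b => (a, b) := by
  ext ⟨a, b⟩
  rw [PMF.bind_apply, tsum_eq_single a, PMF.map_apply, tsum_eq_single b]
  · simp [ENNReal.mul_inv]
  · intro b' hb'
    rw [if_neg fun h => hb' (Prod.ext_iff.1 h).2.symm]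
  · intro a' ha'
    rw [PMF.map_apply, ENNReal.tsum_eq_zero.2, mul_zero]
    intro b'
    rw [if_neg fun h => ha' (Prod.ext_iff.1 h).1.symm]

theorem foldP_insertRandom {α : Type} (c : List α) {k : ℕ} (u : Fin k → α) :
    foldP insertRandom (List.ofFn u).reverse c
      = (PMF.uniformOfFintype (Choices c.length k)).map (Choices.list c u) := by
  induction k with
  | zero =>
    rw [List.ofFn_zero, List.reverse_nil, foldP, show (Choices.list c u) = fun _ => c from rfl]
    exact (PMF.map_const _ _).symm
  | succ k ih =>
    rw [List.ofFn_succ, List.reverse_cons, foldP_append, ih, PMF.bind_map]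
    have h1 : (PMF.uniformOfFintype (Choices c.length (k + 1))).map (Choices.list c u)
        = (PMF.uniformOfFintype (Choices c.length k × Fin (c.length + k + 1))).map
          fun x : Choices c.length k × Fin (c.length + k + 1) =>
            insertAt (Choices.list c (fun i => u i.succ) x.1) (x.2 : ℕ) (u 0) := rfl
    rw [h1, uniform_prod, PMF.map_bind]
    refine congrArg _ (funext fun x => ?_)
    simp only [Function.comp, foldP, PMF.bind_pure]
    rw [insertRandom_eq (Choices.length_list c _ x), PMF.map_comp]
    rfl

end PRC

/-! ### The interleaved word as the result of successive insertions -/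

namespace PRC

theorem Choices.map_list {α β : Type} (f : α → β) (c : List α) {n k : ℕ} (u : Fin k → α)
    (x : Choices n k) :
    (Choices.list c u x).map f = Choices.list (c.map f) (fun i => f (u i)) x := by
  induction k with
  | zero => rfl
  | succ k ih =>
    have h := ih (fun i => u i.succ) x.1
    simp only [Choices.list, insertAt, List.map_append, List.map_cons, List.map_take,
      List.map_drop, h]

theorem flatten_insertAt {α : Type} (its : List (List α)) (j : ℕ) (u : List α) :
    (insertAt its j u).flatten = its.flatten.take ((its.map List.length).take j).sum ++
      (u ++ its.flatten.drop ((its.map List.length).take j).sum) := by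
  have h1 : its.flatten = (its.take j).flatten ++ (its.drop j).flatten := by
    rw [← List.flatten_append, List.take_append_drop]
  have h2 : ((its.map List.length).take j).sum = (its.take j).flatten.length := by
    rw [List.length_flatten, List.map_take]
  rw [h2, h1, List.take_left, List.drop_left, insertAt, List.flatten_append, List.flatten_cons]

open Classical in
/-- Number of positions below `t` that are outside of the blocks. -/
noncomputable def freeCount {k : ℕ} (ℓ : ℕ) (loc : Fin k → ℕ) (t : ℕ) : ℕ :=
  ((Finset.range t).filter fun t' => ¬ ∃ i, loc i ≤ t' ∧ t' < loc i + ℓ).card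

section

variable {q : ℕ} [NeZero q] {k ℓ n N : ℕ}

theorem interleave_block {loc : Fin k → Fin (N + 1)}
    (h : IsPlacement ℓ N fun i => (loc i : ℕ)) (u : Fin k → Fin ℓ → Fin q) (c : Fin n → Fin q)
    (t : Fin N) (i : Fin k) (h1 : (loc i : ℕ) ≤ t) (h2 : (t : ℕ) < loc i + ℓ) :
    interleave loc u c t = u i ⟨t - loc i, by omega⟩ := by
  have hex : ∃ i, (loc i : ℕ) ≤ t ∧ (t : ℕ) < loc i + ℓ := ⟨i, h1, h2⟩
  have hi : hex.choose = i := by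
    by_contra hne
    have h3 := hex.choose_spec
    have h4 := h.2 _ _ hne
    beta_reduce at h4
    omega
  rw [interleave, dif_pos hex]
  have : ∀ (j : Fin k) (hj : j = i) (p : (t : ℕ) - loc j < ℓ),
      u j ⟨t - loc j, p⟩ = u i ⟨t - loc i, by omega⟩ := by
    rintro j rfl p; rfl
  exact this _ hi _

theorem interleave_free {loc : Fin k → Fin (N + 1)} (u : Fin k → Fin ℓ → Fin q)
    (c : Fin n → Fin q) (t : Fin N) (h : ¬ ∃ i, (loc i : ℕ) ≤ t ∧ (t : ℕ) < loc i + ℓ) :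
    interleave loc u c t = if h' : freeCount ℓ (fun i => (loc i : ℕ)) t < n then
      c ⟨_, h'⟩ else 0 := by
  rw [interleave, dif_neg h]
  rfl

end

theorem blocked_insertPos {k ℓ a : ℕ} {loc : Fin k → ℕ} (t : ℕ) :
    (∃ i, insertPos ℓ a loc i ≤ t ∧ t < insertPos ℓ a loc i + ℓ) ↔
      (a ≤ t ∧ t < a + ℓ) ∨ ∃ i, shiftPos ℓ a (loc i) ≤ t ∧ t < shiftPos ℓ a (loc i) + ℓ := by
  rw [Fin.exists_fin_succ]
  rfl

theorem blocked_of_lt {k ℓ a t : ℕ} {loc : Fin k → ℕ} (ht : t < a) :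
    (∃ i, insertPos ℓ a loc i ≤ t ∧ t < insertPos ℓ a loc i + ℓ) ↔
      ∃ i, loc i ≤ t ∧ t < loc i + ℓ := by
  rw [blocked_insertPos]
  constructor
  · rintro (h | ⟨i, h⟩)
    · omega
    · refine ⟨i, ?_⟩
      unfold shiftPos at h
      split_ifs at h <;> omega
  · rintro ⟨i, h⟩
    refine .inr ⟨i, ?_⟩
    unfold shiftPos
    split_ifs <;> omega

theorem blocked_of_ge {k ℓ a t : ℕ} {loc : Fin k → ℕ} (hg : IsGap ℓ loc a) (ht : a ≤ t) :
    (∃ i, insertPos ℓ a loc i ≤ t + ℓ ∧ t + ℓ < insertPos ℓ a loc i + ℓ) ↔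
      ∃ i, loc i ≤ t ∧ t < loc i + ℓ := by
  rw [blocked_insertPos]
  constructor
  · rintro (h | ⟨i, h⟩)
    · omega
    · refine ⟨i, ?_⟩
      have := hg i
      unfold shiftPos at h
      split_ifs at h <;> omega
  · rintro ⟨i, h⟩
    refine .inr ⟨i, ?_⟩
    have := hg i
    unfold shiftPos
    split_ifs <;> omega

theorem freeCount_of_le {k ℓ a t : ℕ} {loc : Fin k → ℕ} (ht : t ≤ a) :
    freeCount ℓ (insertPos ℓ a loc) t = freeCount ℓ loc t := by
  unfold freeCount
  congr 1
  refine Finset.filter_congr fun t' ht' => ?_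
  rw [blocked_of_lt (by rw [Finset.mem_range] at ht'; omega)]

/-- The inserted block contributes no free positions and shifts those from `a` onwards by `ℓ`, so
the payload symbols keep their numbering. -/
theorem freeCount_of_ge {k ℓ a t : ℕ} {loc : Fin k → ℕ} (hg : IsGap ℓ loc a) (ht : a ≤ t) :
    freeCount ℓ (insertPos ℓ a loc) (t + ℓ) = freeCount ℓ loc t := by
  classical
  induction t, ht using Nat.le_induction with
  | base =>
    rw [← freeCount_of_le (le_refl a)]
    unfold freeCount
    congr 1
    ext t'
    simp only [Finset.mem_filter, Finset.mem_range]
    constructor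
    · rintro ⟨h1, h2⟩
      refine ⟨?_, h2⟩
      by_contra h3
      exact h2 (blocked_insertPos t' |>.2 (.inl (by omega)))
    · rintro ⟨h1, h2⟩
      exact ⟨by omega, h2⟩
  | succ t ht ih =>
    unfold freeCount at ih ⊢
    rw [show t + 1 + ℓ = t + ℓ + 1 by omega, Finset.range_add_one, Finset.range_add_one,
      Finset.filter_insert, Finset.filter_insert]
    by_cases h : ∃ i, loc i ≤ t ∧ t < loc i + ℓ
    · rw [if_neg (not_not.2 h), if_neg (not_not.2 ((blocked_of_ge hg ht).2 h)), ih]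
    · rw [if_pos h, if_pos (mt (blocked_of_ge hg ht).1 h),
        Finset.card_insert_of_notMem (by simp), Finset.card_insert_of_notMem (by simp), ih]

/-- There are three ranges of positions: below `a` nothing changes, `[a, a + ℓ)` is the new block,
and from `a + ℓ` on both the blocks and the count of free positions are shifted by `ℓ`. The gap
condition ensures that no old block is cut at `a`. -/
theorem ofFn_interleave_insertPos {q : ℕ} [NeZero q] {k ℓ n N N' a : ℕ} (hN' : N' = N + ℓ)
    {loc' : Fin k → Fin (N + 1)} {loc : Fin (k + 1) → Fin (N' + 1)}
    (hp : IsPlacement ℓ N fun i => (loc' i : ℕ)) (ha : a ≤ N)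
    (hg : IsGap ℓ (fun i => (loc' i : ℕ)) a)
    (hloc : (fun i => (loc i : ℕ)) = insertPos ℓ a fun i => (loc' i : ℕ))
    (u : Fin (k + 1) → Fin ℓ → Fin q) (c : Fin n → Fin q) :
    List.ofFn (interleave loc u c)
      = (List.ofFn (interleave loc' (fun i => u i.succ) c)).take a ++ (List.ofFn (u 0) ++
          (List.ofFn (interleave loc' (fun i => u i.succ) c)).drop a) := by
  have hp' : IsPlacement ℓ N' fun i => (loc i : ℕ) := by
    have := isPlacement_insertPos hp ha hg
    rw [← hloc] at this
    subst hN'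
    exact this
  have h0 : (loc 0 : ℕ) = a := congrFun hloc 0
  have hs : ∀ i : Fin k, (loc i.succ : ℕ) = shiftPos ℓ a (loc' i) := fun i => congrFun hloc i.succ
  have hblock : ∀ t, (∃ i, (loc i : ℕ) ≤ t ∧ t < loc i + ℓ) ↔
      ∃ i, insertPos ℓ a (fun i => (loc' i : ℕ)) i ≤ t ∧
        t < insertPos ℓ a (fun i => (loc' i : ℕ)) i + ℓ := by
    intro t
    rw [← hloc]
  apply List.ext_getElem
  · simp; omega
  intro t h1 h2
  rw [List.length_ofFn] at h1
  rw [List.getElem_ofFn]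
  rcases lt_or_ge t a with hta | hta
  · rw [List.getElem_append_left (by simp; omega), List.getElem_take, List.getElem_ofFn]
    by_cases hb : ∃ i, (loc' i : ℕ) ≤ t ∧ t < loc' i + ℓ
    · obtain ⟨i, hi1, hi2⟩ := hb
      have hsi : (loc i.succ : ℕ) = loc' i := by
        rw [hs, shiftPos, if_pos (by omega)]
      rw [interleave_block hp _ _ ⟨t, by omega⟩ i hi1 hi2,
        interleave_block hp' _ _ ⟨t, h1⟩ i.succ (by simp; omega) (by simp; omega)]
      simp only [hsi]
    · rw [interleave_free _ _ ⟨t, by omega⟩ hb, interleave_free _ _ ⟨t, h1⟩ (by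
        simp only; rw [hblock, blocked_of_lt hta]; exact hb)]
      simp only [hloc, freeCount_of_le hta.le]
  · rw [List.getElem_append_right (by simp; omega)]
    rcases lt_or_ge t (a + ℓ) with htl | htl
    · rw [List.getElem_append_left (by simp; omega), List.getElem_ofFn,
        interleave_block hp' _ _ ⟨t, h1⟩ 0 (by simp; omega) (by simp; omega)]
      congr 1
      simp only [h0, List.length_take, List.length_ofFn, Fin.mk.injEq]
      omega
    · obtain ⟨s, rfl⟩ : ∃ s, t = s + ℓ := ⟨t - ℓ, by omega⟩
      rw [List.getElem_append_right (by simp; omega)]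
      simp only [List.getElem_drop, List.getElem_ofFn, List.length_take, List.length_ofFn]
      have e1 : (⟨a + (s + ℓ - min a N - ℓ), by omega⟩ : Fin N) = ⟨s, by omega⟩ :=
        Fin.ext (by simp; omega)
      rw [e1]
      have has : a ≤ s := by omega
      by_cases hb : ∃ i, (loc' i : ℕ) ≤ s ∧ s < loc' i + ℓ
      · obtain ⟨i, hi1, hi2⟩ := hb
        have hgi := hg i
        simp only at hgi
        have hsi : (loc i.succ : ℕ) = loc' i + ℓ := by
          rw [hs, shiftPos, if_neg (by omega)]
        rw [interleave_block hp _ _ ⟨s, by omega⟩ i hi1 hi2,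
          interleave_block hp' _ _ ⟨s + ℓ, h1⟩ i.succ (by simp; omega) (by simp; omega)]
        congr 1
        simp only [hsi, Fin.mk.injEq]
        omega
      · rw [interleave_free _ _ ⟨s, by omega⟩ hb, interleave_free _ _ ⟨s + ℓ, h1⟩ (by
          simp only; rw [hblock, blocked_of_ge hg has]; exact hb)]
        simp only [hloc, freeCount_of_ge hg has]

section

variable {q : ℕ} [NeZero q] {k ℓ n : ℕ}

theorem freeCount_zero (ℓ : ℕ) (loc : Fin 0 → ℕ) (t : ℕ) : freeCount ℓ loc t = t := by
  simp [freeCount]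

theorem Choices.ofFn_interleave (hℓ : 0 < ℓ) {N : ℕ} (hN : N = n + k * ℓ) (x : Choices n k)
    (u : Fin k → Fin ℓ → Fin q) (c : Fin n → Fin q) :
    List.ofFn (interleave (x.locFin hℓ hN) u c)
      = (Choices.list ((List.ofFn c).map fun a => [a]) (fun i => List.ofFn (u i)) x).flatten := by
  induction k generalizing N with
  | zero =>
    have h1 : (Choices.list ((List.ofFn c).map fun a => [a]) (fun i => List.ofFn (u i)) x)
        = (List.ofFn c).map fun a => [a] := rfl
    rw [h1]
    have h2 : ∀ l : List (Fin q), (l.map fun a => [a]).flatten = l := by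
      intro l
      induction l with
      | nil => rfl
      | cons a t ih => simp [ih]
    rw [h2]
    apply List.ext_getElem
    · simp [hN]
    intro t h3 h4
    rw [List.length_ofFn] at h3 h4
    rw [List.getElem_ofFn, List.getElem_ofFn, interleave_free _ _ _ (by rintro ⟨i, -⟩; exact i.elim0)]
    simp only [freeCount_zero, h4, dif_pos]
  | succ k ih =>
    have hb := Choices.boundary_iff hℓ x.1
    obtain ⟨h3, h4⟩ := (hb.2 _).1 ⟨x.2, by have := x.2.2; omega, rfl⟩
    rw [ofFn_interleave_insertPos (N := n + k * ℓ) (loc' := Choices.locFin hℓ rfl x.1)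
      (a := ((Choices.lens ℓ x.1).take x.2).sum) (by rw [hN]; ring) hb.1 h3 h4 rfl u c,
      ih rfl x.1 fun i => u i.succ]
    have h5 : (Choices.list ((List.ofFn c).map fun a => [a]) (fun i => List.ofFn (u i)) x)
      = insertAt (Choices.list ((List.ofFn c).map fun a => [a]) (fun i => List.ofFn (u i.succ)) x.1)
        x.2 (List.ofFn (u 0)) := rfl
    rw [h5, flatten_insertAt, Choices.map_list]
    have h6 : (Choices.list (((List.ofFn c).map fun a => [a]).map List.length)
        (fun i => (List.ofFn (u i.succ)).length) x.1) = Choices.lens ℓ x.1 := by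
      simp only [List.map_map, List.length_ofFn, Choices.lens]
      congr 1
      rw [List.eq_replicate_iff]
      simp
    rw [h6]

/-- Inserting the blocks at random yields the interleaving for a random placement. -/
theorem scatter_law {N : ℕ} (hN : N = n + k * ℓ) (h : (placements k ℓ N).Nonempty)
    (u : Fin k → Fin ℓ → Fin q) (c : Fin n → Fin q) :
    (PMF.uniformOfFinset (placements k ℓ N) h).map (fun loc => List.ofFn (interleave loc u c))
      = (foldP insertRandom (List.ofFn fun i => List.ofFn (u i)).reverse
          ((List.ofFn c).map fun a => [a])).map List.flatten := by
  -- Empty blocks make distinct choices produce the same positions, so `ℓ = 0` is treated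
  -- separately; there the word is always the payload.
  rcases Nat.eq_zero_or_pos ℓ with rfl | hℓ
  · obtain rfl : N = n := by omega
    have h1 : ∀ loc : Fin k → Fin (N + 1), List.ofFn (interleave loc u c) = List.ofFn c := by
      intro loc
      congr 1
      funext t
      rw [interleave_free _ _ _ (by rintro ⟨i, h1, h2⟩; omega)]
      have : freeCount 0 (fun i => (loc i : ℕ)) t = t := by
        unfold freeCount
        rw [Finset.filter_true_of_mem, Finset.card_range]
        rintro t' - ⟨i, h1, h2⟩
        omega
      simp [this]
    simp only [h1]
    have h2 : ∀ (us : List (List (Fin q))) (its : List (List (Fin q))), (∀ v ∈ us, v = []) →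
        (foldP insertRandom us its).map List.flatten = PMF.pure its.flatten := by
      intro us
      induction us with
      | nil => intro its _; rw [foldP, PMF.pure_map]
      | cons v us ih =>
        intro its hv
        rw [foldP, PMF.map_bind]
        have h3 : ∀ its' ∈ (insertRandom its v).support,
            (foldP insertRandom us its').map List.flatten = PMF.pure its.flatten := by
          intro its' h4
          rw [ih its' fun w hw => hv w (by simp [hw])]
          rw [insertRandom, PMF.mem_support_map_iff] at h4
          obtain ⟨j, -, rfl⟩ := h4
          rw [hv v (by simp), List.flatten_append, List.flatten_cons, List.nil_append,
            ← List.flatten_append, List.take_append_drop]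
        rw [bind_congr_support h3, PMF.bind_const]
    rw [h2 _ _ (by simp)]
    have h5 : ((List.ofFn c).map fun a => [a]).flatten = List.ofFn c := by
      induction List.ofFn c with
      | nil => rfl
      | cons a t ih => simp [ih]
    rw [h5]
    exact PMF.map_const _ _
  · rw [uniform_placements hℓ hN h, PMF.map_comp, foldP_insertRandom, PMF.map_comp]
    have hlen : ((List.ofFn c).map fun a => [a]).length = n := by simp
    rw [show (PMF.uniformOfFintype (Choices ((List.ofFn c).map fun a => [a]).length k)).map
      (List.flatten ∘ Choices.list ((List.ofFn c).map fun a => [a]) fun i => List.ofFn (u i))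
      = (PMF.uniformOfFintype (Choices n k)).map
      (List.flatten ∘ Choices.list ((List.ofFn c).map fun a => [a]) fun i => List.ofFn (u i)) by
      rw [hlen]]
    congr 1
    funext x
    exact Choices.ofFn_interleave hℓ hN x u c

theorem sublist_insertAt_flatten {α : Type} (its : List (List α)) (j : ℕ) (u : List α) :
    its.flatten.Sublist (insertAt its j u).flatten := by
  conv_lhs => rw [← List.take_append_drop j its]
  rw [insertAt, List.flatten_append, List.flatten_append, List.flatten_cons]
  exact (List.Sublist.refl _).append (List.sublist_append_right _ _)

/-- The marker blocks are insertions into the payload. This is what lets the payload decoder be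
applied to the whole received word, without locating the blocks. -/
theorem sublist_interleave (hℓ : 0 < ℓ) {N : ℕ} (hN : N = n + k * ℓ) {loc : Fin k → Fin (N + 1)}
    (h : loc ∈ placements k ℓ N) (u : Fin k → Fin ℓ → Fin q) (c : Fin n → Fin q) :
    (List.ofFn c).Sublist (List.ofFn (interleave loc u c)) := by
  subst hN
  rw [mem_placements_iff hℓ] at h
  obtain ⟨x, hx⟩ := Choices.exists_loc_eq hℓ h
  obtain rfl : x.locFin hℓ rfl = loc := funext fun i => Fin.ext (congrFun hx i)
  rw [Choices.ofFn_interleave]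
  clear h hx
  induction k with
  | zero =>
    have h1 : (Choices.list ((List.ofFn c).map fun a => [a]) (fun i => List.ofFn (u i)) x)
        = (List.ofFn c).map fun a => [a] := rfl
    rw [h1]
    induction List.ofFn c with
    | nil => exact List.Sublist.refl _
    | cons a t ih => simpa using ih
  | succ k ih => exact (ih (fun i => u i.succ) x.1).trans (sublist_insertAt_flatten _ _ _)

theorem interleave_bijective (hℓ : 0 < ℓ) {N : ℕ} (hN : N = n + k * ℓ) {loc : Fin k → Fin (N + 1)}
    (h : loc ∈ placements k ℓ N) :
    Function.Bijective fun p : (Fin k → Fin ℓ → Fin q) × (Fin n → Fin q) =>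
      interleave loc p.1 p.2 := by
  rw [Fintype.bijective_iff_injective_and_card]
  constructor
  · subst hN
    rw [mem_placements_iff hℓ] at h
    obtain ⟨x, hx⟩ := Choices.exists_loc_eq hℓ h
    obtain rfl : x.locFin hℓ rfl = loc := funext fun i => Fin.ext (congrFun hx i)
    clear hx h
    rintro ⟨u, c⟩ ⟨u', c'⟩ heq
    have heq' := congrArg List.ofFn heq
    simp only [Choices.ofFn_interleave] at heq'
    -- The lengths of all items are determined by the choices, so the last inserted block sits at
    -- the same place in both words. Cutting it out leaves words that agree, and the induction
    -- applies to them.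
    have key : ∀ (k : ℕ) (x : Choices n k) (u u' : Fin k → Fin ℓ → Fin q),
        (Choices.list ((List.ofFn c).map fun a => [a]) (fun i => List.ofFn (u i)) x).flatten
        = (Choices.list ((List.ofFn c').map fun a => [a]) (fun i => List.ofFn (u' i)) x).flatten →
        u = u' ∧ c = c' := by
      intro k
      induction k with
      | zero =>
        intro x u u' h1
        refine ⟨funext fun i => i.elim0, ?_⟩
        have h2 : ∀ l : List (Fin q), (l.map fun a => [a]).flatten = l := by
          intro l
          induction l with
          | nil => rfl
          | cons a t ih => simp [ih]
        have h3 : ((List.ofFn c).map fun a => [a]).flatten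
          = ((List.ofFn c').map fun a => [a]).flatten := h1
        rw [h2, h2] at h3
        exact List.ofFn_injective h3
      | succ k ih =>
        intro x u u' h1
        have hl : ∀ (u : Fin (k + 1) → Fin ℓ → Fin q) (c : Fin n → Fin q),
            (Choices.list ((List.ofFn c).map fun a => [a]) (fun i => List.ofFn (u i.succ)) x.1).map
              List.length = Choices.lens ℓ x.1 := by
          intro u c
          rw [Choices.map_list]
          simp only [List.map_map, List.length_ofFn, Choices.lens]
          congr 1
          rw [List.eq_replicate_iff]
          simp
        have h2 : (insertAt (Choices.list ((List.ofFn c).map fun a => [a])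
            (fun i => List.ofFn (u i.succ)) x.1) x.2 (List.ofFn (u 0))).flatten
          = (insertAt (Choices.list ((List.ofFn c').map fun a => [a])
            (fun i => List.ofFn (u' i.succ)) x.1) x.2 (List.ofFn (u' 0))).flatten := h1
        rw [flatten_insertAt, flatten_insertAt, hl, hl] at h2
        have hfl : ∀ (u : Fin (k + 1) → Fin ℓ → Fin q) (c : Fin n → Fin q),
            (Choices.list ((List.ofFn c).map fun a => [a])
              (fun i => List.ofFn (u i.succ)) x.1).flatten.length = (Choices.lens ℓ x.1).sum := by
          intro u c
          rw [List.length_flatten, hl]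
        obtain ⟨h3, h4⟩ := List.append_inj h2 (by
          rw [List.length_take, List.length_take, hfl, hfl])
        obtain ⟨h5, h6⟩ := List.append_inj h4 (by simp)
        have h7 : (Choices.list ((List.ofFn c).map fun a => [a])
              (fun i => List.ofFn (u i.succ)) x.1).flatten
          = (Choices.list ((List.ofFn c').map fun a => [a])
              (fun i => List.ofFn (u' i.succ)) x.1).flatten := by
          rw [← List.take_append_drop ((Choices.lens ℓ x.1).take x.2).sum
            (Choices.list ((List.ofFn c).map fun a => [a])
              (fun i => List.ofFn (u i.succ)) x.1).flatten, h3, h6, List.take_append_drop]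
        obtain ⟨h8, h9⟩ := ih x.1 _ _ h7
        refine ⟨funext fun i => ?_, h9⟩
        induction i using Fin.cases with
        | zero => exact List.ofFn_injective h5
        | succ i => exact congrFun h8 i
    obtain ⟨h1, h2⟩ := key k x u u' heq'
    rw [h1, h2]
  · simp only [Fintype.card_prod, Fintype.card_fun, Fintype.card_fin, hN]
    rw [← pow_mul, ← pow_add]
    congr 1
    ring

/-- For a fixed placement, uniform blocks and a uniform payload give a uniform word. -/
theorem uniform_interleave {N : ℕ} (hN : N = n + k * ℓ) {loc : Fin k → Fin (N + 1)}
    (h : loc ∈ placements k ℓ N) :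
    ((PMF.uniformOfFintype (Fin k → Fin ℓ → Fin q)).bind fun u =>
      (PMF.uniformOfFintype (Fin n → Fin q)).map fun c => interleave loc u c)
      = PMF.uniformOfFintype (Fin N → Fin q) := by
  rcases Nat.eq_zero_or_pos ℓ with rfl | hℓ
  · obtain rfl : N = n := by omega
    have h1 : ∀ (u : Fin k → Fin 0 → Fin q) (c : Fin N → Fin q), interleave loc u c = c := by
      intro u c
      funext t
      rw [interleave_free _ _ _ (by rintro ⟨i, h1, h2⟩; omega)]
      have : freeCount 0 (fun i => (loc i : ℕ)) t = t := by
        unfold freeCount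
        rw [Finset.filter_true_of_mem, Finset.card_range]
        rintro t' - ⟨i, h1, h2⟩
        omega
      simp [this]
    simp only [h1]
    rw [PMF.bind_const]
    exact PMF.map_id _
  · rw [← uniform_map_bijective (interleave_bijective (q := q) hℓ hN h), uniform_prod, PMF.map_bind]
    simp only [PMF.map_comp]
    rfl

end

end PRC

/-! ### Block samplers, key components and parameters in polynomial time -/

namespace PRC

/-- The word carrying independent blocks with laws `ν` at random places of the payload `c`. -/
noncomputable def scatter {q : ℕ} [NeZero q] {k ℓ n N : ℕ} (h : (placements k ℓ N).Nonempty)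
    (ν : Fin k → PMF (Fin ℓ → Fin q)) (c : Fin n → Fin q) : PMF (Fin N → Fin q) :=
  (indep ν).bind fun u => (PMF.uniformOfFinset (placements k ℓ N) h).map fun loc =>
    interleave loc u c

theorem bitsData_false (k : ℕ) : bitsData (fun _ : Fin k => false) = natData k := by
  unfold bitsData natData
  rw [List.ofFn_const]
  induction k with
  | zero => rfl
  | succ k ih => simp only [List.replicate_succ, listData, ih, boolData]

theorem ofFn_joinKey {k a r : ℕ} (key : Fin k → Fin a → Bool) (shift : Fin r → Bool) :
    List.ofFn (joinKey key shift)
      = (List.ofFn fun i => List.ofFn (key i)).flatten ++ List.ofFn shift := by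
  rw [joinKey, List.ofFn_fin_append, List.ofFn_mul]
  congr 3
  funext i
  congr 1
  funext j
  have : (⟨(i : ℕ) * a + j, by
      calc (i : ℕ) * a + j < (i + 1) * a := by rw [Nat.add_mul]; omega
        _ ≤ k * a := Nat.mul_le_mul_right _ i.2⟩ : Fin (k * a)) = finProdFinEquiv (i, j) := by
    apply Fin.ext
    simp [finProdFinEquiv]
    ring
  rw [this, Equiv.symm_apply_apply]

theorem joinKey_parts {k a r : ℕ} (x : Fin (k * a + r) → Bool) :
    joinKey (keyPart x) (shiftPart x) = x := by
  funext t
  unfold joinKey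
  refine Fin.addCases (fun i => ?_) (fun i => ?_) t
  · rw [Fin.append_left, keyPart, Prod.mk.eta, Equiv.apply_symm_apply]
  · rw [Fin.append_right, shiftPart]

theorem keyPart_joinKey {k a r : ℕ} (key : Fin k → Fin a → Bool) (shift : Fin r → Bool) :
    keyPart (joinKey key shift) = key := by
  funext i j
  rw [keyPart, joinKey, Fin.append_left, Equiv.symm_apply_apply]

theorem shiftPart_joinKey {k a r : ℕ} (key : Fin k → Fin a → Bool) (shift : Fin r → Bool) :
    shiftPart (joinKey key shift) = shift := by
  funext j
  rw [shiftPart, joinKey, Fin.append_right]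

theorem chunks_flatten {α : Type} {a : ℕ} (l : List (List α)) (h : ∀ x ∈ l, x.length = a)
    (t : List α) : chunks a l.length (l.flatten ++ t) = l := by
  induction l with
  | nil => rfl
  | cons x l ih =>
    have hx : x.length = a := h x (by simp)
    rw [List.length_cons, chunks, List.flatten_cons, List.append_assoc, List.take_left' hx,
      List.drop_left' hx, ih fun y hy => h y (by simp [hy])]

theorem chunks_ofFn {k a r : ℕ} (x : Fin (k * a + r) → Bool) :
    chunks a k (List.ofFn x) = List.ofFn fun i => List.ofFn (keyPart x i) := by
  conv_lhs => rw [← joinKey_parts x, ofFn_joinKey]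
  have := chunks_flatten (a := a) (List.ofFn fun i => List.ofFn (keyPart x i)) (by
    intro y hy
    rw [List.mem_ofFn] at hy
    obtain ⟨i, rfl⟩ := hy
    simp) (List.ofFn (shiftPart x))
  rwa [List.length_ofFn] at this

theorem drop_ofFn {k a r : ℕ} (x : Fin (k * a + r) → Bool) :
    (List.ofFn x).drop (k * a) = List.ofFn (shiftPart x) := by
  conv_lhs => rw [← joinKey_parts x, ofFn_joinKey]
  rw [List.drop_left']
  rw [List.length_flatten, List.map_ofFn]
  have : (List.length ∘ fun i => List.ofFn (keyPart x i)) = fun _ => a := by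
    funext i; simp
  rw [this, List.sum_ofFn]
  simp

section

variable {ι : Type} {O : ι → Data → PMF Data} {e : ι → Data} {q : ℕ} {k ℓ n N : ι → ℕ}

theorem PT.blocks {τ : ι → Type} {enc : ∀ i, τ i → Data} {v : ∀ i, Fin (k i) → τ i}
    {f : ∀ i, τ i → PMF (Fin (ℓ i) → Fin q)}
    (hv : PT O e fun i => PMF.pure (listData (enc i) (List.ofFn (v i))))
    (hf : PT (fun p : (i : ι) × τ i => O p.1) (fun p => Data.cons (e p.1) (enc p.1 p.2))
      (fun p => (f p.1 p.2).map fun y => wordData (List.ofFn y))) :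
    PT O e fun i => (indep fun j => f i (v i j)).map fun u =>
      listData wordData (List.ofFn fun j => List.ofFn (u j)) := by
  refine (PT.mapP (encB := fun _ => wordData (q := q)) (f := fun i t => (f i t).map List.ofFn)
    hv ?_).congr fun i => ?_
  · refine hf.congr fun p => ?_
    rw [PMF.map_comp]; rfl
  · rw [mapP_ofFn, ← indep_map (fun j => f i (v i j)) (fun _ => List.ofFn), PMF.map_comp,
      PMF.map_comp]
    rfl

theorem PT.scatter [NeZero q] (hN : ∀ i, N i = n i + k i * ℓ i)
    (h : ∀ i, (placements (k i) (ℓ i) (N i)).Nonempty)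
    {ν : ∀ i, Fin (k i) → PMF (Fin (ℓ i) → Fin q)} {c : ∀ i, Fin (n i) → Fin q}
    (hu : PT O e fun i => (indep (ν i)).map fun u =>
      listData wordData (List.ofFn fun j => List.ofFn (u j)))
    (hc : PT O e fun i => PMF.pure (wordData (List.ofFn (c i)))) :
    PT O e fun i => (PRC.scatter (h i) (ν i) (c i)).map fun y => wordData (List.ofFn y) := by
  unfold PRC.scatter
  simp only [PMF.map_bind, PMF.map_comp]
  refine PT.bind hu ?_
  refine (PT.map (α := fun _ => List (List (Fin q))) (enc := fun _ => listData wordData)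
    (g := fun p : (i : ι) × (Fin (k i) → Fin (ℓ i) → Fin q) =>
      PRC.foldP PRC.insertRandom (List.ofFn fun j => List.ofFn (p.2 j)).reverse
        ((List.ofFn (c p.1)).map fun a => [a]))
    (h := fun p l => wordData l.flatten) ?_ ?_).congr ?_
  · refine PT.insertAll (enc := fun _ => wordData (q := q)) ?_ ?_
    · refine PT.listMap (encA := fun _ (a : Fin q) => natData (a : ℕ)) ?_ ?_
      · exact (hc.reindex Sigma.fst).comp (PT.get [false])
      · exact PT.pair (PT.get [true]) PT.nil
    · exact PT.reverse (enc := fun _ => wordData (q := q)) (PT.get [true])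
  · exact PT.flatten (enc := fun _ (a : Fin q) => natData (a : ℕ)) (PT.get [true])
  · rintro ⟨i, u⟩
    have := congrArg (PMF.map wordData) (scatter_law (q := q) (hN i) (h i) u (c i))
    rw [PMF.map_comp, PMF.map_comp] at this
    exact this.symm

end

section

variable {ι : Type} {O : ι → Data → PMF Data} {e : ι → Data}

/-- A parameter that is the length of every possible output of a sampler is computed by running the
sampler once and counting. The output is random, but its length is not. -/
theorem PT.length {α : ι → Type} {g : ∀ i, PMF (α i)} {enc : ∀ i, α i → Data} {k : ι → ℕ}
    {path : List Bool} {β : Type} {encB : β → Data} {l : ∀ i, α i → List β}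
    (hg : PT O e fun i => (g i).map (enc i)) (hl : ∀ i a, (enc i a).get path = listData encB (l i a))
    (hk : ∀ i a, (l i a).length = k i) : PT O e fun i => PMF.pure (natData (k i)) := by
  refine (PT.bind (h := fun i a => PMF.pure (natData (k i))) hg ?_).congr fun i => PMF.bind_const _ _
  refine (PT.replicate_nil (enc := fun _ => encB) (l := fun p => l p.1 p.2) ?_).congr ?_
  · refine (PT.get (true :: path)).congr fun p => ?_
    rw [← hl]; rfl
  · intro p; rw [hk]

variable {q : ℕ} {M ℓ n d d' r : ℕ → ℕ}

theorem Scheme.Efficient.keyGenPT {S : Scheme q M ℓ} (h : S.Efficient) :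
    PT (fun _ => noOracle) (fun lam : ℕ => natData lam)
      fun lam => (S.keyGen lam).map fun k => Data.cons (bitsData k.1) (bitsData k.2) :=
  polyTime_iff.1 h.1

theorem Scheme.Efficient.ekLenPT {S : Scheme q M ℓ} (h : S.Efficient) :
    PT (fun _ => noOracle) (fun lam : ℕ => natData lam)
      fun lam => PMF.pure (natData (S.ekLen lam)) :=
  PT.length (path := [false]) (encB := boolData) (l := fun _ k => List.ofFn k.1) h.keyGenPT
    (fun _ _ => rfl) (fun _ _ => by simp)

theorem Scheme.Efficient.dkLenPT {S : Scheme q M ℓ} (h : S.Efficient) :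
    PT (fun _ => noOracle) (fun lam : ℕ => natData lam)
      fun lam => PMF.pure (natData (S.dkLen lam)) :=
  PT.length (path := [true]) (encB := boolData) (l := fun _ k => List.ofFn k.2) h.keyGenPT
    (fun _ _ => rfl) (fun _ _ => by simp)

/-- Encryption of the message `0` under a computed key. -/
theorem Scheme.Efficient.encPT {S₀ : Scheme q (fun _ => 1) ℓ} (h : S₀.Efficient) {lam : ι → ℕ}
    {key : ∀ i, Fin (S₀.ekLen (lam i)) → Bool}
    (hlam : PT O e fun i => PMF.pure (natData (lam i)))
    (hkey : PT O e fun i => PMF.pure (bitsData (key i))) :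
    PT O e fun i => (S₀.enc (lam i) (key i) 0).map fun y => wordData (List.ofFn y) :=
  (((polyTime_iff.1 h.2.1).reindex fun i => ⟨lam i, key i, 0⟩).anyOracle O).comp
    (PT.pair hlam (PT.pair hkey PT.nil))

/-- Computability of the codeword length is not part of the definition of an efficient scheme; it is
obtained by generating a key and encoding once. -/
theorem Scheme.Efficient.lenPT {S₀ : Scheme q (fun _ => 1) ℓ} (h : S₀.Efficient) :
    PT (fun _ => noOracle) (fun lam : ℕ => natData lam)
      fun lam => PMF.pure (natData (ℓ lam)) := by
  refine PT.length (g := fun lam => (S₀.keyGen lam).bind fun k => S₀.enc lam k.1 0)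
    (path := []) (encB := fun a : Fin q => natData a) (enc := fun _ y => wordData (List.ofFn y))
    (l := fun _ y => List.ofFn y) ?_ (fun _ _ => rfl) (fun _ _ => by simp)
  simp only [PMF.map_bind]
  refine PT.bind h.keyGenPT ?_
  exact h.encPT (PT.get [false]) (PT.get [true, false])

theorem SeedCode.Corrects.encPT {ρ : ℝ} {C : SeedCode d d'} (h : C.Corrects ρ) {lam : ι → ℕ}
    {s : ∀ i, Fin (d (lam i)) → Bool}
    (hlam : PT O e fun i => PMF.pure (natData (lam i)))
    (hs : PT O e fun i => PMF.pure (bitsData (s i))) :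
    PT O e fun i => PMF.pure (bitsData (C.enc (lam i) (s i))) :=
  (((polyTime_iff.1 h.enc_polyTime).reindex fun i => ⟨lam i, s i⟩).anyOracle O).comp
    (PT.pair hlam hs)

theorem PayloadCode.Efficient.encPT {L : PayloadCode q M n d r} (h : L.Efficient) {lam : ι → ℕ}
    {m : ∀ i, Fin (M (lam i))} {s : ∀ i, Fin (d (lam i)) → Bool}
    {shift : ∀ i, Fin (r (lam i)) → Bool}
    (hlam : PT O e fun i => PMF.pure (natData (lam i)))
    (hm : PT O e fun i => PMF.pure (msgData (m i)))
    (hs : PT O e fun i => PMF.pure (bitsData (s i)))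
    (hr : PT O e fun i => PMF.pure (bitsData (shift i))) :
    PT O e fun i => PMF.pure (wordData (List.ofFn (L.enc (lam i) (m i) (s i) (shift i)))) :=
  (((polyTime_iff.1 h.1).reindex fun i => ⟨lam i, m i, s i, shift i⟩).anyOracle O).comp
    (PT.pair hlam (PT.pair hm (PT.pair hs hr)))

theorem PayloadCode.Efficient.decPT {L : PayloadCode q M n d r} (h : L.Efficient) {lam : ι → ℕ}
    {y : ι → List (Fin q)} {s : ∀ i, Fin (d (lam i)) → Bool}
    {shift : ∀ i, Fin (r (lam i)) → Bool}
    (hlam : PT O e fun i => PMF.pure (natData (lam i)))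
    (hy : PT O e fun i => PMF.pure (wordData (y i)))
    (hs : PT O e fun i => PMF.pure (bitsData (s i)))
    (hr : PT O e fun i => PMF.pure (bitsData (shift i))) :
    PT O e fun i => PMF.pure (optionData msgData (L.dec (lam i) (y i) (s i) (shift i))) :=
  (((polyTime_iff.1 h.2.1).reindex fun i => ⟨lam i, y i, s i, shift i⟩).anyOracle O).comp
    (PT.pair hlam (PT.pair hy (PT.pair hs hr)))

theorem PayloadCode.Efficient.seedLenPT {L : PayloadCode q M n d r} (h : L.Efficient) :
    PT (fun _ => noOracle) (fun lam : ℕ => natData lam)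
      fun lam => PMF.pure (natData (d lam)) :=
  polyTime_iff.1 h.2.2.1

theorem PayloadCode.Efficient.shiftLenPT {L : PayloadCode q M n d r} (h : L.Efficient) :
    PT (fun _ => noOracle) (fun lam : ℕ => natData lam)
      fun lam => PMF.pure (natData (r lam)) :=
  polyTime_iff.1 h.2.2.2.1

theorem PayloadCode.Efficient.numMsgPT {L : PayloadCode q M n d r} (h : L.Efficient) :
    PT (fun _ => noOracle) (fun lam : ℕ => natData lam)
      fun lam => PMF.pure (binData (M lam)) :=
  polyTime_iff.1 h.2.2.2.2

/-- The length `d'` is read off the encoding of the all-zero seed, which is encoded by the same tree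
as the unary number `d`. -/
theorem SeedCode.Corrects.lenPT {ρ : ℝ} {C : SeedCode d d'} (h : C.Corrects ρ)
    {L : PayloadCode q M n d r} (hL : L.Efficient) :
    PT (fun _ => noOracle) (fun lam : ℕ => natData lam)
      fun lam => PMF.pure (natData (d' lam)) := by
  refine (PT.replicate_nil (enc := fun _ => boolData)
    (l := fun lam => List.ofFn (C.enc lam fun _ => false)) (h.encPT PT.id ?_)).congr ?_
  · simp only [bitsData_false]
    exact hL.seedLenPT
  · intro lam; simp

/-- Transport of a parameter computation to any environment from which `lam` can be computed. -/
theorem PT.param {k : ℕ → Data} (h : PT (fun _ => noOracle) (fun lam : ℕ => natData lam)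
      fun lam => PMF.pure (k lam)) {lam : ι → ℕ}
    (hlam : PT O e fun i => PMF.pure (natData (lam i))) :
    PT O e fun i => PMF.pure (k (lam i)) :=
  ((h.reindex lam).anyOracle O).comp hlam

theorem natData_add (a b : ℕ) :
    natData (a + b) = listData (fun _ => Data.nil) (List.replicate a () ++ List.replicate b ()) := by
  rw [List.replicate_append_replicate, natData]

theorem PT.natAdd {a b : ι → ℕ} (ha : PT O e fun i => PMF.pure (natData (a i)))
    (hb : PT O e fun i => PMF.pure (natData (b i))) :
    PT O e fun i => PMF.pure (natData (a i + b i)) := by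
  simp only [natData_add]
  exact PT.append (enc := fun _ _ => Data.nil) ha hb

theorem listData_ofFn_bits {k a : ℕ} (f : Fin k → Fin a → Bool) :
    listData (listData boolData) (List.ofFn fun j => List.ofFn (f j))
      = listData bitsData (List.ofFn f) := by
  induction k with
  | zero => rfl
  | succ k ih => simp only [List.ofFn_succ, listData, ih (fun j => f j.succ), bitsData]

theorem PT.joinKey {k a r : ι → ℕ} {key : ∀ i, Fin (k i) → Fin (a i) → Bool}
    {shift : ∀ i, Fin (r i) → Bool}
    (hkey : PT O e fun i => PMF.pure (listData bitsData (List.ofFn (key i))))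
    (hs : PT O e fun i => PMF.pure (bitsData (shift i))) :
    PT O e fun i => PMF.pure (bitsData (PRC.joinKey (key i) (shift i))) := by
  simp only [← listData_ofFn_bits] at hkey
  simp only [bitsData, ofFn_joinKey]
  exact PT.append (enc := fun _ => boolData) (PT.flatten (enc := fun _ => boolData) hkey) hs

theorem PT.keyParts {k a r : ι → ℕ} {x : ∀ i, Fin (k i * a i + r i) → Bool}
    (hk : PT O e fun i => PMF.pure (natData (k i))) (ha : PT O e fun i => PMF.pure (natData (a i)))
    (hx : PT O e fun i => PMF.pure (bitsData (x i))) :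
    (PT O e fun i => PMF.pure (listData bitsData (List.ofFn (keyPart (x i))))) ∧
    PT O e fun i => PMF.pure (bitsData (shiftPart (x i))) := by
  have h := PT.chunks (enc := fun _ => boolData) hk ha hx
  simp only [chunks_ofFn, drop_ofFn] at h
  refine ⟨(PT.get' [false] h).congr fun i => ?_, PT.get' [true] h⟩
  simp only [Data.get, Data.fst]
  congr 1
  exact listData_ofFn_bits _

end

end PRC

/-! ### Efficiency of the construction -/

namespace PRC

section

variable {q : ℕ} [NeZero q] {M ℓ n d d' r : ℕ → ℕ}

/-- Which of the blocks carry codewords. -/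
def marks (C : SeedCode d d') (lam : ℕ) (s : Fin (d lam) → Bool) : Fin (d' lam + d' lam) → Bool :=
  Fin.append (C.enc lam s) fun _ => true

theorem placements_nonempty' (d' ℓ n : ℕ) :
    (placements (d' + d') ℓ (n + 2 * d' * ℓ)).Nonempty :=
  placements_nonempty (by rw [two_mul]; exact Nat.le_add_left _ _)

/-- The encoder of the construction, with arbitrary laws `B` for the marked blocks. -/
noncomputable def markedEnc (L : PayloadCode q M n d r) (C : SeedCode d d') (lam : ℕ)
    (B : Fin (d' lam + d' lam) → PMF (Fin (ℓ lam) → Fin q)) (shift : Fin (r lam) → Bool)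
    (m : Fin (M lam)) : PMF (Fin (n lam + 2 * d' lam * ℓ lam) → Fin q) :=
  (PMF.uniformOfFintype (Fin (d lam) → Bool)).bind fun s =>
    scatter (placements_nonempty' _ _ _)
      (fun i => if marks C lam s i then B i else PMF.uniformOfFintype (Fin (ℓ lam) → Fin q))
      (L.enc lam m s shift)

theorem genericPRC_enc (S₀ : Scheme q (fun _ => 1) ℓ) (L : PayloadCode q M n d r)
    (C : SeedCode d d') (lam : ℕ) (pk : Fin ((genericPRC S₀ L C).ekLen lam) → Bool)
    (m : Fin (M lam)) :
    (genericPRC S₀ L C).enc lam pk m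
      = markedEnc L C lam (fun i => S₀.enc lam (keyPart pk i) 0) (shiftPart pk) m := rfl

open Classical in
/-- The decision of the decoder, given the outcomes of the tests. -/
noncomputable def decodeTests (L : PayloadCode q M n d r) (C : SeedCode d d') (lam : ℕ)
    (st : Fin (d' lam + d' lam) → Bool) (shift : Fin (r lam) → Bool) (y : List (Fin q)) :
    Option (Fin (M lam)) :=
  if ∀ j : Fin (d' lam), st (Fin.natAdd (d' lam) j) = false then none
  else (C.dec lam fun j => st (Fin.castAdd (d' lam) j)).bind fun s => L.dec lam y s shift

theorem genericPRC_dec (S₀ : Scheme q (fun _ => 1) ℓ) (L : PayloadCode q M n d r)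
    (C : SeedCode d d') (lam : ℕ)
    (sk : Fin ((d' lam + d' lam) * S₀.dkLen lam + r lam) → Bool) (y : List (Fin q)) :
    (genericPRC S₀ L C).dec lam sk y
      = (indep fun i => anyAccepts (S₀.dec lam (keyPart sk i)) (substrings y)).map fun st =>
        decodeTests L C lam st (shiftPart sk) y := by
  simp only [genericPRC]
  congr 1
  funext st
  unfold decodeTests
  split_ifs with h1
  · rfl
  · cases C.dec lam fun j => st (Fin.castAdd (d' lam) j) <;> rfl

variable {ι : Type} {O : ι → Data → PMF Data} {e : ι → Data}

theorem zip_ofFn {α β : Type} {k : ℕ} (f : Fin k → α) (g : Fin k → β) :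
    (List.ofFn f).zip (List.ofFn g) = List.ofFn fun i => (f i, g i) := by
  apply List.ext_getElem
  · simp
  · intro i h1 h2
    simp

/-- The sampler `f` for marked blocks is left arbitrary, with data `v i j` for the individual
blocks. The same program then serves the encoder of the construction, where the data are keys, and
the hybrid oracles, where they also tell how the block is produced. -/
theorem PT.markedBlocks {S₀ : Scheme q (fun _ => 1) ℓ} {L : PayloadCode q M n d r}
    {C : SeedCode d d'} {ρ : ℝ} (hS : S₀.Efficient) (hL : L.Efficient) (hC : C.Corrects ρ)
    {lam : ι → ℕ} {s : ∀ i, Fin (d (lam i)) → Bool}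
    {τ : ι → Type} {enc : ∀ i, τ i → Data} {v : ∀ i, Fin (d' (lam i) + d' (lam i)) → τ i}
    {f : ∀ i, τ i → PMF (Fin (ℓ (lam i)) → Fin q)}
    (hlam : PT O e fun i => PMF.pure (natData (lam i)))
    (hs : PT O e fun i => PMF.pure (bitsData (s i)))
    (hv : PT O e fun i => PMF.pure (listData (enc i) (List.ofFn (v i))))
    (hf : PT (fun p : (i : ι) × τ i => O p.1) (fun p => Data.cons (e p.1) (enc p.1 p.2))
      (fun p => (f p.1 p.2).map fun y => wordData (List.ofFn y))) :
    PT O e fun i => (indep fun j => if marks C (lam i) (s i) j then f i (v i j) else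
      PMF.uniformOfFintype (Fin (ℓ (lam i)) → Fin q)).map fun u =>
        listData wordData (List.ofFn fun j => List.ofFn (u j)) := by
  have hzip : PT O e fun i => PMF.pure (listData (pairData boolData (enc i))
      (List.ofFn fun j => (marks C (lam i) (s i) j, v i j))) := by
    simp only [← zip_ofFn]
    refine PT.zip (encA := fun _ => boolData) (encB := enc) ?_ hv
    simp only [marks, List.ofFn_fin_append]
    refine PT.append (enc := fun _ => boolData) (hC.encPT hlam hs) ?_
    refine (PT.listMap (encA := fun _ _ => Data.nil) (encB := fun _ => boolData)
      (f := fun _ (_ : Unit) => true) (PT.param (hC.lenPT hL) hlam)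
      (PT.const (boolData true))).congr fun i => ?_
    rw [List.map_replicate, List.ofFn_const]
  have hblock : PT (fun p : (i : ι) × (Bool × τ i) => O p.1)
      (fun p => Data.cons (e p.1) (pairData boolData (enc p.1) p.2))
      (fun p => (if p.2.1 then f p.1 p.2.2 else
        PMF.uniformOfFintype (Fin (ℓ (lam p.1)) → Fin q)).map fun y => wordData (List.ofFn y)) := by
    have h1 : PT (fun p : (i : ι) × (Bool × τ i) => O p.1)
        (fun p => Data.cons (e p.1) (pairData boolData (enc p.1) p.2))
        (fun p => (f p.1 p.2.2).map fun y => wordData (List.ofFn y)) :=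
      (hf.reindex fun p : (i : ι) × (Bool × τ i) => (⟨p.1, p.2.2⟩ : (i : ι) × τ i)).comp
        (PT.pair (PT.get [false]) (PT.get [true, true]))
    have h2 : PT (fun p : (i : ι) × (Bool × τ i) => O p.1)
        (fun p => Data.cons (e p.1) (pairData boolData (enc p.1) p.2))
        (fun p => (PMF.uniformOfFintype (Fin (ℓ (lam p.1)) → Fin q)).map
          fun y => wordData (List.ofFn y)) :=
      PT.word (PT.param hS.lenPT ((hlam.reindex Sigma.fst).comp (PT.get [false])))
    have h3 : PT (fun p : (i : ι) × (Bool × τ i) => O p.1)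
        (fun p => Data.cons (e p.1) (pairData boolData (enc p.1) p.2))
        (fun p => PMF.pure (boolData p.2.1)) := PT.get [true, false]
    refine PT.ite' h3 h1 h2 ?_ ?_
    · rintro ⟨i, b, t⟩ h
      cases b
      · exact absurd rfl h
      · rfl
    · rintro ⟨i, b, t⟩ h
      cases b
      · rfl
      · exact absurd h (by simp [boolData])
  exact PT.blocks (f := fun i (t : Bool × τ i) => if t.1 then f i t.2 else
        PMF.uniformOfFintype (Fin (ℓ (lam i)) → Fin q)) hzip hblock

theorem PT.markedEnc {S₀ : Scheme q (fun _ => 1) ℓ} {L : PayloadCode q M n d r}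
    {C : SeedCode d d'} {ρ : ℝ} (hS : S₀.Efficient) (hL : L.Efficient) (hC : C.Corrects ρ)
    {lam : ι → ℕ} {shift : ∀ i, Fin (r (lam i)) → Bool} {m : ∀ i, Fin (M (lam i))}
    {τ : ι → Type} {enc : ∀ i, τ i → Data} {v : ∀ i, Fin (d' (lam i) + d' (lam i)) → τ i}
    {f : ∀ i, τ i → PMF (Fin (ℓ (lam i)) → Fin q)}
    (hlam : PT O e fun i => PMF.pure (natData (lam i)))
    (hshift : PT O e fun i => PMF.pure (bitsData (shift i)))
    (hm : PT O e fun i => PMF.pure (msgData (m i)))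
    (hv : PT O e fun i => PMF.pure (listData (enc i) (List.ofFn (v i))))
    (hf : PT (fun p : (i : ι) × τ i => O p.1) (fun p => Data.cons (e p.1) (enc p.1 p.2))
      (fun p => (f p.1 p.2).map fun y => wordData (List.ofFn y))) :
    PT O e fun i => (PRC.markedEnc L C (lam i) (fun j => f i (v i j)) (shift i) (m i)).map
      fun y => wordData (List.ofFn y) := by
  unfold PRC.markedEnc
  simp only [PMF.map_bind]
  refine PT.bind (enc := fun _ => bitsData) (PT.bits (PT.param hL.seedLenPT hlam)) ?_
  have hold : ∀ {w : ι → Data}, (PT O e fun i => PMF.pure (w i)) →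
      PT (fun p : (i : ι) × (Fin (d (lam i)) → Bool) => O p.1)
      (fun p => Data.cons (e p.1) (bitsData p.2)) (fun p => PMF.pure (w p.1)) :=
    fun h => (h.reindex Sigma.fst).comp (PT.get [false])
  have hs : PT (fun p : (i : ι) × (Fin (d (lam i)) → Bool) => O p.1)
      (fun p => Data.cons (e p.1) (bitsData p.2)) (fun p => PMF.pure (bitsData p.2)) := PT.get [true]
  have hf' : PT (fun t : (p : (i : ι) × (Fin (d (lam i)) → Bool)) × τ p.1 => O t.1.1)
      (fun t => Data.cons (Data.cons (e t.1.1) (bitsData t.1.2)) (enc t.1.1 t.2))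
      (fun t => (f t.1.1 t.2).map fun y => wordData (List.ofFn y)) :=
    (hf.reindex fun t : (p : (i : ι) × (Fin (d (lam i)) → Bool)) × τ p.1 =>
      (⟨t.1.1, t.2⟩ : (i : ι) × τ i)).comp (PT.pair (PT.get [false, false]) (PT.get [true]))
  refine PT.scatter (n := fun p : (i : ι) × (Fin (d (lam i)) → Bool) => n (lam p.1))
    (k := fun p => d' (lam p.1) + d' (lam p.1)) (ℓ := fun p => ℓ (lam p.1))
    (N := fun p => n (lam p.1) + 2 * d' (lam p.1) * ℓ (lam p.1))
    (fun p => by ring) (fun p => placements_nonempty' _ _ _) ?_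
    (hL.encPT (hold hlam) (hold hm) hs (hold hshift))
  exact PT.markedBlocks hS hL hC (s := fun p : (i : ι) × (Fin (d (lam i)) → Bool) => p.2)
    (v := fun p => v p.1) (f := fun p => f p.1) (hold hlam) hs (hold hv) hf'

theorem genericPRC_keyGenPT {S₀ : Scheme q (fun _ => 1) ℓ} {L : PayloadCode q M n d r}
    {C : SeedCode d d'} {ρ : ℝ} (hS : S₀.Efficient) (hL : L.Efficient) (hC : C.Corrects ρ) :
    PT (fun _ => noOracle) (fun lam : ℕ => natData lam) fun lam =>
      ((genericPRC S₀ L C).keyGen lam).map fun k => Data.cons (bitsData k.1) (bitsData k.2) := by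
  have h1 : PT (fun _ => noOracle) (fun p : (p : (lam : ℕ) × (Fin (d' lam + d' lam) →
        (Fin (S₀.ekLen lam) → Bool) × (Fin (S₀.dkLen lam) → Bool))) × (Fin (r p.1) → Bool) =>
      Data.cons (Data.cons (natData p.1.1)
        (listData (pairData bitsData bitsData) (List.ofFn p.1.2))) (bitsData p.2))
      fun p => PMF.pure (bitsData (joinKey (fun i => (p.1.2 i).1) p.2)) := by
    refine PT.joinKey ?_ (PT.get [true])
    refine (PT.listMap (encA := fun _ => pairData bitsData bitsData) (encB := fun _ => bitsData)
      (f := fun _ => Prod.fst) (PT.get [false, true]) (PT.get [true, false])).congr fun p => ?_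
    rw [List.map_ofFn]; rfl
  have h2 : PT (fun _ => noOracle) (fun p : (p : (lam : ℕ) × (Fin (d' lam + d' lam) →
        (Fin (S₀.ekLen lam) → Bool) × (Fin (S₀.dkLen lam) → Bool))) × (Fin (r p.1) → Bool) =>
      Data.cons (Data.cons (natData p.1.1)
        (listData (pairData bitsData bitsData) (List.ofFn p.1.2))) (bitsData p.2))
      fun p => PMF.pure (bitsData (joinKey (fun i => (p.1.2 i).2) p.2)) := by
    refine PT.joinKey ?_ (PT.get [true])
    refine (PT.listMap (encA := fun _ => pairData bitsData bitsData) (encB := fun _ => bitsData)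
      (f := fun _ => Prod.snd) (PT.get [false, true]) (PT.get [true, true])).congr fun p => ?_
    rw [List.map_ofFn]; rfl
  simp only [genericPRC, PMF.map_bind, PMF.map_comp]
  refine PT.bind (enc := fun lam ks => listData (pairData bitsData bitsData) (List.ofFn ks))
    (PT.iid (enc := fun lam => pairData bitsData bitsData)
      (PT.natAdd (hC.lenPT hL) (hC.lenPT hL)) hS.keyGenPT) ?_
  refine PT.map (enc := fun _ => bitsData)
    (PT.bits (PT.param hL.shiftLenPT (PT.get [false]))) ?_
  exact PT.pair h1 h2

theorem PT.markTests {S₀ : Scheme q (fun _ => 1) ℓ} (hS : S₀.Efficient) {lam k : ι → ℕ}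
    {key : ∀ i, Fin (k i) → Fin (S₀.dkLen (lam i)) → Bool} {y : ι → List (Fin q)}
    (hlam : PT O e fun i => PMF.pure (natData (lam i)))
    (hkey : PT O e fun i => PMF.pure (listData bitsData (List.ofFn (key i))))
    (hy : PT O e fun i => PMF.pure (wordData (y i))) :
    PT O e fun i => (indep fun j => PRC.anyAccepts (S₀.dec (lam i) (key i j))
      (PRC.substrings (y i))).map bitsData := by
  have h1 : PT (fun p : (i : ι) × (Fin (S₀.dkLen (lam i)) → Bool) => O p.1)
      (fun p => Data.cons (e p.1) (bitsData p.2))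
      (fun p => (PRC.anyAccepts (S₀.dec (lam p.1) p.2) (PRC.substrings (y p.1))).map boolData) := by
    refine PT.anyAccepts (encA := fun _ => wordData (q := q)) (encB := fun _ => msgData)
      (PT.substrings (enc := fun _ (a : Fin q) => natData (a : ℕ))
        ((hy.reindex Sigma.fst).comp (PT.get [false]))) ?_
    have h2 := ((polyTime_iff.1 hS.2.2).reindex fun p : (p : (i : ι) ×
      (Fin (S₀.dkLen (lam i)) → Bool)) × List (Fin q) => ⟨lam p.1.1, p.1.2, p.2⟩).anyOracle
        fun p => O p.1.1
    refine h2.comp (PT.pair ?_ (PT.pair (PT.get [false, true]) (PT.get [true])))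
    exact (hlam.reindex fun p : (p : (i : ι) × (Fin (S₀.dkLen (lam i)) → Bool)) × List (Fin q) =>
      p.1.1).comp (PT.get [false, false])
  refine (PT.mapP (encB := fun _ => boolData)
    (f := fun i key => PRC.anyAccepts (S₀.dec (lam i) key) (PRC.substrings (y i))) hkey h1).congr
    fun i => ?_
  rw [mapP_ofFn, PMF.map_comp]; rfl

open Classical in
theorem PT.decodeTests {L : PayloadCode q M n d r}
    {C : SeedCode d d'} {ρ : ℝ} (hL : L.Efficient) (hC : C.Corrects ρ)
    {lam : ι → ℕ} {st : ∀ i, Fin (d' (lam i) + d' (lam i)) → Bool}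
    {shift : ∀ i, Fin (r (lam i)) → Bool} {y : ι → List (Fin q)}
    (hlam : PT O e fun i => PMF.pure (natData (lam i)))
    (hst : PT O e fun i => PMF.pure (bitsData (st i)))
    (hshift : PT O e fun i => PMF.pure (bitsData (shift i)))
    (hy : PT O e fun i => PMF.pure (wordData (y i))) :
    PT O e fun i => PMF.pure (optionData msgData
      (PRC.decodeTests L C (lam i) (st i) (shift i) (y i))) := by
  have hsplit : ∀ i, List.ofFn (st i)
      = List.ofFn (fun j => st i (Fin.castAdd (d' (lam i)) j)) ++
        List.ofFn (fun j => st i (Fin.natAdd (d' (lam i)) j)) := by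
    intro i
    rw [← List.ofFn_fin_append, Fin.append_castAdd_natAdd]
  have hd := PT.param (hC.lenPT hL) hlam
  have h1 : PT O e fun i => PMF.pure (bitsData fun j => st i (Fin.castAdd (d' (lam i)) j)) := by
    refine (PT.take (enc := fun _ => boolData) hd hst).congr fun i => ?_
    rw [hsplit, List.take_left' (by simp), bitsData]
  have h2 : PT O e fun i => PMF.pure (boolData
      ((List.ofFn fun j => st i (Fin.natAdd (d' (lam i)) j)).any fun b => b)) := by
    refine PT.any (enc := fun _ => boolData) ?_ (PT.get [true])
    refine (PT.drop (enc := fun _ => boolData) hd hst).congr fun i => ?_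
    rw [hsplit, List.drop_left' (by simp)]
  have h3 : PT O e fun i => (C.dec (lam i) fun j => st i (Fin.castAdd (d' (lam i)) j)).elim
      (PMF.pure Data.nil) fun s => PMF.pure (optionData msgData
        (L.dec (lam i) (y i) s (shift i))) := by
    refine PT.optionElim (enc := fun _ => bitsData) ?_ PT.nil ?_
    · exact (((polyTime_iff.1 hC.dec_polyTime).reindex fun i =>
        ⟨lam i, fun j => st i (Fin.castAdd (d' (lam i)) j)⟩).anyOracle O).comp (PT.pair hlam h1)
    · have hold : ∀ {w : ι → Data}, (PT O e fun i => PMF.pure (w i)) →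
          PT (fun p : (i : ι) × (Fin (d (lam i)) → Bool) => O p.1)
          (fun p => Data.cons (e p.1) (bitsData p.2)) (fun p => PMF.pure (w p.1)) :=
        fun h => (h.reindex Sigma.fst).comp (PT.get [false])
      exact hL.decPT (hold hlam) (hold hy) (PT.get [true]) (hold hshift)
  have hany : ∀ i, ((List.ofFn fun j => st i (Fin.natAdd (d' (lam i)) j)).any fun b => b) = false ↔
      ∀ j : Fin (d' (lam i)), st i (Fin.natAdd (d' (lam i)) j) = false := by
    intro i
    simp [List.any_eq_false, List.mem_ofFn]
  refine PT.ite' h2 h3 PT.nil ?_ ?_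
  · intro i hi
    rw [PRC.decodeTests, if_neg]
    · cases h : C.dec (lam i) fun j => st i (Fin.castAdd (d' (lam i)) j) <;> simp [optionData]
    · intro h
      rw [(hany i).2 h] at hi
      exact hi rfl
  · intro i hi
    rw [PRC.decodeTests, if_pos]
    · rfl
    · rw [← hany]
      cases h : (List.ofFn fun j => st i (Fin.natAdd (d' (lam i)) j)).any fun b => b
      · rfl
      · rw [h] at hi; simp [boolData] at hi

theorem genericPRC_decPT {S₀ : Scheme q (fun _ => 1) ℓ} {L : PayloadCode q M n d r}
    {C : SeedCode d d'} {ρ : ℝ} (hS : S₀.Efficient) (hL : L.Efficient) (hC : C.Corrects ρ)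
    {lam : ι → ℕ} {sk : ∀ i, Fin ((d' (lam i) + d' (lam i)) * S₀.dkLen (lam i) + r (lam i)) → Bool}
    {y : ι → List (Fin q)}
    (hlam : PT O e fun i => PMF.pure (natData (lam i)))
    (hsk : PT O e fun i => PMF.pure (bitsData (sk i)))
    (hy : PT O e fun i => PMF.pure (wordData (y i))) :
    PT O e fun i => ((genericPRC S₀ L C).dec (lam i) (sk i) (y i)).map (optionData msgData) := by
  have hk := PT.keyParts (PT.param (PT.natAdd (hC.lenPT hL) (hC.lenPT hL)) hlam)
    (PT.param hS.dkLenPT hlam) hsk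
  simp only [genericPRC_dec, PMF.map_comp]
  refine PT.map (enc := fun _ => bitsData) (PT.markTests hS hlam hk.1 hy) ?_
  have hold : ∀ {w : ι → Data}, (PT O e fun i => PMF.pure (w i)) →
      PT (fun p : (i : ι) × (Fin (d' (lam i) + d' (lam i)) → Bool) => O p.1)
      (fun p => Data.cons (e p.1) (bitsData p.2)) (fun p => PMF.pure (w p.1)) :=
    fun h => (h.reindex Sigma.fst).comp (PT.get [false])
  exact PT.decodeTests hL hC (st := fun p : (i : ι) × (Fin (d' (lam i) + d' (lam i)) → Bool) => p.2)
    (hold hlam) (PT.get [true]) (hold hk.2) (hold hy)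

theorem genericPRC_encPT {S₀ : Scheme q (fun _ => 1) ℓ} {L : PayloadCode q M n d r}
    {C : SeedCode d d'} {ρ : ℝ} (hS : S₀.Efficient) (hL : L.Efficient) (hC : C.Corrects ρ)
    {lam : ι → ℕ} {pk : ∀ i, Fin ((d' (lam i) + d' (lam i)) * S₀.ekLen (lam i) + r (lam i)) → Bool}
    {m : ∀ i, Fin (M (lam i))}
    (hlam : PT O e fun i => PMF.pure (natData (lam i)))
    (hpk : PT O e fun i => PMF.pure (bitsData (pk i)))
    (hm : PT O e fun i => PMF.pure (msgData (m i))) :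
    PT O e fun i => ((genericPRC S₀ L C).enc (lam i) (pk i) (m i)).map
      fun y => wordData (List.ofFn y) := by
  have hk := PT.keyParts (PT.param (PT.natAdd (hC.lenPT hL) (hC.lenPT hL)) hlam)
    (PT.param hS.ekLenPT hlam) hpk
  have hE : PT (fun p : (i : ι) × (Fin (S₀.ekLen (lam i)) → Bool) => O p.1)
      (fun p => Data.cons (e p.1) (bitsData p.2))
      fun p => (S₀.enc (lam p.1) p.2 0).map fun y => wordData (List.ofFn y) :=
    hS.encPT ((hlam.reindex Sigma.fst).comp (PT.get [false])) (PT.get [true])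
  exact PT.markedEnc (v := fun i => keyPart (pk i)) (f := fun i t => S₀.enc (lam i) t 0) hS hL hC
    hlam hk.2 hm hk.1 hE

theorem genericPRC_efficient {S₀ : Scheme q (fun _ => 1) ℓ} {L : PayloadCode q M n d r}
    {C : SeedCode d d'} {ρ : ℝ} (hS : S₀.Efficient) (hL : L.Efficient) (hC : C.Corrects ρ) :
    (genericPRC S₀ L C).Efficient := by
  refine ⟨polyTime_iff.2 (genericPRC_keyGenPT hS hL hC), polyTime_iff.2 ?_, polyTime_iff.2 ?_⟩
  · exact genericPRC_encPT hS hL hC (lam := fun i : (lam : ℕ) ×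
      ((Fin ((genericPRC S₀ L C).ekLen lam) → Bool) × Fin (M lam)) => i.1)
      (pk := fun i => i.2.1) (m := fun i => i.2.2)
      (PT.get [false]) (PT.get [true, false]) (PT.get [true, true])
  · exact genericPRC_decPT hS hL hC (lam := fun i : (lam : ℕ) ×
      ((Fin ((genericPRC S₀ L C).dkLen lam) → Bool) × List (Fin q)) => i.1)
      (sk := fun i => i.2.1) (y := fun i => i.2.2)
      (PT.get [false]) (PT.get [true, false]) (PT.get [true, true])

end

end PRC

/-! ### Probabilities of events and negligible functions -/

namespace PRC

section

variable {α β : Type}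

theorem toOuterMeasure_le_one (μ : PMF α) (S : Set α) : μ.toOuterMeasure S ≤ 1 := by
  classical
  rw [PMF.toOuterMeasure_apply, ← μ.tsum_coe]
  exact ENNReal.tsum_le_tsum fun a => Set.indicator_le_self' (fun _ _ => bot_le) a

theorem toOuterMeasure_ne_top (μ : PMF α) (S : Set α) : μ.toOuterMeasure S ≠ ⊤ :=
  ne_top_of_le_ne_top ENNReal.one_ne_top (toOuterMeasure_le_one μ S)

theorem prob_nonneg (μ : PMF α) (S : Set α) : 0 ≤ prob μ S := ENNReal.toReal_nonneg

theorem prob_le_one (μ : PMF α) (S : Set α) : prob μ S ≤ 1 := by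
  have := ENNReal.toReal_mono ENNReal.one_ne_top (toOuterMeasure_le_one μ S)
  rwa [ENNReal.toReal_one] at this

theorem prob_mono (μ : PMF α) {S T : Set α} (h : ∀ a ∈ μ.support, a ∈ S → a ∈ T) :
    prob μ S ≤ prob μ T := by
  refine ENNReal.toReal_mono (toOuterMeasure_ne_top _ _) (PMF.toOuterMeasure_mono _ ?_)
  rintro a ⟨h1, h2⟩
  exact h a h2 h1

theorem prob_union_le (μ : PMF α) (S T : Set α) : prob μ (S ∪ T) ≤ prob μ S + prob μ T := by
  unfold prob
  rw [← ENNReal.toReal_add (toOuterMeasure_ne_top _ _) (toOuterMeasure_ne_top _ _)]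
  exact ENNReal.toReal_mono (ENNReal.add_ne_top.2
    ⟨toOuterMeasure_ne_top _ _, toOuterMeasure_ne_top _ _⟩) (MeasureTheory.measure_union_le S T)

theorem prob_iUnion_le (μ : PMF α) {κ : Type} (s : Finset κ) (S : κ → Set α) :
    prob μ (⋃ i ∈ s, S i) ≤ ∑ i ∈ s, prob μ (S i) := by
  classical
  induction s using Finset.induction_on with
  | empty => simp [prob]
  | insert i s hi ih =>
    rw [Finset.set_biUnion_insert, Finset.sum_insert hi]
    exact (prob_union_le _ _ _).trans (by gcongr)

theorem prob_compl (μ : PMF α) (S : Set α) : prob μ Sᶜ = 1 - prob μ S := by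
  classical
  have h : μ.toOuterMeasure S + μ.toOuterMeasure Sᶜ = 1 := by
    rw [PMF.toOuterMeasure_apply, PMF.toOuterMeasure_apply, ← ENNReal.tsum_add, ← μ.tsum_coe]
    refine tsum_congr fun a => ?_
    by_cases ha : a ∈ S <;> simp [ha]
  have h2 := congrArg ENNReal.toReal h
  rw [ENNReal.toReal_add (toOuterMeasure_ne_top _ _) (toOuterMeasure_ne_top _ _)] at h2
  simp only [ENNReal.toReal_one] at h2
  unfold prob
  linarith

theorem prob_map (μ : PMF α) (f : α → β) (S : Set β) : prob (μ.map f) S = prob μ (f ⁻¹' S) := by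
  rw [prob, PMF.toOuterMeasure_map_apply, prob]

theorem prob_pure_of_mem {a : α} {S : Set α} (h : a ∈ S) : prob (PMF.pure a) S = 1 := by
  classical
  rw [prob, PMF.toOuterMeasure_pure_apply, if_pos h, ENNReal.toReal_one]

theorem prob_pure_of_notMem {a : α} {S : Set α} (h : a ∉ S) : prob (PMF.pure a) S = 0 := by
  classical
  rw [prob, PMF.toOuterMeasure_pure_apply, if_neg h, ENNReal.toReal_zero]

theorem ofReal_prob (μ : PMF α) (S : Set α) : ENNReal.ofReal (prob μ S) = μ.toOuterMeasure S :=
  ENNReal.ofReal_toReal (toOuterMeasure_ne_top _ _)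

/-- A bound outside of a bad event. -/
theorem prob_bind_le_add {μ : PMF α} {f : α → PMF β} {S : Set β} (B : Set α) {c : ℝ} (hc : 0 ≤ c)
    (h : ∀ a ∈ μ.support, a ∉ B → prob (f a) S ≤ c) : prob (μ.bind f) S ≤ prob μ B + c := by
  classical
  have h1 : (μ.bind f).toOuterMeasure S ≤ μ.toOuterMeasure B + ENNReal.ofReal c := by
    rw [PMF.toOuterMeasure_bind_apply, PMF.toOuterMeasure_apply]
    calc ∑' a, μ a * (f a).toOuterMeasure S
        ≤ ∑' a, (Set.indicator B (⇑μ) a + μ a * ENNReal.ofReal c) := by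
          refine ENNReal.tsum_le_tsum fun a => ?_
          by_cases hB : a ∈ B
          · rw [Set.indicator_of_mem hB]
            refine le_add_right ?_
            calc μ a * (f a).toOuterMeasure S ≤ μ a * 1 := by
                  gcongr; exact toOuterMeasure_le_one _ _
              _ = μ a := mul_one _
          · rw [Set.indicator_of_notMem hB, zero_add]
            by_cases ha : a ∈ μ.support
            · gcongr
              rw [← ofReal_prob]
              exact ENNReal.ofReal_le_ofReal (h a ha hB)
            · rw [PMF.mem_support_iff, not_not] at ha
              rw [ha, zero_mul, zero_mul]
      _ = _ := by rw [ENNReal.tsum_add, ENNReal.tsum_mul_right, μ.tsum_coe, one_mul]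
  have h2 := ENNReal.toReal_mono (ENNReal.add_ne_top.2
    ⟨toOuterMeasure_ne_top μ B, ENNReal.ofReal_ne_top⟩) h1
  rwa [ENNReal.toReal_add (toOuterMeasure_ne_top _ _) ENNReal.ofReal_ne_top,
    ENNReal.toReal_ofReal hc] at h2

theorem prob_bind_le {μ : PMF α} {f : α → PMF β} {S : Set β} {c : ℝ}
    (h : ∀ a ∈ μ.support, prob (f a) S ≤ c) : prob (μ.bind f) S ≤ c := by
  have hc : 0 ≤ c := by
    obtain ⟨a, ha⟩ := μ.support_nonempty
    exact (prob_nonneg _ _).trans (h a ha)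
  have := prob_bind_le_add (S := S) (f := f) (μ := μ) ∅ hc fun a ha _ => h a ha
  have h0 : prob μ ∅ = 0 := by simp [prob]
  rwa [h0, zero_add] at this

theorem prob_bind_fintype [Fintype α] (μ : PMF α) (f : α → PMF β) (S : Set β) :
    prob (μ.bind f) S = ∑ a, (μ a).toReal * prob (f a) S := by
  rw [prob, PMF.toOuterMeasure_bind_apply, tsum_fintype, ENNReal.toReal_sum]
  · simp only [ENNReal.toReal_mul]; rfl
  · intro a _
    exact ENNReal.mul_ne_top (PMF.apply_ne_top _ _) (toOuterMeasure_ne_top _ _)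

theorem prob_uniform_bind [Fintype α] [Nonempty α] (f : α → PMF β) (S : Set β) :
    prob ((PMF.uniformOfFintype α).bind f) S = (Fintype.card α : ℝ)⁻¹ * ∑ a, prob (f a) S := by
  rw [prob_bind_fintype, Finset.mul_sum]
  simp [PMF.uniformOfFintype_apply]

/-- Probability under the uniform distribution. -/
theorem prob_uniform [Fintype α] [Nonempty α] (S : Set α) [DecidablePred (· ∈ S)] :
    prob (PMF.uniformOfFintype α) S
      = ((Finset.univ.filter (· ∈ S)).card : ℝ) / Fintype.card α := by
  classical
  have h := prob_uniform_bind (fun a : α => PMF.pure a) S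
  rw [PMF.bind_pure] at h
  rw [h, div_eq_inv_mul]
  congr 1
  rw [Finset.card_filter]
  push_cast
  refine Finset.sum_congr rfl fun a _ => ?_
  split_ifs with ha
  · exact prob_pure_of_mem ha
  · exact prob_pure_of_notMem ha

end

theorem polynomial_eval_le_pow (P : Polynomial ℕ) :
    ∃ a k₀ : ℕ, ∀ k ≥ k₀, P.eval k ≤ k ^ a := by
  induction P using Polynomial.induction_on' with
  | add p q hp hq =>
    obtain ⟨a, k₀, h1⟩ := hp
    obtain ⟨b, k₁, h2⟩ := hq
    refine ⟨max a b + 1, max 2 (max k₀ k₁), fun k hk => ?_⟩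
    simp only [ge_iff_le, max_le_iff] at hk
    rw [Polynomial.eval_add]
    calc p.eval k + q.eval k ≤ k ^ a + k ^ b := add_le_add (h1 k hk.2.1) (h2 k hk.2.2)
      _ ≤ k ^ max a b + k ^ max a b := add_le_add
          (Nat.pow_le_pow_right (by omega) (le_max_left _ _))
          (Nat.pow_le_pow_right (by omega) (le_max_right _ _))
      _ = 2 * k ^ max a b := by ring
      _ ≤ k * k ^ max a b := Nat.mul_le_mul_right _ hk.1
      _ = _ := by ring
  | monomial n c =>
    refine ⟨n + 1, c, fun k hk => ?_⟩
    rw [Polynomial.eval_monomial, pow_succ, mul_comm]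
    exact Nat.mul_le_mul_left _ hk

theorem Negligible.of_le {ν ν' : ℕ → ℝ} (h : Negligible ν) (h0 : ∀ k, 0 ≤ ν' k)
    (hle : ∀ᶠ k in atTop, ν' k ≤ ν k) : Negligible ν' := by
  refine ⟨h0, fun c hc => ?_⟩
  obtain ⟨k₀, h1⟩ := h.2 c hc
  obtain ⟨k₁, h2⟩ := eventually_atTop.1 hle
  exact ⟨max k₀ k₁, fun k hk => (h2 k (le_of_max_le_right hk)).trans (h1 k (le_of_max_le_left hk))⟩

theorem Negligible.pow_mul {ν : ℕ → ℝ} (h : Negligible ν) (a : ℕ) :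
    Negligible fun k => (k : ℝ) ^ a * ν k := by
  refine ⟨fun k => mul_nonneg (by positivity) (h.1 k), fun c hc => ?_⟩
  obtain ⟨k₀, h1⟩ := h.2 (c + a) (by positivity)
  refine ⟨max 1 k₀, fun k hk => ?_⟩
  have hk1 : 1 ≤ k := le_of_max_le_left hk
  have hk' : (0 : ℝ) < k := by exact_mod_cast hk1
  calc (k : ℝ) ^ a * ν k ≤ (k : ℝ) ^ a * (k : ℝ) ^ (-(c + a)) := by
        gcongr; exact h1 k (le_of_max_le_right hk)
    _ = (k : ℝ) ^ (-c) := by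
        rw [← Real.rpow_natCast, ← Real.rpow_add hk']
        congr 1; ring

theorem Negligible.poly_mul {ν : ℕ → ℝ} (h : Negligible ν) (P : Polynomial ℕ) :
    Negligible fun k => ((P.eval k : ℕ) : ℝ) * ν k := by
  obtain ⟨a, k₀, h1⟩ := polynomial_eval_le_pow P
  refine (h.pow_mul a).of_le (fun k => mul_nonneg (by positivity) (h.1 k)) ?_
  filter_upwards [eventually_ge_atTop k₀] with k hk
  have : ((P.eval k : ℕ) : ℝ) ≤ (k : ℝ) ^ a := by exact_mod_cast h1 k hk
  exact mul_le_mul_of_nonneg_right this (h.1 k)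

theorem Negligible.add {ν ν' : ℕ → ℝ} (h : Negligible ν) (h' : Negligible ν') :
    Negligible fun k => ν k + ν' k := by
  have hmax : Negligible fun k => max (ν k) (ν' k) := by
    refine ⟨fun k => le_max_of_le_left (h.1 k), fun c hc => ?_⟩
    obtain ⟨k₀, h1⟩ := h.2 c hc
    obtain ⟨k₁, h2⟩ := h'.2 c hc
    exact ⟨max k₀ k₁, fun k hk => max_le (h1 k (le_of_max_le_left hk))
      (h2 k (le_of_max_le_right hk))⟩
  refine (hmax.poly_mul (Polynomial.C 2)).of_le (fun k => add_nonneg (h.1 k) (h'.1 k)) ?_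
  filter_upwards with k
  rw [Polynomial.eval_C]
  push_cast
  linarith [le_max_left (ν k) (ν' k), le_max_right (ν k) (ν' k)]

theorem Negligible.tendsto {ν : ℕ → ℝ} (h : Negligible ν) : Tendsto ν atTop (nhds 0) := by
  obtain ⟨k₀, h1⟩ := h.2 1 one_pos
  refine squeeze_zero' (Eventually.of_forall h.1) (eventually_atTop.2 ⟨k₀, h1⟩) ?_
  exact (tendsto_rpow_neg_atTop one_pos).comp tendsto_natCast_atTop_atTop

end PRC

/-! ### Oracles of the hybrid experiments -/

namespace PRC

theorem mem_support_indep {α : Type} {k : ℕ} {μ : Fin k → PMF α} {f : Fin k → α} :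
    f ∈ (indep μ).support ↔ ∀ i, f i ∈ (μ i).support := by
  simp only [PMF.mem_support_iff, indep_apply, Finset.prod_ne_zero_iff, Finset.mem_univ, true_imp_iff]

/-- The uniform law has full support. An adversary that halts in time with the ideal oracle
therefore does so with every oracle of this shape, in particular in the hybrid experiments, about
which the definition of an adversary says nothing. -/
theorem msgOracle_support_subset {q M len : ℕ} [NeZero q] (f : Fin M → PMF (Fin len → Fin q))
    (x : Data) : (msgOracle f x).support ⊆
      (msgOracle (fun _ : Fin M => PMF.uniformOfFintype (Fin len → Fin q)) x).support := by
  intro a ha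
  unfold msgOracle at ha ⊢
  split_ifs at ha ⊢ with h
  · rw [PMF.mem_support_map_iff] at ha ⊢
    obtain ⟨y, -, hy⟩ := ha
    exact ⟨y, by simp, hy⟩
  · exact ha

/-- The only message of a zero-bit code is `0`, whose binary expansion is empty; so the query `nil`
fetches a codeword. -/
theorem msgOracle_nil {q len : ℕ} (f : Fin 1 → PMF (Fin len → Fin q)) :
    msgOracle f Data.nil = (f 0).map fun y => optionData wordData (some (List.ofFn y)) := by
  have h : ∃ m : Fin 1, msgData m = Data.nil := ⟨0, by simp [msgData, binData, listData]⟩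
  rw [msgOracle, dif_pos h, Subsingleton.elim h.choose 0]

theorem size_wordData_le {q : ℕ} (y : List (Fin q)) : (wordData y).size ≤ 1 + y.length * (2 * q + 2) := by
  refine (size_listData_le (S := 2 * q + 1) _ fun a _ => ?_).trans
    (le_of_eq (by ring))
  rw [size_natData]
  have := a.2
  omega

section

variable {ι : Type} {O : ι → Data → PMF Data} {e : ι → Data} {q : ℕ}

theorem PT.query {x : ι → Data} (Q : Polynomial ℕ) (hx : PT O e fun i => PMF.pure (x i))
    (hQ : ∀ i, ∀ a ∈ (O i (x i)).support, a.size ≤ Q.eval (e i).size) :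
    PT O e fun i => O i (x i) := by
  obtain ⟨c, P, hc⟩ := hx
  refine ⟨.comp .query c, P + (P + Q), fun i => ?_⟩
  have h1 := (hc i).size_le (a := x i) (by simp)
  rw [Polynomial.eval_add, Polynomial.eval_add]
  exact (hc i).comp_pure ((computes_query (O i) (x i) (hQ i)).mono (by omega))

/-- A query that is a message is already its own encoding. It is therefore enough to recognize
messages; the message itself enters `f` through the index, without any decoding. -/
theorem PT.msgHandler {M len : ι → ℕ} {x : ι → Data} {f : ∀ i, Fin (M i) → PMF (Fin (len i) → Fin q)}
    (hM : PT O e fun i => PMF.pure (binData (M i))) (hx : PT O e fun i => PMF.pure (x i))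
    (hf : PT (fun p : (i : ι) × {m : Fin (M i) // msgData m = x i} => O p.1) (fun p => e p.1)
      (fun p => (f p.1 p.2).map fun y => wordData (List.ofFn y))) :
    PT O e fun i => msgOracle (f i) (x i) := by
  classical
  have hiff : ∀ i, boolData (decide (∃ m : Fin (M i), msgData m = x i)) ≠ Data.nil ↔
      ∃ m : Fin (M i), msgData m = x i := by
    intro i
    by_cases h : ∃ m : Fin (M i), msgData m = x i <;> simp [h, boolData]
  have hf2 : PT (fun p : (i : ι) × {m : Fin (M i) // msgData m = x i} => O p.1) (fun p => e p.1)
      (fun p => (f p.1 p.2).map fun y => optionData wordData (some (List.ofFn y))) :=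
    PT.map (enc := fun _ y => wordData (List.ofFn y)) hf (PT.pair (PT.get [true]) PT.nil)
  have hf3 := hf2.reindex fun i : {i // boolData (decide (∃ m : Fin (M i), msgData m = x i)) ≠ Data.nil} =>
    (⟨i.1, ((hiff i.1).1 i.2).choose, ((hiff i.1).1 i.2).choose_spec⟩ :
      (i : ι) × {m : Fin (M i) // msgData m = x i})
  refine PT.ite (f := fun i => msgOracle (f i) (x i)) (g := fun i => PMF.pure Data.nil)
    ((PT.isMsg hM hx).congr fun i => by congr!) (hf3.congr ?_) PT.nil ?_ ?_
  · rintro ⟨i, hi⟩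
    simp only
    rw [msgOracle, dif_pos ((hiff i).1 hi)]
  · intro i _; rfl
  · intro i hi
    rw [msgOracle, dif_neg]
    · rfl
    · rw [← hiff]; exact not_not.2 hi

end

section

variable {q : ℕ} [NeZero q] {M ℓ n d d' r : ℕ → ℕ}

/-- What the adversary against the construction is given, from the component keys. -/
def advInput (mode : KeyMode) (lam : ℕ) {k a r : ℕ} (key : Fin k → Fin a → Bool)
    (shift : Fin r → Bool) : Data :=
  match mode with
  | .publicKey => Data.cons (natData lam) (bitsData (joinKey key shift))
  | .secretKey => natData lam

/-- Blocks before `j` are uniform, block `j` has law `B`, later blocks are codewords. -/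
noncomputable def mixBlocks (S₀ : Scheme q (fun _ => 1) ℓ) (lam k j : ℕ)
    (B : PMF (Fin (ℓ lam) → Fin q)) (key : Fin k → Fin (S₀.ekLen lam) → Bool) :
    Fin k → PMF (Fin (ℓ lam) → Fin q) := fun t =>
  if (t : ℕ) < j then PMF.uniformOfFintype _ else if (t : ℕ) = j then B else S₀.enc lam (key t) 0

/-- Blocks before `j` are uniform, the others are codewords. -/
noncomputable def hybBlocks (S₀ : Scheme q (fun _ => 1) ℓ) (lam k j : ℕ)
    (key : Fin k → Fin (S₀.ekLen lam) → Bool) : Fin k → PMF (Fin (ℓ lam) → Fin q) := fun t =>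
  if (t : ℕ) < j then PMF.uniformOfFintype _ else S₀.enc lam (key t) 0

/-- Instructions to the block sampler of the reduction: `none` for a uniform block, `some false` for
the challenge block, `some true` for an honest codeword. -/
def tag (j t : ℕ) : Option Bool := if t < j then none else some (decide (t ≠ j))

/-- The guess `j` may equal `k`, in which case no block is the challenge; truncation to length `k`
covers this case as well. -/
theorem tags_eq (j k : ℕ) : ((List.replicate j (none : Option Bool) ++ [some false]) ++
    List.replicate k (some true)).take k = List.ofFn fun t : Fin k => tag j t := by
  apply List.ext_getElem
  · simp; omega
  · intro t h1 h2
    rw [List.length_ofFn] at h2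
    rw [List.getElem_take, List.getElem_ofFn, tag]
    rcases lt_trichotomy t j with h | h | h
    · rw [List.getElem_append_left (by simp; omega), List.getElem_append_left (by simp; omega),
        List.getElem_replicate, if_pos h]
    · subst h
      rw [List.getElem_append_left (by simp), List.getElem_append_right (by simp)]
      simp
    · rw [List.getElem_append_right (by simp; omega), List.getElem_replicate, if_neg (by simp; omega)]
      simp; omega

variable {ι : Type} {O : ι → Data → PMF Data} {e : ι → Data}

theorem PT.tags {j k : ι → ℕ} (hj : PT O e fun i => PMF.pure (natData (j i)))
    (hk : PT O e fun i => PMF.pure (natData (k i))) :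
    PT O e fun i => PMF.pure (listData (optionData boolData) (List.ofFn fun t : Fin (k i) => tag (j i) t)) := by
  simp only [← tags_eq]
  refine PT.take (enc := fun _ => optionData boolData) hk ?_
  refine PT.append (enc := fun _ => optionData boolData)
    (PT.append (enc := fun _ => optionData boolData) ?_ ?_) ?_
  · refine (PT.listMap (encA := fun _ (_ : Unit) => Data.nil) (encB := fun _ => optionData boolData)
      (f := fun _ _ => none) hj PT.nil).congr fun i => ?_
    rw [List.map_replicate]
  · exact PT.const (listData (optionData boolData) [some false])
  · refine (PT.listMap (encA := fun _ (_ : Unit) => Data.nil) (encB := fun _ => optionData boolData)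
      (f := fun _ _ => some true) hk (PT.const (optionData boolData (some true)))).congr fun i => ?_
    rw [List.map_replicate]

/-- The block sampler of the reduction. -/
theorem PT.mixBlock {S₀ : Scheme q (fun _ => 1) ℓ} (hS : S₀.Efficient) {lam : ι → ℕ}
    {g : ∀ i, Fin 1 → PMF (Fin (ℓ (lam i)) → Fin q)} {t : ι → Option Bool}
    {key : ∀ i, Fin (S₀.ekLen (lam i)) → Bool} (hO : ∀ i, O i = msgOracle (g i))
    (hlam : PT O e fun i => PMF.pure (natData (lam i)))
    (ht : PT O e fun i => PMF.pure (optionData boolData (t i)))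
    (hkey : PT O e fun i => PMF.pure (bitsData (key i))) :
    PT O e fun i => ((t i).elim (PMF.uniformOfFintype (Fin (ℓ (lam i)) → Fin q))
      fun b => if b then S₀.enc (lam i) (key i) 0 else g i 0).map fun y => wordData (List.ofFn y) := by
  have hlen := PT.param hS.lenPT hlam
  have h1 : PT O e fun i => (PMF.uniformOfFintype (Fin (ℓ (lam i)) → Fin q)).map
      fun y => wordData (List.ofFn y) := PT.word hlen
  have h2 := hS.encPT hlam hkey
  have h3 : PT O e fun i => (g i 0).map fun y => wordData (List.ofFn y) := by
    obtain ⟨P, hP⟩ := hlen.size_pure_le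
    have h4 : PT O e fun i => O i Data.nil := by
      refine PT.query (2 + P * Polynomial.C (2 * q + 2) + 1) PT.nil fun i a ha => ?_
      rw [hO, msgOracle_nil, PMF.mem_support_map_iff] at ha
      obtain ⟨y, -, rfl⟩ := ha
      have h5 := size_wordData_le (List.ofFn y)
      have h6 := hP i
      rw [size_natData] at h6
      rw [List.length_ofFn] at h5
      simp only [optionData, Data.size, Polynomial.eval_add, Polynomial.eval_mul, Polynomial.eval_C,
        Polynomial.eval_one, Polynomial.eval_ofNat]
      have h7 : ℓ (lam i) * (2 * q + 2) ≤ P.eval (e i).size * (2 * q + 2) := by gcongr; omega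
      omega
    have h5 : PT O e fun i => (g i 0).map fun y => optionData wordData (some (List.ofFn y)) :=
      h4.congr fun i => by rw [hO, msgOracle_nil]
    exact PT.map (enc := fun _ y => optionData wordData (some (List.ofFn y))) h5 (PT.get [true, false])
  have h4 : PT O e fun i => ((if t i = some true then S₀.enc (lam i) (key i) 0 else g i 0).map fun y => wordData (List.ofFn y)) := by
    refine PT.ite' ht.fst h2 h3 ?_ ?_
    · intro i hi
      rcases h : t i with _ | _ | _ <;> simp [h, optionData, boolData, Data.fst] at hi ⊢
    · intro i hi
      rcases h : t i with _ | _ | _ <;> simp [h, optionData, boolData, Data.fst] at hi ⊢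
  refine PT.ite' ht h4 h1 ?_ ?_
  · intro i hi
    rcases h : t i with _ | _ | _ <;> simp [h, optionData, boolData] at hi ⊢
  · intro i hi
    rcases h : t i with _ | _ | _ <;> simp [h, optionData, boolData] at hi ⊢

/-- The reduction answers a query of the adversary by encoding the message itself, and obtains block
`j`, when it is marked, from its own oracle. It knows all keys except the one behind that oracle. -/
theorem PT.mixOracle {S₀ : Scheme q (fun _ => 1) ℓ} {L : PayloadCode q M n d r}
    {C : SeedCode d d'} {ρ : ℝ} (hS : S₀.Efficient) (hL : L.Efficient) (hC : C.Corrects ρ)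
    {lam j : ι → ℕ} {g : ∀ i, Fin 1 → PMF (Fin (ℓ (lam i)) → Fin q)}
    {key : ∀ i, Fin (d' (lam i) + d' (lam i)) → Fin (S₀.ekLen (lam i)) → Bool}
    {shift : ∀ i, Fin (r (lam i)) → Bool} {x : ι → Data} (hO : ∀ i, O i = msgOracle (g i))
    (hlam : PT O e fun i => PMF.pure (natData (lam i)))
    (hshift : PT O e fun i => PMF.pure (bitsData (shift i)))
    (hitems : PT O e fun i => PMF.pure (listData (pairData (optionData boolData) bitsData)
      (List.ofFn fun t : Fin (d' (lam i) + d' (lam i)) => (tag (j i) t, key i t))))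
    (hx : PT O e fun i => PMF.pure (x i)) :
    PT O e fun i => msgOracle
      (PRC.markedEnc L C (lam i) (mixBlocks S₀ (lam i) _ (j i) (g i 0) (key i)) (shift i)) (x i) := by
  have hb : PT (fun p : (i : ι) × (Option Bool × (Fin (S₀.ekLen (lam i)) → Bool)) => O p.1)
      (fun p => Data.cons (e p.1) (pairData (optionData boolData) bitsData p.2))
      (fun p => (p.2.1.elim (PMF.uniformOfFintype (Fin (ℓ (lam p.1)) → Fin q))
        fun b => if b then S₀.enc (lam p.1) p.2.2 0 else g p.1 0).map
          fun y => wordData (List.ofFn y)) :=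
    PT.mixBlock hS (fun p => hO p.1) ((hlam.reindex Sigma.fst).comp (PT.get [false]))
      (PT.get [true, false]) (PT.get [true, true])
  have hmix : ∀ i, mixBlocks S₀ (lam i) (d' (lam i) + d' (lam i)) (j i) (g i 0) (key i)
      = fun t : Fin (d' (lam i) + d' (lam i)) => (tag (j i) t).elim (PMF.uniformOfFintype (Fin (ℓ (lam i)) → Fin q))
        fun b => if b then S₀.enc (lam i) (key i t) 0 else g i 0 := by
    intro i
    funext t
    unfold mixBlocks tag
    split_ifs with h1 h2
    · rfl
    · simp [h2]
    · simp [h2]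
  simp only [hmix]
  refine PT.msgHandler (M := fun i => M (lam i)) (PT.param hL.numMsgPT hlam) hx ?_
  have hm : PT (fun p : (i : ι) × {m : Fin (M (lam i)) // msgData m = x i} => O p.1)
      (fun p => e p.1) (fun p => PMF.pure (msgData p.2.1)) :=
    (hx.reindex Sigma.fst).congr fun p => by rw [p.2.2]
  exact PT.markedEnc hS hL hC (τ := fun p : (i : ι) × {m : Fin (M (lam i)) // msgData m = x i} =>
      Option Bool × (Fin (S₀.ekLen (lam p.1)) → Bool))
    (v := fun p t => (tag (j p.1) t, key p.1 t))
    (f := fun p t => t.1.elim (PMF.uniformOfFintype (Fin (ℓ (lam p.1)) → Fin q))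
        fun b => if b then S₀.enc (lam p.1) t.2 0 else g p.1 0)
    (hlam.reindex Sigma.fst) (hshift.reindex Sigma.fst) hm (hitems.reindex Sigma.fst)
    (hb.reindex fun p : (p : (i : ι) × {m : Fin (M (lam i)) // msgData m = x i}) ×
      (Option Bool × (Fin (S₀.ekLen (lam p.1)) → Bool)) =>
      (⟨p.1.1, p.2⟩ : (i : ι) × (Option Bool × (Fin (S₀.ekLen (lam i)) → Bool))))

end

end PRC

/-! ### The reduction to the zero-bit code -/

namespace PRC

/-- The challenge key `k₀` takes the slot `j`, so that the key shown to the adversary matches the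
block produced by the challenge oracle. -/
def replKey {k a : ℕ} (j : ℕ) (k₀ : Fin a → Bool) (key : Fin k → Fin a → Bool) :
    Fin k → Fin a → Bool := fun t => if (t : ℕ) = j then k₀ else key t

section

variable {q : ℕ} [NeZero q] {M ℓ n d d' r : ℕ → ℕ}

/-- With a real challenge the block `j` is one more codeword, which is hybrid `j`. With a uniform
challenge (`mixBlocks_ideal`) it joins the uniform blocks, which is hybrid `j + 1`. In both cases
the key in slot `j` is the challenge key. -/
theorem mixBlocks_real (S₀ : Scheme q (fun _ => 1) ℓ) (lam k j : ℕ)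
    (k₀ : Fin (S₀.ekLen lam) → Bool) (key : Fin k → Fin (S₀.ekLen lam) → Bool) :
    mixBlocks S₀ lam k j (S₀.enc lam k₀ 0) key = hybBlocks S₀ lam k j (replKey j k₀ key) := by
  funext t
  unfold mixBlocks hybBlocks replKey
  split_ifs <;> rfl

theorem mixBlocks_ideal (S₀ : Scheme q (fun _ => 1) ℓ) (lam k j : ℕ)
    (k₀ : Fin (S₀.ekLen lam) → Bool) (key : Fin k → Fin (S₀.ekLen lam) → Bool) :
    mixBlocks S₀ lam k j (PMF.uniformOfFintype _) key
      = hybBlocks S₀ lam k (j + 1) (replKey j k₀ key) := by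
  funext t
  unfold mixBlocks hybBlocks replKey
  split_ifs <;> first | rfl | omega

variable {ι : Type} {O : ι → Data → PMF Data} {e : ι → Data}

theorem PT.replKey {a k : ι → ℕ} {j : ι → ℕ} {key : ∀ i, Fin (k i) → Fin (a i) → Bool}
    {k₀ : ∀ i, Fin (a i) → Bool}
    (hitems : PT O e fun i => PMF.pure (listData (pairData (optionData boolData) bitsData)
      (List.ofFn fun t : Fin (k i) => (tag (j i) t, key i t))))
    (hk₀ : PT O e fun i => PMF.pure (bitsData (k₀ i))) :
    PT O e fun i => PMF.pure (listData bitsData (List.ofFn (PRC.replKey (j i) (k₀ i) (key i)))) := by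
  have h1 : PT (fun p : (i : ι) × (Option Bool × (Fin (a i) → Bool)) => O p.1)
      (fun p => Data.cons (e p.1) (pairData (optionData boolData) bitsData p.2))
      (fun p => PMF.pure (bitsData (if p.2.1 = some false then k₀ p.1 else p.2.2))) := by
    have hk : PT (fun p : (i : ι) × (Option Bool × (Fin (a i) → Bool)) => O p.1)
        (fun p => Data.cons (e p.1) (pairData (optionData boolData) bitsData p.2))
        (fun p => PMF.pure (bitsData p.2.2)) := PT.get [true, true]
    have h0 : PT (fun p : (i : ι) × (Option Bool × (Fin (a i) → Bool)) => O p.1)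
        (fun p => Data.cons (e p.1) (pairData (optionData boolData) bitsData p.2))
        (fun p => PMF.pure (bitsData (k₀ p.1))) :=
      (hk₀.reindex fun p : (i : ι) × (Option Bool × (Fin (a i) → Bool)) => p.1).comp
        (PT.get [false])
    have ht : PT (fun p : (i : ι) × (Option Bool × (Fin (a i) → Bool)) => O p.1)
        (fun p => Data.cons (e p.1) (pairData (optionData boolData) bitsData p.2))
        (fun p => PMF.pure (optionData boolData p.2.1)) := PT.get [true, false]
    have h2 : PT (fun p : (i : ι) × (Option Bool × (Fin (a i) → Bool)) => O p.1)
        (fun p => Data.cons (e p.1) (pairData (optionData boolData) bitsData p.2))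
        (fun p => PMF.pure (bitsData (if p.2.1 = some true then p.2.2 else k₀ p.1))) := by
      refine PT.ite' ht.fst hk h0 ?_ ?_ <;>
      · rintro ⟨i, t, k⟩ hi
        rcases t with _ | _ | _ <;> simp [optionData, boolData, Data.fst] at hi ⊢
    refine PT.ite' ht h2 hk ?_ ?_ <;>
    · rintro ⟨i, t, k⟩ hi
      rcases t with _ | _ | _ <;> simp [optionData, boolData] at hi ⊢
  refine (PT.listMap (encA := fun _ => pairData (optionData boolData) bitsData)
    (encB := fun _ => bitsData)
    (f := fun i (t : Option Bool × (Fin (a i) → Bool)) => if t.1 = some false then k₀ i else t.2)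
    hitems h1).congr fun i => ?_
  rw [List.map_ofFn]
  congr 3
  funext t
  simp only [Function.comp, PRC.replKey, tag]
  split_ifs with h3 h4 h5 h6 <;> first | rfl | simp_all

/-- The challenge key is needed only to write down the public key for the adversary. In the
secret-key setting the reduction does not have it, hence the conditional form of `hk₀`. -/
theorem PT.hybridRun {S₀ : Scheme q (fun _ => 1) ℓ} {L : PayloadCode q M n d r}
    {C : SeedCode d d'} {ρ : ℝ} (mode : KeyMode) (hS : S₀.Efficient) (hL : L.Efficient)
    (hC : C.Corrects ρ)
    {lam j : ι → ℕ} {g : ∀ i, Fin 1 → PMF (Fin (ℓ (lam i)) → Fin q)}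
    {key : ∀ i, Fin (d' (lam i) + d' (lam i)) → Fin (S₀.ekLen (lam i)) → Bool}
    {k₀ : ∀ i, Fin (S₀.ekLen (lam i)) → Bool}
    {shift : ∀ i, Fin (r (lam i)) → Bool} (hO : ∀ i, O i = msgOracle (g i))
    (hlam : PT O e fun i => PMF.pure (natData (lam i)))
    (hj : PT O e fun i => PMF.pure (natData (j i)))
    (hkey : PT O e fun i => PMF.pure (listData bitsData (List.ofFn (key i))))
    (hk₀ : mode = .publicKey → PT O e fun i => PMF.pure (bitsData (k₀ i)))
    (hshift : PT O e fun i => PMF.pure (bitsData (shift i))) (A : Prog) (PA : Polynomial ℕ)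
    (hA : ∀ i, A.HaltsWithin
      (msgOracle (PRC.markedEnc L C (lam i) (mixBlocks S₀ (lam i) _ (j i) (g i 0) (key i)) (shift i)))
      (advInput mode (lam i) (PRC.replKey (j i) (k₀ i) (key i)) (shift i)) (PA.eval (lam i))) :
    PT O e fun i => A.law
      (msgOracle (PRC.markedEnc L C (lam i) (mixBlocks S₀ (lam i) _ (j i) (g i 0) (key i)) (shift i)))
      (advInput mode (lam i) (PRC.replKey (j i) (k₀ i) (key i)) (shift i)) (PA.eval (lam i)) := by
  have hk := PT.param (PT.natAdd (hC.lenPT hL) (hC.lenPT hL)) hlam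
  have hitems : PT O e fun i => PMF.pure (listData (pairData (optionData boolData) bitsData)
      (List.ofFn fun t : Fin (d' (lam i) + d' (lam i)) => (tag (j i) t, key i t))) := by
    simp only [← zip_ofFn]
    exact PT.zip (encA := fun _ => optionData boolData) (encB := fun _ => bitsData)
      (PT.tags hj hk) hkey
  obtain ⟨Q, hQ⟩ := hlam.size_pure_le
  refine PT.sim A (PA.comp Q) (v := fun i => Data.cons (natData (lam i)) (Data.cons
    (bitsData (shift i)) (listData (pairData (optionData boolData) bitsData)
      (List.ofFn fun t : Fin (d' (lam i) + d' (lam i)) => (tag (j i) t, key i t)))))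
    (PT.pair hlam (PT.pair hshift hitems)) ?_ hA ?_ ?_
  · cases mode
    · exact PT.pair hlam (PT.joinKey (PT.replKey hitems (hk₀ rfl)) hshift)
    · exact hlam
  · intro i
    rw [Polynomial.eval_comp]
    refine polynomial_eval_mono _ ?_
    have := hQ i
    rw [size_natData] at this
    omega
  · exact PT.mixOracle hS hL hC (lam := fun p : ι × Data => lam p.1) (j := fun p => j p.1)
      (g := fun p => g p.1) (key := fun p => key p.1) (shift := fun p => shift p.1)
      (fun p => hO p.1) (PT.get [false, false]) (PT.get [false, true, false])
      (PT.get [false, true, true]) (PT.get [true])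

theorem PT.hybridShift {S₀ : Scheme q (fun _ => 1) ℓ} {L : PayloadCode q M n d r}
    {C : SeedCode d d'} {ρ : ℝ} (mode : KeyMode) (hS : S₀.Efficient) (hL : L.Efficient)
    (hC : C.Corrects ρ)
    {lam j : ι → ℕ} {g : ∀ i, Fin 1 → PMF (Fin (ℓ (lam i)) → Fin q)}
    {ks : ∀ i, Fin (d' (lam i) + d' (lam i)) →
      (Fin (S₀.ekLen (lam i)) → Bool) × (Fin (S₀.dkLen (lam i)) → Bool)}
    {k₀ : ∀ i, Fin (S₀.ekLen (lam i)) → Bool} (hO : ∀ i, O i = msgOracle (g i))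
    (hlam : PT O e fun i => PMF.pure (natData (lam i)))
    (hj : PT O e fun i => PMF.pure (natData (j i)))
    (hks : PT O e fun i => PMF.pure (listData (pairData bitsData bitsData) (List.ofFn (ks i))))
    (hk₀ : mode = .publicKey → PT O e fun i => PMF.pure (bitsData (k₀ i)))
    (A : Prog) (PA : Polynomial ℕ)
    (hA : ∀ i shift, A.HaltsWithin
      (msgOracle (PRC.markedEnc L C (lam i)
        (mixBlocks S₀ (lam i) _ (j i) (g i 0) fun t => (ks i t).1) shift))
      (advInput mode (lam i) (PRC.replKey (j i) (k₀ i) fun t => (ks i t).1) shift)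
      (PA.eval (lam i))) :
    PT O e fun i => (PMF.uniformOfFintype (Fin (r (lam i)) → Bool)).bind fun shift => A.law
      (msgOracle (PRC.markedEnc L C (lam i)
        (mixBlocks S₀ (lam i) _ (j i) (g i 0) fun t => (ks i t).1) shift))
      (advInput mode (lam i) (PRC.replKey (j i) (k₀ i) fun t => (ks i t).1) shift)
      (PA.eval (lam i)) := by
  have hkeys : PT O e fun i => PMF.pure (listData bitsData (List.ofFn fun t => (ks i t).1)) := by
    refine (PT.listMap (encA := fun _ => pairData bitsData bitsData) (encB := fun _ => bitsData)
      (f := fun _ => Prod.fst) hks (PT.get [true, false])).congr fun p => ?_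
    rw [List.map_ofFn]; rfl
  refine PT.bind (enc := fun _ => bitsData) (PT.bits (PT.param hL.shiftLenPT hlam)) ?_
  have hold : ∀ {w : ι → Data}, (PT O e fun i => PMF.pure (w i)) →
      PT (fun p : (i : ι) × (Fin (r (lam i)) → Bool) => O p.1)
      (fun p => Data.cons (e p.1) (bitsData p.2)) (fun p => PMF.pure (w p.1)) :=
    fun h => (h.reindex Sigma.fst).comp (PT.get [false])
  exact PT.hybridRun mode hS hL hC (j := fun p : (i : ι) × (Fin (r (lam i)) → Bool) => j p.1)
    (g := fun p => g p.1) (k₀ := fun p => k₀ p.1) (key := fun p t => (ks p.1 t).1)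
    (shift := fun p => p.2) (fun p => hO p.1)
    (hold hlam) (hold hj) (hold hkeys) (fun h => hold (hk₀ h)) (PT.get [true]) A PA
    (fun p => hA p.1 p.2)

/-- Output law of the reduction to the zero-bit scheme, when the oracle has law `B`. -/
noncomputable def hybridLaw (S₀ : Scheme q (fun _ => 1) ℓ) (L : PayloadCode q M n d r)
    (C : SeedCode d d') (mode : KeyMode) (A : Prog) (PA : Polynomial ℕ) (lam : ℕ)
    (B : PMF (Fin (ℓ lam) → Fin q)) (k₀ : Fin (S₀.ekLen lam) → Bool) : PMF Data :=
  -- One more value than there are blocks, so that the range is nonempty even for `d' = 0`. For the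
  -- last value no block is replaced, and the corresponding two hybrids coincide.
  (PMF.uniformOfFintype (Fin (d' lam + d' lam + 1))).bind fun j =>
  (indep fun _ : Fin (d' lam + d' lam) => S₀.keyGen lam).bind fun ks =>
  (PMF.uniformOfFintype (Fin (r lam) → Bool)).bind fun shift =>
    A.law (msgOracle (markedEnc L C lam (mixBlocks S₀ lam _ j B fun t => (ks t).1) shift))
      (advInput mode lam (replKey j k₀ fun t => (ks t).1) shift) (PA.eval lam)

theorem PT.hybridLaw {S₀ : Scheme q (fun _ => 1) ℓ} {L : PayloadCode q M n d r}
    {C : SeedCode d d'} {ρ : ℝ} (mode : KeyMode) (hS : S₀.Efficient) (hL : L.Efficient)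
    (hC : C.Corrects ρ)
    {lam : ι → ℕ} {g : ∀ i, Fin 1 → PMF (Fin (ℓ (lam i)) → Fin q)}
    {k₀ : ∀ i, Fin (S₀.ekLen (lam i)) → Bool} (hO : ∀ i, O i = msgOracle (g i))
    (hlam : PT O e fun i => PMF.pure (natData (lam i)))
    (hk₀ : mode = .publicKey → PT O e fun i => PMF.pure (bitsData (k₀ i)))
    (A : Prog) (PA : Polynomial ℕ)
    (hA : ∀ i (j : ℕ), ∀ ks ∈ (indep fun _ : Fin (d' (lam i) + d' (lam i)) =>
      S₀.keyGen (lam i)).support, ∀ shift, A.HaltsWithin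
      (msgOracle (PRC.markedEnc L C (lam i)
        (mixBlocks S₀ (lam i) _ j (g i 0) fun t => (ks t).1) shift))
      (advInput mode (lam i) (PRC.replKey j (k₀ i) fun t => (ks t).1) shift) (PA.eval (lam i))) :
    PT O e fun i => PRC.hybridLaw S₀ L C mode A PA (lam i) (g i 0) (k₀ i) := by
  unfold PRC.hybridLaw
  have hk := PT.param (PT.natAdd (PT.natAdd (hC.lenPT hL) (hC.lenPT hL)) (PT.const (natData 1))) hlam
  refine PT.bind (enc := fun i (j : Fin (d' (lam i) + d' (lam i) + 1)) => natData (j : ℕ))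
    (PT.rand (enc := fun _ _ => Data.nil) (l := fun i =>
      List.replicate (d' (lam i) + d' (lam i) + 1) ()) (fun i => by simp) hk) ?_
  have hold1 : ∀ {w : ι → Data}, (PT O e fun i => PMF.pure (w i)) →
      PT (fun p : (i : ι) × Fin (d' (lam i) + d' (lam i) + 1) => O p.1)
      (fun p => Data.cons (e p.1) (natData (p.2 : ℕ))) (fun p => PMF.pure (w p.1)) :=
    fun h => (h.reindex Sigma.fst).comp (PT.get [false])
  have hks : PT (fun p : (i : ι) × Fin (d' (lam i) + d' (lam i) + 1) => O p.1)
      (fun p => Data.cons (e p.1) (natData (p.2 : ℕ)))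
      fun p => (indep fun _ : Fin (d' (lam p.1) + d' (lam p.1)) => S₀.keyGen (lam p.1)).map
        fun ks => listData (pairData bitsData bitsData) (List.ofFn ks) :=
    PT.iid (k := fun p => d' (lam p.1) + d' (lam p.1)) (enc := fun _ => pairData bitsData bitsData)
      (PT.param (PT.natAdd (hC.lenPT hL) (hC.lenPT hL)) (hold1 hlam))
      (((hS.keyGenPT.reindex fun p : (i : ι) × Fin (d' (lam i) + d' (lam i) + 1) =>
        lam p.1).anyOracle fun p => O p.1).comp (hold1 hlam))
  refine PT.bindSupport hks ?_
  have hold2 : ∀ {w : ι → Data}, (PT O e fun i => PMF.pure (w i)) →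
      PT (fun p : (p : (i : ι) × Fin (d' (lam i) + d' (lam i) + 1)) ×
      {ks // ks ∈ (indep fun _ : Fin (d' (lam p.1) + d' (lam p.1)) => S₀.keyGen (lam p.1)).support} =>
        O p.1.1)
      (fun p => Data.cons (Data.cons (e p.1.1) (natData (p.1.2 : ℕ)))
        (listData (pairData bitsData bitsData) (List.ofFn p.2.1)))
      (fun p => PMF.pure (w p.1.1)) :=
    fun h => (h.reindex fun p : (p : (i : ι) × Fin (d' (lam i) + d' (lam i) + 1)) ×
      {ks // ks ∈ (indep fun _ : Fin (d' (lam p.1) + d' (lam p.1)) => S₀.keyGen (lam p.1)).support} =>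
      p.1.1).comp (PT.get [false, false])
  exact PT.hybridShift mode hS hL hC (j := fun p : (p : (i : ι) × Fin (d' (lam i) + d' (lam i) + 1)) ×
      {ks // ks ∈ (indep fun _ : Fin (d' (lam p.1) + d' (lam p.1)) => S₀.keyGen (lam p.1)).support} =>
      (p.1.2 : ℕ)) (g := fun p => g p.1.1)
    (k₀ := fun p => k₀ p.1.1) (ks := fun p => p.2.1) (fun p => hO p.1.1)
    (hold2 hlam) (PT.get [false, true]) (PT.get [true]) (fun h => hold2 (hk₀ h)) A PA
    (fun p => hA p.1.1 p.1.2 p.2.1 p.2.2)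

end

end PRC

/-! ### The reduction to the payload code -/

namespace PRC

theorem boolData_injective : Function.Injective boolData := by
  intro a b h
  cases a <;> cases b <;> simp [boolData] at h ⊢

theorem binData_injective : Function.Injective binData := by
  intro a b h
  have h1 := congrArg Data.toList h
  rw [binData, binData, toList_listData, toList_listData] at h1
  rw [← bitsVal_bits a, ← bitsVal_bits b, List.map_injective_iff.2 boolData_injective h1]

theorem msgOracle_msg {q M len : ℕ} (f : Fin M → PMF (Fin len → Fin q)) (m : Fin M) :
    msgOracle f (msgData m) = (f m).map fun y => optionData wordData (some (List.ofFn y)) := by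
  have h : ∃ m' : Fin M, msgData m' = msgData m := ⟨m, rfl⟩
  rw [msgOracle, dif_pos h, Fin.ext (binData_injective h.choose_spec)]

theorem size_bitsData_le {k : ℕ} (b : Fin k → Bool) : (bitsData b).size ≤ 1 + 4 * k := by
  refine (size_listData_le (S := 3) _ fun a _ => ?_).trans ?_
  · cases a <;> simp [boolData, Data.size]
  · rw [List.length_ofFn]; omega

theorem PT.exists_le {k : ℕ → ℕ} (h : PT (fun _ => noOracle) (fun lam : ℕ => natData lam)
    fun lam => PMF.pure (natData (k lam))) : ∃ P : Polynomial ℕ, ∀ lam, k lam ≤ P.eval lam := by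
  obtain ⟨P, hP⟩ := h.size_pure_le
  refine ⟨P.comp (2 * Polynomial.X + 1), fun lam => ?_⟩
  have := hP lam
  simp only [size_natData] at this
  simp only [Polynomial.eval_comp, Polynomial.eval_add, Polynomial.eval_mul, Polynomial.eval_X,
    Polynomial.eval_one, Polynomial.eval_ofNat]
  omega

section

variable {q : ℕ} {M ℓ n d d' r : ℕ → ℕ}

/-- The codeword length is bounded by the time of encoding the message `0`. Its encoding has size
one however large `M` is, so the bound is polynomial in `lam`; without messages the encoder has no
inputs and gives no bound. -/
theorem PayloadCode.Efficient.exists_len_le {L : PayloadCode q M n d r} (h : L.Efficient) :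
    ∃ P : Polynomial ℕ, ∀ lam, 0 < M lam → n lam ≤ P.eval lam := by
  obtain ⟨P, hP⟩ := (polyTime_iff.1 h.1).size_pure_le
  obtain ⟨Pd, hPd⟩ := h.seedLenPT.exists_le
  obtain ⟨Pr, hPr⟩ := h.shiftLenPT.exists_le
  refine ⟨P.comp (2 * Polynomial.X + 4 * Pd + 4 * Pr + 7), fun lam hM => ?_⟩
  have h1 := hP ⟨lam, ⟨0, hM⟩, fun _ => false, fun _ => false⟩
  have h2 := length_le_size_listData (fun a : Fin q => natData a)
    (List.ofFn (L.enc lam ⟨0, hM⟩ (fun _ => false) fun _ => false))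
  rw [List.length_ofFn] at h2
  refine h2.trans (h1.trans ?_)
  rw [Polynomial.eval_comp]
  refine polynomial_eval_mono _ ?_
  have h3 := size_bitsData_le (fun _ : Fin (d lam) => false)
  have h4 := size_bitsData_le (fun _ : Fin (r lam) => false)
  have h5 := hPd lam
  have h6 := hPr lam
  have h7 : (msgData (⟨0, hM⟩ : Fin (M lam))).size = 1 := by
    simp [msgData, binData, listData, Data.size]
  simp only [Data.size, size_natData, h7, Polynomial.eval_add, Polynomial.eval_mul,
    Polynomial.eval_X, Polynomial.eval_ofNat]
  omega

variable [NeZero q] {ι : Type} {O : ι → Data → PMF Data} {e : ι → Data}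

/-- The reduction scatters uniform blocks around the answer of its payload oracle. It knows neither
the seed nor the marks, and needs neither because all blocks are uniform by now. -/
theorem PT.payloadOracle {S₀ : Scheme q (fun _ => 1) ℓ} {L : PayloadCode q M n d r}
    {C : SeedCode d d'} {ρ : ℝ} (hS : S₀.Efficient) (hL : L.Efficient) (hC : C.Corrects ρ)
    {lam : ι → ℕ} {g : ∀ i, Fin (M (lam i)) → PMF (Fin (n (lam i)) → Fin q)}
    {x : ι → Data} (hO : ∀ i, O i = msgOracle (g i))
    (hlam : PT O e fun i => PMF.pure (natData (lam i)))
    (hx : PT O e fun i => PMF.pure (x i)) :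
    PT O e fun i => msgOracle (fun m => (g i m).bind (PRC.scatter
      (placements_nonempty' (d' (lam i)) (ℓ (lam i)) (n (lam i)))
        fun _ => PMF.uniformOfFintype (Fin (ℓ (lam i)) → Fin q))) (x i) := by
  refine PT.msgHandler (M := fun i => M (lam i)) (PT.param hL.numMsgPT hlam) hx ?_
  simp only [PMF.map_bind]
  have hlam' : PT (fun p : (i : ι) × {m : Fin (M (lam i)) // msgData m = x i} => O p.1)
      (fun p => e p.1) (fun p => PMF.pure (natData (lam p.1))) := hlam.reindex Sigma.fst
  have hans : PT (fun p : (i : ι) × {m : Fin (M (lam i)) // msgData m = x i} => O p.1)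
      (fun p => e p.1) (fun p => (g p.1 p.2.1).map
        fun y => optionData wordData (some (List.ofFn y))) := by
    obtain ⟨Pn, hPn⟩ := hL.exists_len_le
    obtain ⟨P, hP⟩ := hlam.size_pure_le
    refine (PT.query (1 + (1 + Pn.comp P * Polynomial.C (2 * q + 2)) + 1) (hx.reindex Sigma.fst) ?_).congr ?_
    · rintro ⟨i, m, hm⟩ a ha
      simp only [hO] at ha
      rw [← hm, msgOracle_msg, PMF.mem_support_map_iff] at ha
      obtain ⟨y, -, rfl⟩ := ha
      have h5 := size_wordData_le (List.ofFn y)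
      have h6 := hP i
      simp only [size_natData] at h6
      rw [List.length_ofFn] at h5
      have h7 : n (lam i) ≤ Pn.eval (P.eval (e i).size) :=
        (hPn _ (Fin.pos m)).trans (polynomial_eval_mono _ (by omega))
      have h8 : n (lam i) * (2 * q + 2) ≤ Pn.eval (P.eval (e i).size) * (2 * q + 2) := by gcongr
      simp only [optionData, Data.size, Polynomial.eval_add, Polynomial.eval_mul, Polynomial.eval_C,
        Polynomial.eval_one, Polynomial.eval_comp]
      omega
    · rintro ⟨i, m, hm⟩
      simp only [hO]
      rw [← hm, msgOracle_msg]
  refine PT.bind hans ?_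
  have hlam2 : PT (fun t : (p : (i : ι) × {m : Fin (M (lam i)) // msgData m = x i}) ×
        (Fin (n (lam p.1)) → Fin q) => O t.1.1)
      (fun t => Data.cons (e t.1.1) (optionData wordData (some (List.ofFn t.2))))
      (fun t => PMF.pure (natData (lam t.1.1))) :=
    (hlam'.reindex Sigma.fst).comp (PT.get [false])
  refine PT.scatter (n := fun t : (p : (i : ι) × {m : Fin (M (lam i)) // msgData m = x i}) ×
        (Fin (n (lam p.1)) → Fin q) => n (lam t.1.1))
    (k := fun t => d' (lam t.1.1) + d' (lam t.1.1)) (ℓ := fun t => ℓ (lam t.1.1))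
    (N := fun t => n (lam t.1.1) + 2 * d' (lam t.1.1) * ℓ (lam t.1.1))
    (fun t => by ring) (fun t => placements_nonempty' _ _ _) ?_ (PT.get [true, false])
  refine PT.blocks (τ := fun _ => Unit) (enc := fun _ _ => Data.nil) (v := fun _ _ => ())
    (f := fun (t : (p : (i : ι) × {m : Fin (M (lam i)) // msgData m = x i}) ×
        (Fin (n (lam p.1)) → Fin q)) _ => PMF.uniformOfFintype (Fin (ℓ (lam t.1.1)) → Fin q)) ?_ ?_
  · simp only [List.ofFn_const]
    exact PT.param (PT.natAdd (hC.lenPT hL) (hC.lenPT hL)) hlam2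
  · exact PT.word (PT.param hS.lenPT ((hlam2.reindex Sigma.fst).comp (PT.get [false])))

/-- Output law of the reduction to the payload code, when the oracle is given by `g`. -/
noncomputable def payloadLaw (S₀ : Scheme q (fun _ => 1) ℓ) (d' : ℕ → ℕ) (mode : KeyMode)
    (A : Prog) (PA : Polynomial ℕ) (lam : ℕ) (g : Fin (M lam) → PMF (Fin (n lam) → Fin q))
    (shift : Fin (r lam) → Bool) : PMF Data :=
  (indep fun _ : Fin (d' lam + d' lam) => S₀.keyGen lam).bind fun ks =>
    A.law (msgOracle fun m => (g m).bind (scatter (placements_nonempty' (d' lam) (ℓ lam) (n lam))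
        fun _ => PMF.uniformOfFintype (Fin (ℓ lam) → Fin q)))
      (advInput mode lam (fun t => (ks t).1) shift) (PA.eval lam)

theorem PT.payloadLaw {S₀ : Scheme q (fun _ => 1) ℓ} {L : PayloadCode q M n d r}
    {C : SeedCode d d'} {ρ : ℝ} (mode : KeyMode) (hS : S₀.Efficient) (hL : L.Efficient)
    (hC : C.Corrects ρ)
    {lam : ι → ℕ} {g : ∀ i, Fin (M (lam i)) → PMF (Fin (n (lam i)) → Fin q)}
    {shift : ∀ i, Fin (r (lam i)) → Bool} (hO : ∀ i, O i = msgOracle (g i))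
    (hlam : PT O e fun i => PMF.pure (natData (lam i)))
    (hshift : PT O e fun i => PMF.pure (bitsData (shift i)))
    (A : Prog) (PA : Polynomial ℕ)
    (hA : ∀ i, ∀ ks ∈ (indep fun _ : Fin (d' (lam i) + d' (lam i)) =>
      S₀.keyGen (lam i)).support, A.HaltsWithin
      (msgOracle fun m => (g i m).bind (PRC.scatter
        (placements_nonempty' (d' (lam i)) (ℓ (lam i)) (n (lam i)))
        fun _ => PMF.uniformOfFintype (Fin (ℓ (lam i)) → Fin q)))
      (advInput mode (lam i) (fun t => (ks t).1) (shift i)) (PA.eval (lam i))) :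
    PT O e fun i => PRC.payloadLaw S₀ d' mode A PA (lam i) (g i) (shift i) := by
  unfold PRC.payloadLaw
  refine PT.bindSupport (enc := fun _ ks => listData (pairData bitsData bitsData) (List.ofFn ks))
    (PT.iid (k := fun i => d' (lam i) + d' (lam i)) (enc := fun _ => pairData bitsData bitsData)
      (PT.param (PT.natAdd (hC.lenPT hL) (hC.lenPT hL)) hlam)
      (((hS.keyGenPT.reindex lam).anyOracle O).comp hlam)) ?_
  have hold : ∀ {w : ι → Data}, (PT O e fun i => PMF.pure (w i)) →
      PT (fun p : (i : ι) × {ks // ks ∈ (indep fun _ : Fin (d' (lam i) + d' (lam i)) =>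
        S₀.keyGen (lam i)).support} => O p.1)
      (fun p => Data.cons (e p.1) (listData (pairData bitsData bitsData) (List.ofFn p.2.1)))
      (fun p => PMF.pure (w p.1)) := fun h => (h.reindex Sigma.fst).comp (PT.get [false])
  obtain ⟨Q, hQ⟩ := (hold hlam).size_pure_le
  refine PT.sim A (PA.comp Q) (v := fun p => natData (lam p.1)) (hold hlam) ?_
    (fun p => hA p.1 p.2.1 p.2.2) ?_ ?_
  · cases mode
    · refine PT.pair (hold hlam) (PT.joinKey ?_ (hold hshift))
      refine (PT.listMap (encA := fun _ => pairData bitsData bitsData) (encB := fun _ => bitsData)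
        (f := fun _ => Prod.fst) (PT.get [true]) (PT.get [true, false])).congr fun p => ?_
      rw [List.map_ofFn]; rfl
    · exact hold hlam
  · intro p
    rw [Polynomial.eval_comp]
    refine polynomial_eval_mono _ ?_
    have := hQ p
    rw [size_natData] at this
    omega
  · exact PT.payloadOracle hS hL hC (lam := fun p : ((i : ι) ×
      {ks // ks ∈ (indep fun _ : Fin (d' (lam i) + d' (lam i)) =>
        S₀.keyGen (lam i)).support}) × Data => lam p.1.1) (fun p => hO p.1.1)
      (PT.get [false]) (PT.get [true])

end

end PRC

/-! ### Pseudorandomness by the hybrid argument -/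

namespace PRC

section

variable {q : ℕ} [NeZero q] {M ℓ n d d' r : ℕ → ℕ}

theorem scatter_uniform {d' ℓ n : ℕ} :
    ((PMF.uniformOfFintype (Fin n → Fin q)).bind (scatter (placements_nonempty' d' ℓ n)
      fun _ => PMF.uniformOfFintype (Fin ℓ → Fin q))) = PMF.uniformOfFintype _ := by
  unfold scatter
  rw [indep_uniform, PMF.bind_comm]
  simp only [map_eq_bind]
  conv_lhs =>
    enter [2, u]
    rw [PMF.bind_comm]
  rw [PMF.bind_comm]
  rw [bind_congr_support (g := fun _ => PMF.uniformOfFintype (Fin (n + 2 * d' * ℓ) → Fin q)),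
    PMF.bind_const]
  intro loc hloc
  rw [PMF.support_uniformOfFinset] at hloc
  have := uniform_interleave (q := q) (n := n) (by ring) hloc
  simp only [map_eq_bind] at this
  exact this

/-- The experiment in which the first `j` blocks are uniform. -/
noncomputable def hybridExp (S₀ : Scheme q (fun _ => 1) ℓ) (L : PayloadCode q M n d r)
    (C : SeedCode d d') (mode : KeyMode) (A : Prog) (PA : Polynomial ℕ) (lam j : ℕ) : PMF Data :=
  (indep fun _ : Fin (d' lam + d' lam) => S₀.keyGen lam).bind fun ks =>
  (PMF.uniformOfFintype (Fin (r lam) → Bool)).bind fun shift =>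
    A.law (msgOracle (markedEnc L C lam (hybBlocks S₀ lam _ j fun t => (ks t).1) shift))
      (advInput mode lam (fun t => (ks t).1) shift) (PA.eval lam)

/-- An independent key with the same law may be planted in slot `j` without changing the joint law
of the keys. For `j` beyond the range nothing is planted. -/
theorem indep_replKey {α β : Type} {k : ℕ} (μ : PMF α) (j : ℕ) (G : (Fin k → α) → PMF β) :
    (μ.bind fun a => (indep fun _ : Fin k => μ).bind fun f =>
      G fun t => if (t : ℕ) = j then a else f t) = (indep fun _ : Fin k => μ).bind G := by
  rw [PMF.bind_comm]
  by_cases hj : j < k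
  · rw [indep_resample ⟨j, hj⟩ (fun _ _ => rfl) G]
    congr! 7 with f a t
    simp [Function.update_apply, Fin.ext_iff]
  · have : ∀ (f : Fin k → α) (a : α), (fun t : Fin k => if (t : ℕ) = j then a else f t) = f := by
      intro f a
      funext t
      rw [if_neg (by omega)]
    simp only [this, PMF.bind_const]

theorem fst_replKey {k a b : ℕ} (j : ℕ) (x : (Fin a → Bool) × (Fin b → Bool))
    (ks : Fin k → (Fin a → Bool) × (Fin b → Bool)) :
    (fun t : Fin k => (if (t : ℕ) = j then x else ks t).1)
      = replKey j x.1 fun t => (ks t).1 := by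
  funext t
  unfold replKey
  split_ifs <;> rfl

theorem hybridLaw_real (S₀ : Scheme q (fun _ => 1) ℓ) (L : PayloadCode q M n d r)
    (C : SeedCode d d') (mode : KeyMode) (A : Prog) (PA : Polynomial ℕ) (lam : ℕ) :
    ((S₀.keyGen lam).bind fun k => hybridLaw S₀ L C mode A PA lam (S₀.enc lam k.1 0) k.1)
      = (PMF.uniformOfFintype (Fin (d' lam + d' lam + 1))).bind fun j =>
        hybridExp S₀ L C mode A PA lam j := by
  unfold hybridLaw hybridExp
  rw [PMF.bind_comm]
  congr 1
  funext j
  simp only [mixBlocks_real]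
  refine Eq.trans ?_ (indep_replKey (S₀.keyGen lam) j fun ks =>
    (PMF.uniformOfFintype (Fin (r lam) → Bool)).bind fun shift =>
    A.law (msgOracle (markedEnc L C lam (hybBlocks S₀ lam _ j fun t => (ks t).1) shift))
      (advInput mode lam (fun t => (ks t).1) shift) (PA.eval lam))
  simp only [fst_replKey]

theorem hybridLaw_ideal (S₀ : Scheme q (fun _ => 1) ℓ) (L : PayloadCode q M n d r)
    (C : SeedCode d d') (mode : KeyMode) (A : Prog) (PA : Polynomial ℕ) (lam : ℕ) :
    ((S₀.keyGen lam).bind fun k => hybridLaw S₀ L C mode A PA lam (PMF.uniformOfFintype _) k.1)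
      = (PMF.uniformOfFintype (Fin (d' lam + d' lam + 1))).bind fun j =>
        hybridExp S₀ L C mode A PA lam (j + 1) := by
  unfold hybridLaw hybridExp
  rw [PMF.bind_comm]
  congr 1
  funext j
  refine Eq.trans ?_ (indep_replKey (S₀.keyGen lam) j fun ks =>
    (PMF.uniformOfFintype (Fin (r lam) → Bool)).bind fun shift =>
    A.law (msgOracle (markedEnc L C lam (hybBlocks S₀ lam _ (j + 1) fun t => (ks t).1) shift))
      (advInput mode lam (fun t => (ks t).1) shift) (PA.eval lam))
  simp only [fst_replKey]
  congr 1
  funext k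
  simp only [mixBlocks_ideal S₀ lam _ _ k.1]

/-- When marked blocks are uniform too, the marks have no effect. The seed is then used by the
payload encoder alone, as in the pseudorandomness game of the payload code. -/
theorem markedEnc_uniform (L : PayloadCode q M n d r) (C : SeedCode d d') (lam : ℕ)
    (shift : Fin (r lam) → Bool) :
    markedEnc L C lam (fun _ => PMF.uniformOfFintype (Fin (ℓ lam) → Fin q)) shift
      = fun m => ((PMF.uniformOfFintype (Fin (d lam) → Bool)).map fun s => L.enc lam m s shift).bind
        (scatter (placements_nonempty' (d' lam) (ℓ lam) (n lam))
          fun _ => PMF.uniformOfFintype (Fin (ℓ lam) → Fin q)) := by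
  funext m
  unfold markedEnc
  rw [PMF.bind_map]
  simp only [ite_self]
  rfl

/-- Averaging over the hybrids. -/
theorem prob_avg_sub (k : ℕ) {β : Type} (F : ℕ → PMF β) (S : Set β) :
    prob ((PMF.uniformOfFintype (Fin (k + 1))).bind fun j => F j) S
      - prob ((PMF.uniformOfFintype (Fin (k + 1))).bind fun j => F (j + 1)) S
      = ((k : ℝ) + 1)⁻¹ * (prob (F 0) S - prob (F (k + 1)) S) := by
  rw [prob_uniform_bind, prob_uniform_bind, ← mul_sub, ← Finset.sum_sub_distrib,
    Fin.sum_univ_eq_sum_range (fun j => prob (F j) S - prob (F (j + 1)) S), Finset.sum_range_sub']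
  simp

/-- The keys of the construction, from their components. -/
noncomputable def joinKeys (S₀ : Scheme q (fun _ => 1) ℓ) (L : PayloadCode q M n d r)
    (C : SeedCode d d') (lam : ℕ)
    (ks : Fin (d' lam + d' lam) → (Fin (S₀.ekLen lam) → Bool) × (Fin (S₀.dkLen lam) → Bool))
    (shift : Fin (r lam) → Bool) :
    (Fin ((genericPRC S₀ L C).ekLen lam) → Bool) × (Fin ((genericPRC S₀ L C).dkLen lam) → Bool) :=
  (joinKey (fun i => (ks i).1) shift, joinKey (fun i => (ks i).2) shift)

theorem genericPRC_keyGen_bind {S₀ : Scheme q (fun _ => 1) ℓ} {L : PayloadCode q M n d r}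
    {C : SeedCode d d'} (lam : ℕ) {β : Type}
    (G : (Fin ((genericPRC S₀ L C).ekLen lam) → Bool) ×
      (Fin ((genericPRC S₀ L C).dkLen lam) → Bool) → PMF β) :
    ((genericPRC S₀ L C).keyGen lam).bind G
      = (indep fun _ : Fin (d' lam + d' lam) => S₀.keyGen lam).bind fun ks =>
        (PMF.uniformOfFintype (Fin (r lam) → Bool)).bind fun shift =>
          G (joinKeys S₀ L C lam ks shift) := by
  refine (PMF.bind_bind _ _ _).trans ?_
  congr 1
  funext ks
  exact PMF.bind_map _ _ _

theorem joinKeys_mem_support {S₀ : Scheme q (fun _ => 1) ℓ} {L : PayloadCode q M n d r}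
    {C : SeedCode d d'} {lam : ℕ}
    {ks : Fin (d' lam + d' lam) → (Fin (S₀.ekLen lam) → Bool) × (Fin (S₀.dkLen lam) → Bool)}
    (hks : ks ∈ (indep fun _ : Fin (d' lam + d' lam) => S₀.keyGen lam).support)
    (shift : Fin (r lam) → Bool) :
    joinKeys S₀ L C lam ks shift ∈ ((genericPRC S₀ L C).keyGen lam).support := by
  refine (PMF.mem_support_bind_iff _ _ _).2 ⟨ks, hks, ?_⟩
  exact (PMF.mem_support_map_iff _ _ _).2 ⟨shift, by simp, rfl⟩

theorem adversaryInput_joinKeys {S₀ : Scheme q (fun _ => 1) ℓ} {L : PayloadCode q M n d r}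
    {C : SeedCode d d'} (mode : KeyMode) (lam : ℕ)
    (ks : Fin (d' lam + d' lam) → (Fin (S₀.ekLen lam) → Bool) × (Fin (S₀.dkLen lam) → Bool))
    (shift : Fin (r lam) → Bool) :
    (genericPRC S₀ L C).adversaryInput mode lam (joinKeys S₀ L C lam ks shift)
      = advInput mode lam (fun i => (ks i).1) shift := by
  cases mode <;> rfl

theorem genericPRC_enc_joinKeys (S₀ : Scheme q (fun _ => 1) ℓ) (L : PayloadCode q M n d r)
    (C : SeedCode d d') (lam : ℕ)
    (ks : Fin (d' lam + d' lam) → (Fin (S₀.ekLen lam) → Bool) × (Fin (S₀.dkLen lam) → Bool))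
    (shift : Fin (r lam) → Bool) (m : Fin (M lam)) :
    (genericPRC S₀ L C).enc lam (joinKeys S₀ L C lam ks shift).1 m
      = markedEnc L C lam (fun i => S₀.enc lam (ks i).1 0) shift m := by
  rw [genericPRC_enc]
  simp only [joinKeys, keyPart_joinKey, shiftPart_joinKey]

theorem genericPRC_dec_joinKeys (S₀ : Scheme q (fun _ => 1) ℓ) (L : PayloadCode q M n d r)
    (C : SeedCode d d') (lam : ℕ)
    (ks : Fin (d' lam + d' lam) → (Fin (S₀.ekLen lam) → Bool) × (Fin (S₀.dkLen lam) → Bool))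
    (shift : Fin (r lam) → Bool) (y : List (Fin q)) :
    (genericPRC S₀ L C).dec lam (joinKeys S₀ L C lam ks shift).2 y
      = (indep fun i => anyAccepts (S₀.dec lam (ks i).2) (substrings y)).map fun st =>
        decodeTests L C lam st shift y := by
  refine (genericPRC_dec S₀ L C lam _ y).trans ?_
  simp only [joinKeys, keyPart_joinKey, shiftPart_joinKey]

theorem Prog.HaltsWithin.output_eq {O : Data → PMF Data} {c : Prog} {x : Data} {T : ℕ}
    (h : c.HaltsWithin O x T) : c.output O x T = (c.law O x T).map some :=
  (computes_iff.1 h.computes).2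

theorem prob_map_some {α : Type} (μ : PMF α) (a : α) : prob (μ.map some) {some a} = prob μ {a} := by
  rw [prob_map]
  congr 1
  ext b
  simp

theorem prob_bind_map_some {α β : Type} (μ : PMF α) {f : α → PMF (Option β)} {g : α → PMF β}
    (h : ∀ a ∈ μ.support, f a = (g a).map some) (b : β) :
    prob (μ.bind f) {some b} = prob (μ.bind g) {b} := by
  rw [bind_congr_support h, ← PMF.map_bind, prob_map_some]

theorem hybridExp_first {S₀ : Scheme q (fun _ => 1) ℓ} {L : PayloadCode q M n d r}
    {C : SeedCode d d'} {mode : KeyMode} {A : Prog} {PA : Polynomial ℕ} (lam : ℕ) :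
    (((genericPRC S₀ L C).keyGen lam).bind fun k =>
      A.law (msgOracle fun m => (genericPRC S₀ L C).enc lam k.1 m)
        ((genericPRC S₀ L C).adversaryInput mode lam k) (PA.eval lam))
      = hybridExp S₀ L C mode A PA lam 0 := by
  rw [genericPRC_keyGen_bind]
  have hb : ∀ key : Fin (d' lam + d' lam) → Fin (S₀.ekLen lam) → Bool,
      hybBlocks S₀ lam (d' lam + d' lam) 0 key = fun t => S₀.enc lam (key t) 0 := by
    intro key
    funext t
    rw [hybBlocks, if_neg (by omega)]
  unfold hybridExp
  simp only [hb]
  congr 1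
  funext ks
  congr 1
  funext shift
  rw [adversaryInput_joinKeys]
  have h : (fun m => (genericPRC S₀ L C).enc lam (joinKeys S₀ L C lam ks shift).1 m)
      = markedEnc L C lam (fun i => S₀.enc lam (ks i).1 0) shift :=
    funext fun m => genericPRC_enc_joinKeys S₀ L C lam ks shift m
  exact congrArg (fun f => A.law (msgOracle f) _ _) h

theorem hybridExp_last {S₀ : Scheme q (fun _ => 1) ℓ} {L : PayloadCode q M n d r}
    {C : SeedCode d d'} {mode : KeyMode} {A : Prog} {PA : Polynomial ℕ} (lam : ℕ) :
    hybridExp S₀ L C mode A PA lam (d' lam + d' lam + 1)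
      = (PMF.uniformOfFintype (Fin (r lam) → Bool)).bind fun shift =>
        payloadLaw S₀ d' mode A PA lam (fun m =>
          (PMF.uniformOfFintype (Fin (d lam) → Bool)).map fun s => L.enc lam m s shift) shift := by
  unfold hybridExp payloadLaw
  rw [PMF.bind_comm]
  have hb : ∀ key : Fin (d' lam + d' lam) → Fin (S₀.ekLen lam) → Bool,
      hybBlocks S₀ lam (d' lam + d' lam) (d' lam + d' lam + 1) key
        = fun _ => PMF.uniformOfFintype _ := by
    intro key
    funext t
    rw [hybBlocks, if_pos (by omega)]
  simp only [hb, markedEnc_uniform]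

theorem payloadLaw_uniform {S₀ : Scheme q (fun _ => 1) ℓ} {L : PayloadCode q M n d r}
    {C : SeedCode d d'} {mode : KeyMode} {A : Prog} {PA : Polynomial ℕ} (lam : ℕ) :
    ((PMF.uniformOfFintype (Fin (r lam) → Bool)).bind fun shift =>
        payloadLaw (M := M) (n := n) S₀ d' mode A PA lam (fun _ => PMF.uniformOfFintype _) shift)
      = ((genericPRC S₀ L C).keyGen lam).bind fun k =>
          A.law (msgOracle fun _ : Fin (M lam) =>
            PMF.uniformOfFintype (Fin (n lam + 2 * d' lam * ℓ lam) → Fin q))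
            ((genericPRC S₀ L C).adversaryInput mode lam k) (PA.eval lam) := by
  rw [genericPRC_keyGen_bind]
  unfold payloadLaw
  rw [PMF.bind_comm]
  simp only [scatter_uniform, adversaryInput_joinKeys]

/-- For a uniformly guessed index the advantage of the reduction telescopes: it is the distance
between the first and the last hybrid, divided by the number `2 d' + 1` of guesses. -/
theorem hybridExp_blocks {S₀ : Scheme q (fun _ => 1) ℓ} {L : PayloadCode q M n d r}
    {C : SeedCode d d'} {ρ : ℝ} {mode : KeyMode} (hS : S₀.Efficient) (hL : L.Efficient)
    (hC : C.Corrects ρ) (hSp : S₀.Pseudorandom mode) (A : Prog) (PA : Polynomial ℕ)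
    (hA : ∀ lam, ∀ ks ∈ (indep fun _ : Fin (d' lam + d' lam) => S₀.keyGen lam).support,
      ∀ (shift : Fin (r lam) → Bool)
        (f : Fin (M lam) → PMF (Fin (n lam + 2 * d' lam * ℓ lam) → Fin q)),
      A.HaltsWithin (msgOracle f) (advInput mode lam (fun t => (ks t).1) shift) (PA.eval lam)) :
    ∃ ν, Negligible ν ∧ ∀ lam,
      |prob (hybridExp S₀ L C mode A PA lam 0) {boolData true}
        - prob (hybridExp S₀ L C mode A PA lam (d' lam + d' lam + 1)) {boolData true}|
        ≤ (d' lam + d' lam + 1) * ν lam := by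
  -- The Boolean index selects the real or the ideal oracle. Treating both in one family yields a
  -- single program with the required output law in either experiment.
  let g : ∀ i : (lam : ℕ) × ({k // k ∈ (S₀.keyGen lam).support} × Bool),
      Fin 1 → PMF (Fin (ℓ i.1) → Fin q) :=
    fun i m => if i.2.2 then S₀.enc i.1 i.2.1.1.1 m else PMF.uniformOfFintype _
  have hR := PT.hybridLaw (O := fun i => msgOracle (g i)) mode hS hL hC
    (e := fun i : (lam : ℕ) × ({k // k ∈ (S₀.keyGen lam).support} × Bool) =>
      S₀.adversaryInput mode i.1 i.2.1.1)
    (lam := fun i => i.1) (g := g) (k₀ := fun i => i.2.1.1.1) (fun i => rfl) (by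
      cases mode
      · exact PT.get [false]
      · exact PT.id) (by
      rintro rfl
      exact PT.get [true]) A PA (by
      intro i j ks hks shift
      -- The time bound is applied to the tuple with the challenge key planted in it, which is again
      -- a possible outcome of key generation.
      have hks' : (fun t : Fin (d' i.1 + d' i.1) => if (t : ℕ) = j then i.2.1.1 else ks t) ∈
          (indep fun _ : Fin (d' i.1 + d' i.1) => S₀.keyGen i.1).support := by
        rw [mem_support_indep] at hks ⊢
        intro t
        split_ifs
        · exact i.2.1.2
        · exact hks t
      have := hA i.1 _ hks' shift
      simp only [fst_replKey] at this
      exact this _)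
  obtain ⟨c, P, hc⟩ := hR
  obtain ⟨Pk, hPk⟩ := hS.keyGenPT.size_le
  let Q : Polynomial ℕ := P.comp (2 * Polynomial.X + 2 + Pk.comp (2 * Polynomial.X + 1))
  have hsize : ∀ lam, ∀ k ∈ (S₀.keyGen lam).support,
      P.eval (S₀.adversaryInput mode lam k).size ≤ Q.eval lam := by
    intro lam k hk
    have h1 := hPk lam (Data.cons (bitsData k.1) (bitsData k.2))
      ((PMF.mem_support_map_iff _ _ _).2 ⟨k, hk, rfl⟩)
    simp only [size_natData, Data.size] at h1
    simp only [Q, Polynomial.eval_comp]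
    refine polynomial_eval_mono _ ?_
    simp only [Polynomial.eval_add, Polynomial.eval_mul, Polynomial.eval_X, Polynomial.eval_ofNat,
      Polynomial.eval_comp, Polynomial.eval_one]
    cases mode <;> simp only [Scheme.adversaryInput, Data.size, size_natData] <;> omega
  have hreal : ∀ lam, ∀ k ∈ (S₀.keyGen lam).support,
      Computes (msgOracle fun m : Fin 1 => S₀.enc lam k.1 m) c (S₀.adversaryInput mode lam k)
        (hybridLaw S₀ L C mode A PA lam (S₀.enc lam k.1 0) k.1) (Q.eval lam) :=
    fun lam k hk => (hc ⟨lam, ⟨k, hk⟩, true⟩).mono (hsize lam k hk)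
  have hideal : ∀ lam, ∀ k ∈ (S₀.keyGen lam).support,
      Computes (msgOracle fun _ : Fin 1 => PMF.uniformOfFintype (Fin (ℓ lam) → Fin q)) c
        (S₀.adversaryInput mode lam k)
        (hybridLaw S₀ L C mode A PA lam (PMF.uniformOfFintype _) k.1) (Q.eval lam) :=
    fun lam k hk => (hc ⟨lam, ⟨k, hk⟩, false⟩).mono (hsize lam k hk)
  refine ⟨_, hSp c Q fun lam k hk => ⟨(computes_iff.1 (hreal lam k hk)).1,
    (computes_iff.1 (hideal lam k hk)).1⟩, fun lam => ?_⟩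
  beta_reduce
  rw [prob_bind_map_some _ fun k hk => (computes_iff.1 (hreal lam k hk)).2,
    prob_bind_map_some _ fun k hk => (computes_iff.1 (hideal lam k hk)).2,
    hybridLaw_real, hybridLaw_ideal,
    prob_avg_sub (d' lam + d' lam) (fun j => hybridExp S₀ L C mode A PA lam j), abs_mul]
  push_cast
  rw [abs_of_nonneg (show (0 : ℝ) ≤ ((d' lam : ℝ) + d' lam + 1)⁻¹ by positivity), ← mul_assoc, mul_inv_cancel₀ (by positivity), one_mul]

/-- No guess is involved here: the two experiments of the reduction are exactly the last hybrid and
the ideal experiment, since uniform blocks scattered in a uniform payload form a uniform word. -/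
theorem hybridExp_payload {S₀ : Scheme q (fun _ => 1) ℓ} {L : PayloadCode q M n d r}
    {C : SeedCode d d'} {ρ : ℝ} {mode : KeyMode} (hS : S₀.Efficient) (hL : L.Efficient)
    (hC : C.Corrects ρ) (hLp : L.Pseudorandom) (A : Prog) (PA : Polynomial ℕ)
    (hA : ∀ lam, ∀ ks ∈ (indep fun _ : Fin (d' lam + d' lam) => S₀.keyGen lam).support,
      ∀ (shift : Fin (r lam) → Bool)
        (f : Fin (M lam) → PMF (Fin (n lam + 2 * d' lam * ℓ lam) → Fin q)),
      A.HaltsWithin (msgOracle f) (advInput mode lam (fun t => (ks t).1) shift) (PA.eval lam)) :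
    ∃ ν, Negligible ν ∧ ∀ lam,
      |prob (hybridExp S₀ L C mode A PA lam (d' lam + d' lam + 1)) {boolData true}
        - prob (((genericPRC S₀ L C).keyGen lam).bind fun k =>
          A.law (msgOracle fun _ : Fin (M lam) =>
            PMF.uniformOfFintype (Fin (n lam + 2 * d' lam * ℓ lam) → Fin q))
            ((genericPRC S₀ L C).adversaryInput mode lam k) (PA.eval lam)) {boolData true}|
        ≤ ν lam := by
  let g : ∀ i : (lam : ℕ) × ((Fin (r lam) → Bool) × Bool),
      Fin (M i.1) → PMF (Fin (n i.1) → Fin q) :=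
    fun i m => if i.2.2 then (PMF.uniformOfFintype (Fin (d i.1) → Bool)).map fun s =>
      L.enc i.1 m s i.2.1 else PMF.uniformOfFintype _
  have hR := PT.payloadLaw (O := fun i => msgOracle (g i)) mode hS hL hC
    (e := fun i : (lam : ℕ) × ((Fin (r lam) → Bool) × Bool) =>
      Data.cons (natData i.1) (bitsData i.2.1))
    (lam := fun i => i.1) (g := g) (shift := fun i => i.2.1) (fun i => rfl)
    (PT.get [false]) (PT.get [true]) A PA (fun i ks hks => hA i.1 ks hks i.2.1 _)
  obtain ⟨c, P, hc⟩ := hR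
  obtain ⟨Pr, hPr⟩ := hL.shiftLenPT.exists_le
  let Q : Polynomial ℕ := P.comp (2 * Polynomial.X + 4 * Pr + 3)
  have hsize : ∀ lam (shift : Fin (r lam) → Bool),
      P.eval (Data.cons (natData lam) (bitsData shift)).size ≤ Q.eval lam := by
    intro lam shift
    have h1 := size_bitsData_le shift
    have h2 := hPr lam
    simp only [Q, Polynomial.eval_comp]
    refine polynomial_eval_mono _ ?_
    simp only [Data.size, size_natData, Polynomial.eval_add, Polynomial.eval_mul,
      Polynomial.eval_X, Polynomial.eval_ofNat]
    omega
  have hreal : ∀ lam, ∀ shift : Fin (r lam) → Bool,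
      Computes (msgOracle fun m : Fin (M lam) => (PMF.uniformOfFintype (Fin (d lam) → Bool)).map
        fun s => L.enc lam m s shift) c (Data.cons (natData lam) (bitsData shift))
        (payloadLaw S₀ d' mode A PA lam (fun m =>
          (PMF.uniformOfFintype (Fin (d lam) → Bool)).map fun s => L.enc lam m s shift) shift)
        (Q.eval lam) :=
    fun lam shift => (hc ⟨lam, shift, true⟩).mono (hsize lam shift)
  have hideal : ∀ lam, ∀ shift : Fin (r lam) → Bool,
      Computes (msgOracle fun _ : Fin (M lam) => PMF.uniformOfFintype (Fin (n lam) → Fin q)) c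
        (Data.cons (natData lam) (bitsData shift))
        (payloadLaw (M := M) (n := n) S₀ d' mode A PA lam (fun _ => PMF.uniformOfFintype _) shift)
        (Q.eval lam) :=
    fun lam shift => (hc ⟨lam, shift, false⟩).mono (hsize lam shift)
  refine ⟨_, hLp c Q fun lam shift _ => ⟨(computes_iff.1 (hreal lam shift)).1,
    (computes_iff.1 (hideal lam shift)).1⟩, fun lam => le_of_eq ?_⟩
  beta_reduce
  rw [prob_bind_map_some _ fun shift _ => (computes_iff.1 (hreal lam shift)).2,
    prob_bind_map_some _ fun shift _ => (computes_iff.1 (hideal lam shift)).2,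
    hybridExp_last, payloadLaw_uniform (L := L) (C := C)]

theorem genericPRC_pseudorandom {S₀ : Scheme q (fun _ => 1) ℓ} {L : PayloadCode q M n d r}
    {C : SeedCode d d'} {ρ : ℝ} {mode : KeyMode} (hS : S₀.Efficient) (hL : L.Efficient)
    (hC : C.Corrects ρ) (hSp : S₀.Pseudorandom mode) (hLp : L.Pseudorandom) :
    (genericPRC S₀ L C).Pseudorandom mode := by
  intro A PA hA
  -- Halting is taken from the ideal experiment, whose oracle has full support.
  have hA' : ∀ lam, ∀ ks ∈ (indep fun _ : Fin (d' lam + d' lam) => S₀.keyGen lam).support,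
      ∀ (shift : Fin (r lam) → Bool) (f : Fin (M lam) → PMF (Fin (n lam + 2 * d' lam * ℓ lam) → Fin q)),
      A.HaltsWithin (msgOracle f) (advInput mode lam (fun t => (ks t).1) shift) (PA.eval lam) := by
    intro lam ks hks shift f
    rw [← adversaryInput_joinKeys (L := L) (C := C)]
    exact (hA lam _ (joinKeys_mem_support hks shift)).2.of_support_subset
      (msgOracle_support_subset f)
  obtain ⟨ν₁, hν₁, h₁⟩ := hybridExp_blocks hS hL hC hSp A PA hA'
  obtain ⟨ν₂, hν₂, h₂⟩ := hybridExp_payload hS hL hC hLp A PA hA'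
  obtain ⟨Pd, hPd⟩ := (PT.natAdd (hC.lenPT hL) (hC.lenPT hL)).exists_le
  have h₃ : ∀ lam, prob (((genericPRC S₀ L C).keyGen lam).bind fun k =>
      A.output (msgOracle fun m => (genericPRC S₀ L C).enc lam k.1 m)
        ((genericPRC S₀ L C).adversaryInput mode lam k) (PA.eval lam)) {some (boolData true)}
      = prob (hybridExp S₀ L C mode A PA lam 0) {boolData true} := fun lam =>
    (prob_bind_map_some _ (fun k hk => (hA lam k hk).1.output_eq) _).trans
      (congrArg (fun μ => prob μ _) (hybridExp_first lam))
  have h₄ : ∀ lam, prob (((genericPRC S₀ L C).keyGen lam).bind fun k =>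
      A.output (msgOracle fun _ : Fin (M lam) =>
        PMF.uniformOfFintype (Fin (n lam + 2 * d' lam * ℓ lam) → Fin q))
        ((genericPRC S₀ L C).adversaryInput mode lam k) (PA.eval lam)) {some (boolData true)}
      = prob (((genericPRC S₀ L C).keyGen lam).bind fun k =>
          A.law (msgOracle fun _ : Fin (M lam) =>
            PMF.uniformOfFintype (Fin (n lam + 2 * d' lam * ℓ lam) → Fin q))
            ((genericPRC S₀ L C).adversaryInput mode lam k) (PA.eval lam)) {boolData true} :=
    fun lam => prob_bind_map_some _ (fun k hk => (hA lam k hk).2.output_eq) _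
  refine ((hν₁.poly_mul (Pd + 1)).add hν₂).of_le (fun _ => abs_nonneg _) (Eventually.of_forall ?_)
  intro lam
  refine (le_of_eq (congrArg₂ (fun x y => |x - y|) (h₃ lam) (h₄ lam))).trans ?_
  refine (abs_sub_le _ (prob (hybridExp S₀ L C mode A PA lam (d' lam + d' lam + 1))
    {boolData true}) _).trans (add_le_add ((h₁ lam).trans ?_) (h₂ lam))
  refine mul_le_mul_of_nonneg_right ?_ (hν₁.1 lam)
  rw [Polynomial.eval_add, Polynomial.eval_one]
  have := hPd lam
  exact_mod_cast Nat.succ_le_succ this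

theorem genericPRC_keysMatch {S₀ : Scheme q (fun _ => 1) ℓ} (L : PayloadCode q M n d r)
    (C : SeedCode d d') {mode : KeyMode} (h : S₀.KeysMatch mode) :
    (genericPRC S₀ L C).KeysMatch mode := by
  cases mode
  · trivial
  · intro lam k hk
    obtain ⟨ks, hks, hk⟩ := (PMF.mem_support_bind_iff _ _ _).1 hk
    obtain ⟨shift, -, rfl⟩ := (PMF.mem_support_map_iff _ _ _).1 hk
    rw [mem_support_indep] at hks
    have : List.ofFn (joinKey (fun i => (ks i).1) shift)
        = List.ofFn (joinKey (fun i => (ks i).2) shift) := by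
      rw [ofFn_joinKey, ofFn_joinKey]
      congr 3
      funext i
      exact h lam _ (hks i)
    exact this

end

end PRC

/-! ### Edit distance, alignments and substrings -/

namespace PRC

section

variable {α : Type}

theorem lcsLength_mem (x y : List α) :
    ∃ z : List α, z.Sublist x ∧ z.Sublist y ∧ z.length = lcsLength x y :=
  Nat.sSup_mem (s := {k | ∃ z : List α, z.Sublist x ∧ z.Sublist y ∧ z.length = k})
    ⟨0, [], by simp, by simp, rfl⟩ ⟨x.length, by rintro k ⟨z, h, -, rfl⟩; exact h.length_le⟩

theorem length_le_lcsLength {x y z : List α} (hx : z.Sublist x) (hy : z.Sublist y) :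
    z.length ≤ lcsLength x y :=
  le_csSup (s := {k | ∃ z : List α, z.Sublist x ∧ z.Sublist y ∧ z.length = k})
    ⟨x.length, by rintro k ⟨z, h, -, rfl⟩; exact h.length_le⟩ ⟨z, hx, hy, rfl⟩

theorem exists_editDist (x y : List α) : ∃ z : List α, z.Sublist x ∧ z.Sublist y ∧
    editDist x y + 2 * z.length = x.length + y.length := by
  obtain ⟨z, hx, hy, hz⟩ := lcsLength_mem x y
  refine ⟨z, hx, hy, ?_⟩
  have := hx.length_le
  have := hy.length_le
  unfold editDist
  omega

theorem editDist_le {x y z : List α} (hx : z.Sublist x) (hy : z.Sublist y) :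
    editDist x y + 2 * z.length ≤ x.length + y.length := by
  have h1 := length_le_lcsLength hx hy
  obtain ⟨w, h2, h3, h4⟩ := lcsLength_mem x y
  have := h2.length_le
  have := h3.length_le
  unfold editDist
  omega

theorem editDist_self (x : List α) : editDist x x = 0 := by
  have := editDist_le (List.Sublist.refl x) (List.Sublist.refl x)
  omega

theorem editDist_nil_right (x : List α) : editDist x [] = x.length := by
  obtain ⟨z, -, h2, h3⟩ := exists_editDist x []
  obtain rfl := List.sublist_nil.1 h2
  simpa using h3

theorem length_le_add_editDist (x y : List α) : y.length ≤ x.length + editDist x y := by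
  obtain ⟨z, h1, h2, h3⟩ := exists_editDist x y
  have := h1.length_le
  omega

theorem editDist_append_le (a b c d : List α) :
    editDist (a ++ b) (c ++ d) ≤ editDist a c + editDist b d := by
  obtain ⟨z, h1, h2, h3⟩ := exists_editDist a c
  obtain ⟨w, h4, h5, h6⟩ := exists_editDist b d
  have := editDist_le (h1.append h4) (h2.append h5)
  simp only [List.length_append] at this
  omega

/-- Two sublists have a long common sublist. -/
theorem exists_common_sublist {u v y : List α} (hu : u.Sublist y) (hv : v.Sublist y) :
    ∃ w : List α, w.Sublist u ∧ w.Sublist v ∧ u.length + v.length ≤ w.length + y.length := by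
  induction y generalizing u v with
  | nil =>
    obtain rfl := List.sublist_nil.1 hu
    obtain rfl := List.sublist_nil.1 hv
    exact ⟨[], by simp⟩
  | cons a y ih =>
    cases hu with
    | cons _ hu =>
      cases hv with
      | cons _ hv =>
        obtain ⟨w, h1, h2, h3⟩ := ih hu hv
        exact ⟨w, h1, h2, by simp; omega⟩
      | cons_cons _ hv =>
        obtain ⟨w, h1, h2, h3⟩ := ih hu hv
        exact ⟨w, h1, h2.cons _, by simp; omega⟩
    | cons_cons _ hu =>
      cases hv with
      | cons _ hv =>
        obtain ⟨w, h1, h2, h3⟩ := ih hu hv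
        exact ⟨w, h1.cons _, h2, by simp; omega⟩
      | cons_cons _ hv =>
        obtain ⟨w, h1, h2, h3⟩ := ih hu hv
        exact ⟨a :: w, h1.cons_cons _, h2.cons_cons _, by simp; omega⟩

/-- Passing from `x` to its subsequence `c` costs `x.length - c.length` deletions; the inequality is
written additively to avoid subtraction. It is applied with `c` the payload inside the codeword. -/
theorem editDist_le_of_sublist {x y c : List α} (hc : c.Sublist x) :
    editDist y c + c.length ≤ editDist x y + x.length := by
  obtain ⟨z, h1, h2, h3⟩ := exists_editDist x y
  obtain ⟨w, h4, h5, h6⟩ := exists_common_sublist h1 hc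
  have := editDist_le (h4.trans h2) h5
  omega

/-- Each symbol of `x` is aligned with a chunk of `y`, at a cost; the costs add up to at most the
edit distance. -/
theorem exists_alignment (x y : List α) : ∃ W : List (List α × ℕ),
    List.Forall₂ (fun a w => editDist [a] w.1 ≤ w.2) x W ∧ (W.map Prod.fst).flatten <+: y ∧
      (W.map Prod.snd).sum ≤ editDist x y := by
  obtain ⟨z, h1, h2, h3⟩ := exists_editDist x y
  suffices h : ∃ W : List (List α × ℕ),
      List.Forall₂ (fun a w => editDist [a] w.1 ≤ w.2) x W ∧ (W.map Prod.fst).flatten <+: y ∧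
        (W.map Prod.snd).sum + 2 * z.length ≤ x.length + y.length by
    obtain ⟨W, h4, h5, h6⟩ := h
    exact ⟨W, h4, h5, by omega⟩
  clear h3
  induction x generalizing y z with
  | nil =>
    obtain rfl := List.sublist_nil.1 h1
    exact ⟨[], .nil, by simp, by simp⟩
  | cons a x ih =>
    cases h1 with
    | cons _ h1 =>
      obtain ⟨W, h4, h5, h6⟩ := ih y z h1 h2
      -- A symbol outside the common subsequence is deleted: it is aligned with the empty chunk at
      -- cost one.
      refine ⟨([], 1) :: W, .cons ?_ h4, by simpa using h5, by simp; omega⟩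
      rw [editDist_nil_right]; rfl
    | @cons_cons z' _ _ h1 =>
      obtain ⟨y₁, y₂, rfl, hy, hz⟩ := List.cons_sublist_iff.1 h2
      obtain ⟨s, t, rfl⟩ := List.append_of_mem hy
      have h2' : z'.Sublist (t ++ y₂) := hz.trans (List.sublist_append_right _ _)
      obtain ⟨W, h4, h5, h6⟩ := ih (t ++ y₂) z' h1 h2'
      -- A matched symbol absorbs the insertions `s` that precede its partner. Symbols of `y` after
      -- the last match belong to no chunk, which is why the chunks form only a prefix of `y`.
      refine ⟨(s ++ [a], s.length) :: W, .cons ?_ h4, ?_, ?_⟩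
      · have := editDist_le (List.Sublist.refl [a]) (List.sublist_append_right s [a])
        simp only [List.length_append, List.length_singleton] at this
        show editDist [a] (s ++ [a]) ≤ s.length
        omega
      · simpa using h5
      · simp only [List.length_append] at h6
        simp
        omega

theorem editDist_flatten_le {x : List α} {W : List (List α × ℕ)}
    (h : List.Forall₂ (fun a w => editDist [a] w.1 ≤ w.2) x W) :
    editDist x (W.map Prod.fst).flatten ≤ (W.map Prod.snd).sum := by
  induction h with
  | nil => simp [editDist_self]
  | @cons a w x W h _ ih =>
    have := editDist_append_le [a] x w.1 (W.map Prod.fst).flatten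
    simp only [List.singleton_append] at this
    simp only [List.map_cons, List.flatten_cons, List.sum_cons]
    omega

/-- Each entry lies in at most `k` windows of length `k`. -/
theorem sum_windows_le (l : List ℕ) (k : ℕ) :
    ∑ a ∈ Finset.range l.length, ((l.drop a).take k).sum ≤ k * l.sum := by
  have h1 : ∀ (l : List ℕ) (k : ℕ), (l.take k).sum = ∑ j ∈ Finset.range k, l.getD j 0 := by
    intro l
    induction l with
    | nil => intro k; simp
    | cons a l ih =>
      intro k
      cases k with
      | zero => simp
      | succ k => rw [List.take_succ_cons, List.sum_cons, ih, Finset.sum_range_succ']; simp [add_comm]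
  have h2 : ∀ (l : List ℕ) (k N : ℕ), ∑ a ∈ Finset.range N, l.getD (a + k) 0 ≤ l.sum := by
    intro l k N
    have h3 : l.sum = ∑ j ∈ Finset.range (N + k + l.length), l.getD j 0 := by
      rw [← h1, List.take_of_length_le (by omega)]
    rw [h3, Finset.range_eq_Ico, Finset.sum_Ico_add' (fun a => l.getD a 0)]
    exact Finset.sum_le_sum_of_subset (fun a ha => by simp at ha ⊢; omega)
  calc ∑ a ∈ Finset.range l.length, ((l.drop a).take k).sum
      = ∑ a ∈ Finset.range l.length, ∑ j ∈ Finset.range k, l.getD (a + j) 0 := by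
        refine Finset.sum_congr rfl fun a _ => ?_
        rw [h1]
        refine Finset.sum_congr rfl fun j _ => ?_
        simp [List.getD_eq_getElem?_getD]
    _ = ∑ j ∈ Finset.range k, ∑ a ∈ Finset.range l.length, l.getD (a + j) 0 := Finset.sum_comm
    _ ≤ ∑ j ∈ Finset.range k, l.sum := Finset.sum_le_sum fun j _ => h2 l j _
    _ = k * l.sum := by simp

open Classical in
/-- An alignment of `x` with `y`. -/
noncomputable def alignment (x y : List α) : List (List α × ℕ) := (exists_alignment x y).choose

/-- The part of `y` that corresponds to the window of length `k` of `x` at `a`. -/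
noncomputable def alignedWindow (x y : List α) (a k : ℕ) : List α :=
  (((alignment x y).drop a).take k |>.map Prod.fst).flatten

noncomputable def windowCost (x y : List α) (a k : ℕ) : ℕ :=
  (((alignment x y).map Prod.snd).drop a |>.take k).sum

theorem editDist_alignedWindow (x y : List α) (a k : ℕ) :
    editDist ((x.drop a).take k) (alignedWindow x y a k) ≤ windowCost x y a k := by
  have h := (exists_alignment x y).choose_spec.1
  have := editDist_flatten_le (List.forall₂_take k (List.forall₂_drop a h))
  rw [windowCost, ← List.map_drop, ← List.map_take]
  exact this

theorem alignedWindow_infix (x y : List α) (a k : ℕ) : alignedWindow x y a k <:+: y := by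
  have h := (exists_alignment x y).choose_spec.2.1
  refine List.IsInfix.trans ?_ h.isInfix
  refine ⟨((alignment x y).take a |>.map Prod.fst).flatten,
    (((alignment x y).drop a).drop k |>.map Prod.fst).flatten, ?_⟩
  rw [alignedWindow, ← List.flatten_append, ← List.flatten_append, ← List.map_append,
    ← List.map_append, List.append_assoc, List.take_append_drop, List.take_append_drop]
  rfl

theorem sum_windowCost_le (x y : List α) (k : ℕ) :
    ∑ a ∈ Finset.range x.length, windowCost x y a k ≤ k * editDist x y := by
  have h := (exists_alignment x y).choose_spec
  have h1 : x.length = ((alignment x y).map Prod.snd).length := by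
    rw [List.length_map]; exact h.1.length_eq
  rw [h1]
  exact (sum_windows_le _ k).trans (Nat.mul_le_mul_left _ h.2.2)

theorem mem_substrings {y z : List α} (hz : z ≠ []) (h : z <:+: y) : z ∈ substrings y := by
  obtain ⟨s, t, rfl⟩ := h
  have hl : 0 < z.length := List.length_pos_iff.2 hz
  simp only [substrings, List.mem_flatMap, List.mem_map, List.mem_range, List.length_append]
  refine ⟨s.length, by omega, z.length - 1, by omega, ?_⟩
  rw [Nat.sub_add_cancel hl, List.append_assoc, List.drop_left, List.take_left]

theorem length_substrings_le (y : List α) : (substrings y).length ≤ y.length * y.length := by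
  rw [substrings, List.length_flatMap]
  refine (List.sum_le_card_nsmul _ y.length ?_).trans (by simp)
  intro n hn
  simp only [List.mem_map, List.mem_range] at hn
  obtain ⟨a, ha, rfl⟩ := hn
  simp

theorem length_le_of_mem_substrings {y z : List α} (h : z ∈ substrings y) :
    z.length ≤ y.length := by
  simp only [substrings, List.mem_flatMap, List.mem_map, List.mem_range] at h
  obtain ⟨a, ha, b, hb, rfl⟩ := h
  simp only [List.length_take, List.length_drop]
  omega

end

end PRC

namespace PRC

/-! ### Few blocks of a random placement start in a sparse set -/

/-- Block `0` is inserted last. Once its position `a ∈ B` is fixed, the other blocks must lie in `B`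
after being shifted, so they start in a preimage of `B`, which is no larger than `B`. There are `n +
k + 1 ≥ n` places for block `0`, so each block contributes a factor of at most `|B| / n`. -/
theorem Choices.card_filter_le {ℓ : ℕ} (hℓ : 0 < ℓ) {n : ℕ} (t : ℕ) :
    ∀ (k : ℕ) (_ : t ≤ k) (B : Finset ℕ),
      (Finset.univ.filter fun x : Choices n k => ∀ i : Fin k, (i : ℕ) < t → x.loc ℓ i ∈ B).card
        * n ^ t ≤ B.card ^ t * Fintype.card (Choices n k) := by
  induction t with
  | zero =>
    intro k _ B
    simp
  | succ t ih =>
    intro k hk B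
    obtain ⟨k, rfl⟩ : ∃ k', k = k' + 1 := ⟨k - 1, by omega⟩
    classical
    let pre : ℕ → Finset ℕ := fun a => B.preimage (shiftPos ℓ a) (shiftPos_injective ℓ a).injOn
    have hpre : ∀ a, (pre a).card ≤ B.card := fun a => by
      rw [← Finset.card_map ⟨shiftPos ℓ a, shiftPos_injective ℓ a⟩]
      refine Finset.card_le_card fun b hb => ?_
      obtain ⟨c, hc, rfl⟩ := Finset.mem_map.1 hb
      exact Finset.mem_preimage.1 hc
    have hcard : Fintype.card (Choices n (k + 1)) = Fintype.card (Choices n k) * (n + k + 1) := by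
      have : Fintype.card (Choices n (k + 1)) = Fintype.card (Choices n k × Fin (n + k + 1)) := rfl
      rw [this, Fintype.card_prod, Fintype.card_fin]
    have h1 : (Finset.univ.filter fun x : Choices n (k + 1) =>
        ∀ i : Fin (k + 1), (i : ℕ) < t + 1 → x.loc ℓ i ∈ B).card
        ≤ ∑ a ∈ B, (Finset.univ.filter fun x : Choices n k =>
          ∀ i : Fin k, (i : ℕ) < t → x.loc ℓ i ∈ pre a).card := by
      rw [← Finset.card_sigma]
      -- A sequence of choices is determined by the position of block `0` and the choices of the
      -- other blocks, since positions determine choices.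
      refine Finset.card_le_card_of_injOn
        (fun x => ⟨((Choices.lens ℓ x.1).take x.2).sum, x.1⟩) ?_ ?_
      · intro x hx
        have hx := (Finset.mem_filter.1 hx).2
        refine Finset.mem_sigma.2 ⟨hx 0 (by simp), Finset.mem_filter.2 ⟨Finset.mem_univ _, ?_⟩⟩
        intro i hi
        exact Finset.mem_preimage.2 (hx i.succ (by simpa using hi))
      · intro x _ y _ hxy
        have h2 := Sigma.mk.inj_iff.1 hxy
        refine Choices.loc_injective hℓ ?_
        show insertPos ℓ _ _ = insertPos ℓ _ _
        rw [h2.1, eq_of_heq h2.2]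
    calc _ ≤ (∑ a ∈ B, (Finset.univ.filter fun x : Choices n k =>
          ∀ i : Fin k, (i : ℕ) < t → x.loc ℓ i ∈ pre a).card) * n ^ (t + 1) :=
          Nat.mul_le_mul_right _ h1
      _ = ∑ a ∈ B, (Finset.univ.filter fun x : Choices n k =>
          ∀ i : Fin k, (i : ℕ) < t → x.loc ℓ i ∈ pre a).card * n ^ t * n := by
          rw [Finset.sum_mul]
          exact Finset.sum_congr rfl fun a _ => by ring
      _ ≤ ∑ _a ∈ B, B.card ^ t * Fintype.card (Choices n k) * (n + k + 1) :=
          Finset.sum_le_sum fun a _ => Nat.mul_le_mul ((ih k (by omega) (pre a)).trans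
            (Nat.mul_le_mul_right _ (Nat.pow_le_pow_left (hpre a) t))) (by omega)
      _ = B.card ^ (t + 1) * Fintype.card (Choices n (k + 1)) := by
          rw [Finset.sum_const, smul_eq_mul, hcard]
          ring

section tail

variable {k ℓ n N : ℕ} (hℓ : 0 < ℓ) (hN : N = n + k * ℓ)
include hℓ hN

theorem placements_eq_image [DecidableEq (Fin k → Fin (N + 1))] :
    placements k ℓ N = Finset.univ.image (Choices.locFin hℓ hN) := by
  subst hN
  ext loc
  rw [mem_placements_iff hℓ, Finset.mem_image]
  constructor
  · intro h1
    obtain ⟨x, hx⟩ := Choices.exists_loc_eq hℓ h1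
    exact ⟨x, Finset.mem_univ _, funext fun i => Fin.ext (congrFun hx i)⟩
  · rintro ⟨x, -, rfl⟩
    exact (Choices.boundary_iff hℓ x).1

/-- The set of placements is invariant under permutations of the blocks, so an arbitrary set `T` of
blocks can be moved to the first `T.card` indices. -/
theorem card_placements_filter_le (B : Finset ℕ) (T : Finset (Fin k)) :
    ((placements k ℓ N).filter fun loc => ∀ i ∈ T, (loc i : ℕ) ∈ B).card * n ^ T.card
      ≤ B.card ^ T.card * (placements k ℓ N).card := by
  classical
  have hinj : Function.Injective (Choices.locFin (n := n) hℓ hN) := fun x y hxy =>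
    Choices.loc_injective hℓ (funext fun i => congrArg Fin.val (congrFun hxy i))
  have hT : T.card ≤ k := by simpa using Finset.card_le_univ T
  have h1 := Choices.card_filter_le (n := n) hℓ T.card k hT B
  have h2 : (placements k ℓ N).card = Fintype.card (Choices n k) := by
    rw [placements_eq_image hℓ hN, Finset.card_image_of_injective _ hinj, Finset.card_univ]
  rw [h2]
  refine le_trans (Nat.mul_le_mul_right _ ?_) h1
  have e : {i : Fin k // (i : ℕ) < T.card} ≃ {i : Fin k // i ∈ T} := by
    refine Fintype.equivOfCardEq ?_
    rw [Fintype.card_subtype, Fintype.card_coe]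
    rw [Fin.card_filter_val_lt, min_eq_right hT]
  let σ : Equiv.Perm (Fin k) := e.extendSubtype
  rw [← Finset.card_image_of_injective _ hinj]
  refine Finset.card_le_card_of_injOn (fun loc i => loc (σ i)) ?_ ?_
  · intro loc hloc
    obtain ⟨h3, h4⟩ := Finset.mem_filter.1 hloc
    have h5 : (fun i => loc (σ i)) ∈ placements k ℓ N := by
      simp only [placements, Finset.mem_filter, Finset.mem_univ, true_and] at h3 ⊢
      exact ⟨fun i => h3.1 _, fun i j hij => h3.2 _ _ fun h => hij (σ.injective h)⟩
    rw [placements_eq_image hℓ hN] at h5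
    obtain ⟨x, -, hx⟩ := Finset.mem_image.1 h5
    refine Finset.mem_coe.2 (Finset.mem_image.2 ⟨x, Finset.mem_filter.2 ⟨Finset.mem_univ _, ?_⟩, hx⟩)
    intro i hi
    have := h4 (σ i) (e.extendSubtype_mem i hi)
    rwa [show x.loc ℓ i = (loc (σ i) : ℕ) from congrArg Fin.val (congrFun hx i)]
  · intro loc _ loc' _ h
    funext i
    have := congrFun h (σ.symm i)
    simpa using this

/-- Expanding `(1 + θ) ^ count` over subsets of `H` leaves nonnegative multiples of the
probabilities that all blocks of a subset start in `B`. Each is at most its value for independent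
blocks, so the sum is at most the binomial one. The blocks need not be independent. -/
theorem placements_mgf_le (hn : 0 < n) (B : Finset ℕ) (H : Finset (Fin k)) {θ : ℝ} (hθ : 0 ≤ θ) :
    ∑ loc ∈ placements k ℓ N, (1 + θ) ^ (H.filter fun i => (loc i : ℕ) ∈ B).card
      ≤ (placements k ℓ N).card * (1 + θ * (B.card / n)) ^ H.card := by
  classical
  have h1 : ∀ loc : Fin k → Fin (N + 1),
      (1 + θ) ^ (H.filter fun i => (loc i : ℕ) ∈ B).card
        = ∑ T ∈ H.powerset, if ∀ i ∈ T, (loc i : ℕ) ∈ B then θ ^ T.card else 0 := by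
    intro loc
    have : (1 + θ) ^ (H.filter fun i => (loc i : ℕ) ∈ B).card
        = ∏ i ∈ H, (1 + if (loc i : ℕ) ∈ B then θ else 0) := by
      rw [← Finset.prod_const, Finset.prod_filter]
      exact Finset.prod_congr rfl fun i _ => by split_ifs <;> simp
    rw [this, Finset.prod_one_add]
    refine Finset.sum_congr rfl fun T _ => ?_
    split_ifs with h
    · rw [← Finset.prod_const]
      exact Finset.prod_congr rfl fun i hi => if_pos (h i hi)
    · push Not at h
      obtain ⟨i, hi, hiB⟩ := h
      exact Finset.prod_eq_zero hi (if_neg hiB)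
  simp only [h1]
  rw [Finset.sum_comm]
  have h2 : ((1 : ℝ) + θ * (B.card / n)) ^ H.card
      = ∑ T ∈ H.powerset, (θ * (B.card / n)) ^ T.card := by
    rw [← Finset.prod_const, Finset.prod_one_add]
    exact Finset.sum_congr rfl fun T _ => Finset.prod_const _
  rw [h2, Finset.mul_sum]
  refine Finset.sum_le_sum fun T _ => ?_
  rw [← Finset.sum_filter, Finset.sum_const, nsmul_eq_mul, mul_pow, div_pow]
  have h3 : (((placements k ℓ N).filter fun loc => ∀ i ∈ T, (loc i : ℕ) ∈ B).card : ℝ)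
      * (n : ℝ) ^ T.card ≤ (B.card : ℝ) ^ T.card * (placements k ℓ N).card := by
    exact_mod_cast card_placements_filter_le hℓ hN B T
  have hn' : (0 : ℝ) < (n : ℝ) ^ T.card := by positivity
  rw [← le_div_iff₀ hn'] at h3
  calc _ ≤ (B.card : ℝ) ^ T.card * (placements k ℓ N).card / (n : ℝ) ^ T.card * θ ^ T.card :=
        mul_le_mul_of_nonneg_right h3 (by positivity)
    _ = _ := by ring

theorem placements_tail (hn : 0 < n) (h : (placements k ℓ N).Nonempty) (B : Finset ℕ)
    (H : Finset (Fin k)) {θ τ : ℝ} (hθ : 0 ≤ θ) :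
    prob (PMF.uniformOfFinset (placements k ℓ N) h)
      {loc | τ < (H.filter fun i => (loc i : ℕ) ∈ B).card}
      ≤ (1 + θ * (B.card / n)) ^ H.card / (1 + θ) ^ τ := by
  classical
  have hc : (0 : ℝ) < (placements k ℓ N).card := by exact_mod_cast h.card_pos
  have hpos : (0 : ℝ) < (1 + θ) ^ τ := Real.rpow_pos_of_pos (by linarith) _
  have h1 : prob (PMF.uniformOfFinset (placements k ℓ N) h)
      {loc | τ < (H.filter fun i => (loc i : ℕ) ∈ B).card}
      = ((placements k ℓ N).filter fun loc =>
        τ < (H.filter fun i => (loc i : ℕ) ∈ B).card).card / (placements k ℓ N).card := by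
    rw [prob, PMF.toOuterMeasure_uniformOfFinset_apply, ENNReal.toReal_div]
    simp
  rw [h1, div_le_div_iff₀ hc hpos]
  -- Markov's inequality for `(1 + θ) ^ count`.
  calc _ = ∑ loc ∈ (placements k ℓ N).filter fun loc =>
        τ < (H.filter fun i => (loc i : ℕ) ∈ B).card, (1 + θ) ^ τ := by
        rw [Finset.sum_const, nsmul_eq_mul]
    _ ≤ ∑ loc ∈ (placements k ℓ N).filter fun loc =>
        τ < (H.filter fun i => (loc i : ℕ) ∈ B).card,
          (1 + θ) ^ (H.filter fun i => (loc i : ℕ) ∈ B).card := by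
        refine Finset.sum_le_sum fun loc hloc => ?_
        rw [← Real.rpow_natCast]
        exact Real.rpow_le_rpow_of_exponent_le (by linarith) (Finset.mem_filter.1 hloc).2.le
    _ ≤ ∑ loc ∈ placements k ℓ N, (1 + θ) ^ (H.filter fun i => (loc i : ℕ) ∈ B).card :=
        Finset.sum_le_sum_of_subset_of_nonneg (Finset.filter_subset _ _) fun _ _ _ => by positivity
    _ ≤ _ := (placements_mgf_le hℓ hN hn B H hθ).trans_eq (mul_comm _ _)

end tail

end PRC

namespace PRC

/-! ### Soundness of the construction -/

section anyAccepts

variable {α β κ : Type}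

theorem prob_bind_le_add_bind [Fintype κ] {γ δ : Type} {μ : PMF κ} {f : κ → PMF α} {g : κ → PMF γ}
    {h : κ → PMF δ} {S : Set α} {T : Set γ} {U : Set δ}
    (H : ∀ a, prob (f a) S ≤ prob (g a) T + prob (h a) U) :
    prob (μ.bind f) S ≤ prob (μ.bind g) T + prob (μ.bind h) U := by
  rw [prob_bind_fintype, prob_bind_fintype, prob_bind_fintype, ← Finset.sum_add_distrib]
  refine Finset.sum_le_sum fun a _ => ?_
  rw [← mul_add]
  exact mul_le_mul_of_nonneg_left (H a) ENNReal.toReal_nonneg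

theorem prob_anyAccepts_false_le (f : α → PMF (Option β)) {z : α} {zs : List α} (hz : z ∈ zs) :
    prob (anyAccepts f zs) {false} ≤ prob (f z) {none} := by
  induction zs with
  | nil => exact absurd hz List.not_mem_nil
  | cons w zs ih =>
    rcases List.mem_cons.1 hz with rfl | hz
    · rw [← add_zero (prob (f z) {none})]
      refine prob_bind_le_add {none} le_rfl fun o _ ho => ?_
      obtain ⟨b, rfl⟩ := Option.ne_none_iff_exists'.1 ho
      rw [prob_map]
      exact (prob_mono (T := ∅) _ fun a _ ha => absurd ha (by simp)).trans_eq (by simp [prob])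
    · refine prob_bind_le fun o _ => ?_
      rw [prob_map]
      refine (prob_mono _ fun b _ hb => ?_).trans (ih hz)
      have : (o.isSome || b) = false := hb
      rw [Bool.or_eq_false_iff] at this
      exact this.2

/-- A union bound over the list, with the key averaged separately in each term: the tests share one
key and are not independent. -/
theorem prob_anyAccepts_true_le [Fintype κ] {μ : PMF κ} {f : κ → α → PMF (Option β)}
    {zs : List α} {c : ℝ} (h : ∀ z ∈ zs, prob (μ.bind fun a => f a z) {none}ᶜ ≤ c) :
    prob (μ.bind fun a => anyAccepts (f a) zs) {true} ≤ zs.length * c := by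
  induction zs with
  | nil =>
    refine (prob_bind_le fun a _ => ?_).trans (by simp : (0 : ℝ) ≤ _)
    exact (prob_pure_of_notMem (by simp)).le
  | cons z zs ih =>
    have h1 : prob (μ.bind fun a => anyAccepts (f a) (z :: zs)) {true}
        ≤ prob (μ.bind fun a => f a z) {none}ᶜ
          + prob (μ.bind fun a => anyAccepts (f a) zs) {true} := by
      refine prob_bind_le_add_bind fun a => ?_
      refine prob_bind_le_add {none}ᶜ (prob_nonneg _ _) fun o _ ho => ?_
      obtain rfl : o = none := by simpa using ho
      rw [prob_map]
      exact prob_mono _ fun b _ hb => by simpa using hb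
    have h2 := h z List.mem_cons_self
    have h3 := ih fun w hw => h w (List.mem_cons_of_mem _ hw)
    rw [List.length_cons]
    push_cast
    linarith

end anyAccepts

variable {q : ℕ} {M ℓ n d d' r : ℕ → ℕ}

theorem Scheme.Sound.anyAccepts {S₀ : Scheme q (fun _ => 1) ℓ} (hS : S₀.Sound)
    (P : Polynomial ℕ) :
    ∃ ν, Negligible ν ∧ ∀ lam (y : List (Fin q)), y.length ≤ P.eval lam →
      prob ((S₀.keyGen lam).bind fun k => PRC.anyAccepts (S₀.dec lam k.2) (substrings y)) {true}
        ≤ ν lam := by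
  obtain ⟨ν, hν, h⟩ := hS P
  refine ⟨_, hν.poly_mul (P * P), fun lam y hy => ?_⟩
  refine (prob_anyAccepts_true_le (c := ν lam) fun z hz => ?_).trans ?_
  · rw [prob_compl]
    linarith [h lam z ((length_le_of_mem_substrings hz).trans hy)]
  · refine mul_le_mul_of_nonneg_right ?_ (hν.1 lam)
    rw [Polynomial.eval_mul]
    exact_mod_cast (length_substrings_le y).trans (Nat.mul_le_mul hy hy)

theorem prob_indep_le {α : Type} {k : ℕ} (μ : Fin k → PMF α) (i : Fin k) (S : Set α) :
    prob (indep μ) {f | f i ∈ S} = prob (μ i) S := by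
  rw [← indep_map_eval μ i, prob_map]
  rfl

/-- Output other than `⊥` requires one of the last `d'` tests to accept a substring. The word is
fixed in advance and each test has its own fresh key, so a union bound over tests and substrings
suffices. -/
theorem genericPRC_sound [NeZero q] {S₀ : Scheme q (fun _ => 1) ℓ} {L : PayloadCode q M n d r}
    {C : SeedCode d d'} {ρ : ℝ} (hL : L.Efficient) (hC : C.Corrects ρ)
    (hS : S₀.Sound) : (genericPRC S₀ L C).Sound := by
  intro P
  obtain ⟨ν, hν, h⟩ := hS.anyAccepts P
  obtain ⟨D, hD⟩ := (hC.lenPT hL).exists_le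
  refine ⟨_, hν.poly_mul D, fun lam c hc => ?_⟩
  suffices h1 : prob (((genericPRC S₀ L C).keyGen lam).bind fun k =>
      (genericPRC S₀ L C).dec lam k.2 c) {none}ᶜ ≤ (D.eval lam : ℕ) * ν lam by
    rw [prob_compl] at h1
    linarith
  rw [genericPRC_keyGen_bind, PMF.bind_comm]
  refine prob_bind_le fun shift _ => ?_
  simp only [genericPRC_dec_joinKeys]
  rw [← PMF.map_bind, indep_bind (fun _ => S₀.keyGen lam)
    (fun _ k => PRC.anyAccepts (S₀.dec lam k.2) (substrings c)), prob_map]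
  refine (prob_mono (T := ⋃ j ∈ (Finset.univ : Finset (Fin (d' lam))),
    {st | st (Fin.natAdd (d' lam) j) ∈ ({true} : Set Bool)}) _ fun st _ hst => ?_).trans ?_
  · by_contra hno
    refine hst ?_
    show decodeTests L C lam st shift c = none
    rw [decodeTests, if_pos]
    intro j
    by_contra hj
    exact hno (Set.mem_iUnion₂.2 ⟨j, Finset.mem_univ _, by simpa using hj⟩)
  · refine (prob_iUnion_le _ _ _).trans ?_
    simp only [prob_indep_le]
    rw [Finset.sum_const, Finset.card_univ, Fintype.card_fin, nsmul_eq_mul]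
    exact mul_le_mul (by exact_mod_cast hD lam) (h lam c hc) (prob_nonneg _ _) (Nat.cast_nonneg _)

end PRC

namespace PRC

/-! ### Growth of the parameters -/

theorem editBounded_id {α : Type} {p : ℕ → ℝ} (hp : ∀ k, p k ∈ Set.Icc (0 : ℝ) 1) :
    EditBounded (α := α) p id := fun x => by
  rw [id, editDist_self, Nat.cast_zero]
  exact mul_nonneg (hp _).1 (Nat.cast_nonneg _)

variable {q : ℕ} {ℓ : ℕ → ℕ}

theorem prob_bind_le_sum {α β : Type} [Fintype α] (μ : PMF α) (f : α → PMF β) (S : Set β) :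
    prob (μ.bind f) S ≤ ∑ a, prob (f a) S := by
  rw [prob_bind_fintype]
  refine Finset.sum_le_sum fun a _ => mul_le_of_le_one_left (prob_nonneg _ _) ?_
  exact ENNReal.toReal_le_of_le_ofReal zero_le_one (by simpa using μ.coe_le_one a)

/-- As fixed words are rejected and codewords are accepted, there are superpolynomially many words
of length `ℓ`. -/
theorem Scheme.exists_pow_mul_ge {S₀ : Scheme q (fun _ => 1) ℓ} (hE : S₀.Efficient)
    (hR : S₀.Robust id) (hS : S₀.Sound) :
    ∃ ν, Negligible ν ∧ ∀ᶠ lam in atTop, (1 / 2 : ℝ) ≤ (q : ℝ) ^ ℓ lam * ν lam := by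
  obtain ⟨P, hP⟩ := hE.lenPT.exists_le
  obtain ⟨ν', hν', h'⟩ := hR
  obtain ⟨ν, hν, h⟩ := hS P
  refine ⟨ν, hν, ?_⟩
  filter_upwards [hν'.tendsto.eventually_le_const (show (0 : ℝ) < 1 / 2 by norm_num)] with lam hlam
  have h1 := h' lam 0
  -- For each key, the event that the codeword is accepted is covered by the events that a given
  -- word is accepted, the chance of encoding to that word being bounded by one.
  have h2 : prob ((S₀.keyGen lam).bind fun k => (S₀.enc lam k.1 0).bind fun x =>
      S₀.dec lam k.2 (id (List.ofFn x))) {some 0}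
      ≤ ∑ c : Fin (ℓ lam) → Fin q,
        prob ((S₀.keyGen lam).bind fun k => S₀.dec lam k.2 (List.ofFn c)) {none}ᶜ := by
    simp only [prob_bind_fintype (S₀.keyGen lam)]
    rw [Finset.sum_comm]
    refine Finset.sum_le_sum fun k _ => ?_
    rw [← Finset.mul_sum]
    refine mul_le_mul_of_nonneg_left ?_ ENNReal.toReal_nonneg
    refine (prob_bind_le_sum _ _ _).trans (Finset.sum_le_sum fun c _ => ?_)
    exact prob_mono _ fun o _ ho => by
      rw [Set.mem_singleton_iff.1 ho]
      simp
  have h3 : ∑ c : Fin (ℓ lam) → Fin q,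
      prob ((S₀.keyGen lam).bind fun k => S₀.dec lam k.2 (List.ofFn c)) {none}ᶜ
      ≤ ∑ _c : Fin (ℓ lam) → Fin q, ν lam := by
    refine Finset.sum_le_sum fun c _ => ?_
    rw [prob_compl]
    linarith [h lam (List.ofFn c) (by simpa using hP lam)]
  rw [Finset.sum_const, Finset.card_univ, Fintype.card_fun, Fintype.card_fin, Fintype.card_fin,
    nsmul_eq_mul, Nat.cast_pow] at h3
  linarith

/-- `f` grows faster than any multiple of the logarithm. -/
def SuperLog (f : ℕ → ℕ) : Prop := ∀ A : ℝ, ∀ᶠ k : ℕ in atTop, A * Real.log k ≤ f k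

theorem Scheme.superLog [NeZero q] {S₀ : Scheme q (fun _ => 1) ℓ} (hE : S₀.Efficient)
    (hR : S₀.Robust id) (hS : S₀.Sound) : SuperLog ℓ := by
  intro A
  obtain ⟨ν, hν, h⟩ := S₀.exists_pow_mul_ge hE hR hS
  have hq : (1 : ℝ) ≤ q := by exact_mod_cast Nat.one_le_iff_ne_zero.2 (NeZero.ne q)
  have hlq : 0 ≤ Real.log q := Real.log_nonneg hq
  -- After taking logarithms the additional `1` in the exponent contributes `log k`, which beats
  -- `log 2` for `k ≥ 3`. The resulting strict inequality also excludes a one-letter alphabet, for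
  -- which `log q = 0`.
  obtain ⟨k₀, hk₀⟩ := hν.2 (|A| * Real.log q + 1) (by positivity)
  filter_upwards [h, eventually_ge_atTop k₀, eventually_ge_atTop 3] with k h1 h2 h3
  have hk : (3 : ℝ) ≤ k := by exact_mod_cast h3
  have h4 : (1 / 2 : ℝ) ≤ (q : ℝ) ^ ℓ k * (k : ℝ) ^ (-(|A| * Real.log q + 1)) :=
    h1.trans (mul_le_mul_of_nonneg_left (hk₀ k h2) (by positivity))
  have h5 := Real.log_le_log (by norm_num) h4
  rw [Real.log_mul (by positivity) (Real.rpow_pos_of_pos (by linarith) _).ne', Real.log_pow,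
    Real.log_rpow (by linarith), one_div, Real.log_inv] at h5
  have h6 : Real.log 2 < Real.log k := Real.log_lt_log (by norm_num) (by linarith)
  have hlk : 0 ≤ Real.log k := Real.log_nonneg (by linarith)
  have h7 : |A| * Real.log k * Real.log q < ℓ k * Real.log q := by nlinarith
  have h8 : |A| * Real.log k < ℓ k := lt_of_mul_lt_mul_right h7 hlq
  nlinarith [le_abs_self A]

theorem SuperLog.tendsto {f : ℕ → ℕ} (hf : SuperLog f) :
    Tendsto (fun k => (f k : ℝ)) atTop atTop :=
  tendsto_atTop_mono' _ ((hf 1).mono fun k hk => by simpa using hk)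
    (Real.tendsto_log_atTop.comp tendsto_natCast_atTop_atTop)

theorem SuperLog.of_isBigO {f g : ℕ → ℕ} (hf : SuperLog f)
    (h : (fun k => (f k : ℝ)) =O[atTop] fun k => (g k : ℝ)) : SuperLog g := by
  intro A
  obtain ⟨c, hc, h⟩ := h.exists_pos
  filter_upwards [hf (c * A), h.bound] with k h1 h2
  rw [Real.norm_natCast, Real.norm_natCast] at h2
  refine le_of_mul_le_mul_left ?_ hc
  linarith

theorem SuperLog.negligible {f : ℕ → ℕ} (hf : SuperLog f) {ρ : ℝ} (hρ : 0 < ρ) (hρ' : ρ < 1) :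
    Negligible fun k => ρ ^ f k := by
  refine ⟨fun k => by positivity, fun c hc => ?_⟩
  have hl : 0 < -Real.log ρ := neg_pos.2 (Real.log_neg hρ hρ')
  obtain ⟨k₀, hk₀⟩ := eventually_atTop.1 (hf (c / -Real.log ρ))
  refine ⟨max k₀ 1, fun k hk => ?_⟩
  have h1 := hk₀ k (le_of_max_le_left hk)
  have hk1 : (0 : ℝ) < k := by exact_mod_cast (le_of_max_le_right hk : 1 ≤ k)
  rw [div_mul_eq_mul_div, div_le_iff₀ hl] at h1
  rw [← Real.log_le_log_iff (by positivity) (Real.rpow_pos_of_pos hk1 _), Real.log_pow,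
    Real.log_rpow hk1]
  linarith

section parameters

variable {n d' : ℕ → ℕ} {γ : ℝ}

/-- Nothing is assumed about the growth of `n` itself; since `ℓ` is of order `n ^ γ` with `γ > 0`,
it is forced by the growth of `ℓ`. -/
theorem tendsto_len (hγ : 0 < γ) (hℓ' : Tendsto (fun k => (ℓ k : ℝ)) atTop atTop)
    (hℓ : (fun k => (ℓ k : ℝ)) =Θ[atTop] fun k => (n k : ℝ) ^ γ) :
    Tendsto (fun k => (n k : ℝ)) atTop atTop := by
  have h1 : Tendsto (fun k => (n k : ℝ) ^ γ) atTop atTop := by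
    obtain ⟨c, hc, h⟩ := hℓ.isBigO.exists_pos
    refine tendsto_atTop_mono' _ ?_ (hℓ'.atTop_div_const hc)
    filter_upwards [h.bound] with k hk
    rw [Real.norm_natCast, Real.norm_of_nonneg (by positivity)] at hk
    rw [div_le_iff₀ hc]
    linarith
  refine tendsto_atTop.2 fun b => ?_
  filter_upwards [h1.eventually_gt_atTop (|b| ^ γ)] with k hk
  have := (Real.rpow_lt_rpow_iff (abs_nonneg b) (Nat.cast_nonneg (n k)) hγ).1 hk
  exact (le_abs_self b).trans this.le

/-- The overhead is of order `n ^ (2 * γ)`, and `2 * γ < 1`. -/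
theorem eventually_overhead_le (hγ' : γ < 1 / 2)
    (hn : Tendsto (fun k => (n k : ℝ)) atTop atTop)
    (hd' : (fun k => (d' k : ℝ)) =Θ[atTop] fun k => (n k : ℝ) ^ γ)
    (hℓ : (fun k => (ℓ k : ℝ)) =Θ[atTop] fun k => (n k : ℝ) ^ γ) {κ : ℝ} (hκ : 0 < κ) :
    ∀ᶠ k in atTop, 2 * (d' k : ℝ) * ℓ k ≤ κ * n k := by
  have h1 : (fun k => (d' k : ℝ) * ℓ k) =O[atTop] fun k => (n k : ℝ) ^ γ * (n k : ℝ) ^ γ :=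
    hd'.isBigO.mul hℓ.isBigO
  have h2 : (fun k => (n k : ℝ) ^ γ * (n k : ℝ) ^ γ) =o[atTop] fun k => (n k : ℝ) := by
    have h3 : (fun x : ℝ => x ^ (γ + γ)) =o[atTop] fun x : ℝ => x := by
      refine (isLittleO_iff_tendsto' ?_).2 ?_
      · filter_upwards [eventually_gt_atTop 0] with x hx h
        exact absurd h hx.ne'
      · refine (tendsto_rpow_neg_atTop (show 0 < 1 - 2 * γ by linarith)).congr' ?_
        filter_upwards [eventually_gt_atTop 0] with x hx
        rw [show -(1 - 2 * γ) = γ + γ - 1 by ring, Real.rpow_sub_one hx.ne']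
    refine (h3.comp_tendsto hn).congr' ?_ EventuallyEq.rfl
    filter_upwards [hn.eventually_gt_atTop 0] with k hk
    exact Real.rpow_add hk _ _
  filter_upwards [(h1.trans_isLittleO h2).bound (half_pos hκ)] with k hk
  rw [Real.norm_natCast, Real.norm_of_nonneg (by positivity)] at hk
  linarith

end parameters

end PRC

namespace PRC

/-! ### Missed blocks -/

variable {q : ℕ} {ℓ : ℕ → ℕ}

theorem prob_bind_le_bind {α β κ : Type} {μ : PMF α} {f : α → PMF β} {g : α → PMF κ}
    {S : Set β} {T : Set κ}
    (h : ∀ a ∈ μ.support, prob (f a) S ≤ prob (g a) T) :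
    prob (μ.bind f) S ≤ prob (μ.bind g) T := by
  refine ENNReal.toReal_mono (toOuterMeasure_ne_top _ _) ?_
  rw [PMF.toOuterMeasure_bind_apply, PMF.toOuterMeasure_bind_apply]
  refine ENNReal.tsum_le_tsum fun a => ?_
  by_cases ha : a ∈ μ.support
  · refine mul_le_mul_right ?_ _
    rw [← ofReal_prob, ← ofReal_prob]
    exact ENNReal.ofReal_le_ofReal (h a ha)
  · rw [PMF.mem_support_iff, not_not] at ha
    rw [ha, zero_mul, zero_mul]

/-- The probability that a codeword is rejected after passing through the channel. -/
noncomputable def Scheme.missProb (S₀ : Scheme q (fun _ => 1) ℓ) (lam : ℕ)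
    (E : List (Fin q) → List (Fin q)) : ℝ :=
  prob ((S₀.keyGen lam).bind fun k => (S₀.enc lam k.1 0).bind fun v =>
    S₀.dec lam k.2 (E (List.ofFn v))) {none}

theorem Scheme.Robust.missProb_negligible {S₀ : Scheme q (fun _ => 1) ℓ}
    {E : List (Fin q) → List (Fin q)} (h : S₀.Robust E) :
    ∃ ν, Negligible ν ∧ ∀ lam, S₀.missProb lam E ≤ ν lam := by
  obtain ⟨ν, hν, h⟩ := h
  refine ⟨ν, hν, fun lam => ?_⟩
  have h1 := h lam 0
  have h2 : S₀.missProb lam E ≤ _ := prob_mono (T := {some 0}ᶜ) _ fun o _ ho => by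
    rw [Set.mem_singleton_iff.1 ho]
    simp
  rw [prob_compl] at h2
  linarith

/-- A scheme that is robust to each bounded channel is robust to all of them uniformly. -/
theorem Scheme.exists_missProb_le {S₀ : Scheme q (fun _ => 1) ℓ} {p₀ : ℕ → ℝ}
    (hp₀ : ∀ k, p₀ k ∈ Set.Icc (0 : ℝ) 1)
    (hR : ∀ E : List (Fin q) → List (Fin q), EditBounded p₀ E → S₀.Robust E)
    (hℓ : Tendsto (fun k => (ℓ k : ℝ)) atTop atTop) :
    ∃ ν, Negligible ν ∧ ∀ lam (E : List (Fin q) → List (Fin q)), EditBounded p₀ E →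
      S₀.missProb lam E ≤ ν lam := by
  classical
  let V : ℕ → Set ℝ := fun lam => {x | ∃ E, EditBounded p₀ E ∧ S₀.missProb lam E = x}
  have hV : ∀ lam, BddAbove (V lam) := fun lam => ⟨1, by
    rintro x ⟨E, -, rfl⟩
    exact prob_le_one _ _⟩
  have hV0 : ∀ lam, S₀.missProb lam id ∈ V lam := fun lam => ⟨id, editBounded_id hp₀, rfl⟩
  refine ⟨fun lam => sSup (V lam), ⟨fun lam => ?_, fun c hc => ?_⟩, fun lam E hE =>
    le_csSup (hV lam) ⟨E, hE, rfl⟩⟩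
  · exact (prob_nonneg _ _).trans (le_csSup (hV lam) (hV0 lam))
  by_contra! hcon
  have hex : ∀ lam : ℕ, ∃ E, EditBounded p₀ E ∧
      ((lam : ℝ) ^ (-c) < sSup (V lam) → (lam : ℝ) ^ (-c) < S₀.missProb lam E) := by
    intro lam
    by_cases h : (lam : ℝ) ^ (-c) < sSup (V lam)
    · obtain ⟨x, ⟨E, hE, rfl⟩, hx⟩ := exists_lt_of_lt_csSup ⟨_, hV0 lam⟩ h
      exact ⟨E, hE, fun _ => hx⟩
    · exact ⟨id, editBounded_id hp₀, fun h' => absurd h' h⟩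
  choose E hE hbad using hex
  -- A channel sees the length of a word but not `lam`, and several parameters may share a codeword
  -- length. The diagonal channel therefore uses, on words of length `L`, the bad channel of one
  -- chosen violating parameter with this length, if there is one.
  let g : ℕ → ℕ := fun L =>
    if h : ∃ lam, ℓ lam = L ∧ (lam : ℝ) ^ (-c) < sSup (V lam) then h.choose else 0
  obtain ⟨ν, hν, h⟩ := (hR (fun x => E (g x.length) x) fun x => hE _ x).missProb_negligible
  obtain ⟨k₀, hk₀⟩ := hν.2 c hc
  obtain ⟨k₁, hk₁⟩ := eventually_atTop.1
    (hℓ.eventually_gt_atTop (((Finset.range k₀).sup ℓ : ℕ) : ℝ))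
  obtain ⟨lam, hlam, hlt⟩ := hcon k₁
  have hg : ∃ lam', ℓ lam' = ℓ lam ∧ (lam' : ℝ) ^ (-c) < sSup (V lam') := ⟨lam, rfl, hlt⟩
  have hspec := hg.choose_spec
  have hgeq : g (ℓ lam) = hg.choose := dif_pos hg
  generalize hg.choose = lam' at hspec hgeq
  -- The chosen parameter may differ from `lam`, but it has the same codeword length. This length
  -- exceeds those of all parameters below `k₀`, so the chosen parameter is large too.
  have hge : k₀ ≤ lam' := by
    by_contra hlt'
    have h1 : ℓ lam' ≤ (Finset.range k₀).sup ℓ :=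
      Finset.le_sup (Finset.mem_range.2 (not_le.1 hlt'))
    have h2 : (Finset.range k₀).sup ℓ < ℓ lam := by exact_mod_cast hk₁ lam hlam
    omega
  have h3 := hbad lam' hspec.2
  have h4 : S₀.missProb lam' (fun x => E (g x.length) x) = S₀.missProb lam' (E lam') := by
    simp only [Scheme.missProb, List.length_ofFn, hspec.1, hgeq]
  have h5 := h lam'
  rw [h4] at h5
  linarith [hk₀ lam' hge]

/-- If the block that carries a codeword is mapped to a word close to it, then the tests on the
substrings of a word that contains the latter succeed. -/
theorem Scheme.exists_miss_le {S₀ : Scheme q (fun _ => 1) ℓ} {p₀ : ℕ → ℝ}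
    (hp₀ : ∀ k, p₀ k ∈ Set.Icc (0 : ℝ) 1)
    (hR : ∀ E : List (Fin q) → List (Fin q), EditBounded p₀ E → S₀.Robust E) (hS : S₀.Sound)
    (hℓ : Tendsto (fun k => (ℓ k : ℝ)) atTop atTop) :
    ∃ ν, Negligible ν ∧ ∀ lam (Y : (Fin (ℓ lam) → Fin q) → List (Fin q))
      (G : (Fin (ℓ lam) → Fin q) → Bool),
      (∀ v, G v = true → ∃ w, w <:+: Y v ∧
        (editDist (List.ofFn v) w : ℝ) ≤ p₀ (ℓ lam) * ℓ lam) →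
      prob ((S₀.keyGen lam).bind fun k => (S₀.enc lam k.1 0).bind fun v =>
        if G v then (anyAccepts (S₀.dec lam k.2) (substrings (Y v))).map not
        else PMF.pure false) {true} ≤ ν lam := by
  classical
  obtain ⟨ν, hν, h⟩ := Scheme.exists_missProb_le hp₀ hR hℓ
  obtain ⟨ν', hν', h'⟩ := hS 0
  -- The added term makes the bound trivial when `p₀ (ℓ lam) = 1` or `ℓ lam = 0`, which can happen
  -- for finitely many `lam` only.
  let σ : ℕ → ℝ := fun lam => ν lam + if p₀ (ℓ lam) < 1 ∧ 0 < ℓ lam then 0 else 1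
  have hσ0 : ∀ lam, 0 ≤ (if p₀ (ℓ lam) < 1 ∧ 0 < ℓ lam then 0 else 1 : ℝ) := fun lam => by
    split_ifs <;> norm_num
  refine ⟨σ, hν.of_le (fun lam => add_nonneg (hν.1 lam) (hσ0 lam)) ?_, ?_⟩
  · filter_upwards [hℓ.eventually_gt_atTop 0,
      hν.tendsto.eventually_lt_const (show (0 : ℝ) < 1 / 2 by norm_num),
      hν'.tendsto.eventually_lt_const (show (0 : ℝ) < 1 / 2 by norm_num)] with lam h1 h2 h3
    have h4 : p₀ (ℓ lam) < 1 := by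
      by_contra hge
      -- If the full length may be edited, the channel may erase the codeword; then robustness would
      -- require the empty word to be accepted, against soundness.
      have hE : EditBounded p₀ fun x : List (Fin q) => if x.length = ℓ lam then [] else x := by
        intro x
        dsimp only
        split_ifs with hx
        · rw [editDist_nil_right, hx]
          nlinarith
        · exact editBounded_id hp₀ x
      have h5 := h lam _ hE
      simp only [Scheme.missProb, List.length_ofFn, if_true, PMF.bind_const] at h5
      linarith [h' lam [] (by simp)]
    have h6 : p₀ (ℓ lam) < 1 ∧ 0 < ℓ lam := ⟨h4, by exact_mod_cast h1⟩
    exact (by simp only [σ, if_pos h6, add_zero]; exact le_rfl)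
  · intro lam Y G hG
    by_cases hlam : p₀ (ℓ lam) < 1 ∧ 0 < ℓ lam
    swap
    · exact (prob_le_one _ _).trans (by simp only [σ, if_neg hlam]; linarith [hν.1 lam])
    -- The partial map from good blocks to nearby infixes of the received word is completed by the
    -- identity to a bounded channel defined on all words.
    have hex : ∀ x : List (Fin q), ∃ w, (editDist x w : ℝ) ≤ p₀ x.length * x.length ∧
        ∀ v, x = List.ofFn v → G v = true → w <:+: Y v := by
      intro x
      by_cases hx : ∃ v, x = List.ofFn v ∧ G v = true
      · obtain ⟨v, rfl, hv⟩ := hx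
        obtain ⟨w, hw, hd⟩ := hG v hv
        refine ⟨w, by simpa using hd, fun v' hv' _ => ?_⟩
        rwa [← List.ofFn_injective hv']
      · exact ⟨x, editBounded_id hp₀ x, fun v h1 h2 => absurd ⟨v, h1, h2⟩ hx⟩
    choose E hE hEG using hex
    simp only [σ, if_pos hlam, add_zero]
    refine le_trans ?_ (h lam E hE)
    refine prob_bind_le_bind fun k _ => prob_bind_le_bind fun v _ => ?_
    by_cases hv : G v = true
    · rw [if_pos hv, prob_map]
      refine (prob_mono (T := {false}) _ fun b _ hb => by simpa using hb).trans ?_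
      -- The tests run over nonempty substrings. The corrupted block is nonempty because fewer than
      -- `ℓ` edits cannot delete all of it.
      refine prob_anyAccepts_false_le _ (mem_substrings ?_ (hEG _ v rfl hv))
      intro h0
      have h1 := hE (List.ofFn v)
      rw [h0, editDist_nil_right, List.length_ofFn] at h1
      have : (0 : ℝ) < ℓ lam := by exact_mod_cast hlam.2
      nlinarith [hlam.1]
    · rw [if_neg hv, prob_pure_of_notMem (by simp)]
      exact prob_nonneg _ _

end PRC

namespace PRC

/-! ### Independent blocks and the tests -/

section blocks

variable {κ α β R : Type} {μ : PMF κ} {enc : κ → PMF α} {U : PMF α} {K : ℕ}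

theorem prob_bind_le_add_sum [Fintype κ] {f : κ → PMF α} {S : Set α} (B : Set κ) {φ : κ → ℝ}
    (h0 : ∀ a, 0 ≤ φ a) (h : ∀ a ∈ μ.support, a ∉ B → prob (f a) S ≤ φ a) :
    prob (μ.bind f) S ≤ prob μ B + ∑ a, (μ a).toReal * φ a := by
  have hB : prob μ B = ∑ a, (μ a).toReal * prob (PMF.pure a) B := by
    rw [← prob_bind_fintype, PMF.bind_pure]
  rw [prob_bind_fintype, hB, ← Finset.sum_add_distrib]
  refine Finset.sum_le_sum fun a _ => ?_
  rw [← mul_add]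
  by_cases ha : a ∈ μ.support
  · refine mul_le_mul_of_nonneg_left ?_ ENNReal.toReal_nonneg
    by_cases haB : a ∈ B
    · rw [prob_pure_of_mem haB]
      linarith [prob_le_one (f a) S, h0 a]
    · rw [prob_pure_of_notMem haB, zero_add]
      exact h a ha haB
  · rw [PMF.mem_support_iff, not_not] at ha
    rw [ha, ENNReal.toReal_zero, zero_mul, zero_mul]

theorem prob_bind_le_add_bind_add [Fintype κ] {f : κ → PMF α} {g : κ → PMF β} {S : Set α}
    {T : Set β} (B : Set κ) {c : ℝ} (hc : 0 ≤ c)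
    (h : ∀ a ∈ μ.support, a ∉ B → prob (f a) S ≤ prob (g a) T + c) :
    prob (μ.bind f) S ≤ prob μ B + (prob (μ.bind g) T + c) := by
  refine (prob_bind_le_add_sum B (fun a => add_nonneg (prob_nonneg (g a) T) hc) h).trans_eq ?_
  have h1 : ∑ a, (μ a).toReal = 1 := by
    have := prob_bind_fintype μ PMF.pure Set.univ
    simp only [prob_pure_of_mem (Set.mem_univ _), mul_one, PMF.bind_pure] at this
    rw [← this, ← Set.compl_empty, prob_compl]
    simp [prob]
  simp only [mul_add, Finset.sum_add_distrib, ← Finset.sum_mul, h1, one_mul, prob_bind_fintype]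

/-- A key together with a word, which is a codeword if `b` holds. -/
noncomputable def block (μ : PMF κ) (enc : κ → PMF α) (U : PMF α) (b : Bool) : PMF (κ × α) :=
  μ.bind fun k => (if b then enc k else U).map (Prod.mk k)

theorem indep_block_bind (b : Fin K → Bool) (F : (Fin K → κ) → (Fin K → α) → PMF R) :
    ((indep fun _ : Fin K => μ).bind fun ks =>
      (indep fun i => if b i then enc (ks i) else U).bind fun u => F ks u)
      = (indep fun i => block μ enc U (b i)).bind fun ku =>
        F (fun i => (ku i).1) fun i => (ku i).2 := by
  have h1 : (indep fun i => block μ enc U (b i)) = _ := (indep_bind (fun _ : Fin K => μ)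
    fun i k => (if b i then enc k else U).map (Prod.mk k)).symm
  rw [h1, PMF.bind_bind]
  congr 1
  funext ks
  rw [← indep_map (fun i => if b i then enc (ks i) else U) fun i => Prod.mk (ks i), PMF.bind_map]
  rfl

/-- When the key is forgotten, a codeword of a uniform scheme is exactly uniform. So the blocks
carry no trace of the marks, although the tests, which know the keys, do. -/
theorem indep_block_map_snd (h : μ.bind enc = U) (b : Fin K → Bool) :
    (indep fun i => block μ enc U (b i)).map (fun ku i => (ku i).2) = indep fun _ => U := by
  rw [indep_map (fun i => block μ enc U (b i)) fun _ => Prod.snd]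
  congr 1
  funext i
  have hid : ∀ ν : PMF α, ν.map (fun x => x) = ν := PMF.map_id
  simp only [block, PMF.map_bind, PMF.map_comp, Function.comp_def, hid]
  cases b i
  · exact PMF.bind_const _ _
  · exact h

/-- Did a test fail in a good window of a marked block (`b`), or succeed for a random block? -/
noncomputable def testError (b g : Bool) (A : PMF Bool) : PMF Bool :=
  if b then if g then A.map not else PMF.pure false else A

theorem prob_indep_map_le {A : Fin K → PMF Bool} {D : (Fin K → Bool) → R} {S : Set R}
    (bad : Fin K → Set Bool) (h : ∀ st, (∀ i, st i ∉ bad i) → D st ∉ S) :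
    prob ((indep A).map D) S ≤ ∑ i, prob (A i) (bad i) := by
  rw [prob_map]
  have h1 : ∀ st, st ∈ D ⁻¹' S → st ∈ ⋃ i ∈ (Finset.univ : Finset (Fin K)),
      {st : Fin K → Bool | st i ∈ bad i} := by
    intro st hst
    by_contra hno
    exact h st (fun i hi => hno (Set.mem_iUnion₂.2 ⟨i, Finset.mem_univ _, hi⟩)) hst
  refine (prob_mono _ fun st _ hst => h1 st hst).trans ((prob_iUnion_le _ _ _).trans ?_)
  simp only [prob_indep_le]
  exact le_rfl

theorem prob_indep_tests_le {b g : Fin K → Bool} {A : Fin K → PMF Bool} {D : (Fin K → Bool) → R}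
    {S : Set R} (h : ∀ st, (∀ i, b i = false → st i = false) →
      (∀ i, b i = true → g i = true → st i = true) → D st ∉ S) :
    prob ((indep A).map D) S ≤ ∑ i, prob (testError (b i) (g i) (A i)) {true} := by
  -- The wrong results of a test: rejection for a codeword in a good window, acceptance for a random
  -- block. For a codeword in a bad window every result is tolerated.
  let bad : Bool → Bool → Set Bool := fun b g => if b then if g then {false} else ∅ else {true}
  have herr : ∀ (b g : Bool) (A : PMF Bool),
      prob A (bad b g) ≤ prob (testError b g A) {true} := by
    intro b g A
    cases b <;> cases g <;> simp only [testError, bad, if_true, Bool.false_eq_true, if_false]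
    · exact le_rfl
    · exact le_rfl
    · exact (by simp [prob] : prob _ (∅ : Set Bool) = 0).trans_le (prob_nonneg _ _)
    · rw [prob_map]
      exact prob_mono _ fun a _ ha => by simpa using ha
  refine (prob_indep_map_le (fun i => bad (b i) (g i)) fun st hst => h st ?_ ?_).trans
    (Finset.sum_le_sum fun i _ => herr _ _ _)
  · intro i hi
    have := hst i
    rw [hi] at this
    simpa [bad] using this
  · intro i hi hG
    have := hst i
    rw [hi, hG] at this
    simpa [bad] using this

/-- The key and the word of block `i` are redrawn with all other blocks fixed. For a random block
the received word is then independent of the key. For a codeword the received word is a function of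
the codeword alone, which is the situation of `hmiss`. -/
theorem prob_testError_le {b : Fin K → Bool} {Y : (Fin K → α) → β}
    {A : κ → β → PMF Bool} {G : (Fin K → α) → Fin K → Bool} {c : ℝ}
    (hrandom : ∀ u, prob (μ.bind fun k => A k (Y u)) {true} ≤ c)
    (hmiss : ∀ u i, prob (μ.bind fun k => (enc k).bind fun v =>
      if G (Function.update u i v) i then (A k (Y (Function.update u i v))).map not
      else PMF.pure false) {true} ≤ c) (i : Fin K) :
    prob ((indep fun i => block μ enc U (b i)).bind fun ku =>
      testError (b i) (G (fun j => (ku j).2) i) (A (ku i).1 (Y fun j => (ku j).2))) {true} ≤ c := by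
  rw [indep_resample i (fun _ _ => rfl)]
  refine prob_bind_le fun f _ => ?_
  have hupd : ∀ k v, (fun j => (Function.update f i (k, v) j).2)
      = Function.update (fun j => (f j).2) i v := by
    intro k v
    funext j
    by_cases hj : j = i
    · subst hj; simp
    · simp [hj]
  rw [block, PMF.bind_bind]
  simp only [PMF.bind_map, Function.comp_def, hupd, Function.update_self, testError]
  cases b i
  · simp only [Bool.false_eq_true, if_false]
    rw [PMF.bind_comm]
    exact prob_bind_le fun v _ => hrandom _
  · simpa only [if_true] using hmiss (fun j => (f j).2) i

/-- The decoder fails only if too many windows are bad, a random block passes a test or a codeword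
in a good window fails it. -/
theorem prob_tests_le [Fintype κ] [Fintype α] {b : Fin K → Bool} {Y : (Fin K → α) → β}
    {A : κ → β → PMF Bool} {D : (Fin K → Bool) → β → R} {S : Set R} {H : Set (Fin K → α)}
    {G : (Fin K → α) → Fin K → Bool} {c : ℝ}
    (hdet : ∀ u ∉ H, ∀ st, (∀ i, b i = false → st i = false) →
      (∀ i, b i = true → G u i = true → st i = true) → D st (Y u) ∉ S)
    (hrandom : ∀ u, prob (μ.bind fun k => A k (Y u)) {true} ≤ c)
    (hmiss : ∀ u i, prob (μ.bind fun k => (enc k).bind fun v =>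
      if G (Function.update u i v) i then (A k (Y (Function.update u i v))).map not
      else PMF.pure false) {true} ≤ c) :
    prob ((indep fun i => block μ enc U (b i)).bind fun ku =>
      (indep fun i => A (ku i).1 (Y fun j => (ku j).2)).map fun st =>
        D st (Y fun j => (ku j).2)) S
      ≤ prob ((indep fun i => block μ enc U (b i)).map fun ku j => (ku j).2) H + K * c := by
  classical
  rw [prob_map]
  have h1 := prob_bind_le_add_sum (μ := indep fun i => block μ enc U (b i))
    (f := fun ku => (indep fun i => A (ku i).1 (Y fun j => (ku j).2)).map fun st =>
      D st (Y fun j => (ku j).2)) (S := S) ((fun ku j => (ku j).2) ⁻¹' H)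
    (φ := fun ku => ∑ i, prob (testError (b i) (G (fun j => (ku j).2) i)
      (A (ku i).1 (Y fun j => (ku j).2))) {true})
    (fun ku => Finset.sum_nonneg fun i _ => prob_nonneg _ _)
    fun ku _ hku => prob_indep_tests_le (hdet _ hku)
  refine h1.trans (add_le_add_right ?_ _)
  simp only [Finset.mul_sum]
  rw [Finset.sum_comm]
  simp only [← prob_bind_fintype]
  refine (Finset.sum_le_sum fun i _ => prob_testError_le hrandom hmiss i).trans_eq ?_
  rw [Finset.sum_const, Finset.card_univ, Fintype.card_fin, nsmul_eq_mul]

end blocks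

end PRC

namespace PRC

/-! ### Robustness of the construction -/

variable {q : ℕ}

/-- The positions at which a window of length `ℓ` is corrupted too much. -/
noncomputable def badStarts (x y : List (Fin q)) (ℓ : ℕ) (ρ : ℝ) : Finset ℕ :=
  open Classical in (Finset.range x.length).filter fun a => ρ * ℓ < windowCost x y a ℓ

/-- Each bad window costs more than `ρ * ℓ`, and the costs of all windows add up to at most `ℓ`
times the edit distance. For `ρ = 0` this says nothing about the number of bad windows, but then
there are no edits and no bad windows. -/
theorem card_badStarts_le {x y : List (Fin q)} {ℓ : ℕ} {ρ β : ℝ} (hℓ : 0 < ℓ) (hρ : 0 ≤ ρ)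
    (h : (editDist x y : ℝ) ≤ β * ρ * x.length) :
    ((badStarts x y ℓ ρ).card : ℝ) * ρ ≤ β * x.length * ρ ∧
      (ρ = 0 → (badStarts x y ℓ ρ).card = 0) := by
  classical
  have hsum : (∑ a ∈ Finset.range x.length, (windowCost x y a ℓ : ℝ)) ≤ ℓ * editDist x y := by
    exact_mod_cast sum_windowCost_le x y ℓ
  have hℓ' : (0 : ℝ) < ℓ := by exact_mod_cast hℓ
  constructor
  · have h1 : ((badStarts x y ℓ ρ).card : ℝ) * (ρ * ℓ)
        ≤ ∑ a ∈ Finset.range x.length, (windowCost x y a ℓ : ℝ) := by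
      rw [← nsmul_eq_mul, ← Finset.sum_const]
      refine (Finset.sum_le_sum fun a ha => (Finset.mem_filter.1 ha).2.le).trans ?_
      exact Finset.sum_le_sum_of_subset_of_nonneg (Finset.filter_subset _ _) fun _ _ _ =>
        Nat.cast_nonneg _
    refine le_of_mul_le_mul_right ?_ hℓ'
    nlinarith
  · rintro rfl
    have h0 : (editDist x y : ℝ) = 0 := le_antisymm (by simpa using h) (Nat.cast_nonneg _)
    rw [h0, mul_zero] at hsum
    rw [Finset.card_eq_zero, badStarts, Finset.filter_eq_empty_iff]
    intro a ha
    have := Finset.single_le_sum (f := fun a => (windowCost x y a ℓ : ℝ))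
      (fun _ _ => Nat.cast_nonneg _) ha
    rw [zero_mul]
    linarith

theorem card_badStarts_le_mul {x y : List (Fin q)} {ℓ : ℕ} {ρ β : ℝ} (hℓ : 0 < ℓ) (hρ : 0 ≤ ρ)
    (hβ : 0 ≤ β) (h : (editDist x y : ℝ) ≤ β * ρ * x.length) :
    ((badStarts x y ℓ ρ).card : ℝ) ≤ β * x.length := by
  obtain ⟨h1, h2⟩ := card_badStarts_le hℓ hρ h
  rcases hρ.eq_or_lt with rfl | hρ
  · rw [h2 rfl, Nat.cast_zero]
    positivity
  · exact le_of_mul_le_mul_right h1 hρ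

section

variable {d' ℓ n : ℕ}

/-- Too many blocks of one of the halves start at positions in `B`. -/
def ManyBad {N : ℕ} (B : Finset ℕ) (τ : ℝ) (loc : Fin (d' + d') → Fin (N + 1)) : Prop :=
  τ < ((Finset.univ.map (Fin.castAddEmb d')).filter fun i => (loc i : ℕ) ∈ B).card ∨
  τ < ((Finset.univ.map (Fin.natAddEmb d')).filter fun i => (loc i : ℕ) ∈ B).card

theorem prob_manyBad_le (hℓ : 0 < ℓ) (hn : 0 < n) {B : Finset ℕ} {β θ ρ : ℝ} (hθ : 0 ≤ θ)
    (hB : (B.card : ℝ) ≤ β * n) :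
    prob (PMF.uniformOfFinset _ (placements_nonempty' d' ℓ n)) {loc | ManyBad B (ρ * d') loc}
      ≤ 2 * ((1 + θ * β) / (1 + θ) ^ ρ) ^ d' := by
  have hn' : (0 : ℝ) < n := by exact_mod_cast hn
  have hB' : (B.card : ℝ) / n ≤ β := (div_le_iff₀ hn').2 hB
  -- Each half consists of `d'` blocks and is estimated separately; the factor `2` is the union
  -- bound over the halves.
  have key : ∀ H : Finset (Fin (d' + d')), H.card = d' →
      prob (PMF.uniformOfFinset _ (placements_nonempty' d' ℓ n))
        {loc | ρ * d' < (H.filter fun i => (loc i : ℕ) ∈ B).card}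
      ≤ ((1 + θ * β) / (1 + θ) ^ ρ) ^ d' := by
    intro H hH
    refine (placements_tail hℓ (by ring) hn _ B H hθ).trans ?_
    rw [hH, Real.rpow_mul_natCast (by linarith), ← div_pow]
    refine pow_le_pow_left₀ (by positivity) ?_ _
    gcongr
  refine (prob_union_le _ _ _).trans ?_
  exact (add_le_add (key _ (by simp)) (key _ (by simp))).trans_eq (two_mul _).symm

theorem take_drop_interleave [NeZero q] (hℓ : 0 < ℓ) {k N : ℕ} {loc : Fin k → Fin (N + 1)}
    (h : loc ∈ placements k ℓ N) (u : Fin k → Fin ℓ → Fin q) (c : Fin n → Fin q) (i : Fin k) :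
    ((List.ofFn (interleave loc u c)).drop (loc i)).take ℓ = List.ofFn (u i) := by
  have hp := (mem_placements_iff hℓ).1 h
  have hle : (loc i : ℕ) + ℓ ≤ N := hp.1 i
  refine List.ext_getElem ?_ fun t h1 h2 => ?_
  · simp only [List.length_take, List.length_drop, List.length_ofFn]
    omega
  · simp only [List.length_ofFn] at h2
    rw [List.getElem_take, List.getElem_drop, List.getElem_ofFn, List.getElem_ofFn]
    rw [interleave_block hp u c ⟨loc i + t, by omega⟩ i (by simp) (by simpa using h2)]
    congr 1
    exact Fin.ext (by simp)

end

variable {M ℓ n d d' r : ℕ → ℕ}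

/-- In the first half a test can be wrong only for a codeword that starts in `B`, so the test
results are within the radius of the seed code. In the second half all blocks are codewords, and as
`ρ < 1` at least one of them starts outside `B` and is detected. -/
theorem decodeTests_eq_some {L : PayloadCode q M n d r} {C : SeedCode d d'} {ρ : ℝ}
    (hC : C.Corrects ρ) (hρ : ρ < 1) {lam N : ℕ} (hd' : 0 < d' lam) {m : Fin (M lam)}
    {s : Fin (d lam) → Bool} {shift : Fin (r lam) → Bool} {y : List (Fin q)} {B : Finset ℕ}
    {loc : Fin (d' lam + d' lam) → Fin (N + 1)} {st : Fin (d' lam + d' lam) → Bool}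
    (hB : ¬ ManyBad B (ρ * d' lam) loc)
    (h0 : ∀ i, marks C lam s i = false → st i = false)
    (h1 : ∀ i, marks C lam s i = true → (loc i : ℕ) ∉ B → st i = true)
    (hL : L.dec lam y s shift = some m) : decodeTests L C lam st shift y = some m := by
  classical
  rw [ManyBad, not_or, not_lt, not_lt] at hB
  have h2 : C.dec lam (fun j => st (Fin.castAdd (d' lam) j)) = some s := by
    refine hC.corrects lam s _ (le_trans ?_ hB.1)
    rw [Finset.filter_map, Finset.card_map, hammingDist]
    exact_mod_cast Finset.card_le_card fun j hj => by
      refine Finset.mem_filter.2 ⟨Finset.mem_univ _, ?_⟩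
      by_contra hno
      refine (Finset.mem_filter.1 hj).2 ?_
      have hm : marks C lam s (Fin.castAdd (d' lam) j) = C.enc lam s j := by simp [marks]
      cases hc : C.enc lam s j
      · exact h0 _ (hm.trans hc)
      · exact h1 _ (hm.trans hc) hno
  rw [decodeTests, if_neg, h2]
  · exact hL
  · intro hall
    have h3 : (Finset.univ.map (Fin.natAddEmb (d' lam))).filter (fun i => (loc i : ℕ) ∈ B)
        = Finset.univ.map (Fin.natAddEmb (d' lam)) := by
      rw [Finset.filter_eq_self]
      intro i hi
      obtain ⟨j, -, rfl⟩ := Finset.mem_map.1 hi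
      by_contra hno
      have hm : marks C lam s (Fin.natAdd (d' lam) j) = true :=
        Fin.append_right _ _ j
      exact absurd (hall j) (by rw [h1 _ hm hno]; simp)
    have h4 := hB.2
    rw [h3, Finset.card_map, Finset.card_univ, Fintype.card_fin] at h4
    have : (0 : ℝ) < d' lam := by exact_mod_cast hd'
    nlinarith

variable [NeZero q]

/-- The decoding of the word `F x`, for a given seed, mask and position of the blocks. -/
noncomputable def trial (S₀ : Scheme q (fun _ => 1) ℓ) (L : PayloadCode q M n d r)
    (C : SeedCode d d') (lam : ℕ) (m : Fin (M lam))
    (F : (Fin (n lam + 2 * d' lam * ℓ lam) → Fin q) → List (Fin q))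
    (a : (Fin (d lam) → Bool) × (Fin (r lam) → Bool))
    (loc : Fin (d' lam + d' lam) → Fin (n lam + 2 * d' lam * ℓ lam + 1)) :
    PMF (Option (Fin (M lam))) :=
  (indep fun i => block (S₀.keyGen lam) (fun k => S₀.enc lam k.1 0)
    (PMF.uniformOfFintype _) (marks C lam a.1 i)).bind fun ku =>
  (indep fun i => anyAccepts (S₀.dec lam (ku i).1.2)
    (substrings (F (interleave loc (fun j => (ku j).2) (L.enc lam m a.1 a.2))))).map fun st =>
  decodeTests L C lam st a.2 (F (interleave loc (fun j => (ku j).2) (L.enc lam m a.1 a.2)))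

/-- The position of the blocks and the codeword of a trial. -/
noncomputable def placed (S₀ : Scheme q (fun _ => 1) ℓ) (L : PayloadCode q M n d r)
    (C : SeedCode d d') (lam : ℕ) (m : Fin (M lam))
    (a : (Fin (d lam) → Bool) × (Fin (r lam) → Bool))
    (loc : Fin (d' lam + d' lam) → Fin (n lam + 2 * d' lam * ℓ lam + 1)) :
    PMF ((Fin (d' lam + d' lam) → Fin (n lam + 2 * d' lam * ℓ lam + 1)) ×
      (Fin (n lam + 2 * d' lam * ℓ lam) → Fin q)) :=
  ((indep fun i => block (S₀.keyGen lam) (fun k => S₀.enc lam k.1 0)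
    (PMF.uniformOfFintype _) (marks C lam a.1 i)).map fun ku j => (ku j).2).map fun u =>
  (loc, interleave loc u (L.enc lam m a.1 a.2))

/-- The independent choices are reordered: seed, mask and placement come first, then each key
together with the word of its block. In this order the tests of distinct blocks can be analysed
separately. -/
theorem genericPRC_law (S₀ : Scheme q (fun _ => 1) ℓ) (L : PayloadCode q M n d r)
    (C : SeedCode d d') (lam : ℕ) (m : Fin (M lam))
    (F : (Fin (n lam + 2 * d' lam * ℓ lam) → Fin q) → List (Fin q)) :
    (((genericPRC S₀ L C).keyGen lam).bind fun k =>
      ((genericPRC S₀ L C).enc lam k.1 m).bind fun x => (genericPRC S₀ L C).dec lam k.2 (F x))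
      = (PMF.uniformOfFintype ((Fin (d lam) → Bool) × (Fin (r lam) → Bool))).bind fun a =>
        (PMF.uniformOfFinset _ (placements_nonempty' (d' lam) (ℓ lam) (n lam))).bind fun loc =>
        trial S₀ L C lam m F a loc := by
  rw [genericPRC_keyGen_bind, uniform_prod]
  simp only [trial, genericPRC_enc_joinKeys, genericPRC_dec_joinKeys, markedEnc, scatter, PMF.bind_bind,
    PMF.bind_map, Function.comp_def]
  rw [PMF.bind_comm]
  simp only [PMF.bind_comm (indep fun _ : Fin (d' lam + d' lam) => S₀.keyGen lam)
    (PMF.uniformOfFintype (Fin (d lam) → Bool))]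
  rw [PMF.bind_comm]
  refine congrArg _ (funext fun s => congrArg _ (funext fun shift => ?_))
  exact (indep_block_bind (μ := S₀.keyGen lam) (enc := fun k => S₀.enc lam k.1 0)
    (U := PMF.uniformOfFintype (Fin (ℓ lam) → Fin q)) (marks C lam s) fun ks u =>
    (PMF.uniformOfFinset _ (placements_nonempty' (d' lam) (ℓ lam) (n lam))).bind fun loc =>
      (indep fun i => anyAccepts (S₀.dec lam (ks i).2)
        (substrings (F (interleave loc u (L.enc lam m s shift))))).map fun st =>
      decodeTests L C lam st shift (F (interleave loc u (L.enc lam m s shift)))).trans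
    (PMF.bind_comm _ _ _)

/-- Position of the blocks and codeword are independent and uniform. -/
theorem placed_uniform {S₀ : Scheme q (fun _ => 1) ℓ} (hS : S₀.Uniform)
    {L : PayloadCode q M n d r} (hL : L.Uniform) (C : SeedCode d d') (lam : ℕ) (m : Fin (M lam)) :
    ((PMF.uniformOfFintype ((Fin (d lam) → Bool) × (Fin (r lam) → Bool))).bind fun a =>
      (PMF.uniformOfFinset _ (placements_nonempty' (d' lam) (ℓ lam) (n lam))).bind fun loc =>
        placed S₀ L C lam m a loc)
      = (PMF.uniformOfFintype (Fin (n lam + 2 * d' lam * ℓ lam) → Fin q)).bind fun x =>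
        (PMF.uniformOfFinset _ (placements_nonempty' (d' lam) (ℓ lam) (n lam))).map fun loc =>
        (loc, x) := by
  simp only [placed, indep_block_map_snd (hS lam 0), indep_uniform, uniform_prod, PMF.bind_bind,
    PMF.bind_map, Function.comp_def]
  refine (congrArg (PMF.bind _) (funext fun s => ?_)).trans (PMF.bind_const _ _)
  -- For a fixed seed and placement the mask makes the payload uniform, and together with uniform
  -- blocks the whole word is uniform. Its law is the same for every placement, which gives the
  -- independence.
  have hx : ∀ loc ∈ (PMF.uniformOfFinset _
      (placements_nonempty' (d' lam) (ℓ lam) (n lam))).support,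
      ((PMF.uniformOfFintype (Fin (r lam) → Bool)).bind fun shift =>
        (PMF.uniformOfFintype (Fin (d' lam + d' lam) → Fin (ℓ lam) → Fin q)).map fun u =>
          (loc, interleave loc u (L.enc lam m s shift)))
      = (PMF.uniformOfFintype _).map fun x => (loc, x) := by
    intro loc hloc
    rw [← uniform_interleave (k := d' lam + d' lam) (ℓ := ℓ lam) (n := n lam) (by ring)
      ((PMF.mem_support_uniformOfFinset_iff _ _).1 hloc), ← hL lam m s]
    simp only [PMF.map, PMF.bind_bind, PMF.pure_bind, Function.comp_def]
    exact PMF.bind_comm _ _ _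
  rw [PMF.bind_comm]
  refine (bind_congr_support hx).trans ?_
  simp only [PMF.map]
  exact PMF.bind_comm _ _ _

end PRC

/-! ### Failure probability of the decoder -/

namespace PRC

section robust

variable {q : ℕ} [NeZero q] {M ℓ n d d' r : ℕ → ℕ}

/-- The codewords in good windows are found, and the payload is decoded. -/
theorem trial_fail_le {S₀ : Scheme q (fun _ => 1) ℓ} {L : PayloadCode q M n d r}
    {C : SeedCode d d'} {ρ : ℝ} (hC : C.Corrects ρ) (hρ : ρ < 1) {lam : ℕ} (m : Fin (M lam))
    (hℓ : 0 < ℓ lam) (hd' : 0 < d' lam) {E : List (Fin q) → List (Fin q)} {p₁ δ c : ℝ}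
    (hE : ∀ x : Fin (n lam + 2 * d' lam * ℓ lam) → Fin q,
      (editDist (List.ofFn x) (E (List.ofFn x)) : ℝ) + 2 * d' lam * ℓ lam ≤ δ * n lam)
    (hrandom : ∀ x : Fin (n lam + 2 * d' lam * ℓ lam) → Fin q,
      prob ((S₀.keyGen lam).bind fun k =>
        anyAccepts (S₀.dec lam k.2) (substrings (E (List.ofFn x)))) {true} ≤ c)
    (hmiss : ∀ (Y : (Fin (ℓ lam) → Fin q) → List (Fin q)) (G : (Fin (ℓ lam) → Fin q) → Bool),
      (∀ v, G v = true → ∃ w, w <:+: Y v ∧ (editDist (List.ofFn v) w : ℝ) ≤ p₁ * ℓ lam) →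
      prob ((S₀.keyGen lam).bind fun k => (S₀.enc lam k.1 0).bind fun v =>
        if G v then (anyAccepts (S₀.dec lam k.2) (substrings (Y v))).map not
        else PMF.pure false) {true} ≤ c)
    {a : (Fin (d lam) → Bool) × (Fin (r lam) → Bool)}
    (ha : ∀ y : List (Fin q), (editDist y (List.ofFn (L.enc lam m a.1 a.2)) : ℝ) ≤ δ * n lam →
      L.dec lam y a.1 a.2 = some m)
    {loc : Fin (d' lam + d' lam) → Fin (n lam + 2 * d' lam * ℓ lam + 1)}
    (hloc : loc ∈ placements (d' lam + d' lam) (ℓ lam) (n lam + 2 * d' lam * ℓ lam)) :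
    prob (trial S₀ L C lam m (fun x => E (List.ofFn x)) a loc) {some m}ᶜ
      ≤ prob (placed S₀ L C lam m a loc) {z | ManyBad (badStarts (List.ofFn z.2)
        (E (List.ofFn z.2)) (ℓ lam) p₁) (ρ * d' lam) z.1} + (d' lam + d' lam : ℕ) * c := by
  classical
  rw [trial, placed, prob_map _ (fun u => (loc, interleave loc u (L.enc lam m a.1 a.2)))]
  refine prob_tests_le (μ := S₀.keyGen lam) (enc := fun k => S₀.enc lam k.1 0)
    (U := PMF.uniformOfFintype (Fin (ℓ lam) → Fin q)) (b := marks C lam a.1)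
    (S := {some m}ᶜ) (c := c) (H := {u | ManyBad
      (badStarts (List.ofFn (interleave loc u (L.enc lam m a.1 a.2)))
        (E (List.ofFn (interleave loc u (L.enc lam m a.1 a.2)))) (ℓ lam) p₁) (ρ * d' lam) loc})
    (Y := fun u => E (List.ofFn (interleave loc u (L.enc lam m a.1 a.2))))
    (A := fun k y => anyAccepts (S₀.dec lam k.2) (substrings y))
    (D := fun st y => decodeTests L C lam st a.2 y)
    (G := fun u i => decide ((loc i : ℕ) ∉
      badStarts (List.ofFn (interleave loc u (L.enc lam m a.1 a.2)))
        (E (List.ofFn (interleave loc u (L.enc lam m a.1 a.2)))) (ℓ lam) p₁))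
    ?_ (fun u => hrandom _) (fun u i => hmiss _ _ fun v hv => ?_)
  · intro u hu st h3 h4 h5
    refine h5 (decodeTests_eq_some hC hρ hd' hu h3 (fun i hi hb => h4 i hi (decide_eq_true hb))
      (ha _ ?_))
    have hsub := sublist_interleave hℓ (by ring) hloc u (L.enc lam m a.1 a.2)
    -- The received word is compared with the payload alone; removing the marker blocks costs their
    -- total length, which the second term in `hE` accounts for.
    have h6 := editDist_le_of_sublist
      (y := E (List.ofFn (interleave loc u (L.enc lam m a.1 a.2)))) hsub
    rw [List.length_ofFn, List.length_ofFn] at h6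
    have h7 := hE (interleave loc u (L.enc lam m a.1 a.2))
    have h8 : (editDist (E (List.ofFn (interleave loc u (L.enc lam m a.1 a.2))))
        (List.ofFn (L.enc lam m a.1 a.2)) : ℝ) + n lam
        ≤ editDist (List.ofFn (interleave loc u (L.enc lam m a.1 a.2)))
          (E (List.ofFn (interleave loc u (L.enc lam m a.1 a.2))))
          + (n lam + 2 * d' lam * ℓ lam) := by exact_mod_cast h6
    linarith
  · have hv' := of_decide_eq_true hv
    have h9 := take_drop_interleave hℓ hloc (Function.update u i v) (L.enc lam m a.1 a.2) i
    rw [Function.update_self] at h9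
    generalize hx : List.ofFn (interleave loc (Function.update u i v) (L.enc lam m a.1 a.2)) = x
      at hv' h9 ⊢
    -- The block occupies the window that starts at `loc i`, so if this start is not bad the chunk
    -- of the received word aligned with it is close to the block.
    refine ⟨alignedWindow x (E x) (loc i) (ℓ lam), alignedWindow_infix _ _ _ _, ?_⟩
    have h10 := editDist_alignedWindow x (E x) (loc i) (ℓ lam)
    rw [h9] at h10
    have h11 : (loc i : ℕ) < x.length := by
      have h12 : (loc i : ℕ) + ℓ lam ≤ n lam + 2 * d' lam * ℓ lam :=
        ((mem_placements_iff hℓ).1 hloc).1 i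
      rw [← hx, List.length_ofFn]
      omega
    have h13 : ¬ p₁ * ℓ lam < windowCost x (E x) (loc i) (ℓ lam) := fun h =>
      hv' (Finset.mem_filter.2 ⟨Finset.mem_range.2 h11, h⟩)
    exact le_trans (by exact_mod_cast h10) (not_lt.1 h13)

/-- The set of bad starts depends only on the codeword, which is independent of the placement.
Conditioned on the codeword it is a fixed set, to which the tail bound for placements applies. -/
theorem placed_manyBad_le {S₀ : Scheme q (fun _ => 1) ℓ} (hSu : S₀.Uniform)
    {L : PayloadCode q M n d r} (hLu : L.Uniform) (C : SeedCode d d') {ρ : ℝ} {lam : ℕ}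
    (m : Fin (M lam)) (hℓ : 0 < ℓ lam) (hn : 0 < n lam) {E : List (Fin q) → List (Fin q)}
    {p₁ β θ : ℝ} (hp₁ : 0 ≤ p₁) (hβ : 0 ≤ β) (hθ : 0 ≤ θ)
    (hE : ∀ x : Fin (n lam + 2 * d' lam * ℓ lam) → Fin q,
      (editDist (List.ofFn x) (E (List.ofFn x)) : ℝ)
        ≤ β * p₁ * ((n lam + 2 * d' lam * ℓ lam : ℕ) : ℝ))
    {β' : ℝ} (hβ' : β * ((n lam + 2 * d' lam * ℓ lam : ℕ) : ℝ) ≤ β' * n lam) :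
    prob ((PMF.uniformOfFintype ((Fin (d lam) → Bool) × (Fin (r lam) → Bool))).bind fun a =>
      (PMF.uniformOfFinset _ (placements_nonempty' (d' lam) (ℓ lam) (n lam))).bind fun loc =>
        placed S₀ L C lam m a loc) {z | ManyBad (badStarts (List.ofFn z.2)
        (E (List.ofFn z.2)) (ℓ lam) p₁) (ρ * d' lam) z.1}
      ≤ 2 * ((1 + θ * β') / (1 + θ) ^ ρ) ^ d' lam := by
  rw [placed_uniform hSu hLu C lam m]
  refine prob_bind_le fun x _ => ?_
  rw [prob_map]
  show prob _ {loc | ManyBad (badStarts (List.ofFn x) (E (List.ofFn x)) (ℓ lam) p₁)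
    (ρ * d' lam) loc} ≤ _
  refine prob_manyBad_le (B := badStarts (List.ofFn x) (E (List.ofFn x)) (ℓ lam) p₁) (β := β')
    hℓ hn hθ (le_trans ?_ hβ')
  have := card_badStarts_le_mul (x := List.ofFn x) (y := E (List.ofFn x)) hℓ hp₁ hβ
    (by rw [List.length_ofFn]; exact hE x)
  rwa [List.length_ofFn] at this

/-- Uniformity of the codeword is available only after averaging over seed, mask and placement. The
event of too many bad blocks is therefore kept as it is in the estimate of each single trial and is
bounded only after the average. -/
theorem genericPRC_fail_le {S₀ : Scheme q (fun _ => 1) ℓ} (hSu : S₀.Uniform)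
    {L : PayloadCode q M n d r} (hLu : L.Uniform) {C : SeedCode d d'} {ρ : ℝ}
    (hC : C.Corrects ρ) (hρ : ρ < 1) {lam : ℕ} (m : Fin (M lam)) (hℓ : 0 < ℓ lam)
    (hn : 0 < n lam) (hd' : 0 < d' lam) {E : List (Fin q) → List (Fin q)} {p₁ β δ θ c e : ℝ}
    (hp₁ : 0 ≤ p₁) (hβ : 0 ≤ β) (hθ : 0 ≤ θ) (hc : 0 ≤ c)
    (hE : ∀ x : Fin (n lam + 2 * d' lam * ℓ lam) → Fin q,
      (editDist (List.ofFn x) (E (List.ofFn x)) : ℝ)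
        ≤ β * p₁ * ((n lam + 2 * d' lam * ℓ lam : ℕ) : ℝ) ∧
      (editDist (List.ofFn x) (E (List.ofFn x)) : ℝ) + 2 * d' lam * ℓ lam ≤ δ * n lam)
    {β' : ℝ} (hβ' : β * ((n lam + 2 * d' lam * ℓ lam : ℕ) : ℝ) ≤ β' * n lam)
    (hload : prob (PMF.uniformOfFintype ((Fin (d lam) → Bool) × (Fin (r lam) → Bool)))
      {a | ∀ y : List (Fin q), (editDist y (List.ofFn (L.enc lam m a.1 a.2)) : ℝ) ≤ δ * n lam →
        L.dec lam y a.1 a.2 = some m}ᶜ ≤ e)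
    (hrandom : ∀ x : Fin (n lam + 2 * d' lam * ℓ lam) → Fin q,
      prob ((S₀.keyGen lam).bind fun k =>
        anyAccepts (S₀.dec lam k.2) (substrings (E (List.ofFn x)))) {true} ≤ c)
    (hmiss : ∀ (Y : (Fin (ℓ lam) → Fin q) → List (Fin q)) (G : (Fin (ℓ lam) → Fin q) → Bool),
      (∀ v, G v = true → ∃ w, w <:+: Y v ∧ (editDist (List.ofFn v) w : ℝ) ≤ p₁ * ℓ lam) →
      prob ((S₀.keyGen lam).bind fun k => (S₀.enc lam k.1 0).bind fun v =>
        if G v then (anyAccepts (S₀.dec lam k.2) (substrings (Y v))).map not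
        else PMF.pure false) {true} ≤ c) :
    prob (((genericPRC S₀ L C).keyGen lam).bind fun k =>
      ((genericPRC S₀ L C).enc lam k.1 m).bind fun x =>
        (genericPRC S₀ L C).dec lam k.2 (E (List.ofFn x))) {some m}ᶜ
      ≤ e + (2 * ((1 + θ * β') / (1 + θ) ^ ρ) ^ d' lam + (d' lam + d' lam : ℕ) * c) := by
  have hKc : 0 ≤ ((d' lam + d' lam : ℕ) : ℝ) * c := by positivity
  rw [genericPRC_law S₀ L C lam m fun x => E (List.ofFn x)]
  refine (prob_bind_le_add_bind_add _ hKc fun a _ ha => ?_).trans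
    (add_le_add hload (add_le_add_left (placed_manyBad_le hSu hLu C m hℓ hn hp₁ hβ hθ
      (fun x => (hE x).1) hβ') _))
  refine (prob_bind_le_add_bind_add (g := placed S₀ L C lam m a) ∅ hKc fun loc hloc _ =>
    trial_fail_le hC hρ m hℓ hd' (fun x => (hE x).2) hrandom hmiss (not_not.1 ha)
      ((PMF.mem_support_uniformOfFinset_iff _ _).1 hloc)).trans_eq ?_
  rw [show prob _ (∅ : Set _) = 0 by simp [prob], zero_add]

end robust

end PRC

/-! ### Choice of constants and robustness -/

namespace PRC

/-- The mean fraction of bad blocks is `(1 - η) * ρ` and the threshold is `ρ`. With parameter `η` in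
the exponential moment, `log (1 + x) ≤ x` and `log (1 + η) ≥ η / (1 + η)` reduce the claim to `(1 -
η) * (1 + η) < 1`. -/
theorem tail_base_lt_one {η ρ : ℝ} (hη : 0 < η) (hη' : η < 1) (hρ : 0 < ρ) :
    0 < (1 + η * ((1 - η) * ρ)) / (1 + η) ^ ρ ∧ (1 + η * ((1 - η) * ρ)) / (1 + η) ^ ρ < 1 := by
  have h1 : 0 < η * ((1 - η) * ρ) := mul_pos hη (mul_pos (by linarith) hρ)
  have h2 : 0 < (1 + η) ^ ρ := Real.rpow_pos_of_pos (by linarith) _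
  refine ⟨div_pos (by linarith) h2, (div_lt_one h2).2 ?_⟩
  rw [← Real.log_lt_log_iff (by linarith) h2, Real.log_rpow (by linarith)]
  have h3 := Real.log_le_sub_one_of_pos (show 0 < 1 + η * ((1 - η) * ρ) by linarith)
  have h4 := Real.one_sub_inv_le_log_of_pos (show 0 < 1 + η by linarith)
  have h5 : η * (1 - η) < 1 - (1 + η)⁻¹ := by
    rw [show 1 - (1 + η)⁻¹ = η / (1 + η) by field_simp; ring, lt_div_iff₀ (by linarith)]
    nlinarith [mul_pos hη (mul_pos hη hη)]
  nlinarith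

variable {q : ℕ} {M ℓ n d d' r : ℕ → ℕ}

/-- For the finitely many remaining parameters the failure bound is set to `1`, which leaves it
negligible. -/
theorem Scheme.robust_of_eventually {S : Scheme q M n} {E : List (Fin q) → List (Fin q)}
    {ν : ℕ → ℝ} (hν : Negligible ν) (h : ∀ᶠ lam in atTop, ∀ m : Fin (M lam),
      prob ((S.keyGen lam).bind fun k => (S.enc lam k.1 m).bind fun x =>
        S.dec lam k.2 (E (List.ofFn x))) {some m}ᶜ ≤ ν lam) : S.Robust E := by
  obtain ⟨k₀, hk₀⟩ := eventually_atTop.1 h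
  refine ⟨fun lam => if lam < k₀ then 1 else ν lam, hν.of_le (fun lam => ?_) ?_, fun lam m => ?_⟩
  · split_ifs
    exacts [zero_le_one, hν.1 lam]
  · filter_upwards [eventually_ge_atTop k₀] with lam hlam
    rw [if_neg (not_lt.2 hlam)]
  · dsimp only
    split_ifs with hlam
    · rw [sub_self]
      exact prob_nonneg _ _
    · have := hk₀ lam (not_lt.1 hlam) m
      rw [prob_compl] at this
      linarith

theorem genericPRC_robust [NeZero q] {S₀ : Scheme q (fun _ => 1) ℓ} {L : PayloadCode q M n d r}
    {C : SeedCode d d'} {p₀ p : ℕ → ℝ} {δ ρ γ ε : ℝ}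
    (hp₀ : ∀ k, p₀ k ∈ Set.Icc (0 : ℝ) 1) (hp : ∀ k, p k ∈ Set.Icc (0 : ℝ) 1)
    (hSE : S₀.Efficient) (hSu : S₀.Uniform) (hSs : S₀.Sound)
    (hSr : ∀ E : List (Fin q) → List (Fin q), EditBounded p₀ E → S₀.Robust E)
    (hδ : 0 < δ) (hL : L.IsSeeded δ) (hρ : 0 < ρ) (hρ' : ρ < 1) (hC : C.Corrects ρ)
    (hγ : 0 < γ) (hγ' : γ < 1 / 2)
    (hd' : (fun lam => (d' lam : ℝ)) =Θ[atTop] fun lam => (n lam : ℝ) ^ γ)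
    (hℓ : (fun lam => (ℓ lam : ℝ)) =Θ[atTop] fun lam => (n lam : ℝ) ^ γ)
    (hε : 0 < ε)
    (hpN : ∀ lam, p (n lam + 2 * d' lam * ℓ lam) ≤ (1 - ε) * min δ (p₀ (ℓ lam) * ρ))
    {E : List (Fin q) → List (Fin q)} (hE : EditBounded p E) : (genericPRC S₀ L C).Robust E := by
  have hlog : SuperLog ℓ := S₀.superLog hSE (hSr id (editBounded_id hp₀)) hSs
  -- The tail bound is exponential in `d'`, so it is negligible only if `d'` is superlogarithmic; it
  -- inherits this from `ℓ`, which has the same order.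
  have hlog' : SuperLog d' := hlog.of_isBigO (hℓ.trans hd'.symm).isBigO
  have hn := tendsto_len hγ hlog.tendsto hℓ
  obtain ⟨Pn, hPn⟩ := hL.efficient.exists_len_le
  obtain ⟨Pd, hPd⟩ := (hC.lenPT hL.efficient).exists_le
  obtain ⟨Pℓ, hPℓ⟩ := hSE.lenPT.exists_le
  obtain ⟨ν₁, hν₁, h₁⟩ := hL.robust
  -- As `p ≤ 1`, the received word is at most twice as long as the codeword, whose length is `n + 2
  -- * d' * ℓ`.
  obtain ⟨ν₂, hν₂, h₂⟩ := hSs.anyAccepts (2 * (Pn + 2 * Pd * Pℓ))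
  obtain ⟨ν₃, hν₃, h₃⟩ := S₀.exists_miss_le hp₀ hSr hSs hlog.tendsto
  -- Half of the slack: from `2 * η ≤ ε` the edit rate is at most `1 - 2 * η` times the threshold.
  -- One `η` absorbs the ratio of `n + 2 * d' * ℓ` to `n`, the other remains for the tail bound.
  set η : ℝ := min ε (1 / 2) / 2 with hη
  have hηpos : 0 < η := half_pos (lt_min hε (by norm_num))
  have hηle : η ≤ 1 / 4 := by linarith [min_le_right ε (1 / 2)]
  have hηε : 2 * η ≤ ε := by linarith [min_le_left ε (1 / 2)]
  obtain ⟨hb0, hb1⟩ := tail_base_lt_one hηpos (by linarith) hρ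
  have hν := hν₁.add (((hlog'.negligible hb0 hb1).add (hlog'.negligible hb0 hb1)).add
    ((hν₂.add hν₃).poly_mul (Pd + Pd)))
  refine Scheme.robust_of_eventually hν ?_
  -- Two requirements on the overhead `o`: `o ≤ η * n` gives `(1 - 2 * η) * (n + o) ≤ (1 - η) * n`
  -- for the count of bad starts, and `(δ + 1) * o ≤ 2 * η * δ * n` gives `(1 - 2 * η) * δ * (n + o)
  -- + o ≤ δ * n` for the payload decoder.
  have hκ : 0 < min η (2 * η * δ / (δ + 1)) := lt_min hηpos (by positivity)
  filter_upwards [hlog.tendsto.eventually_gt_atTop 0, hlog'.tendsto.eventually_gt_atTop 0,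
    hn.eventually_gt_atTop 0, eventually_overhead_le hγ' hn hd' hℓ hκ] with lam hℓ0 hd0 hn0 hov m
  have hov1 : 2 * (d' lam : ℝ) * ℓ lam ≤ η * n lam :=
    hov.trans (mul_le_mul_of_nonneg_right (min_le_left _ _) hn0.le)
  have hov2 : (δ + 1) * (2 * (d' lam : ℝ) * ℓ lam) ≤ 2 * η * δ * n lam := by
    have := hov.trans (mul_le_mul_of_nonneg_right (min_le_right _ _) hn0.le)
    rw [div_mul_eq_mul_div, le_div_iff₀ (by linarith)] at this
    linarith
  set o : ℝ := 2 * (d' lam : ℝ) * ℓ lam with ho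
  have ho0 : 0 ≤ o := by positivity
  have hN : ((n lam + 2 * d' lam * ℓ lam : ℕ) : ℝ) = n lam + o := by push_cast; rfl
  have hpb := (hp₀ (ℓ lam)).1
  have hmin0 : 0 ≤ min δ (p₀ (ℓ lam) * ρ) := le_min hδ.le (mul_nonneg hpb hρ.le)
  have hpN' : p (n lam + 2 * d' lam * ℓ lam) ≤ (1 - 2 * η) * min δ (p₀ (ℓ lam) * ρ) :=
    (hpN lam).trans (mul_le_mul_of_nonneg_right (by linarith) hmin0)
  have hEx : ∀ x : Fin (n lam + 2 * d' lam * ℓ lam) → Fin q,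
      (editDist (List.ofFn x) (E (List.ofFn x)) : ℝ)
        ≤ p (n lam + 2 * d' lam * ℓ lam) * (n lam + o) := by
    intro x
    have := hE (List.ofFn x)
    rwa [List.length_ofFn, hN] at this
  have hlen : ∀ x : Fin (n lam + 2 * d' lam * ℓ lam) → Fin q,
      (E (List.ofFn x)).length ≤ (2 * (Pn + 2 * Pd * Pℓ)).eval lam := by
    intro x
    have h1 : editDist (List.ofFn x) (E (List.ofFn x)) ≤ n lam + 2 * d' lam * ℓ lam := by
      have h2 := (hEx x).trans (mul_le_of_le_one_left (by linarith) (hp _).2)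
      rw [← hN] at h2
      exact_mod_cast h2
    have h3 := length_le_add_editDist (List.ofFn x) (E (List.ofFn x))
    rw [List.length_ofFn] at h3
    have h4 := hPn lam m.pos
    have h5 : 2 * d' lam * ℓ lam ≤ 2 * Pd.eval lam * Pℓ.eval lam :=
      Nat.mul_le_mul (Nat.mul_le_mul_left 2 (hPd lam)) (hPℓ lam)
    simp only [Polynomial.eval_mul, Polynomial.eval_add, Polynomial.eval_ofNat]
    linarith
  have hc0 : 0 ≤ ν₂ lam + ν₃ lam := add_nonneg (hν₂.1 lam) (hν₃.1 lam)
  refine (genericPRC_fail_le hSu hL.uniform hC hρ' m (by exact_mod_cast hℓ0)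
    (by exact_mod_cast hn0) (by exact_mod_cast hd0) (E := E) (p₁ := p₀ (ℓ lam))
    (β := (1 - 2 * η) * ρ) (β' := (1 - η) * ρ) (δ := δ) (θ := η) (c := ν₂ lam + ν₃ lam)
    (e := ν₁ lam) hpb (mul_nonneg (by linarith) hρ.le) hηpos.le hc0 (fun x => ⟨?_, ?_⟩) ?_ ?_
    (fun x => ?_) fun Y G hG => ?_).trans ?_
  · rw [hN]
    refine (hEx x).trans (mul_le_mul_of_nonneg_right ?_ (by linarith))
    refine hpN'.trans ((mul_le_mul_of_nonneg_left (min_le_right _ _) (by linarith)).trans_eq ?_)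
    ring
  · have h1 : p (n lam + 2 * d' lam * ℓ lam) ≤ (1 - 2 * η) * δ :=
      hpN'.trans (mul_le_mul_of_nonneg_left (min_le_left _ _) (by linarith))
    have h2 := (hEx x).trans (mul_le_mul_of_nonneg_right h1 (by linarith))
    rw [← ho]
    nlinarith [mul_nonneg (mul_nonneg hηpos.le hδ.le) ho0]
  · rw [hN]
    have : (1 - 2 * η) * (n lam + o) ≤ (1 - η) * n lam := by
      nlinarith [mul_nonneg hηpos.le ho0]
    nlinarith
  · rw [prob_compl]
    linarith [h₁ lam m]
  · exact (h₂ lam _ (hlen x)).trans (le_add_of_nonneg_right (hν₃.1 lam))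
  · exact (h₃ lam Y G hG).trans (le_add_of_nonneg_left (hν₂.1 lam))
  · refine add_le_add_right (add_le_add (two_mul _).le ?_) _
    refine mul_le_mul_of_nonneg_right ?_ hc0
    rw [Polynomial.eval_add]
    exact_mod_cast add_le_add (hPd lam) (hPd lam)

end PRC

namespace PRC

/-! ### The rate -/

variable {q : ℕ} {M ℓ n d d' r : ℕ → ℕ}

/-- Double counting of the pairs of a message and a choice of seed and mask for which the
uncorrupted codeword is decoded correctly. For fixed seed and mask such messages have distinct
codewords, so there are at most `q ^ n` of them. -/
theorem PayloadCode.Robust.card_le {L : PayloadCode q M n d r} {δ : ℝ} (hδ : 0 ≤ δ)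
    (h : L.Robust δ) :
    ∃ ν, Negligible ν ∧ ∀ lam, (M lam : ℝ) * (1 - ν lam) ≤ (q : ℝ) ^ n lam := by
  classical
  obtain ⟨ν, hν, h⟩ := h
  refine ⟨ν, hν, fun lam => ?_⟩
  let A := (Fin (d lam) → Bool) × (Fin (r lam) → Bool)
  let good : Fin (M lam) → A → Prop := fun m a =>
    L.dec lam (List.ofFn (L.enc lam m a.1 a.2)) a.1 a.2 = some m
  have hA : (0 : ℝ) < Fintype.card A := by exact_mod_cast Fintype.card_pos
  have h1 : ∀ m, (1 - ν lam) * Fintype.card A ≤ ((Finset.univ.filter (good m)).card : ℝ) := by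
    intro m
    rw [← le_div_iff₀ hA]
    refine ((h lam m).trans (prob_mono (T := {a | good m a}) _ fun a _ ha => ?_)).trans_eq ?_
    · refine ha _ ?_
      rw [editDist_self, Nat.cast_zero]
      positivity
    · exact prob_uniform {a : A | good m a}
  have h2 : ∑ m, (Finset.univ.filter (good m)).card ≤ q ^ n lam * Fintype.card A := by
    have hcomm : ∑ m, (Finset.univ.filter (good m)).card
        = ∑ a, (Finset.univ.filter fun m => good m a).card := by
      simp only [Finset.card_filter]
      exact Finset.sum_comm
    rw [hcomm]
    refine (Finset.sum_le_sum (g := fun _ => q ^ n lam) fun a _ => ?_).trans_eq ?_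
    · have hc : Fintype.card (Fin (n lam) → Fin q) = q ^ n lam := by simp
      rw [← hc]
      refine Finset.card_le_card_of_injOn (t := Finset.univ) (fun m => L.enc lam m a.1 a.2)
        (fun _ _ => Finset.mem_coe.2 (Finset.mem_univ _)) ?_
      intro m hm m' hm' hmm
      have hg : good m a := (Finset.mem_filter.1 hm).2
      have hg' : good m' a := (Finset.mem_filter.1 hm').2
      simp only [good] at hg hg'
      simp only at hmm
      rw [hmm, hg'] at hg
      exact (Option.some.inj hg).symm
    · rw [Finset.sum_const, Finset.card_univ, smul_eq_mul, mul_comm]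
  have h3 : (M lam : ℝ) * ((1 - ν lam) * Fintype.card A)
      ≤ ∑ m, ((Finset.univ.filter (good m)).card : ℝ) := by
    refine le_trans (le_of_eq ?_) (Finset.sum_le_sum fun m _ => h1 m)
    simp
  have h4 : ∑ m, ((Finset.univ.filter (good m)).card : ℝ) ≤ (q : ℝ) ^ n lam * Fintype.card A := by
    exact_mod_cast h2
  refine le_of_mul_le_mul_right ?_ hA
  linarith

/-- Eventually `M ≤ 2 * q ^ n ≤ q ^ (n + 1)` once `q ≥ 2`. For `q = 1` or `M = 0` the logarithm
takes the value `0`. -/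
theorem PayloadCode.Robust.logb_le [NeZero q] {L : PayloadCode q M n d r} {δ : ℝ} (hδ : 0 ≤ δ)
    (h : L.Robust δ) :
    ∀ᶠ lam in atTop, 0 ≤ Real.logb q (M lam) ∧ Real.logb q (M lam) ≤ n lam + 1 := by
  obtain ⟨ν, hν, h⟩ := h.card_le hδ
  filter_upwards [hν.tendsto.eventually_le_const (show (0 : ℝ) < 1 / 2 by norm_num)] with lam hlam
  have hn : (0 : ℝ) ≤ n lam := Nat.cast_nonneg _
  rcases Nat.eq_zero_or_pos (M lam) with hM | hM
  · rw [hM, Nat.cast_zero, Real.logb_zero]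
    exact ⟨le_rfl, by linarith⟩
  rcases (Nat.one_le_iff_ne_zero.2 (NeZero.ne q)).eq_or_lt with hq | hq
  · rw [← hq, Nat.cast_one, Real.logb_one_left]
    exact ⟨le_rfl, by linarith⟩
  have hq' : (2 : ℝ) ≤ q := by exact_mod_cast hq
  have hM' : (1 : ℝ) ≤ M lam := by exact_mod_cast hM
  refine ⟨Real.logb_nonneg (by linarith) hM', ?_⟩
  rw [Real.logb_le_iff_le_rpow (by linarith) (by linarith), Real.rpow_add (by linarith),
    Real.rpow_one, Real.rpow_natCast]
  have h1 := h lam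
  have h2 : (0 : ℝ) < (q : ℝ) ^ n lam := by positivity
  nlinarith

theorem genericPRC_rate [NeZero q] (S₀ : Scheme q (fun _ => 1) ℓ) (L : PayloadCode q M n d r)
    (C : SeedCode d d') (lam : ℕ) : (genericPRC S₀ L C).rate lam
      = Real.logb q (M lam) / ((n lam : ℝ) + 2 * d' lam * ℓ lam) := by
  rw [Scheme.rate]
  push_cast
  rfl

theorem tendsto_rate_sub [NeZero q] (S₀ : Scheme q (fun _ => 1) ℓ) {L : PayloadCode q M n d r}
    (C : SeedCode d d') {δ : ℝ} (hδ : 0 ≤ δ) (hL : L.Robust δ)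
    (hn : Tendsto (fun k => (n k : ℝ)) atTop atTop)
    (ho : ∀ κ : ℝ, 0 < κ → ∀ᶠ k in atTop, 2 * (d' k : ℝ) * ℓ k ≤ κ * n k) :
    Tendsto (fun lam => L.rate lam - (genericPRC S₀ L C).rate lam) atTop (nhds 0) := by
  rw [Metric.tendsto_nhds]
  intro e he
  filter_upwards [hL.logb_le hδ, ho (e / 3) (by positivity), hn.eventually_ge_atTop 1]
    with lam ⟨h1, h2⟩ h3 h4
  rw [dist_zero_right, genericPRC_rate, PayloadCode.rate]
  set b := Real.logb q (M lam)
  set o : ℝ := 2 * (d' lam : ℝ) * ℓ lam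
  set x : ℝ := (n lam : ℝ)
  have ho0 : 0 ≤ o := by positivity
  have hx : 0 < x := by linarith
  -- With `b ≤ x + 1 ≤ 2 * x` and `o ≤ (e / 3) * x`, this difference is at most two thirds of `e`.
  have h5 : b / x - b / (x + o) = b * o / (x * (x + o)) := by
    field_simp
    ring
  rw [h5, Real.norm_of_nonneg (by positivity), div_lt_iff₀ (by positivity)]
  calc b * o ≤ (x + 1) * (e / 3 * x) := mul_le_mul h2 h3 ho0 (by linarith)
    _ ≤ 2 * x * (e / 3 * x) := mul_le_mul_of_nonneg_right (by linarith) (by positivity)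
    _ < e * (x * (x + o)) := by
        have h6 := mul_nonneg he.le (mul_nonneg hx.le ho0)
        have h7 : 0 < e * (x * x) := by positivity
        nlinarith

end PRC

/-! ### The main theorem -/

theorem mainTheorem3 (mode : PRC.KeyMode) (q : ℕ) [NeZero q] (M ℓ n d d' r : ℕ → ℕ)
    (S₀ : PRC.Scheme q (fun _ => 1) ℓ) (L : PRC.PayloadCode q M n d r) (C : PRC.SeedCode d d')
    (p₀ p : ℕ → ℝ) (δ pseed γ ε : ℝ)
    (hp₀ : ∀ k, p₀ k ∈ Set.Icc (0 : ℝ) 1) (hp : ∀ k, p k ∈ Set.Icc (0 : ℝ) 1)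
    (hS₀ : ∀ E : List (Fin q) → List (Fin q), PRC.EditBounded p₀ E → S₀.IsPRC mode E)
    (hS₀u : S₀.Uniform)
    (hδ : 0 < δ) (hL : L.IsSeeded δ)
    (hpseed : 0 < pseed) (hpseed' : pseed < 1 / 4) (hC : C.Corrects pseed)
    (hγ : 0 < γ) (hγ' : γ < 1 / 4)
    (hd' : (fun lam => (d' lam : ℝ)) =Θ[atTop] fun lam => (n lam : ℝ) ^ γ)
    (hℓ : (fun lam => (ℓ lam : ℝ)) =Θ[atTop] fun lam => (n lam : ℝ) ^ γ)
    (hε : 0 < ε)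
    (hpN : ∀ lam, p (n lam + 2 * d' lam * ℓ lam) ≤ (1 - ε) * min δ (p₀ (ℓ lam) * pseed)) :
    (∀ E : List (Fin q) → List (Fin q), PRC.EditBounded p E →
      (PRC.genericPRC S₀ L C).IsPRC mode E) ∧
    (∀ lam, (PRC.genericPRC S₀ L C).rate lam
      = Real.logb q (M lam) / ((n lam : ℝ) + 2 * d' lam * ℓ lam)) ∧
    Tendsto (fun lam => L.rate lam - (PRC.genericPRC S₀ L C).rate lam) atTop (nhds 0) := by
  -- The identity is a `p₀`-bounded channel, so it supplies those properties of the zero-bit code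
  -- that do not refer to a channel, and correctness without errors for the growth of `ℓ`.
  have hid := hS₀ id (PRC.editBounded_id hp₀)
  have hlog : PRC.SuperLog ℓ := S₀.superLog hid.efficient hid.robust hid.sound
  have hn := PRC.tendsto_len hγ hlog.tendsto hℓ
  refine ⟨fun E hE => ⟨PRC.genericPRC_efficient hid.efficient hL.efficient hC,
    PRC.genericPRC_keysMatch L C hid.keysMatch, ?_, PRC.genericPRC_sound hL.efficient hC hid.sound,
    PRC.genericPRC_pseudorandom hid.efficient hL.efficient hC hid.pseudorandom hL.pseudorandom⟩,
    PRC.genericPRC_rate S₀ L C, PRC.tendsto_rate_sub S₀ C hδ.le hL.robust hn fun κ hκ =>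
      PRC.eventually_overhead_le (by linarith) hn hd' hℓ hκ⟩
  exact PRC.genericPRC_robust hp₀ hp hid.efficient hS₀u hid.sound (fun E hE => (hS₀ E hE).robust)
    hδ hL hpseed (by linarith) hC hγ (by linarith) hd' hℓ hε hpN hE
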